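/- **Notation.** For $n\ge 0$, $\Sigma_1(\mathbf R^n)$ is the Gelfand–Shilov space of all $f\in C^\infty(\mathbf R^n)$ such that $\sup_{x,\alpha,\beta}|x^\beta\partial^\alpha f(x)|/(h^{|\alpha+\beta|}\alpha!\,\beta!)<\infty$ for every $h>0$, with the topology given by these norms; $\Sigma_1'(\mathbf R^n)$ is its strong dual, and $\Sigma_1\subseteq\Sigma_1'$ through $\langle a,\psi\rangle=\int a\psi\,dx$. The space $\mathcal L(\Sigma_1(\mathbf R^d),\Sigma_1'(\mathbf R^d))$ of continuous linear maps carries the topology of uniform convergence on bounded sets. With $\phi(y)=\pi^{-n/4}e^{-|y|^2/2}$ let $V_\phi u(x,\xi)=(2\pi)^{-n/2}\langle u,\phi(\cdot-x)e^{-i\langle\cdot,\xi\rangle}\rangle$ for $u\in\Sigma_1'(\mathbf R^n)$. A *weight* is a positive measurable function $\omega$ such that $\omega$ and $1/\omega$ are locally bounded. It belongs to $\mathscr P_s$ if $\omega(x+y)\le C\omega(x)e^{r|y|^{1/s}}$ for all $x,y$ and some $r,C>0$. A weight $v$ is *submultiplicative* if it is even and $v(x+y)\le Cv(x)v(y)$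 for all $x,y$ and some $C>0$. A *Young function* is a convex $\Phi:[0,\infty]\to[0,\infty]$ with $\Phi(0)=0$ and $\lim_{t\to\infty}\Phi(t)=\Phi(\infty)=\infty$. We set $q_\Phi=\inf_{t>0}t\Phi_+'(t)/\Phi(t)$ and $p_\Phi=\sup_{t>0}t\Phi_+'(t)/\Phi(t)$, where $\Phi'_+$ is the right derivative and the quotient is read as $\infty$ where $\Phi(t)\in\{0,\infty\}$; and $\|F\|_{L^\Phi}=\inf\{\lambda>0:\int\Phi(|F|/\lambda)\le1\}$. For a weight $\omega$ on $\mathbf R^{2n}$, $M^{\infty,1}_{(\omega)}(\mathbf R^n)$ and $M^\Phi_{(\omega)}(\mathbf R^n)$ are the spaces of all $u\in\Sigma_1'(\mathbf R^n)$ for which, respectively, $$\|u\|_{M^{\infty,1}_{(\omega)}}=\int\|V_\phi u(\cdot,\xi)\,\omega(\cdot,\xi)\|_{L^\infty}\,d\xi,\qquad \|u\|_{M^\Phi_{(\omega)}}=\|V_\phi u\cdot\omega\|_{L^\Phi(\mathbf R^{2n})}$$ is finite. A sequence $a_j$ in $M^{\infty,1}_{(\omega)}$ *converges narrowly* to $a\in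 M^{\infty,1}_{(\omega)}$ if $\langle a_j,\psi\rangle\to\langle a,\psi\rangle$ for every $\psi\in\Sigma_1$ and there is an integrable function $G$ with $\|V_\phi a_j(\cdot,\xi)\omega(\cdot,\xi)\|_{L^\infty}\le G(\xi)$ for all $j$ and almost every $\xi$. **Theorem.** Let $d,m\ge0$ be integers, $s>1$, and $\Phi$ a Young function with $1<q_\Phi\le p_\Phi<\infty$. Let $\omega\in\mathscr P_s(\mathbf R^{2(2d+m)})$, $\omega_0\in\mathscr P_s(\mathbf R^{4d})$, $\omega_1,\omega_2\in\mathscr P_s(\mathbf R^{2d})$, let $v_0\in\mathscr P_s(\mathbf R^{2d+m})$ be submultiplicative with $\sup_{t\in[0,1]}\|v_0(t\,\cdot)/v_0\|_{L^\infty}<\infty$, set $v(X,\Xi)=v_0(\Xi)$, and suppose that for some constant $D$ $$\omega(X,\Xi_1+\Xi_2)\le D\,\omega(X,\Xi_1)\,v_0(\Xi_2),\qquad X,\Xi_1,\Xi_2\in\mathbf R^{2d+m}.$$ Let $C_1,C_2$ be constants. Then there is a constant $C>0$, depending only on the data above, such that the following holds for every $\bar d>0$ and every continuous $\varphi:\mathbf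 R^{2d+m}\to\mathbf R$, written as a function of $X=(x,y,\zeta)$ with $x,y\in\mathbf R^d$, $\zeta\in\mathbf R^m$, whose distributional derivatives of order two belong to $M^{\infty,1}_{(v)}(\mathbf R^{2d+m})$ (so that $\varphi\in C^2$), and which satisfies $$\frac{\omega_2(x,\xi)}{\omega_1(y,-\eta)}\le C_1\omega_0(x,y,\xi,\eta)\le C_2\,\omega\bigl(X,\xi-\varphi_x'(X),\eta-\varphi_y'(X),-\varphi_\zeta'(X)\bigr)$$ for all $X=(x,y,\zeta)$ and $\xi,\eta\in\mathbf R^d$, and $$\left|\det\begin{pmatrix}\varphi''_{y,x}&\varphi''_{\zeta,x}\\ \varphi''_{y,\zeta}&\varphi''_{\zeta,\zeta}\end{pmatrix}\right|\ge\bar d .$$ For $a\in\Sigma_1(\mathbf R^{2d+m})$ and $f\in\Sigma_1(\mathbf R^d)$ let $$\operatorname{Op}_\varphi(a)f(x)=(2\pi)^{-\frac{d+m}2}\iint_{\mathbf R^{d+m}}a(x,y,\zeta)f(y)e^{i\varphi(x,y,\zeta)}\,dy\,d\zeta .$$ 1. $\Sigma_1(\mathbf R^{2d+m})\subseteq M^{\infty,1}_{(\omega)}(\mathbf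 R^{2d+m})$, and the map $a\mapsto\operatorname{Op}_\varphi(a)$ extends to a linear map from $M^{\infty,1}_{(\omega)}(\mathbf R^{2d+m})$ to $\mathcal L(\Sigma_1(\mathbf R^d),\Sigma_1'(\mathbf R^d))$ which is continuous for the norm and along narrowly convergent sequences; it is the only extension that is continuous along narrowly convergent sequences. 2. For every $a\in M^{\infty,1}_{(\omega)}(\mathbf R^{2d+m})$ the map $\operatorname{Op}_\varphi(a)$ extends uniquely from $\Sigma_1(\mathbf R^d)\subseteq M^\Phi_{(\omega_1)}(\mathbf R^d)$ to a continuous linear operator from $M^\Phi_{(\omega_1)}(\mathbf R^d)$ to $M^\Phi_{(\omega_2)}(\mathbf R^d)$, and $$\|\operatorname{Op}_\varphi(a)\|_{M^\Phi_{(\omega_1)}\to M^\Phi_{(\omega_2)}}\le C\,\bar d^{\,-1}\,\|a\|_{M^{\infty,1}_{(\omega)}}\exp\bigl(C\|\varphi''\|_{M^{\infty,1}_{(v)}}\bigr),$$ where $\|\varphi''\|_{M^{\infty,1}_{(v)}}$ is the sum of the norms of the second order partial derivatives of $\varphi$. -/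

import Mathlib

open MeasureTheory Filter Topology
open scoped ENNReal NNReal

noncomputable section

/-- The space `ℝ^n`, with coordinates indexed by a finite type. -/
abbrev RR (ι : Type) [Fintype ι] : Type := EuclideanSpace ℝ ι

/-! ### Gelfand-Shilov spaces of Beurling type and order one -/

/-- `‖x‖^k ‖D^l f(x)‖ / (h^(k+l) k! l!)`. Taking the full derivatives instead of the single partial
derivatives changes each Gelfand-Shilov norm only by a dilation of `h`. -/
def gsQuot {ι : Type} [Fintype ι] (h : ℝ) (f : RR ι → ℂ) (q : ℕ × ℕ × RR ι) : ℝ :=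
  ‖q.2.2‖ ^ q.1 * ‖iteratedFDeriv ℝ q.2.1 f q.2.2‖ /
    (h ^ (q.1 + q.2.1) * (q.1.factorial * q.2.1.factorial))

theorem gsQuot_nonneg {ι : Type} [Fintype ι] {h : ℝ} (hh : 0 < h) (f : RR ι → ℂ)
    (q : ℕ × ℕ × RR ι) : 0 ≤ gsQuot h f q := by
  unfold gsQuot; positivity

theorem gsQuot_add {ι : Type} [Fintype ι] {h : ℝ} (hh : 0 < h) {f g : RR ι → ℂ}
    (hf : ContDiff ℝ (⊤ : ℕ∞) f) (hg : ContDiff ℝ (⊤ : ℕ∞) g) (q : ℕ × ℕ × RR ι) :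
    gsQuot h (f + g) q ≤ gsQuot h f q + gsQuot h g q := by
  unfold gsQuot
  rw [← add_div, ← mul_add]
  have e : iteratedFDeriv ℝ q.2.1 (f + g) q.2.2 =
      iteratedFDeriv ℝ q.2.1 f q.2.2 + iteratedFDeriv ℝ q.2.1 g q.2.2 :=
    iteratedFDeriv_add_apply ((hf.of_le (mod_cast le_top)).contDiffAt)
      ((hg.of_le (mod_cast le_top)).contDiffAt)
  rw [e]
  gcongr
  exact norm_add_le _ _

theorem gsQuot_smul {ι : Type} [Fintype ι] (h : ℝ) (c : ℂ) {f : RR ι → ℂ}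
    (hf : ContDiff ℝ (⊤ : ℕ∞) f) (q : ℕ × ℕ × RR ι) :
    gsQuot h (c • f) q = ‖c‖ * gsQuot h f q := by
  unfold gsQuot
  have e : iteratedFDeriv ℝ q.2.1 (c • f) q.2.2 = c • iteratedFDeriv ℝ q.2.1 f q.2.2 :=
    iteratedFDeriv_const_smul_apply ((hf.of_le (mod_cast le_top)).contDiffAt)
  rw [e, norm_smul]
  ring

/-- `Σ₁(ℝ^n)` as a space of functions: smooth `f` whose Gelfand-Shilov norms are finite for every
`h > 0`. -/
def gsSubmodule (ι : Type) [Fintype ι] : Submodule ℂ (RR ι → ℂ) where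
  carrier := {f | ContDiff ℝ (⊤ : ℕ∞) f ∧ ∀ h : ℝ, 0 < h → BddAbove (Set.range (gsQuot h f))}
  zero_mem' := by
    refine ⟨contDiff_const, fun h hh => ⟨0, ?_⟩⟩
    rintro _ ⟨q, rfl⟩
    have := gsQuot_smul h 0 (f := (0 : RR ι → ℂ)) contDiff_const q
    simp only [zero_smul, norm_zero, zero_mul] at this
    exact this.le
  add_mem' := by
    rintro f g ⟨hf, hf'⟩ ⟨hg, hg'⟩
    refine ⟨hf.add hg, fun h hh => ?_⟩
    obtain ⟨A, hA⟩ := hf' h hh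
    obtain ⟨B, hB⟩ := hg' h hh
    refine ⟨A + B, ?_⟩
    rintro _ ⟨q, rfl⟩
    exact (gsQuot_add hh hf hg q).trans (add_le_add (hA ⟨q, rfl⟩) (hB ⟨q, rfl⟩))
  smul_mem' := by
    rintro c f ⟨hf, hf'⟩
    refine ⟨hf.const_smul c, fun h hh => ?_⟩
    obtain ⟨A, hA⟩ := hf' h hh
    refine ⟨‖c‖ * A, ?_⟩
    rintro _ ⟨q, rfl⟩
    rw [gsQuot_smul h c hf]
    exact mul_le_mul_of_nonneg_left (hA ⟨q, rfl⟩) (norm_nonneg c)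

/-- The Gelfand-Shilov space `Σ₁(ℝ^n)`. -/
def GS (ι : Type) [Fintype ι] : Type := gsSubmodule ι

instance (ι : Type) [Fintype ι] : AddCommGroup (GS ι) :=
  inferInstanceAs (AddCommGroup (gsSubmodule ι))

instance (ι : Type) [Fintype ι] : Module ℂ (GS ι) :=
  inferInstanceAs (Module ℂ (gsSubmodule ι))

instance (ι : Type) [Fintype ι] : CoeFun (GS ι) (fun _ => RR ι → ℂ) := ⟨fun f => f.1⟩

/-- The Gelfand-Shilov norms on `Σ₁(ℝ^n)`. -/
def gsSeminorm (ι : Type) [Fintype ι] (h : Set.Ioi (0 : ℝ)) : Seminorm ℂ (GS ι) :=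
  Seminorm.of (fun f => ⨆ q, gsQuot h.1 f q)
    (by
      intro f g
      refine ciSup_le fun q => ?_
      exact (gsQuot_add h.2 f.2.1 g.2.1 q).trans
        (add_le_add (le_ciSup (f.2.2 h.1 h.2) q) (le_ciSup (g.2.2 h.1 h.2) q)))
    (by
      intro c f
      rw [Real.mul_iSup_of_nonneg (norm_nonneg c)]
      exact iSup_congr fun q => gsQuot_smul h.1 c f.2.1 q)

/-- The projective limit topology of `Σ₁(ℝ^n)`. -/
instance (ι : Type) [Fintype ι] : TopologicalSpace (GS ι) :=
  (SeminormFamily.moduleFilterBasis (𝕜 := ℂ) (gsSeminorm ι)).topology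

theorem gs_withSeminorms (ι : Type) [Fintype ι] : WithSeminorms (𝕜 := ℂ) (gsSeminorm ι) := ⟨rfl⟩

instance (ι : Type) [Fintype ι] : IsTopologicalAddGroup (GS ι) :=
  (gs_withSeminorms ι).topologicalAddGroup

instance (ι : Type) [Fintype ι] : ContinuousSMul ℂ (GS ι) :=
  (gs_withSeminorms ι).continuousSMul

/-- The space `Σ₁'(ℝ^n)` of continuous linear forms, with its strong topology. -/
abbrev GSDual (ι : Type) [Fintype ι] : Type := GS ι →L[ℂ] ℂ

theorem gs_decay {ι : Type} [Fintype ι] (f : GS ι) (k l : ℕ) :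
    ∃ C : ℝ, ∀ x, ‖x‖ ^ k * ‖iteratedFDeriv ℝ l (f : RR ι → ℂ) x‖ ≤ C := by
  obtain ⟨C, hC⟩ := f.2.2 1 one_pos
  refine ⟨C * ((1 : ℝ) ^ (k + l) * (k.factorial * l.factorial)), fun x => ?_⟩
  have := hC ⟨(k, l, x), rfl⟩
  unfold gsQuot at this
  rwa [div_le_iff₀ (by positivity)] at this

/-- Elements of `Σ₁` are Schwartz functions. -/
def GS.toSchwartz {ι : Type} [Fintype ι] (f : GS ι) : SchwartzMap (RR ι) ℂ where
  toFun := f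
  smooth' := f.2.1
  decay' := gs_decay f

theorem GS.integrable {ι : Type} [Fintype ι] (f : GS ι) : Integrable (f : RR ι → ℂ) :=
  f.toSchwartz.integrable

theorem GS.norm_le {ι : Type} [Fintype ι] (f : GS ι) (x : RR ι) :
    ‖f x‖ ≤ gsSeminorm ι ⟨1, Set.mem_Ioi.2 one_pos⟩ f := by
  have := le_ciSup (f.2.2 1 one_pos) (0, 0, x)
  simp only [gsQuot, pow_zero, one_mul, norm_iteratedFDeriv_zero, add_zero, Nat.factorial_zero,
    Nat.cast_one, mul_one, div_one] at this
  exact this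

theorem GS.integrable_mul {ι : Type} [Fintype ι] (a f : GS ι) :
    Integrable (fun x => a x * f x) := by
  refine (a.integrable.mul_bdd (c := gsSeminorm ι ⟨1, Set.mem_Ioi.2 one_pos⟩ f) ?_ ?_)
  · exact f.2.1.continuous.aestronglyMeasurable
  · exact Eventually.of_forall f.norm_le

/-- The embedding `Σ₁ → Σ₁'`, `a ↦ (ψ ↦ ∫ a ψ)`, as a linear form. -/
def GS.toLin {ι : Type} [Fintype ι] (a : GS ι) : GS ι →ₗ[ℂ] ℂ where
  toFun ψ := ∫ x, a x * ψ x
  map_add' f g := by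
    rw [← integral_add (a.integrable_mul f) (a.integrable_mul g)]
    exact integral_congr_ae (Eventually.of_forall fun x => mul_add (a x) (f x) (g x))
  map_smul' c f := by
    rw [RingHom.id_apply, smul_eq_mul, ← integral_const_mul]
    exact integral_congr_ae (Eventually.of_forall fun x => mul_left_comm (a x) c (f x))

/-- The embedding `Σ₁ → Σ₁'`, `a ↦ (ψ ↦ ∫ a ψ)`. -/
def GS.toDual {ι : Type} [Fintype ι] (a : GS ι) : GSDual ι where
  toLinearMap := a.toLin
  cont := by
    refine (gs_withSeminorms ι).continuous_normedSpace_rng _ a.toLin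
      ⟨{⟨1, Set.mem_Ioi.2 one_pos⟩}, ⟨∫ x, ‖a x‖, integral_nonneg fun x => norm_nonneg _⟩,
        fun f => ?_⟩
    simp only [Finset.sup_singleton, Seminorm.comp_apply, coe_normSeminorm]
    change ‖∫ x, a x * f x‖ ≤ (∫ x, ‖a x‖) * gsSeminorm ι ⟨1, Set.mem_Ioi.2 one_pos⟩ f
    rw [← integral_mul_const]
    refine norm_integral_le_of_norm_le (a.integrable.norm.mul_const _)
      (Eventually.of_forall fun x => ?_)
    rw [norm_mul]
    exact mul_le_mul_of_nonneg_left (f.norm_le x) (norm_nonneg _)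

/-! ### The short-time Fourier transform with Gaussian window -/

/-- The entire function `exp (-(z - x)^2 / 2 - i z ξ)`; an auxiliary function for showing that the
Gaussian and its time-frequency shifts belong to `Σ₁`. -/
def gauss1 (x ξ : ℝ) (z : ℂ) : ℂ := Complex.exp (-(z - x) ^ 2 / 2 - Complex.I * z * ξ)

theorem gauss1_differentiable (x ξ : ℝ) : Differentiable ℂ (gauss1 x ξ) := by
  unfold gauss1; fun_prop

theorem gauss1_iteratedDeriv (x ξ : ℝ) (l : ℕ) :
    iteratedDeriv l (fun t : ℝ => gauss1 x ξ t) = fun t : ℝ => iteratedDeriv l (gauss1 x ξ) t := by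
  induction l with
  | zero => simp
  | succ l ih =>
    rw [iteratedDeriv_succ, ih]
    funext t
    have hd : DifferentiableAt ℂ (iteratedDeriv l (gauss1 x ξ)) t :=
      ((gauss1_differentiable x ξ).contDiff (n := (⊤ : ℕ∞))).differentiable_iteratedDeriv l
        (by exact_mod_cast WithTop.coe_lt_top _) _
    rw [iteratedDeriv_succ]
    exact hd.hasDerivAt.comp_ofReal.deriv

theorem gauss1_bound (x ξ : ℝ) {ε : ℝ} (hε : 0 < ε) : ∃ C : ℝ, 0 ≤ C ∧ ∀ (l : ℕ) (t : ℝ),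
    ‖iteratedDeriv l (fun t : ℝ => gauss1 x ξ t) t‖ ≤
      C * (ε ^ l * l.factorial * Real.exp (-(t ^ 2) / 4)) := by
  set R : ℝ := ε⁻¹ with hR
  have hRp : 0 < R := inv_pos.2 hε
  refine ⟨Real.exp ((R + |x|) ^ 2 / 2 + R ^ 2 / 2 + R * |ξ|), (Real.exp_pos _).le, fun l t => ?_⟩
  rw [gauss1_iteratedDeriv]
  have key := Complex.norm_iteratedDeriv_le_of_forall_mem_sphere_norm_le (f := gauss1 x ξ) l
    (c := (t : ℂ)) (R := R)
    (C := Real.exp ((R + |x|) ^ 2 / 2 + R ^ 2 / 2 + R * |ξ|) * Real.exp (-(t ^ 2) / 4)) hRp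
    (gauss1_differentiable x ξ).diffContOnCl ?_
  · refine key.trans (le_of_eq ?_)
    rw [show R ^ l = (ε ^ l)⁻¹ by rw [hR, inv_pow], div_inv_eq_mul]
    ring
  · intro z hz
    obtain ⟨w, rfl⟩ : ∃ w : ℂ, z = t + w := ⟨z - t, by ring⟩
    have hw : ‖w‖ = R := by simpa using hz
    have h1 : |w.re| ≤ R := hw ▸ Complex.abs_re_le_norm w
    have h2 : |w.im| ≤ R := hw ▸ Complex.abs_im_le_norm w
    unfold gauss1
    rw [Complex.norm_exp, ← Real.exp_add]
    apply Real.exp_le_exp.2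
    have e : (-((t : ℂ) + w - x) ^ 2 / 2 - Complex.I * (t + w) * ξ).re =
        -((t + w.re - x) ^ 2 - w.im ^ 2) / 2 + w.im * ξ := by
      simp [pow_two]
    rw [e]
    have h3 : w.im * ξ ≤ R * |ξ| := by
      calc w.im * ξ ≤ |w.im * ξ| := le_abs_self _
        _ = |w.im| * |ξ| := abs_mul _ _
        _ ≤ R * |ξ| := mul_le_mul_of_nonneg_right h2 (abs_nonneg _)
    have h4 : w.im ^ 2 ≤ R ^ 2 := sq_le_sq' (by linarith [(abs_le.1 h2).1]) (abs_le.1 h2).2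
    have h5 : (w.re - x) ^ 2 ≤ (R + |x|) ^ 2 := by
      apply sq_le_sq'
      · linarith [(abs_le.1 h1).1, le_abs_self x]
      · linarith [(abs_le.1 h1).2, neg_abs_le x]
    nlinarith [sq_nonneg (t + 2 * (w.re - x))]

theorem gaussProd_bound {ι : Type} [Fintype ι] (x ξ : RR ι) (s : Finset ι) :
    ∀ ε : ℝ, 0 < ε → ∃ C : ℝ, 0 ≤ C ∧ ∀ (l : ℕ) (y : RR ι),
    ‖iteratedFDeriv ℝ l (fun y : RR ι => ∏ i ∈ s, gauss1 (x i) (ξ i) (y i)) y‖ ≤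
      C * (ε ^ l * l.factorial * Real.exp (-(∑ i ∈ s, y i ^ 2) / 4)) := by
  classical
  have hc : ∀ i, ContDiff ℝ (⊤ : ℕ∞) (fun t : ℝ => gauss1 (x i) (ξ i) t) := fun i =>
    (((gauss1_differentiable (x i) (ξ i)).contDiff (n := (⊤ : ℕ∞))).restrict_scalars ℝ).comp
      Complex.ofRealCLM.contDiff
  have hc' : ∀ i, ContDiff ℝ (⊤ : ℕ∞) (fun y : RR ι => gauss1 (x i) (ξ i) (y i)) := fun i =>
    (hc i).comp (EuclideanSpace.proj (𝕜 := ℝ) i).contDiff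
  induction s using Finset.induction_on with
  | empty =>
    intro ε hε
    refine ⟨1, zero_le_one, fun l y => ?_⟩
    simp only [Finset.prod_empty, Finset.sum_empty]
    rcases Nat.eq_zero_or_pos l with rfl | hl
    · simp
    · rw [iteratedFDeriv_const_of_ne hl.ne']
      simp; positivity
  | insert a s ha ih =>
    intro ε hε
    obtain ⟨A, hA0, hA⟩ := gauss1_bound (x a) (ξ a) (half_pos hε)
    obtain ⟨B, hB0, hB⟩ := ih (ε / 2) (half_pos hε)
    refine ⟨A * B, mul_nonneg hA0 hB0, fun l y => ?_⟩
    have hA' : ∀ k, ‖iteratedFDeriv ℝ k (fun y : RR ι => gauss1 (x a) (ξ a) (y a)) y‖ ≤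
        A * ((ε / 2) ^ k * k.factorial * Real.exp (-(y a ^ 2) / 4)) := by
      intro k
      refine le_trans ?_ (hA k (y a))
      have h1 := (EuclideanSpace.proj (𝕜 := ℝ) a).iteratedFDeriv_comp_right (hc a) y
        (i := k) (by exact_mod_cast le_top)
      have h2 := (iteratedFDeriv ℝ k (fun t : ℝ => gauss1 (x a) (ξ a) t)
        (y a)).norm_compContinuousLinearMap_le (fun _ => EuclideanSpace.proj (𝕜 := ℝ) a)
      have h3 : ‖(EuclideanSpace.proj (𝕜 := ℝ) a : RR ι →L[ℝ] ℝ)‖ ≤ 1 :=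
        ContinuousLinearMap.opNorm_le_bound _ zero_le_one fun z => by
          simpa using PiLp.norm_apply_le z a
      change ‖iteratedFDeriv ℝ k ((fun t : ℝ => gauss1 (x a) (ξ a) t) ∘
        (EuclideanSpace.proj (𝕜 := ℝ) a)) y‖ ≤ _
      rw [h1, ← norm_iteratedFDeriv_eq_norm_iteratedDeriv]
      refine h2.trans (mul_le_of_le_one_right (norm_nonneg _) ?_)
      exact Finset.prod_le_one (fun _ _ => norm_nonneg _) (fun _ _ => h3)
    simp only [Finset.prod_insert ha, Finset.sum_insert ha]
    refine (norm_iteratedFDeriv_mul_le (hc' a) (contDiff_prod fun i _ => hc' i) y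
      (n := l) (by exact_mod_cast le_top)).trans ?_
    have hsum : ∀ k ∈ Finset.range (l + 1), (l.choose k : ℝ) *
        ‖iteratedFDeriv ℝ k (fun y : RR ι => gauss1 (x a) (ξ a) (y a)) y‖ *
        ‖iteratedFDeriv ℝ (l - k) (fun y : RR ι => ∏ i ∈ s, gauss1 (x i) (ξ i) (y i)) y‖ ≤
        A * B * ((ε / 2) ^ l * l.factorial *
          Real.exp (-(y a ^ 2 + ∑ i ∈ s, y i ^ 2) / 4)) := by
      intro k hk
      have hk' : k ≤ l := Nat.lt_succ_iff.1 (Finset.mem_range.1 hk)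
      calc _ ≤ (l.choose k : ℝ) * (A * ((ε / 2) ^ k * k.factorial * Real.exp (-(y a ^ 2) / 4))) *
            (B * ((ε / 2) ^ (l - k) * (l - k).factorial *
              Real.exp (-(∑ i ∈ s, y i ^ 2) / 4))) := by
            gcongr
            · exact hA' k
            · exact hB (l - k) y
        _ = A * B * (((ε / 2) ^ k * (ε / 2) ^ (l - k)) *
              ((l.choose k : ℝ) * k.factorial * (l - k).factorial) *
              (Real.exp (-(y a ^ 2) / 4) * Real.exp (-(∑ i ∈ s, y i ^ 2) / 4))) := by ring
        _ = _ := by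
            rw [← pow_add, Nat.add_sub_cancel' hk', ← Real.exp_add]
            have := Nat.choose_mul_factorial_mul_factorial hk'
            rw [show (l.choose k : ℝ) * k.factorial * (l - k).factorial = l.factorial by
              exact_mod_cast this]
            congr 3
            ring
    refine (Finset.sum_le_sum hsum).trans ?_
    rw [Finset.sum_const, Finset.card_range, nsmul_eq_mul]
    have h2 : ((l + 1 : ℕ) : ℝ) ≤ 2 ^ l := by
      exact_mod_cast Nat.lt_two_pow_self
    calc _ ≤ (2 : ℝ) ^ l * (A * B * ((ε / 2) ^ l * l.factorial *
          Real.exp (-(y a ^ 2 + ∑ i ∈ s, y i ^ 2) / 4))) := by gcongr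
      _ = A * B * (((2 : ℝ) ^ l * (ε / 2) ^ l) * l.factorial *
          Real.exp (-(y a ^ 2 + ∑ i ∈ s, y i ^ 2) / 4)) := by ring
      _ = _ := by rw [← mul_pow, mul_div_cancel₀ ε two_ne_zero]

/-- The function `y ↦ conj (φ (y - x)) exp (-i ⟨y, ξ⟩)` with the Gaussian window
`φ (y) = π^(-n/4) exp (-|y|^2 / 2)`. -/
def gaborFun {ι : Type} [Fintype ι] (x ξ : RR ι) (y : RR ι) : ℂ :=
  ((Real.pi ^ (-(Fintype.card ι : ℝ) / 4) * Real.exp (-‖y - x‖ ^ 2 / 2) : ℝ) : ℂ) *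
    Complex.exp (-(Complex.I * (inner ℝ y ξ : ℝ)))

theorem gaborFun_eq {ι : Type} [Fintype ι] (x ξ : RR ι) :
    gaborFun x ξ = ((Real.pi ^ (-(Fintype.card ι : ℝ) / 4) : ℝ) : ℂ) •
      fun y : RR ι => ∏ i ∈ Finset.univ, gauss1 (x i) (ξ i) (y i) := by
  funext y
  simp only [gaborFun, Pi.smul_apply, smul_eq_mul, gauss1, ← Complex.exp_sum, Complex.ofReal_mul,
    Complex.ofReal_exp, mul_assoc, ← Complex.exp_add]
  congr 2
  have h1 : ((‖y - x‖ ^ 2 : ℝ) : ℂ) = ∑ i, ((y i : ℂ) - (x i : ℂ)) ^ 2 := by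
    rw [EuclideanSpace.norm_sq_eq, Complex.ofReal_sum]
    refine Finset.sum_congr rfl fun i _ => ?_
    rw [Real.norm_eq_abs, sq_abs]
    simp
  have h2 : ((inner ℝ y ξ : ℝ) : ℂ) = ∑ i, (y i : ℂ) * (ξ i : ℂ) := by
    rw [PiLp.inner_apply, Complex.ofReal_sum]
    refine Finset.sum_congr rfl fun i _ => ?_
    simp [mul_comm]
  rw [h2, Complex.ofReal_div, Complex.ofReal_neg, h1, Finset.mul_sum, ← Finset.sum_neg_distrib,
    ← Finset.sum_neg_distrib, Finset.sum_div, ← Finset.sum_add_distrib]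
  refine Finset.sum_congr rfl fun i _ => ?_
  push_cast
  ring

theorem gaborFun_mem {ι : Type} [Fintype ι] (x ξ : RR ι) : gaborFun x ξ ∈ gsSubmodule ι := by
  rw [gaborFun_eq]
  refine Submodule.smul_mem _ _ ⟨?_, fun h hh => ?_⟩
  · refine contDiff_prod fun i _ => ?_
    exact ((((gauss1_differentiable (x i) (ξ i)).contDiff (n := (⊤ : ℕ∞))).restrict_scalars ℝ).comp
      Complex.ofRealCLM.contDiff).comp (EuclideanSpace.proj (𝕜 := ℝ) i).contDiff
  · obtain ⟨C, hC0, hC⟩ := gaussProd_bound x ξ Finset.univ h hh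
    refine ⟨C * Real.exp (1 / h ^ 2), ?_⟩
    rintro _ ⟨⟨k, l, y⟩, rfl⟩
    unfold gsQuot
    simp only
    rw [div_le_iff₀ (by positivity)]
    have h1 : ‖y‖ ^ k ≤ h ^ k * k.factorial * Real.exp (‖y‖ / h) := by
      have := Real.pow_div_factorial_le_exp (‖y‖ / h) (by positivity) k
      rw [div_pow, div_div, div_le_iff₀ (by positivity)] at this
      linarith
    have h2 : Real.exp (‖y‖ / h) * Real.exp (-(∑ i, y i ^ 2) / 4) ≤ Real.exp (1 / h ^ 2) := by
      rw [← Real.exp_add]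
      apply Real.exp_le_exp.2
      have e : ∑ i, y i ^ 2 = ‖y‖ ^ 2 := by
        rw [EuclideanSpace.norm_sq_eq]
        exact Finset.sum_congr rfl fun i _ => by rw [Real.norm_eq_abs, sq_abs]
      rw [e]
      have := sq_nonneg (1 / h - ‖y‖ / 2)
      have e2 : 1 / h ^ 2 = (1 / h) ^ 2 := by rw [div_pow, one_pow]
      have e3 : ‖y‖ / h = ‖y‖ * (1 / h) := by ring
      rw [e2, e3]
      nlinarith
    calc _ ≤ (h ^ k * k.factorial * Real.exp (‖y‖ / h)) *
          (C * (h ^ l * l.factorial * Real.exp (-(∑ i, y i ^ 2) / 4))) :=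
          mul_le_mul h1 (hC l y) (norm_nonneg _) (by positivity)
      _ = C * (h ^ (k + l) * (k.factorial * l.factorial)) *
          (Real.exp (‖y‖ / h) * Real.exp (-(∑ i, y i ^ 2) / 4)) := by ring
      _ ≤ C * (h ^ (k + l) * (k.factorial * l.factorial)) * Real.exp (1 / h ^ 2) := by
          gcongr
      _ = _ := by ring

/-- `gaborFun` as an element of `Σ₁`. -/
def gaborAtom {ι : Type} [Fintype ι] (x ξ : RR ι) : GS ι := ⟨gaborFun x ξ, gaborFun_mem x ξ⟩

/-- The short-time Fourier transform of `u ∈ Σ₁'(ℝ^n)` with Gaussian window, at `(x, ξ)`. -/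
def stft {ι : Type} [Fintype ι] (u : GSDual ι) (z : RR ι × RR ι) : ℂ :=
  (((2 * Real.pi) ^ (-(Fintype.card ι : ℝ) / 2) : ℝ) : ℂ) * u (gaborAtom z.1 z.2)

theorem stft_add {ι : Type} [Fintype ι] (u w : GSDual ι) : stft (u + w) = stft u + stft w := by
  funext z
  simp [stft, mul_add]

theorem stft_smul {ι : Type} [Fintype ι] (c : ℂ) (u : GSDual ι) :
    stft (c • u) = c • stft u := by
  funext z
  simp [stft, mul_left_comm]

theorem stft_zero {ι : Type} [Fintype ι] : stft (0 : GSDual ι) = 0 := by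
  funext z
  simp [stft]

/-! ### Weights -/

/-- Weight functions: positive, measurable, locally bounded together with their reciprocals. -/
structure Weight (V : Type) [NormedAddCommGroup V] [MeasurableSpace V] where
  toFun : V → ℝ
  measurable' : Measurable toFun
  pos' : ∀ x, 0 < toFun x
  locBdd' : ∀ K : Set V, IsCompact K → ∃ C : ℝ, ∀ x ∈ K, toFun x ≤ C ∧ (toFun x)⁻¹ ≤ C

instance (V : Type) [NormedAddCommGroup V] [MeasurableSpace V] :
    CoeFun (Weight V) (fun _ => V → ℝ) := ⟨Weight.toFun⟩

/-- The class `𝒫_s`. The choice of the norm on the finite-dimensional space `V` is immaterial. -/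
def Weight.IsP {V : Type} [NormedAddCommGroup V] [MeasurableSpace V] (s : ℝ) (ω : Weight V) :
    Prop :=
  ∃ r > 0, ∃ C > 0, ∀ x y : V, ω (x + y) ≤ C * (ω x * Real.exp (r * ‖y‖ ^ (1 / s)))

/-- Submultiplicative weights (up to a constant), assumed to be even. -/
def Weight.IsSubmultiplicative {V : Type} [NormedAddCommGroup V] [MeasurableSpace V]
    (v : Weight V) : Prop :=
  (∀ x, v (-x) = v x) ∧ ∃ C > 0, ∀ x y : V, v (x + y) ≤ C * (v x * v y)

/-- The weight `(X, Ξ) ↦ v₀ (Ξ)`. -/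
def Weight.onSnd {V : Type} [NormedAddCommGroup V] [MeasurableSpace V] (v₀ : Weight V) :
    Weight (V × V) where
  toFun z := v₀ z.2
  measurable' := v₀.measurable'.comp measurable_snd
  pos' z := v₀.pos' z.2
  locBdd' K hK := by
    obtain ⟨C, hC⟩ := v₀.locBdd' (Prod.snd '' K) (hK.image continuous_snd)
    exact ⟨C, fun z hz => hC z.2 ⟨z, hz, rfl⟩⟩

/-! ### Spaces defined by a norm condition on the short-time Fourier transform -/

/-- A norm with values in `[0, ∞]` on the measurable functions. -/
structure IsFunctionNorm {α : Type} [MeasurableSpace α] (N : (α → ℂ) → ℝ≥0∞) : Prop where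
  map_zero : N 0 = 0
  map_smul : ∀ (c : ℂ) (F : α → ℂ), N (c • F) = ‖c‖ₑ * N F
  map_add : ∀ F G : α → ℂ, Measurable F → Measurable G → N (F + G) ≤ N F + N G

/-- The `u ∈ Σ₁'` with measurable short-time Fourier transform of finite norm. (The transform is
in fact always continuous.) -/
def stftSubmodule {ι : Type} [Fintype ι] {N : (RR ι × RR ι → ℂ) → ℝ≥0∞}
    (hN : IsFunctionNorm N) : Submodule ℂ (GSDual ι) where
  carrier := {u | Measurable (stft u) ∧ N (stft u) < ∞}
  zero_mem' := by
    change Measurable (stft 0) ∧ N (stft 0) < ∞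
    rw [stft_zero, hN.map_zero]
    exact ⟨measurable_const, ENNReal.zero_lt_top⟩
  add_mem' := by
    rintro u w ⟨hu, hu'⟩ ⟨hw, hw'⟩
    change Measurable (stft (u + w)) ∧ N (stft (u + w)) < ∞
    rw [stft_add]
    exact ⟨hu.add hw, (hN.map_add _ _ hu hw).trans_lt (ENNReal.add_lt_top.2 ⟨hu', hw'⟩)⟩
  smul_mem' := by
    rintro c u ⟨hu, hu'⟩
    change Measurable (stft (c • u)) ∧ N (stft (c • u)) < ∞
    rw [stft_smul, hN.map_smul]
    exact ⟨hu.const_smul c, ENNReal.mul_lt_top enorm_lt_top hu'⟩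

/-- The space of all `u ∈ Σ₁'` with `N (V_φ u) < ∞`, with the norm `N (V_φ u)`. -/
def StftSpace {ι : Type} [Fintype ι] {N : (RR ι × RR ι → ℂ) → ℝ≥0∞}
    (hN : IsFunctionNorm N) : Type := stftSubmodule hN

section StftSpace

variable {ι : Type} [Fintype ι] {N : (RR ι × RR ι → ℂ) → ℝ≥0∞} (hN : IsFunctionNorm N)

instance : AddCommGroup (StftSpace hN) := inferInstanceAs (AddCommGroup (stftSubmodule hN))

instance : Module ℂ (StftSpace hN) := inferInstanceAs (Module ℂ (stftSubmodule hN))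

instance : Norm (StftSpace hN) := ⟨fun u => (N (stft u.1)).toReal⟩

theorem stftSpace_core : SeminormedSpace.Core ℂ (StftSpace hN) where
  norm_nonneg u := ENNReal.toReal_nonneg
  norm_smul c u := by
    change (N (stft (c • u.1))).toReal = ‖c‖ * (N (stft u.1)).toReal
    rw [stft_smul, hN.map_smul, ENNReal.toReal_mul, toReal_enorm]
  norm_triangle u w := by
    change (N (stft (u.1 + w.1))).toReal ≤ (N (stft u.1)).toReal + (N (stft w.1)).toReal
    rw [stft_add, ← ENNReal.toReal_add u.2.2.ne w.2.2.ne]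
    exact ENNReal.toReal_mono (ENNReal.add_ne_top.2 ⟨u.2.2.ne, w.2.2.ne⟩)
      (hN.map_add _ _ u.2.1 w.2.1)

instance : SeminormedAddCommGroup (StftSpace hN) :=
  SeminormedAddCommGroup.ofCore (stftSpace_core hN)

instance : NormedSpace ℂ (StftSpace hN) where
  norm_smul_le c u := (stftSpace_core hN).norm_smul c u |>.le

end StftSpace

/-! ### The modulation space `M^{∞,1}_{(ω)}` -/

/-- `ξ ↦ ‖F(·, ξ) ω(·, ξ)‖_{L^∞}`. -/
def supProfile {ι : Type} [Fintype ι] (ω : Weight (RR ι × RR ι)) (F : RR ι × RR ι → ℂ)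
    (ξ : RR ι) : ℝ≥0∞ :=
  eLpNorm (fun x => F (x, ξ) * (ω (x, ξ) : ℂ)) ∞ volume

/-- The norm of the weighted mixed Lebesgue space `L^{∞,1}_{(ω)}`. -/
def normInf1 {ι : Type} [Fintype ι] (ω : Weight (RR ι × RR ι)) (F : RR ι × RR ι → ℂ) : ℝ≥0∞ :=
  ∫⁻ ξ, supProfile ω F ξ

theorem measurable_supProfile {ι : Type} [Fintype ι] (ω : Weight (RR ι × RR ι))
    {F : RR ι × RR ι → ℂ} (hF : Measurable F) : Measurable (supProfile ω F) := by
  have hm : Measurable fun z : RR ι × RR ι => ‖F z * (ω z : ℂ)‖ₑ :=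
    (hF.mul (Complex.measurable_ofReal.comp ω.measurable')).enorm
  refine measurable_of_Iic fun c => ?_
  have e : supProfile ω F ⁻¹' Set.Iic c = {ξ | volume ((fun x : RR ι => (x, ξ)) ⁻¹'
      {z : RR ι × RR ι | c < ‖F z * (ω z : ℂ)‖ₑ}) = 0} := by
    ext ξ
    simp only [Set.mem_preimage, Set.mem_Iic, Set.mem_ofPred_eq, supProfile, eLpNorm_exponent_top,
      eLpNormEssSup]
    constructor
    · intro h
      have h1 := ENNReal.ae_le_essSup (μ := volume) fun x => ‖F (x, ξ) * (ω (x, ξ) : ℂ)‖ₑ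
      have h2 : ∀ᵐ x, ‖F (x, ξ) * (ω (x, ξ) : ℂ)‖ₑ ≤ c := h1.mono fun x hx => hx.trans h
      rw [ae_iff] at h2
      simpa using h2
    · intro h
      refine essSup_le_of_ae_le c ?_
      rw [EventuallyLE, ae_iff]
      simpa using h
  rw [e]
  exact measurable_measure_prodMk_right (measurableSet_lt measurable_const hm)
    (measurableSet_singleton 0)

theorem normInf1_isFunctionNorm {ι : Type} [Fintype ι] (ω : Weight (RR ι × RR ι)) :
    IsFunctionNorm (normInf1 ω) where
  map_zero := by
    have e : ∀ ξ, supProfile ω 0 ξ = 0 := fun ξ => by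
      unfold supProfile
      simp only [Pi.zero_apply, zero_mul]
      exact eLpNorm_zero
    simp [normInf1, e]
  map_smul c F := by
    unfold normInf1
    rw [← lintegral_const_mul' _ _ enorm_ne_top]
    refine lintegral_congr fun ξ => ?_
    unfold supProfile
    rw [← eLpNorm_const_smul]
    congr 1
    funext x
    simp [mul_assoc]
  map_add F G hF hG := by
    unfold normInf1
    rw [← lintegral_add_left (measurable_supProfile ω hF)]
    refine lintegral_mono fun ξ => ?_
    unfold supProfile
    have hw : Measurable fun x : RR ι => (ω (x, ξ) : ℂ) :=
      Complex.measurable_ofReal.comp (ω.measurable'.comp measurable_prodMk_right)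
    refine le_trans (le_of_eq ?_) (eLpNorm_add_le
      (((hF.comp measurable_prodMk_right).mul hw).aestronglyMeasurable)
      (((hG.comp measurable_prodMk_right).mul hw).aestronglyMeasurable) le_top)
    congr 1
    funext x
    simp [add_mul]

/-- The modulation space `M^{∞,1}_{(ω)}(ℝ^n)`. -/
abbrev ModInf1 {ι : Type} [Fintype ι] (ω : Weight (RR ι × RR ι)) : Type :=
  StftSpace (normInf1_isFunctionNorm ω)

/-- Narrow convergence of `a_j` to `a` in `M^{∞,1}_{(ω)}`: convergence in the weak topology of `Σ₁'`,
with `ξ ↦ ‖V_φ a_j(·, ξ) ω(·, ξ)‖_{L^∞}` dominated by a fixed integrable function. -/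
def NarrowTendsto {ι : Type} [Fintype ι] {ω : Weight (RR ι × RR ι)} (a : ℕ → ModInf1 ω)
    (a₀ : ModInf1 ω) : Prop :=
  (∀ ψ : GS ι, Tendsto (fun j => (a j).1 ψ) atTop (𝓝 (a₀.1 ψ))) ∧
    ∃ G : RR ι → ℝ≥0∞, Measurable G ∧ ∫⁻ ξ, G ξ < ∞ ∧
      ∀ j, ∀ᵐ ξ, supProfile ω (stft (a j).1) ξ ≤ G ξ

/-- Continuity along narrowly convergent sequences. -/
def NarrowContinuous {ι : Type} [Fintype ι] {ω : Weight (RR ι × RR ι)} {Y : Type}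
    [TopologicalSpace Y] (T : ModInf1 ω → Y) : Prop :=
  ∀ (a : ℕ → ModInf1 ω) (a₀ : ModInf1 ω), NarrowTendsto a a₀ →
    Tendsto (fun j => T (a j)) atTop (𝓝 (T a₀))

/-! ### Young functions and Orlicz modulation spaces -/

/-- Young functions. -/
structure YoungFunction where
  toFun : ℝ≥0∞ → ℝ≥0∞
  convex' : ∀ s₁ s₂ t₁ t₂ : ℝ≥0, s₁ + s₂ = 1 →
    toFun ((s₁ * t₁ + s₂ * t₂ : ℝ≥0) : ℝ≥0∞) ≤ s₁ * toFun t₁ + s₂ * toFun t₂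
  map_zero' : toFun 0 = 0
  map_top' : toFun ∞ = ∞
  tendsto' : Tendsto (fun t : ℝ≥0 => toFun t) atTop (𝓝 ∞)

instance : CoeFun YoungFunction (fun _ => ℝ≥0∞ → ℝ≥0∞) := ⟨YoungFunction.toFun⟩

/-- The right derivative `Φ'₊(t)` at a point where `Φ` is finite, as the infimum of the difference
quotients, which are nondecreasing in `h` by convexity. -/
def YoungFunction.rightDeriv (Φ : YoungFunction) (t : ℝ≥0) : ℝ≥0∞ :=
  ⨅ (h : ℝ≥0) (_ : 0 < h), (Φ ((t + h : ℝ≥0) : ℝ≥0∞) - Φ t) / h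

open Classical in
/-- The quotient `t Φ'₊(t) / Φ(t)`, read as `∞` where `Φ` is not positive and finite. -/
def YoungFunction.expQuot (Φ : YoungFunction) (t : ℝ≥0) : ℝ≥0∞ :=
  if Φ t = 0 ∨ Φ t = ∞ then ∞ else t * Φ.rightDeriv t / Φ t

/-- The lower Lebesgue exponent `q_Φ = inf_{t>0} t Φ'₊(t) / Φ(t)`. -/
def YoungFunction.lowerExp (Φ : YoungFunction) : ℝ≥0∞ := ⨅ (t : ℝ≥0) (_ : 0 < t), Φ.expQuot t

/-- The upper Lebesgue exponent `p_Φ = sup_{t>0} t Φ'₊(t) / Φ(t)`. -/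
def YoungFunction.upperExp (Φ : YoungFunction) : ℝ≥0∞ := ⨆ (t : ℝ≥0) (_ : 0 < t), Φ.expQuot t

theorem YoungFunction.mono (Φ : YoungFunction) : Monotone fun t : ℝ≥0 => Φ t := by
  intro a b hab
  rcases eq_or_ne b 0 with rfl | hb
  · simp [le_antisymm hab (zero_le)]
  have h1 : a / b ≤ 1 := div_le_one_of_le₀ hab (zero_le)
  have := Φ.convex' (a / b) (1 - a / b) b 0 (add_tsub_cancel_of_le h1)
  rw [div_mul_cancel₀ a hb, mul_zero, add_zero, ENNReal.coe_zero, Φ.map_zero', mul_zero,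
    add_zero] at this
  refine this.trans (mul_le_of_le_one_left (zero_le) ?_)
  exact_mod_cast h1

/-- The numbers `c > 0` with `∫ Φ(|F| / c) ≤ 1`. -/
def luxSet {α : Type} [MeasureSpace α] (Φ : YoungFunction) (F : α → ℂ) : Set ℝ≥0 :=
  {c | 0 < c ∧ ∫⁻ x, Φ ((‖F x‖₊ / c : ℝ≥0) : ℝ≥0∞) ≤ 1}

/-- The norm of the Orlicz space `L^Φ`. -/
def luxNorm {α : Type} [MeasureSpace α] (Φ : YoungFunction) (F : α → ℂ) : ℝ≥0∞ :=
  ⨅ c ∈ luxSet Φ F, (c : ℝ≥0∞)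

theorem luxNorm_zero {α : Type} [MeasureSpace α] (Φ : YoungFunction) :
    luxNorm Φ (0 : α → ℂ) = 0 := by
  refine le_antisymm (ENNReal.le_of_forall_pos_le_add fun ε hε _ => ?_) (zero_le)
  rw [zero_add]
  refine iInf₂_le ε ⟨hε, ?_⟩
  simp [Φ.map_zero']

theorem luxNorm_smul_le {α : Type} [MeasureSpace α] (Φ : YoungFunction) (c : ℂ) (hc : c ≠ 0)
    (F : α → ℂ) : luxNorm Φ (c • F) ≤ ‖c‖ₑ * luxNorm Φ F := by
  unfold luxNorm
  rw [ENNReal.mul_iInf_of_ne (by simpa using hc) enorm_ne_top]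
  refine le_iInf fun l => ?_
  by_cases hl : l ∈ luxSet Φ F
  · simp only [hl, iInf_pos]
    have hc' : 0 < ‖c‖₊ := by simpa using hc
    have : ‖c‖₊ * l ∈ luxSet Φ (c • F) := by
      refine ⟨mul_pos hc' hl.1, le_trans (le_of_eq ?_) hl.2⟩
      refine lintegral_congr fun x => ?_
      rw [Pi.smul_apply, nnnorm_smul, mul_div_mul_left _ _ hc'.ne']
    refine (iInf₂_le _ this).trans (le_of_eq ?_)
    rw [ENNReal.coe_mul]
    rfl
  · simp only [hl, iInf_false]
    rw [ENNReal.mul_top (by simpa using hc)]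
    exact le_top

theorem luxNorm_smul {α : Type} [MeasureSpace α] (Φ : YoungFunction) (c : ℂ) (F : α → ℂ) :
    luxNorm Φ (c • F) = ‖c‖ₑ * luxNorm Φ F := by
  rcases eq_or_ne c 0 with rfl | hc
  · rw [zero_smul, luxNorm_zero]; simp
  refine le_antisymm (luxNorm_smul_le Φ c hc F) ?_
  have h := luxNorm_smul_le Φ c⁻¹ (inv_ne_zero hc) (c • F)
  rw [inv_smul_smul₀ hc] at h
  calc ‖c‖ₑ * luxNorm Φ F ≤ ‖c‖ₑ * (‖c⁻¹‖ₑ * luxNorm Φ (c • F)) := by gcongr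
    _ = luxNorm Φ (c • F) := by
      rw [← mul_assoc, ← enorm_mul, mul_inv_cancel₀ hc, enorm_one, one_mul]

theorem luxSet_add {α : Type} [MeasureSpace α] (Φ : YoungFunction) {F G : α → ℂ}
    (hF : Measurable F) {a b : ℝ≥0} (ha : a ∈ luxSet Φ F) (hb : b ∈ luxSet Φ G) :
    a + b ∈ luxSet Φ (F + G) := by
  have hab : a + b ≠ 0 := (add_pos ha.1 hb.1).ne'
  have ha0 : a ≠ 0 := ha.1.ne'
  have hb0 : b ≠ 0 := hb.1.ne'
  have h1 : a / (a + b) + b / (a + b) = 1 := by rw [← add_div, div_self hab]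
  refine ⟨add_pos ha.1 hb.1, ?_⟩
  have hmeas : Measurable fun x => ((a / (a + b) : ℝ≥0) : ℝ≥0∞) *
      Φ ((‖F x‖₊ / a : ℝ≥0) : ℝ≥0∞) :=
    (Φ.mono.measurable.comp (hF.nnnorm.div_const a)).const_mul _
  calc ∫⁻ x, Φ ((‖(F + G) x‖₊ / (a + b) : ℝ≥0) : ℝ≥0∞)
      ≤ ∫⁻ x, (((a / (a + b) : ℝ≥0) : ℝ≥0∞) * Φ ((‖F x‖₊ / a : ℝ≥0) : ℝ≥0∞) +
          ((b / (a + b) : ℝ≥0) : ℝ≥0∞) * Φ ((‖G x‖₊ / b : ℝ≥0) : ℝ≥0∞)) := by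
        refine lintegral_mono fun x => ?_
        refine le_trans (Φ.mono ?_) (Φ.convex' _ _ _ _ h1)
        have e : a / (a + b) * (‖F x‖₊ / a) + b / (a + b) * (‖G x‖₊ / b) =
            (‖F x‖₊ + ‖G x‖₊) / (a + b) := by
          field_simp
        rw [e]
        gcongr
        exact nnnorm_add_le _ _
    _ = ((a / (a + b) : ℝ≥0) : ℝ≥0∞) * (∫⁻ x, Φ ((‖F x‖₊ / a : ℝ≥0) : ℝ≥0∞)) +
          ((b / (a + b) : ℝ≥0) : ℝ≥0∞) * ∫⁻ x, Φ ((‖G x‖₊ / b : ℝ≥0) : ℝ≥0∞) := by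
        rw [lintegral_add_left hmeas, lintegral_const_mul' _ _ ENNReal.coe_ne_top,
          lintegral_const_mul' _ _ ENNReal.coe_ne_top]
    _ ≤ ((a / (a + b) : ℝ≥0) : ℝ≥0∞) * 1 + ((b / (a + b) : ℝ≥0) : ℝ≥0∞) * 1 := by
        gcongr
        · exact ha.2
        · exact hb.2
    _ = 1 := by rw [mul_one, mul_one, ← ENNReal.coe_add, h1, ENNReal.coe_one]

theorem luxNorm_add {α : Type} [MeasureSpace α] (Φ : YoungFunction) {F G : α → ℂ}
    (hF : Measurable F) : luxNorm Φ (F + G) ≤ luxNorm Φ F + luxNorm Φ G := by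
  unfold luxNorm
  rw [ENNReal.iInf_add]
  refine le_iInf fun a => ?_
  by_cases ha : a ∈ luxSet Φ F
  · simp only [ha, iInf_pos]
    rw [ENNReal.add_iInf]
    refine le_iInf fun b => ?_
    by_cases hb : b ∈ luxSet Φ G
    · simp only [hb, iInf_pos]
      exact (iInf₂_le _ (luxSet_add Φ hF ha hb)).trans (by rw [ENNReal.coe_add])
    · simp [hb]
  · simp [ha]

/-- The norm of the weighted Orlicz space `L^Φ_{(ω)}(ℝ^{2n})`. -/
def normOrlicz {ι : Type} [Fintype ι] (Φ : YoungFunction) (ω : Weight (RR ι × RR ι))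
    (F : RR ι × RR ι → ℂ) : ℝ≥0∞ :=
  luxNorm Φ fun z => F z * (ω z : ℂ)

theorem normOrlicz_isFunctionNorm {ι : Type} [Fintype ι] (Φ : YoungFunction)
    (ω : Weight (RR ι × RR ι)) : IsFunctionNorm (normOrlicz Φ ω) where
  map_zero := by
    unfold normOrlicz
    simp only [Pi.zero_apply, zero_mul]
    exact luxNorm_zero Φ
  map_smul c F := by
    unfold normOrlicz
    rw [← luxNorm_smul]
    congr 1
    funext z
    simp [mul_assoc]
  map_add F G hF hG := by
    unfold normOrlicz
    refine le_trans (le_of_eq ?_) (luxNorm_add Φ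
      (hF.mul (Complex.measurable_ofReal.comp ω.measurable')))
    congr 1
    funext z
    simp [add_mul]

/-- The Orlicz modulation space `M^Φ_{(ω)}(ℝ^n)`. -/
abbrev ModOrlicz {ι : Type} [Fintype ι] (Φ : YoungFunction) (ω : Weight (RR ι × RR ι)) : Type :=
  StftSpace (normOrlicz_isFunctionNorm Φ ω)

/-! ### Phase functions and Fourier integral operators -/

/-- The pair `(x, y)` as one vector. -/
def cat {ι κ : Type} [Fintype ι] [Fintype κ] (x : RR ι) (y : RR κ) : RR (ι ⊕ κ) :=
  WithLp.toLp 2 (Sum.elim x y)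

/-- The index set of the coordinates of `X = (x, y, ζ) ∈ ℝ^{2d+m}`. -/
abbrev Ix (d m : ℕ) : Type := Fin d ⊕ Fin d ⊕ Fin m

/-- The distribution `u ∈ Σ₁'` is given by the function `g`. -/
def IsGivenBy {ι : Type} [Fintype ι] (u : GSDual ι) (g : RR ι → ℂ) : Prop :=
  ∀ ψ : GS ι, Integrable (fun x => g x * ψ x) ∧ u ψ = ∫ x, g x * ψ x

/-- `φ` is continuous and its distributional derivatives of order two are the functions `H i j`,
which are the elements `U i j` of `M^{∞,1}_{(v)}`. -/
structure IsPhase {ι : Type} [Fintype ι] [DecidableEq ι] (v : Weight (RR ι × RR ι))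
    (φ : RR ι → ℝ) (H : ι → ι → RR ι → ℝ) (U : ι → ι → ModInf1 v) : Prop where
  continuous : Continuous φ
  locallyIntegrable : ∀ i j, LocallyIntegrable (H i j)
  weakDeriv : ∀ i j, ∀ ψ : RR ι → ℝ, ContDiff ℝ (⊤ : ℕ∞) ψ → HasCompactSupport ψ →
    ∫ X, φ X * fderiv ℝ (fun Y => fderiv ℝ ψ Y (EuclideanSpace.single j 1)) X
      (EuclideanSpace.single i 1) = ∫ X, H i j X * ψ X
  isGivenBy : ∀ i j, IsGivenBy (U i j).1 fun X => (H i j X : ℂ)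

/-- The norm `‖φ''‖` in `M^{∞,1}_{(v)}`. -/
def hessNorm {ι : Type} [Fintype ι] {v : Weight (RR ι × RR ι)} (U : ι → ι → ModInf1 v) : ℝ :=
  ∑ i, ∑ j, ‖U i j‖

/-- The matrix with the blocks `φ''_{y,x}`, `φ''_{ζ,x}`, `φ''_{y,ζ}`, `φ''_{ζ,ζ}`. -/
def mixedHessian {d m : ℕ} (H : Ix d m → Ix d m → RR (Ix d m) → ℝ) (X : RR (Ix d m)) :
    Matrix (Fin d ⊕ Fin m) (Fin d ⊕ Fin m) ℝ :=
  Matrix.fromBlocks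
    (Matrix.of fun i j => H (Sum.inl i) (Sum.inr (Sum.inl j)) X)
    (Matrix.of fun i j => H (Sum.inl i) (Sum.inr (Sum.inr j)) X)
    (Matrix.of fun i j => H (Sum.inr (Sum.inr i)) (Sum.inr (Sum.inl j)) X)
    (Matrix.of fun i j => H (Sum.inr (Sum.inr i)) (Sum.inr (Sum.inr j)) X)

/-- The function `Op_φ(a) f` for `a ∈ Σ₁(ℝ^{2d+m})` and `f ∈ Σ₁(ℝ^d)`. -/
def opFun {d m : ℕ} (φ : RR (Ix d m) → ℝ) (a : GS (Ix d m)) (f : GS (Fin d)) (x : RR (Fin d)) : ℂ :=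
  (((2 * Real.pi) ^ (-((d : ℝ) + m) / 2) : ℝ) : ℂ) *
    ∫ p : RR (Fin d) × RR (Fin m), a (cat x (cat p.1 p.2)) * f p.1 *
      Complex.exp (Complex.I * (φ (cat x (cat p.1 p.2)) : ℂ))

/-- `Σ₁(ℝ^{2d+m})` is contained in `M^{∞,1}_{(ω)}(ℝ^{2d+m})`, and on it `T` is `a ↦ Op_φ(a)`. -/
def ExtendsOp {d m : ℕ} {ω : Weight (RR (Ix d m) × RR (Ix d m))} (φ : RR (Ix d m) → ℝ)
    (T : ModInf1 ω → (GS (Fin d) →L[ℂ] GSDual (Fin d))) : Prop :=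
  ∀ a : GS (Ix d m), ∃ A : ModInf1 ω, A.1 = a.toDual ∧
    ∀ f : GS (Fin d), IsGivenBy (T A f) (opFun φ a f)

/-- `Σ₁(ℝ^d)` is contained in `M^Φ_{(ω₁)}(ℝ^d)`, and on it `S` agrees with `L : Σ₁ → Σ₁'`. -/
def ExtendsToOrlicz {d : ℕ} {Φ : YoungFunction} {ω₁ ω₂ : Weight (RR (Fin d) × RR (Fin d))}
    (L : GS (Fin d) →L[ℂ] GSDual (Fin d)) (S : ModOrlicz Φ ω₁ →L[ℂ] ModOrlicz Φ ω₂) : Prop :=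
  ∀ f : GS (Fin d), ∃ F : ModOrlicz Φ ω₁, F.1 = f.toDual ∧ (S F).1 = L f

end

open MeasureTheory Filter Topology

/-! ### Global injectivity of maps with uniformly invertible derivative -/

theorem injective_of_uniform_local_inverse {E : Type*} [NormedAddCommGroup E] [NormedSpace ℝ E]
    {f : E → E} (hf : Continuous f) {ρ σ L : ℝ} (hρ : 0 < ρ) (hσ : 0 < σ)
    (hanti : ∀ x, ∀ x₁ ∈ Metric.ball x ρ, ∀ x₂ ∈ Metric.ball x ρ, dist x₁ x₂ ≤ L * dist (f x₁) (f x₂))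
    (hsurj : ∀ x, ∀ y ∈ Metric.ball (f x) σ, ∃ x' ∈ Metric.ball x (ρ / 4), f x' = y) :
    Function.Injective f := by
  intro a b hab
  set y := f a with hy
  set ℓ : ℝ → E := fun s => a + s • (b - a) with hℓ
  have hℓc : Continuous ℓ := by simp only [hℓ]; fun_prop
  set γ : ℝ → ℝ → E := fun t s => y + (1 - t) • (f (ℓ s) - y) with hγ
  have hγc : ∀ t, Continuous (γ t) := fun t => by
    have := hf.comp hℓc
    simp only [hγ]; fun_prop
  obtain ⟨K, hK⟩ := (isCompact_Icc (a := (0 : ℝ)) (b := 1)).exists_bound_of_continuousOn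
    ((hf.comp hℓc).sub (continuous_const (y := y))).continuousOn
  have hK0 : 0 ≤ K := (norm_nonneg _).trans (hK 0 (by simp))
  let P : ℝ → Prop := fun t => ∃ Γ : ℝ → E, ContinuousOn Γ (Set.Icc 0 1) ∧ Γ 0 = a ∧ Γ 1 = b ∧
    ∀ s ∈ Set.Icc (0 : ℝ) 1, f (Γ s) = γ t s
  have hP0 : P 0 := ⟨ℓ, hℓc.continuousOn, by simp [hℓ], by simp [hℓ], fun s _ => by simp [hγ]⟩
  have hstep : ∀ t t', |t' - t| * K < σ → P t → P t' := by
    rintro t t' htt ⟨Γ, hΓ, h0, h1, hlift⟩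
    have hclose : ∀ s ∈ Set.Icc (0 : ℝ) 1, γ t' s ∈ Metric.ball (f (Γ s)) σ := by
      intro s hs
      rw [hlift s hs, Metric.mem_ball, dist_eq_norm]
      have : γ t' s - γ t s = (t - t') • (f (ℓ s) - y) := by
        simp only [hγ]; module
      rw [this, norm_smul, Real.norm_eq_abs, abs_sub_comm]
      exact (mul_le_mul_of_nonneg_left (hK s hs) (abs_nonneg _)).trans_lt htt
    have : ∀ s, ∃ x', s ∈ Set.Icc (0 : ℝ) 1 → x' ∈ Metric.ball (Γ s) (ρ / 4) ∧ f x' = γ t' s := by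
      intro s
      by_cases hs : s ∈ Set.Icc (0 : ℝ) 1
      · obtain ⟨x', hx', hx⟩ := hsurj _ _ (hclose s hs)
        exact ⟨x', fun _ => ⟨hx', hx⟩⟩
      · exact ⟨0, fun h => absurd h hs⟩
    choose Γ' hΓ' using this
    have hend : ∀ s ∈ Set.Icc (0 : ℝ) 1, γ t' s = f (Γ s) → Γ' s = Γ s := by
      intro s hs h
      have := hanti (Γ s) (Γ' s) (Metric.ball_subset_ball (by linarith) (hΓ' s hs).1)
        (Γ s) (Metric.mem_ball_self hρ)
      rw [(hΓ' s hs).2, h, dist_self, mul_zero] at this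
      exact dist_le_zero.1 this
    refine ⟨Γ', ?_, ?_, ?_, fun s hs => (hΓ' s hs).2⟩
    · intro s hs
      have h1 : Tendsto (fun s' => L * dist (γ t' s') (γ t' s)) (𝓝[Set.Icc 0 1] s) (𝓝 0) := by
        have : Tendsto (fun s' => L * dist (γ t' s') (γ t' s)) (𝓝 s) (𝓝 (L * dist (γ t' s) (γ t' s))) :=
          ((continuous_const.mul ((hγc t').dist continuous_const)).tendsto s)
        rw [dist_self, mul_zero] at this
        exact this.mono_left nhdsWithin_le_nhds
      rw [ContinuousWithinAt, tendsto_iff_dist_tendsto_zero]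
      refine squeeze_zero' (Eventually.of_forall fun _ => dist_nonneg) ?_ h1
      have h2 : ∀ᶠ s' in 𝓝[Set.Icc 0 1] s, dist (Γ s') (Γ s) < ρ / 4 :=
        (hΓ s hs) (Metric.ball_mem_nhds _ (by positivity))
      filter_upwards [h2, self_mem_nhdsWithin] with s' hs' hmem
      have e1 := Metric.mem_ball.1 (hΓ' s' hmem).1
      have e2 := Metric.mem_ball.1 (hΓ' s hs).1
      have := hanti (Γ s) (Γ' s') (by
        rw [Metric.mem_ball]; linarith [dist_triangle (Γ' s') (Γ s') (Γ s)])
        (Γ' s) (by rw [Metric.mem_ball]; linarith)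
      rwa [(hΓ' s' hmem).2, (hΓ' s hs).2] at this
    · rw [hend 0 (by simp), h0]
      rw [h0]; simp [hγ, hℓ, hy]
    · rw [hend 1 (by simp), h1]
      rw [h1]; simp [hγ, hℓ, hab]
  obtain ⟨N, hN⟩ := exists_nat_gt (K / σ)
  have hNpos : (0 : ℝ) < N := lt_of_le_of_lt (by positivity) hN
  have hPn : ∀ k : ℕ, P (k / N) := by
    intro k
    induction k with
    | zero => simpa using hP0
    | succ k ih =>
      refine hstep _ _ ?_ ih
      have : ((k + 1 : ℕ) : ℝ) / N - k / N = 1 / N := by push_cast; ring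
      rw [this, abs_of_pos (by positivity), one_div_mul_eq_div, div_lt_iff₀ hNpos]
      rw [div_lt_iff₀ hσ] at hN
      linarith
  obtain ⟨Γ, hΓ, h0, h1, hlift⟩ := hPn N
  rw [div_self hNpos.ne'] at hlift
  have hconst : ∀ s ∈ Set.Icc (0 : ℝ) 1, f (Γ s) = y := fun s hs => by
    rw [hlift s hs]; simp [hγ]
  have hloc : ∀ s : Set.Icc (0 : ℝ) 1, ∀ᶠ s' : Set.Icc (0 : ℝ) 1 in 𝓝 s, Γ s' = Γ s := by
    intro s
    have hcs : Continuous fun s : Set.Icc (0 : ℝ) 1 => Γ s := continuousOn_iff_continuous_domRestrict.1 hΓ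
    filter_upwards [(hcs.continuousAt (x := s)).eventually (Metric.ball_mem_nhds _ hρ)] with s' hs'
    have := hanti (Γ s) (Γ s') hs' (Γ s) (Metric.mem_ball_self hρ)
    rw [hconst s' s'.2, hconst s s.2, dist_self, mul_zero] at this
    exact dist_le_zero.1 this
  have hlc : IsLocallyConstant fun s : Set.Icc (0 : ℝ) 1 => Γ s :=
    (IsLocallyConstant.iff_eventually_eq _).2 hloc
  have := hlc.apply_eq_of_preconnectedSpace ⟨0, by simp⟩ ⟨1, by simp⟩
  simpa [h0, h1] using this

theorem exists_lower_bound_of_det {E : Type*} [NormedAddCommGroup E] [NormedSpace ℝ E]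
    [FiniteDimensional ℝ E] {M δ : ℝ} (hδ : 0 < δ) :
    ∃ c > 0, ∀ A : E →L[ℝ] E, ‖A‖ ≤ M → δ ≤ |A.det| → ∀ v, c * ‖v‖ ≤ ‖A v‖ := by
  set S : Set ((E →L[ℝ] E) × E) :=
    (Metric.closedBall 0 M ∩ {A | δ ≤ |A.det|}) ×ˢ Metric.sphere 0 1 with hS
  have hclosed : IsClosed {A : E →L[ℝ] E | δ ≤ |A.det|} :=
    isClosed_le continuous_const ContinuousLinearMap.continuous_det.abs
  have hSc : IsCompact S :=
    ((isCompact_closedBall 0 M).inter_right hclosed).prod (isCompact_sphere 0 1)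
  have hcont : ContinuousOn (fun p : (E →L[ℝ] E) × E => ‖p.1 p.2‖) S := by fun_prop
  have key : ∃ c > 0, ∀ p ∈ S, c ≤ ‖p.1 p.2‖ := by
    rcases S.eq_empty_or_nonempty with h | h
    · exact ⟨1, one_pos, fun p hp => by simp [h] at hp⟩
    · obtain ⟨p, hp, hmin⟩ := hSc.exists_isMinOn h hcont
      refine ⟨‖p.1 p.2‖, ?_, fun q hq => hmin hq⟩
      obtain ⟨⟨-, hdet⟩, hs⟩ := hp
      have hd : p.1.det ≠ 0 := fun h0 => by
        simp only [Set.mem_ofPred_eq, h0, abs_zero] at hdet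
        linarith
      have hinj : Function.Injective p.1 := by
        have := (p.1.toContinuousLinearEquivOfDetNeZero hd).injective
        intro a b hab
        apply this
        simpa using hab
      refine norm_pos_iff.2 fun h0 => ?_
      have : p.2 = 0 := hinj (by rw [h0, map_zero])
      simp [this] at hs
  obtain ⟨c, hc, h⟩ := key
  refine ⟨c, hc, fun A hA hd v => ?_⟩
  rcases eq_or_ne v 0 with rfl | hv
  · simp
  have hv' : 0 < ‖v‖ := norm_pos_iff.2 hv
  have := h (A, ‖v‖⁻¹ • v) ⟨⟨by simpa using hA, hd⟩, by
    simp [norm_smul, hv'.ne']⟩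
  simp only [map_smul, norm_smul, norm_inv, norm_norm] at this
  rwa [inv_mul_eq_div, le_div_iff₀ hv'] at this

theorem injective_of_det_bound {E : Type*} [NormedAddCommGroup E] [NormedSpace ℝ E]
    [FiniteDimensional ℝ E] {f : E → E} {f' : E → E →L[ℝ] E} (hf : ∀ x, HasFDerivAt f (f' x) x)
    (hu : UniformContinuous f') {M δ : ℝ} (hM : ∀ x, ‖f' x‖ ≤ M) (hδ : 0 < δ)
    (hdet : ∀ x, δ ≤ |(f' x).det|) : Function.Injective f := by
  rcases subsingleton_or_nontrivial E with hE | hE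
  · exact fun a b _ => Subsingleton.elim a b
  obtain ⟨c, hc, hlow⟩ := exists_lower_bound_of_det (E := E) (M := M) hδ
  obtain ⟨ρ, hρ, hρu⟩ := Metric.uniformContinuous_iff.1 hu (c / 2) (by positivity)
  have happ : ∀ x, ApproximatesLinearOn f (f' x) (Metric.ball x ρ) ⟨c / 2, by positivity⟩ := by
    intro x x₁ h₁ x₂ h₂
    have := (convex_ball x ρ).norm_image_sub_le_of_norm_hasFDerivWithin_le
      (f := fun z => f z - f' x z) (f' := fun z => f' z - f' x) (C := c / 2)
      (fun z _ => ((hf z).sub (f' x).hasFDerivAt).hasFDerivWithinAt)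
      (fun z hz => by rw [← dist_eq_norm]; exact (hρu hz).le) h₂ h₁
    have e : f x₁ - f' x x₁ - (f x₂ - f' x x₂) = f x₁ - f x₂ - f' x (x₁ - x₂) := by
      rw [map_sub]; abel
    rw [e] at this
    exact this
  refine injective_of_uniform_local_inverse (ρ := ρ) (σ := c / 2 * (ρ / 8)) (L := 2 / c)
    (continuous_iff_continuousAt.2 fun x => (hf x).continuousAt) hρ (by positivity)
    ?_ ?_
  · intro x x₁ h₁ x₂ h₂
    have h := happ x x₁ h₁ x₂ h₂
    have h' := hlow _ (hM x) (hdet x) (x₁ - x₂)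
    rw [dist_eq_norm, dist_eq_norm]
    have h3 : ‖f' x (x₁ - x₂)‖ ≤ ‖f x₁ - f x₂‖ + ‖f x₁ - f x₂ - f' x (x₁ - x₂)‖ := by
      have := norm_sub_le (f x₁ - f x₂) (f x₁ - f x₂ - f' x (x₁ - x₂))
      rwa [sub_sub_cancel] at this
    change ‖f x₁ - f x₂ - f' x (x₁ - x₂)‖ ≤ c / 2 * ‖x₁ - x₂‖ at h
    rw [div_mul_eq_mul_div, le_div_iff₀ hc]
    nlinarith
  · intro x y hy
    have hd : (f' x).det ≠ 0 := fun h0 => by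
      have := hdet x
      rw [h0, abs_zero] at this
      linarith
    set e := (f' x).toContinuousLinearEquivOfDetNeZero hd
    have he : (e : E →L[ℝ] E) = f' x := (f' x).coe_toContinuousLinearEquivOfDetNeZero hd
    have hap : ApproximatesLinearOn f (e : E →L[ℝ] E) (Metric.ball x ρ) ⟨c / 2, by positivity⟩ := by
      rw [he]; exact happ x
    have hsub : Metric.closedBall x (ρ / 8) ⊆ Metric.ball x ρ :=
      Metric.closedBall_subset_ball (by linarith)
    have hs := hap.surjOn_closedBall_of_nonlinearRightInverse e.toNonlinearRightInverse
      (by positivity : (0 : ℝ) ≤ ρ / 8) hsub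
    have hnorm : c ≤ (‖(e.symm : E →L[ℝ] E)‖)⁻¹ := by
      have h1 : ‖(e.symm : E →L[ℝ] E)‖ ≤ c⁻¹ := by
        refine ContinuousLinearMap.opNorm_le_bound _ (by positivity) fun v => ?_
        have := hlow _ (hM x) (hdet x) (e.symm v)
        rw [← he] at this
        simp only [ContinuousLinearEquiv.coe_coe, ContinuousLinearEquiv.apply_symm_apply] at this ⊢
        rw [inv_mul_eq_div, le_div_iff₀ hc]
        linarith
      rw [le_inv_comm₀ hc (ContinuousLinearEquiv.norm_symm_pos e)]
      exact h1
    obtain ⟨x', hx', hxy⟩ := hs (show y ∈ _ from by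
      rw [Metric.mem_closedBall]
      refine (Metric.mem_ball.1 hy).le.trans (mul_le_mul_of_nonneg_right ?_ (by positivity))
      change c / 2 ≤ (‖(e.symm : E →L[ℝ] E)‖)⁻¹ - c / 2
      linarith)
    exact ⟨x', Metric.closedBall_subset_ball (by linarith) hx', hxy⟩

theorem lintegral_comp_le_of_det_bound {E : Type*} [NormedAddCommGroup E] [NormedSpace ℝ E]
    [FiniteDimensional ℝ E] [MeasurableSpace E] [BorelSpace E] (μ : Measure E) [μ.IsAddHaarMeasure]
    {f : E → E} {f' : E → E →L[ℝ] E}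
    (hf : ∀ x, HasFDerivAt f (f' x) x)
    (hu : UniformContinuous f') {M δ : ℝ} (hM : ∀ x, ‖f' x‖ ≤ M) (hδ : 0 < δ)
    (hdet : ∀ x, δ ≤ |(f' x).det|) (g : E → ℝ≥0∞) :
    ∫⁻ x, g (f x) ∂μ ≤ ENNReal.ofReal δ⁻¹ * ∫⁻ x, g x ∂μ := by
  have hinj := injective_of_det_bound hf hu hM hδ hdet
  have h := lintegral_image_eq_lintegral_abs_det_fderiv_mul μ MeasurableSet.univ
    (fun x _ => (hf x).hasFDerivWithinAt) hinj.injOn g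
  rw [setLIntegral_univ] at h
  have hpt : ∀ x, g (f x) ≤ ENNReal.ofReal δ⁻¹ * (ENNReal.ofReal |(f' x).det| * g (f x)) := by
    intro x
    rw [← mul_assoc, ← ENNReal.ofReal_mul (by positivity)]
    refine le_mul_of_one_le_left (zero_le) ?_
    rw [← ENNReal.ofReal_one]
    refine ENNReal.ofReal_le_ofReal ?_
    rw [inv_mul_eq_div, one_le_div hδ]
    exact hdet x
  calc ∫⁻ x, g (f x) ∂μ ≤ ∫⁻ x, ENNReal.ofReal δ⁻¹ * (ENNReal.ofReal |(f' x).det| * g (f x)) ∂μ :=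
        lintegral_mono hpt
    _ = ENNReal.ofReal δ⁻¹ * ∫⁻ x, ENNReal.ofReal |(f' x).det| * g (f x) ∂μ :=
        lintegral_const_mul' _ _ ENNReal.ofReal_ne_top
    _ ≤ _ := by
        rw [← h]
        exact mul_le_mul_right (setLIntegral_le_lintegral _ _) _

noncomputable section

/-! ### The Fourier transform with kernel `exp (-i ⟨y, ξ⟩)` -/

/-- The character `exp (-i ⟨y, ξ⟩)`. -/
def ecis {ι : Type} [Fintype ι] (y ξ : RR ι) : ℂ :=
  Complex.exp (-(Complex.I * (inner ℝ y ξ : ℝ)))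

section ecis

variable {ι : Type} [Fintype ι]

theorem norm_ecis (y ξ : RR ι) : ‖ecis y ξ‖ = 1 := by
  rw [ecis, Complex.norm_exp]; simp

theorem ecis_comm (y ξ : RR ι) : ecis y ξ = ecis ξ y := by
  rw [ecis, ecis, real_inner_comm]

theorem ecis_add_left (y y' ξ : RR ι) : ecis (y + y') ξ = ecis y ξ * ecis y' ξ := by
  rw [ecis, ecis, ecis, ← Complex.exp_add, inner_add_left]
  congr 1; push_cast; ring

theorem ecis_add_right (y ξ ξ' : RR ι) : ecis y (ξ + ξ') = ecis y ξ * ecis y ξ' := by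
  rw [ecis_comm, ecis_add_left, ecis_comm ξ, ecis_comm ξ']

theorem ecis_neg_left (y ξ : RR ι) : ecis (-y) ξ = ecis y (-ξ) := by
  rw [ecis, ecis, inner_neg_left, inner_neg_right]

@[simp] theorem ecis_zero_right (y : RR ι) : ecis y 0 = 1 := by simp [ecis]

@[simp] theorem ecis_zero_left (y : RR ι) : ecis 0 y = 1 := by simp [ecis]

@[fun_prop]
theorem Continuous.ecis {α : Type*} [TopologicalSpace α] {f g : α → RR ι} (hf : Continuous f)
    (hg : Continuous g) : Continuous fun a => ecis (f a) (g a) := by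
  unfold _root_.ecis; fun_prop

end ecis

/-- The Fourier transform `∫ F(y) exp (-i ⟨y, ξ⟩) dy`. -/
def ft {ι : Type} [Fintype ι] (F : RR ι → ℂ) (ξ : RR ι) : ℂ := ∫ y, F y * ecis y ξ

section ft

variable {ι : Type} [Fintype ι]

open scoped FourierTransform

theorem fourier_eq_ft (F : RR ι → ℂ) (w : RR ι) : 𝓕 F w = ft F ((2 * Real.pi) • w) := by
  rw [Real.fourier_eq', ft]
  refine integral_congr_ae (Eventually.of_forall fun y => ?_)
  simp only [smul_eq_mul, ecis, inner_smul_right]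
  rw [mul_comm]
  congr 2
  push_cast; ring

theorem ft_eq_fourier (F : RR ι → ℂ) (ξ : RR ι) : ft F ξ = 𝓕 F ((2 * Real.pi)⁻¹ • ξ) := by
  rw [fourier_eq_ft, smul_inv_smul₀ (by positivity)]

theorem norm_ft_le (F : RR ι → ℂ) (ξ : RR ι) : ‖ft F ξ‖ ≤ ∫ y, ‖F y‖ := by
  refine (norm_integral_le_integral_norm _).trans (le_of_eq ?_)
  simp [norm_ecis]

theorem ft_inversion {F : RR ι → ℂ} (hc : Continuous F) (hF : Integrable F)
    (hF' : Integrable (ft F)) (y : RR ι) :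
    ∫ ξ, ft F ξ * ecis y (-ξ) = ((2 * Real.pi) ^ Fintype.card ι : ℝ) * F y := by
  have h2 : (2 * Real.pi) ≠ 0 := by positivity
  have hF'' : Integrable (𝓕 F) := by
    rw [show 𝓕 F = fun w => ft F ((2 * Real.pi) • w) from funext (fourier_eq_ft F)]
    exact hF'.comp_smul h2
  have := congrFun (hc.fourierInv_fourier_eq hF hF'') y
  rw [Real.fourierInv_eq'] at this
  have h3 := Measure.integral_comp_smul volume (fun ξ => ft F ξ * ecis y (-ξ)) (2 * Real.pi)
  rw [← this, finrank_euclideanSpace] at *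
  have e : (∫ w, Complex.exp (↑(2 * Real.pi * inner ℝ w y) * Complex.I) • 𝓕 F w) =
      ∫ x : RR ι, (fun ξ => ft F ξ * ecis y (-ξ)) ((2 * Real.pi) • x) := by
    refine integral_congr_ae (Eventually.of_forall fun w => ?_)
    simp only [smul_eq_mul, fourier_eq_ft]
    rw [mul_comm]
    congr 1
    rw [ecis, inner_neg_right, inner_smul_right, real_inner_comm]
    congr 1; push_cast; ring
  rw [e, h3, abs_of_pos (by positivity), Complex.real_smul, ← mul_assoc, ← Complex.ofReal_mul,
    mul_inv_cancel₀ (by positivity), Complex.ofReal_one, one_mul]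

theorem pow_mul_norm_ft_le {F : RR ι → ℂ} (hF : ContDiff ℝ (⊤ : ℕ∞) F)
    (hi : ∀ n, Integrable (iteratedFDeriv ℝ n F)) (n : ℕ) (ξ : RR ι) :
    ‖ξ‖ ^ n * ‖ft F ξ‖ ≤ ∫ y, ‖iteratedFDeriv ℝ n F y‖ := by
  rcases eq_or_ne ξ 0 with rfl | hξ
  · rcases Nat.eq_zero_or_pos n with rfl | hn
    · simpa using norm_ft_le F 0
    · rw [norm_zero, zero_pow hn.ne', zero_mul]
      exact integral_nonneg fun _ => norm_nonneg _
  set w := (2 * Real.pi)⁻¹ • ξ with hw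
  have hwn : 2 * Real.pi * ‖w‖ = ‖ξ‖ := by
    rw [hw, norm_smul, norm_inv, Real.norm_of_nonneg (by positivity),
      mul_inv_cancel_left₀ (by positivity)]
  have hw0 : 0 < ‖w‖ := by
    have := norm_pos_iff.2 hξ
    rw [← hwn] at this
    exact pos_of_mul_pos_right this (by positivity)
  have key := congrFun (Real.fourier_iteratedFDeriv (N := ⊤) hF (fun n _ => hi n) (n := n) le_top) w
  have h1 : ‖𝓕 (iteratedFDeriv ℝ n F) w‖ ≤ ∫ y, ‖iteratedFDeriv ℝ n F y‖ := by
    rw [Real.fourier_eq]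
    refine (norm_integral_le_integral_norm _).trans (le_of_eq ?_)
    simp
  have h2 := (𝓕 (iteratedFDeriv ℝ n F) w).le_opNorm (fun _ => w)
  rw [key, VectorFourier.fourierPowSMulRight_apply] at h2
  have e0 : ∀ u u' : RR ι, (-(innerSL ℝ : RR ι →L[ℝ] RR ι →L[ℝ] ℝ)) u u' = -inner ℝ u u' :=
    fun _ _ => rfl
  simp only [e0, Finset.prod_const, Finset.card_univ, Fintype.card_fin, norm_smul, norm_pow,
    norm_neg, norm_mul, Complex.norm_I, mul_one, Complex.norm_real, real_inner_self_eq_norm_sq,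
    norm_norm] at h2
  rw [← key, RCLike.norm_ofNat, Real.norm_of_nonneg Real.pi_pos.le] at h2
  rw [← hwn, ft_eq_fourier]
  have hwp : 0 < ‖w‖ ^ n := by positivity
  refine le_of_mul_le_mul_right (le_trans (le_of_eq ?_) (h2.trans
    (mul_le_mul_of_nonneg_right h1 hwp.le))) hwp
  rw [mul_pow]; ring

end ft

theorem exp_mul_le_of_pow_mul_le {t A B c R : ℝ} (hR : 0 ≤ R) (hB : 0 ≤ B)
    (hc : 0 ≤ c) (hRc : R * c ≤ 1 / 2) (h : ∀ k : ℕ, t ^ k * A ≤ B * (c ^ k * k.factorial)) :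
    Real.exp (R * t) * A ≤ 2 * B := by
  have h1 : HasSum (fun k : ℕ => (R * t) ^ k / k.factorial * A) (Real.exp (R * t) * A) := by
    have := (NormedSpace.expSeries_div_hasSum_exp (R * t)).mul_right A
    rwa [← Real.exp_eq_exp_ℝ] at this
  have h2 : HasSum (fun k : ℕ => B * (1 / 2 : ℝ) ^ k) (B * 2) := hasSum_geometric_two.mul_left B
  rw [mul_comm 2 B]
  refine hasSum_le (fun k => ?_) h1 h2
  have hk : (0 : ℝ) < k.factorial := by positivity
  calc (R * t) ^ k / k.factorial * A = R ^ k / k.factorial * (t ^ k * A) := by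
        rw [mul_pow]; ring
    _ ≤ R ^ k / k.factorial * (B * (c ^ k * k.factorial)) :=
        mul_le_mul_of_nonneg_left (h k) (by positivity)
    _ = B * (R * c) ^ k := by rw [mul_pow]; field_simp
    _ ≤ B * (1 / 2) ^ k := by gcongr

/-! ### Estimates in the Gelfand-Shilov space -/

section GS

variable {ι : Type} [Fintype ι]

theorem GS.bound (f : GS ι) (h : Set.Ioi (0 : ℝ)) (k l : ℕ) (x : RR ι) :
    ‖x‖ ^ k * ‖iteratedFDeriv ℝ l (f : RR ι → ℂ) x‖ ≤
      gsSeminorm ι h f * (h.1 ^ (k + l) * (k.factorial * l.factorial)) := by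
  have hh : 0 < h.1 := h.2
  have := le_ciSup (f.2.2 h.1 h.2) (k, l, x)
  unfold gsQuot at this
  rwa [div_le_iff₀ (by positivity)] at this

theorem GS.exp_decay (f : GS ι) (h : Set.Ioi (0 : ℝ)) {R : ℝ} (hR : 0 ≤ R) (hRh : R * h.1 ≤ 1 / 2)
    (l : ℕ) (x : RR ι) :
    Real.exp (R * ‖x‖) * ‖iteratedFDeriv ℝ l (f : RR ι → ℂ) x‖ ≤
      2 * (gsSeminorm ι h f * (h.1 ^ l * l.factorial)) := by
  have hh : 0 < h.1 := h.2
  have hp : 0 ≤ gsSeminorm ι h f := apply_nonneg _ _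
  refine exp_mul_le_of_pow_mul_le hR (by positivity) hh.le hRh fun k => ?_
  refine (f.bound h k l x).trans (le_of_eq ?_)
  rw [pow_add]; ring

theorem gsSeminorm_le {f : GS ι} {h : Set.Ioi (0 : ℝ)} {M : ℝ}
    (hM : ∀ k l x, ‖x‖ ^ k * ‖iteratedFDeriv ℝ l (f : RR ι → ℂ) x‖ ≤
      M * (h.1 ^ (k + l) * (k.factorial * l.factorial))) : gsSeminorm ι h f ≤ M := by
  have hh : 0 < h.1 := h.2
  refine ciSup_le fun q => ?_
  unfold gsQuot
  rw [div_le_iff₀ (by positivity)]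
  exact hM q.1 q.2.1 q.2.2

/-- The Gaussian window `π^(-n/4) exp (-|y|^2 / 2)`. -/
def win (y : RR ι) : ℝ := Real.pi ^ (-(Fintype.card ι : ℝ) / 4) * Real.exp (-‖y‖ ^ 2 / 2)

theorem win_pos (y : RR ι) : 0 < win y := by unfold win; positivity

@[fun_prop]
theorem continuous_win : Continuous (win : RR ι → ℝ) := by unfold win; fun_prop

theorem gaborFun_apply (x ξ y : RR ι) : gaborFun x ξ y = (win (y - x) : ℂ) * ecis y ξ := rfl

theorem contDiff_win : ContDiff ℝ (⊤ : ℕ∞) (fun y : RR ι => (win y : ℂ)) := by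
  have := (gaborFun_mem (0 : RR ι) 0).1
  have e : gaborFun (0 : RR ι) 0 = fun y => (win y : ℂ) := by
    funext y; simp [gaborFun_apply]
  rwa [e] at this

theorem iteratedFDeriv_win_le {ε : ℝ} (hε : 0 < ε) : ∃ C : ℝ, 0 ≤ C ∧ ∀ (l : ℕ) (y : RR ι),
    ‖iteratedFDeriv ℝ l (fun y : RR ι => (win y : ℂ)) y‖ ≤
      C * (ε ^ l * l.factorial * Real.exp (-‖y‖ ^ 2 / 4)) := by
  obtain ⟨C, hC0, hC⟩ := gaussProd_bound (0 : RR ι) 0 Finset.univ ε hε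
  have hcd : ContDiff ℝ (⊤ : ℕ∞) (fun y : RR ι => ∏ i ∈ Finset.univ,
      gauss1 ((0 : RR ι) i) ((0 : RR ι) i) (y i)) := by
    refine contDiff_prod fun i _ => ?_
    exact ((((gauss1_differentiable _ _).contDiff (n := (⊤ : ℕ∞))).restrict_scalars ℝ).comp
      Complex.ofRealCLM.contDiff).comp (EuclideanSpace.proj (𝕜 := ℝ) i).contDiff
  have e : (fun y : RR ι => (win y : ℂ)) = ((Real.pi ^ (-(Fintype.card ι : ℝ) / 4) : ℝ) : ℂ) •
      fun y : RR ι => ∏ i ∈ Finset.univ, gauss1 ((0 : RR ι) i) ((0 : RR ι) i) (y i) := by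
    rw [← gaborFun_eq]
    funext y; simp [gaborFun_apply]
  refine ⟨‖((Real.pi ^ (-(Fintype.card ι : ℝ) / 4) : ℝ) : ℂ)‖ * C, by positivity, fun l y => ?_⟩
  rw [e, iteratedFDeriv_const_smul_apply ((hcd.of_le (mod_cast le_top)).contDiffAt), norm_smul,
    mul_assoc]
  gcongr
  refine (hC l y).trans (le_of_eq ?_)
  have e : ∑ i, y i ^ 2 = ‖y‖ ^ 2 := by
    rw [EuclideanSpace.norm_sq_eq]
    exact Finset.sum_congr rfl fun i _ => by rw [Real.norm_eq_abs, sq_abs]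
  rw [e]

theorem integrable_exp_neg_mul_sq_norm {b : ℝ} (hb : 0 < b) :
    Integrable fun y : RR ι => Real.exp (-b * ‖y‖ ^ 2) := by
  have := (GaussianFourier.integrable_cexp_neg_mul_sq_norm_add (V := RR ι) (b := (b : ℂ))
    (by simpa using hb) 0 0).norm
  refine this.congr (Eventually.of_forall fun y => ?_)
  simp only [Complex.norm_exp]
  congr 1
  simp [← Complex.ofReal_pow]

theorem integrable_exp_neg_norm {b : ℝ} (hb : 0 < b) :
    Integrable fun y : RR ι => Real.exp (-b * ‖y‖) := by
  set N := Module.finrank ℝ (RR ι) + 1 with hN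
  have h := (integrable_one_add_norm (E := RR ι) (μ := volume) (r := (N : ℝ))
    (by rw [hN]; push_cast; linarith)).const_mul (N.factorial * (b ^ N)⁻¹ * Real.exp b)
  refine h.mono' (by fun_prop) (Eventually.of_forall fun y => ?_)
  have hy : (0 : ℝ) < 1 + ‖y‖ := by positivity
  rw [Real.norm_of_nonneg (Real.exp_pos _).le, Real.rpow_neg hy.le, Real.rpow_natCast]
  have := Real.pow_div_factorial_le_exp (b * (1 + ‖y‖)) (by positivity) N
  rw [div_le_iff₀ (by positivity), mul_pow] at this
  rw [← div_eq_mul_inv, le_div_iff₀ (by positivity)]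
  have e : Real.exp (b * (1 + ‖y‖)) = Real.exp b * Real.exp (b * ‖y‖) := by
    rw [← Real.exp_add]; ring_nf
  rw [e] at this
  have e2 : Real.exp (-b * ‖y‖) * Real.exp (b * ‖y‖) = 1 := by
    rw [← Real.exp_add]; simp
  have hb' : 0 < b ^ N := by positivity
  calc Real.exp (-b * ‖y‖) * (1 + ‖y‖) ^ N
      = Real.exp (-b * ‖y‖) * ((b ^ N)⁻¹ * (b ^ N * (1 + ‖y‖) ^ N)) := by
        rw [inv_mul_cancel_left₀ hb'.ne']
    _ ≤ Real.exp (-b * ‖y‖) * ((b ^ N)⁻¹ * (Real.exp b * Real.exp (b * ‖y‖) * N.factorial)) := by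
        gcongr
    _ = (Real.exp (-b * ‖y‖) * Real.exp (b * ‖y‖)) * (N.factorial * (b ^ N)⁻¹ * Real.exp b) := by
        ring
    _ = _ := by rw [e2, one_mul]

theorem choose_sum_le {l : ℕ} {a b : ℕ → ℝ} {A B c : ℝ} (hc : 0 ≤ c) (hA : 0 ≤ A) (hB : 0 ≤ B)
    (hb0 : ∀ k, 0 ≤ b k)
    (ha : ∀ k, a k ≤ A * (c ^ k * k.factorial)) (hb : ∀ k, b k ≤ B * (c ^ k * k.factorial)) :
    ∑ k ∈ Finset.range (l + 1), (l.choose k : ℝ) * a k * b (l - k) ≤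
      A * B * ((2 * c) ^ l * l.factorial) := by
  have hsum : ∀ k ∈ Finset.range (l + 1), (l.choose k : ℝ) * a k * b (l - k) ≤
      A * B * (c ^ l * l.factorial) := by
    intro k hk
    have hk' : k ≤ l := Nat.lt_succ_iff.1 (Finset.mem_range.1 hk)
    calc _ ≤ (l.choose k : ℝ) * (A * (c ^ k * k.factorial)) *
          (B * (c ^ (l - k) * (l - k).factorial)) := by
          gcongr
          · exact hb0 _
          · exact ha k
          · exact hb _
      _ = A * B * ((c ^ k * c ^ (l - k)) * ((l.choose k : ℝ) * k.factorial * (l - k).factorial)) := by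
          ring
      _ = _ := by
          rw [← pow_add, Nat.add_sub_cancel' hk']
          have := Nat.choose_mul_factorial_mul_factorial hk'
          rw [show (l.choose k : ℝ) * k.factorial * (l - k).factorial = l.factorial by
            exact_mod_cast this]
  refine (Finset.sum_le_sum hsum).trans ?_
  rw [Finset.sum_const, Finset.card_range, nsmul_eq_mul]
  have h2 : ((l + 1 : ℕ) : ℝ) ≤ 2 ^ l := by exact_mod_cast Nat.lt_two_pow_self
  calc _ ≤ (2 : ℝ) ^ l * (A * B * (c ^ l * l.factorial)) := by gcongr
    _ = _ := by rw [mul_pow]; ring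

end GS
end

noncomputable section

section GS

variable {ι : Type} [Fintype ι]

/-! ### Decay of the short-time Fourier transform on `Σ₁` -/

/-- The constant `(2π)^(-n/2)`. -/
def ftc (ι : Type) [Fintype ι] : ℝ := (2 * Real.pi) ^ (-(Fintype.card ι : ℝ) / 2)

theorem ftc_pos : 0 < ftc ι := by unfold ftc; positivity

theorem ftc_mul_self : ftc ι * ftc ι * (2 * Real.pi) ^ Fintype.card ι = 1 := by
  unfold ftc
  rw [← Real.rpow_add (by positivity), ← Real.rpow_natCast, ← Real.rpow_add (by positivity)]
  ring_nf
  simp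

theorem stft_eq (u : GSDual ι) (z : RR ι × RR ι) : stft u z = ftc ι * u (gaborAtom z.1 z.2) := rfl

theorem stft_toDual (f : GS ι) (z : RR ι × RR ι) :
    stft f.toDual z = ftc ι * ft (fun y => f y * (win (y - z.1) : ℂ)) z.2 := by
  rw [stft_eq, ft]
  congr 1
  change ∫ y, f y * gaborFun z.1 z.2 y = _
  refine integral_congr_ae (Eventually.of_forall fun y => ?_)
  simp only [gaborFun_apply, mul_assoc]

theorem contDiff_win_sub (x : RR ι) : ContDiff ℝ (⊤ : ℕ∞) (fun y : RR ι => (win (y - x) : ℂ)) :=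
  contDiff_win.comp (contDiff_id.sub contDiff_const)

theorem exp_shift_bound {R : ℝ} (hR : 0 ≤ R) (x y : RR ι) :
    Real.exp (-(R * ‖y‖)) * Real.exp (-‖y - x‖ ^ 2 / 4) ≤
      Real.exp (2 * R ^ 2) * Real.exp (-(R * ‖x‖)) * Real.exp (-(1 / 8) * ‖y - x‖ ^ 2) := by
  rw [← Real.exp_add, ← Real.exp_add, ← Real.exp_add]
  apply Real.exp_le_exp.2
  have h1 : ‖x‖ ≤ ‖y‖ + ‖y - x‖ := by
    have := norm_sub_le y (y - x)
    rwa [sub_sub_cancel] at this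
  nlinarith [sq_nonneg (‖y - x‖ - 4 * R), mul_le_mul_of_nonneg_left h1 hR]

theorem iteratedFDeriv_mul_win_le {R : ℝ} (hR : 0 ≤ R) {h : ℝ} (hh : 0 < h) (hRh : R * h ≤ 1 / 2) :
    ∃ C : ℝ, 0 ≤ C ∧ ∀ (f : GS ι) (l : ℕ) (x y : RR ι),
    ‖iteratedFDeriv ℝ l (fun y => f y * (win (y - x) : ℂ)) y‖ ≤
      C * gsSeminorm ι ⟨h, hh⟩ f * ((2 * h) ^ l * l.factorial) * Real.exp (-(R * ‖x‖)) *
        Real.exp (-(1 / 8) * ‖y - x‖ ^ 2) := by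
  obtain ⟨C, hC0, hC⟩ := iteratedFDeriv_win_le (ι := ι) hh
  refine ⟨2 * C * Real.exp (2 * R ^ 2), by positivity, fun f l x y => ?_⟩
  have hp : 0 ≤ gsSeminorm ι ⟨h, hh⟩ f := apply_nonneg _ _
  refine (norm_iteratedFDeriv_mul_le (n := l) f.2.1 (contDiff_win_sub x) y
    (by exact_mod_cast le_top)).trans ?_
  have ha : ∀ k, ‖iteratedFDeriv ℝ k (f : RR ι → ℂ) y‖ ≤
      (2 * gsSeminorm ι ⟨h, hh⟩ f * Real.exp (-(R * ‖y‖))) * (h ^ k * k.factorial) := by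
    intro k
    have := f.exp_decay ⟨h, hh⟩ hR hRh k y
    rw [Real.exp_neg, mul_right_comm, ← div_eq_mul_inv, le_div_iff₀ (Real.exp_pos _)]
    linarith
  have hb : ∀ k, ‖iteratedFDeriv ℝ k (fun y => (win (y - x) : ℂ)) y‖ ≤
      (C * Real.exp (-‖y - x‖ ^ 2 / 4)) * (h ^ k * k.factorial) := by
    intro k
    rw [iteratedFDeriv_comp_sub k x y (f := fun y : RR ι => (win y : ℂ))]
    refine (hC k (y - x)).trans (le_of_eq (by ring))
  refine (choose_sum_le hh.le (by positivity) (by positivity) (fun _ => norm_nonneg _) ha hb).trans ?_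
  have := exp_shift_bound hR x y
  calc _ = 2 * gsSeminorm ι ⟨h, hh⟩ f * C * ((2 * h) ^ l * l.factorial) *
        (Real.exp (-(R * ‖y‖)) * Real.exp (-‖y - x‖ ^ 2 / 4)) := by ring
    _ ≤ 2 * gsSeminorm ι ⟨h, hh⟩ f * C * ((2 * h) ^ l * l.factorial) *
        (Real.exp (2 * R ^ 2) * Real.exp (-(R * ‖x‖)) * Real.exp (-(1 / 8) * ‖y - x‖ ^ 2)) := by
        gcongr
    _ = _ := by ring

theorem integral_exp_sub_eq (x : RR ι) (b : ℝ) :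
    ∫ y : RR ι, Real.exp (-b * ‖y - x‖ ^ 2) = ∫ y : RR ι, Real.exp (-b * ‖y‖ ^ 2) :=
  integral_sub_right_eq_self (fun y : RR ι => Real.exp (-b * ‖y‖ ^ 2)) x

theorem GS.contDiff_mul_win (f : GS ι) (x : RR ι) :
    ContDiff ℝ (⊤ : ℕ∞) (fun y => f y * (win (y - x) : ℂ)) := f.2.1.mul (contDiff_win_sub x)

theorem GS.integrable_iteratedFDeriv_mul_win (f : GS ι) (x : RR ι) (n : ℕ) :
    Integrable (iteratedFDeriv ℝ n (fun y => f y * (win (y - x) : ℂ))) := by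
  obtain ⟨C, hC0, hC⟩ := iteratedFDeriv_mul_win_le (ι := ι) le_rfl one_pos (by norm_num)
  have hi : Integrable fun y : RR ι => Real.exp (-(1 / 8) * ‖y - x‖ ^ 2) :=
    (integrable_exp_neg_mul_sq_norm (by norm_num)).comp_sub_right x
  refine (hi.const_mul _).mono' ?_ (Eventually.of_forall fun y => hC f n x y)
  exact ((f.contDiff_mul_win x).continuous_iteratedFDeriv
    (by exact_mod_cast le_top)).aestronglyMeasurable

theorem stft_decay (R : ℝ) (hR : 0 ≤ R) : ∃ (h : Set.Ioi (0 : ℝ)) (C : ℝ), 0 < C ∧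
    ∀ (f : GS ι) (z : RR ι × RR ι), ‖stft f.toDual z‖ ≤
      C * gsSeminorm ι h f * (Real.exp (-(R * ‖z.1‖)) * Real.exp (-(R * ‖z.2‖))) := by
  obtain ⟨h, hh, h1⟩ : ∃ h : ℝ, 0 < h ∧ R * (2 * h) ≤ 1 / 2 := by
    refine ⟨1 / (4 * (R + 1)), by positivity, ?_⟩
    rw [show R * (2 * (1 / (4 * (R + 1)))) = R / (R + 1) / 2 by field_simp; ring]
    have : R / (R + 1) ≤ 1 := by rw [div_le_one (by positivity)]; linarith
    linarith
  obtain ⟨C, hC0, hC⟩ := iteratedFDeriv_mul_win_le (ι := ι) hR hh (by nlinarith)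
  set I := ∫ y : RR ι, Real.exp (-(1 / 8) * ‖y‖ ^ 2) with hI
  have hI0 : 0 ≤ I := integral_nonneg fun _ => (Real.exp_pos _).le
  have hftc := ftc_pos (ι := ι)
  refine ⟨⟨h, hh⟩, 2 * ftc ι * C * I + 1, by positivity, fun f z => ?_⟩
  have hp : 0 ≤ gsSeminorm ι ⟨h, hh⟩ f := apply_nonneg _ _
  rw [stft_toDual, norm_mul, Complex.norm_real, Real.norm_of_nonneg hftc.le]
  set F := fun y => f y * (win (y - z.1) : ℂ) with hF
  have hi : Integrable fun y : RR ι => Real.exp (-(1 / 8) * ‖y - z.1‖ ^ 2) :=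
    (integrable_exp_neg_mul_sq_norm (by norm_num)).comp_sub_right z.1
  have key : ∀ k : ℕ, ‖z.2‖ ^ k * ‖ft F z.2‖ ≤ (C * gsSeminorm ι ⟨h, hh⟩ f * I *
      Real.exp (-(R * ‖z.1‖))) * ((2 * h) ^ k * k.factorial) := by
    intro k
    refine (pow_mul_norm_ft_le (f.contDiff_mul_win z.1)
      (f.integrable_iteratedFDeriv_mul_win z.1) k z.2).trans ?_
    refine (integral_mono (f.integrable_iteratedFDeriv_mul_win z.1 k).norm (hi.const_mul _)
      (fun y => hC f k z.1 y)).trans (le_of_eq ?_)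
    rw [integral_const_mul, integral_exp_sub_eq]
    ring
  have := exp_mul_le_of_pow_mul_le hR (by positivity) (by positivity) h1 key
  have h2 : ‖ft F z.2‖ ≤ 2 * (C * gsSeminorm ι ⟨h, hh⟩ f * I * Real.exp (-(R * ‖z.1‖))) *
      Real.exp (-(R * ‖z.2‖)) := by
    rw [Real.exp_neg (R * ‖z.2‖), ← div_eq_mul_inv, le_div_iff₀ (Real.exp_pos _)]
    linarith
  calc ftc ι * ‖ft F z.2‖ ≤ ftc ι * (2 * (C * gsSeminorm ι ⟨h, hh⟩ f * I *
        Real.exp (-(R * ‖z.1‖))) * Real.exp (-(R * ‖z.2‖))) := by gcongr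
    _ = (2 * ftc ι * C * I) * gsSeminorm ι ⟨h, hh⟩ f *
        (Real.exp (-(R * ‖z.1‖)) * Real.exp (-(R * ‖z.2‖))) := by ring
    _ ≤ _ := by gcongr; linarith

/-! ### Seminorms of time-frequency shifts of the Gaussian -/

theorem iteratedDeriv_exp_neg_I (k : ℕ) :
    iteratedDeriv k (fun t : ℝ => Complex.exp (-(Complex.I * t))) =
      fun t : ℝ => (-Complex.I) ^ k * Complex.exp (-(Complex.I * t)) := by
  induction k with
  | zero => simp
  | succ k ih =>
    rw [iteratedDeriv_succ, ih]
    funext t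
    have h : HasDerivAt (fun t : ℝ => Complex.exp (-(Complex.I * t)))
        (Complex.exp (-(Complex.I * t)) * -(Complex.I * 1)) t :=
      (((Complex.ofRealCLM.hasDerivAt (x := t)).const_mul Complex.I).neg).cexp
    rw [(h.const_mul _).deriv]
    ring

theorem contDiff_ecis (ξ : RR ι) : ContDiff ℝ (⊤ : ℕ∞) (fun y : RR ι => ecis y ξ) := by
  have h : ContDiff ℝ (⊤ : ℕ∞) (fun y : RR ι => (inner ℝ y ξ : ℝ)) :=
    contDiff_id.inner ℝ contDiff_const
  unfold ecis
  exact (contDiff_const.mul (Complex.ofRealCLM.contDiff.comp h)).neg.cexp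

theorem norm_iteratedFDeriv_ecis_le (k : ℕ) (ξ y : RR ι) :
    ‖iteratedFDeriv ℝ k (fun y : RR ι => ecis y ξ) y‖ ≤ ‖ξ‖ ^ k := by
  have hg : ContDiff ℝ (⊤ : ℕ∞) (fun t : ℝ => Complex.exp (-(Complex.I * t))) :=
    (contDiff_const.mul Complex.ofRealCLM.contDiff).neg.cexp
  have e : (fun y : RR ι => ecis y ξ) =
      (fun t : ℝ => Complex.exp (-(Complex.I * t))) ∘ (innerSL ℝ ξ) := by
    funext y
    simp [ecis, real_inner_comm]
  rw [e, (innerSL ℝ ξ).iteratedFDeriv_comp_right hg y (i := k) (by exact_mod_cast le_top)]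
  refine (ContinuousMultilinearMap.norm_compContinuousLinearMap_le _ _).trans ?_
  rw [norm_iteratedFDeriv_eq_norm_iteratedDeriv, iteratedDeriv_exp_neg_I]
  simp [Complex.norm_exp]

theorem gaborAtom_seminorm_le (h : Set.Ioi (0 : ℝ)) : ∃ R C : ℝ, 0 ≤ R ∧ 0 < C ∧
    ∀ x ξ : RR ι, gsSeminorm ι h (gaborAtom x ξ) ≤
      C * (Real.exp (R * ‖x‖) * Real.exp (R * ‖ξ‖)) := by
  obtain ⟨h, hh⟩ := h
  have hh' : 0 < h := hh
  obtain ⟨C, hC0, hC⟩ := iteratedFDeriv_win_le (ι := ι) (half_pos hh')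
  refine ⟨2 / h, C * Real.exp (1 / h ^ 2) + 1, by positivity, by positivity,
    fun x ξ => gsSeminorm_le fun k l y => ?_⟩
  have hD : ‖iteratedFDeriv ℝ l (gaborFun x ξ) y‖ ≤ (C * Real.exp (-‖y - x‖ ^ 2 / 4)) *
      Real.exp (‖ξ‖ / (h / 2)) * (h ^ l * l.factorial) := by
    have e : gaborFun x ξ = fun y => (win (y - x) : ℂ) * ecis y ξ := funext (gaborFun_apply x ξ)
    rw [e]
    refine (norm_iteratedFDeriv_mul_le (n := l) (contDiff_win_sub x) (contDiff_ecis ξ) y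
      (by exact_mod_cast le_top)).trans ?_
    have ha : ∀ k, ‖iteratedFDeriv ℝ k (fun y => (win (y - x) : ℂ)) y‖ ≤
        (C * Real.exp (-‖y - x‖ ^ 2 / 4)) * ((h / 2) ^ k * k.factorial) := by
      intro k
      rw [iteratedFDeriv_comp_sub k x y (f := fun y : RR ι => (win y : ℂ))]
      refine (hC k (y - x)).trans (le_of_eq (by ring))
    have hb : ∀ k, ‖iteratedFDeriv ℝ k (fun y => ecis y ξ) y‖ ≤
        Real.exp (‖ξ‖ / (h / 2)) * ((h / 2) ^ k * k.factorial) := by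
      intro k
      refine (norm_iteratedFDeriv_ecis_le k ξ y).trans ?_
      have := Real.pow_div_factorial_le_exp (‖ξ‖ / (h / 2)) (by positivity) k
      rw [div_pow, div_div, div_le_iff₀ (by positivity)] at this
      exact this
    refine (choose_sum_le (by positivity) (by positivity) (by positivity) (fun _ => norm_nonneg _)
      ha hb).trans (le_of_eq ?_)
    rw [mul_div_cancel₀ h two_ne_zero]
  have h1 : ‖y‖ ^ k ≤ h ^ k * k.factorial * Real.exp (‖y‖ / h) := by
    have := Real.pow_div_factorial_le_exp (‖y‖ / h) (by positivity) k
    rw [div_pow, div_div, div_le_iff₀ (by positivity)] at this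
    linarith
  have h2 : Real.exp (‖y‖ / h) * Real.exp (-‖y - x‖ ^ 2 / 4) ≤
      Real.exp (1 / h ^ 2) * Real.exp (2 / h * ‖x‖) := by
    rw [← Real.exp_add, ← Real.exp_add]
    apply Real.exp_le_exp.2
    have h3 : ‖y‖ ≤ ‖x‖ + ‖y - x‖ := norm_le_norm_add_norm_sub' y x
    have h4 : ‖y‖ / h ≤ ‖x‖ / h + ‖y - x‖ / h := by rw [← add_div]; gcongr
    have h5 : 2 / h * ‖x‖ = 2 * (‖x‖ / h) := by ring
    have h6 : 0 ≤ ‖x‖ / h := by positivity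
    have e2 : 1 / h ^ 2 = (1 / h) ^ 2 := by rw [div_pow, one_pow]
    have e3 : ‖y - x‖ / h = ‖y - x‖ * (1 / h) := by ring
    rw [e2, h5]
    rw [e3] at h4
    nlinarith [sq_nonneg (1 / h - ‖y - x‖ / 2)]
  change ‖y‖ ^ k * ‖iteratedFDeriv ℝ l (gaborFun x ξ) y‖ ≤ _
  calc _ ≤ (h ^ k * k.factorial * Real.exp (‖y‖ / h)) * ((C * Real.exp (-‖y - x‖ ^ 2 / 4)) *
        Real.exp (‖ξ‖ / (h / 2)) * (h ^ l * l.factorial)) := by gcongr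
    _ = C * (Real.exp (‖y‖ / h) * Real.exp (-‖y - x‖ ^ 2 / 4)) * Real.exp (2 / h * ‖ξ‖) *
        (h ^ (k + l) * (k.factorial * l.factorial)) := by
        rw [show ‖ξ‖ / (h / 2) = 2 / h * ‖ξ‖ by field_simp, pow_add]; ring
    _ ≤ C * (Real.exp (1 / h ^ 2) * Real.exp (2 / h * ‖x‖)) * Real.exp (2 / h * ‖ξ‖) *
        (h ^ (k + l) * (k.factorial * l.factorial)) := by gcongr
    _ = (C * Real.exp (1 / h ^ 2)) * (Real.exp (2 / h * ‖x‖) * Real.exp (2 / h * ‖ξ‖)) *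
        (h ^ (k + l) * (k.factorial * l.factorial)) := by ring
    _ ≤ _ := by gcongr; linarith

/-! ### Integrals of families of elements of `Σ₁` -/

theorem continuous_iteratedFDeriv_gaborFun (l : ℕ) (y : RR ι) :
    Continuous fun z : RR ι × RR ι => iteratedFDeriv ℝ l (gaborFun z.1 z.2) y := by
  set J : (RR ι × RR ι) × RR ι → ℂ := fun p => (win (p.2 - p.1.1) : ℂ) * ecis p.2 p.1.2 with hJ
  have hJc : ContDiff ℝ (⊤ : ℕ∞) J := by
    refine ContDiff.mul (contDiff_win.comp (contDiff_snd.sub (contDiff_fst.comp contDiff_fst))) ?_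
    have h : ContDiff ℝ (⊤ : ℕ∞) (fun p : (RR ι × RR ι) × RR ι => (inner ℝ p.2 p.1.2 : ℝ)) :=
      contDiff_snd.inner ℝ (contDiff_snd.comp contDiff_fst)
    unfold ecis
    exact (contDiff_const.mul (Complex.ofRealCLM.contDiff.comp h)).neg.cexp
  have e : ∀ z : RR ι × RR ι, iteratedFDeriv ℝ l (gaborFun z.1 z.2) y =
      (iteratedFDeriv ℝ l J (z, y)).compContinuousLinearMap
        (fun _ => ContinuousLinearMap.inr ℝ (RR ι × RR ι) (RR ι)) := by
    intro z
    have h1 : gaborFun z.1 z.2 = (fun p => J ((z, 0) + p)) ∘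
        ContinuousLinearMap.inr ℝ (RR ι × RR ι) (RR ι) := by
      funext y'
      simp [hJ, gaborFun_apply]
    have hc : ContDiff ℝ (⊤ : ℕ∞) (fun p => J ((z, 0) + p)) :=
      hJc.comp (contDiff_const.add contDiff_id)
    rw [h1, ContinuousLinearMap.iteratedFDeriv_comp_right _ hc y (by exact_mod_cast le_top),
      iteratedFDeriv_comp_add_left]
    simp
  simp_rw [e]
  have h2 : Continuous fun z : RR ι × RR ι => iteratedFDeriv ℝ l J (z, y) :=
    (hJc.continuous_iteratedFDeriv (by exact_mod_cast le_top)).comp (by fun_prop)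
  exact (ContinuousMultilinearMap.compContinuousLinearMapL
    (fun _ : Fin l => ContinuousLinearMap.inr ℝ (RR ι × RR ι) (RR ι))).continuous.comp h2

end GS
end

noncomputable section

section GS

variable {ι : Type} [Fintype ι]

theorem GS.norm_iteratedFDeriv_le (f : GS ι) (l : ℕ) (y : RR ι) :
    ‖iteratedFDeriv ℝ l (f : RR ι → ℂ) y‖ ≤
      gsSeminorm ι ⟨1, Set.mem_Ioi.2 one_pos⟩ f * l.factorial := by
  have := f.bound ⟨1, Set.mem_Ioi.2 one_pos⟩ 0 l y
  simpa using this

theorem hasFDerivAt_integral_of_apply {α V E : Type*} [MeasurableSpace α] {μ : Measure α}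
    [NormedAddCommGroup V] [NormedSpace ℝ V] [NormedAddCommGroup E] [NormedSpace ℝ E]
    [CompleteSpace E] {F : V → α → E} {F' : V → α → V →L[ℝ] E} {D : V →L[ℝ] E} {x₀ : V}
    (hD : ∀ v, D v = ∫ a, F' x₀ a v ∂μ) {bound : α → ℝ}
    (hF_meas : ∀ x, AEStronglyMeasurable (F x) μ) (hF_int : Integrable (F x₀) μ)
    (hF'_meas : AEStronglyMeasurable (F' x₀) μ)
    (h_bound : ∀ a x, ‖F' x a‖ ≤ bound a) (bound_integrable : Integrable bound μ)
    (h_diff : ∀ a x, HasFDerivAt (F · a) (F' x a) x) :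
    HasFDerivAt (fun x ↦ ∫ a, F x a ∂μ) D x₀ := by
  have hi : Integrable (F' x₀) μ :=
    bound_integrable.mono' hF'_meas (Eventually.of_forall fun a => h_bound a x₀)
  have e : D = ∫ a, F' x₀ a ∂μ := by
    ext v
    rw [hD, ContinuousLinearMap.integral_apply hi]
  rw [e]
  exact hasFDerivAt_integral_of_dominated_of_fderiv_le (s := Set.univ) univ_mem
    (Eventually.of_forall hF_meas) hF_int hF'_meas
    (Eventually.of_forall fun a x _ => h_bound a x) bound_integrable
    (Eventually.of_forall fun a x _ => h_diff a x)

theorem exists_gs_integral {α : Type*} [MeasurableSpace α] {μ : Measure α} (k : α → GS ι)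
    (hm : ∀ l y, AEStronglyMeasurable (fun a => iteratedFDeriv ℝ l (k a : RR ι → ℂ) y) μ)
    (B : Set.Ioi (0 : ℝ) → α → ℝ) (hBi : ∀ h, Integrable (B h) μ)
    (hB : ∀ h a, gsSeminorm ι h (k a) ≤ B h a) :
    ∃ g : GS ι, (∀ y, g y = ∫ a, k a y ∂μ) ∧ ∀ h, gsSeminorm ι h g ≤ ∫ a, B h a ∂μ := by
  set one' : Set.Ioi (0 : ℝ) := ⟨1, Set.mem_Ioi.2 one_pos⟩
  have hInt : ∀ l y, Integrable (fun a => iteratedFDeriv ℝ l (k a : RR ι → ℂ) y) μ := by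
    intro l y
    refine ((hBi one').mul_const (l.factorial : ℝ)).mono' (hm l y) (Eventually.of_forall fun a => ?_)
    exact ((k a).norm_iteratedFDeriv_le l y).trans (by gcongr; exact hB _ a)
  set f : RR ι → ℂ := fun y => ∫ a, k a y ∂μ with hf
  set p : RR ι → FormalMultilinearSeries ℝ (RR ι) ℂ :=
    fun y l => ∫ a, iteratedFDeriv ℝ l (k a : RR ι → ℂ) y ∂μ with hp
  have hderiv : ∀ (m : ℕ) (y : RR ι), HasFDerivAt (fun y => p y m) (p y (m + 1)).curryLeft y := by
    intro m y
    let L := (continuousMultilinearCurryLeftEquiv ℝ (fun _ : Fin (m + 1) => RR ι) ℂ).toContinuousLinearEquiv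
    refine hasFDerivAt_integral_of_apply (D := (p y (m + 1)).curryLeft)
      (fun v => ContinuousMultilinearMap.ext fun w => ?_)
      (F := fun y a => iteratedFDeriv ℝ m (k a : RR ι → ℂ) y)
      (F' := fun y a => (iteratedFDeriv ℝ (m + 1) (k a : RR ι → ℂ) y).curryLeft)
      (bound := fun a => B one' a * ((m + 1).factorial : ℝ))
      (fun y => hm m y) (hInt m y)
      (L.continuous.comp_aestronglyMeasurable (hm (m + 1) y)) ?_ ((hBi one').mul_const _) ?_
    · have hv : Integrable (fun a => (iteratedFDeriv ℝ (m + 1) (k a : RR ι → ℂ) y).curryLeft v) μ := by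
        refine ((hInt (m + 1) y).norm.mul_const ‖v‖).mono' ?_ (Eventually.of_forall fun a => ?_)
        · exact (L.continuous.clm_apply continuous_const).comp_aestronglyMeasurable (hm (m + 1) y)
        · exact ((iteratedFDeriv ℝ (m + 1) (k a : RR ι → ℂ) y).curryLeft.le_opNorm v).trans
            (by rw [ContinuousMultilinearMap.curryLeft_norm])
      rw [ContinuousMultilinearMap.curryLeft_apply,
        ContinuousMultilinearMap.integral_apply (hInt (m + 1) y),
        ContinuousMultilinearMap.integral_apply hv]
      rfl
    · intro a y
      rw [ContinuousMultilinearMap.curryLeft_norm]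
      exact ((k a).norm_iteratedFDeriv_le (m + 1) y).trans (by gcongr; exact hB _ a)
    · intro a y
      exact (contDiff_iff_ftaylorSeries.1 (k a).2.1).fderiv m (by exact_mod_cast WithTop.coe_lt_top _) y
  have hT : HasFTaylorSeriesUpTo (⊤ : ℕ∞) f p := by
    refine ⟨fun y => ?_, fun m _ y => hderiv m y, fun m _ => ?_⟩
    · change (∫ a, iteratedFDeriv ℝ 0 (k a : RR ι → ℂ) y ∂μ) 0 = _
      have := (ContinuousMultilinearMap.apply ℝ (fun _ : Fin 0 => RR ι) ℂ 0).integral_comp_comm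
        (hInt 0 y)
      exact this.symm.trans (by simp [hf])
    · exact continuous_iff_continuousAt.2 fun y => (hderiv m y).continuousAt
  have hcd : ContDiff ℝ (⊤ : ℕ∞) f := hT.contDiff
  have hid : ∀ l y, iteratedFDeriv ℝ l f y = ∫ a, iteratedFDeriv ℝ l (k a : RR ι → ℂ) y ∂μ :=
    fun l y => (hT.eq_iteratedFDeriv (by exact_mod_cast le_top) y).symm
  have hbd : ∀ (h : Set.Ioi (0 : ℝ)) (k' l : ℕ) (y : RR ι), ‖y‖ ^ k' * ‖iteratedFDeriv ℝ l f y‖ ≤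
      (∫ a, B h a ∂μ) * (h.1 ^ (k' + l) * (k'.factorial * l.factorial)) := by
    intro h k' l y
    rw [hid, ← integral_mul_const]
    calc _ ≤ ‖y‖ ^ k' * ∫ a, ‖iteratedFDeriv ℝ l (k a : RR ι → ℂ) y‖ ∂μ := by
          gcongr; exact norm_integral_le_integral_norm _
      _ = ∫ a, ‖y‖ ^ k' * ‖iteratedFDeriv ℝ l (k a : RR ι → ℂ) y‖ ∂μ := by
          rw [integral_const_mul]
      _ ≤ _ := by
          refine integral_mono ((hInt l y).norm.const_mul _) ((hBi h).mul_const _) fun a => ?_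
          have hh : 0 < h.1 := h.2
          refine ((k a).bound h k' l y).trans ?_
          gcongr
          exact hB h a
  have hmem : f ∈ gsSubmodule ι := by
    refine ⟨hcd, fun h hh => ⟨∫ a, B ⟨h, hh⟩ a ∂μ, ?_⟩⟩
    rintro _ ⟨q, rfl⟩
    unfold gsQuot
    rw [div_le_iff₀ (by positivity)]
    exact hbd ⟨h, hh⟩ q.1 q.2.1 q.2.2
  exact ⟨⟨f, hmem⟩, fun y => rfl, fun h => gsSeminorm_le fun k' l y => hbd h k' l y⟩

/-! ### Inversion of the short-time Fourier transform on `Σ₁` -/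

theorem win_le (y : RR ι) : win y ≤ Real.pi ^ (-(Fintype.card ι : ℝ) / 4) := by
  unfold win
  refine mul_le_of_le_one_right (by positivity) (Real.exp_le_one_iff.2 ?_)
  have := sq_nonneg ‖y‖
  linarith

theorem continuous_stft_toDual (f : GS ι) : Continuous (stft f.toDual) := by
  have e : stft f.toDual = fun z => (ftc ι : ℂ) * ∫ y, f y * gaborFun z.1 z.2 y := rfl
  rw [e]
  refine continuous_const.mul (continuous_of_dominated
    (bound := fun y => ‖f y‖ * Real.pi ^ (-(Fintype.card ι : ℝ) / 4)) ?_ ?_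
    (f.integrable.norm.mul_const _) ?_)
  · intro z
    exact (f.2.1.continuous.mul (gaborFun_mem z.1 z.2).1.continuous).aestronglyMeasurable
  · refine fun z => Eventually.of_forall fun y => ?_
    rw [norm_mul, gaborFun_apply, norm_mul, norm_ecis, mul_one, Complex.norm_real,
      Real.norm_of_nonneg (win_pos _).le]
    gcongr
    exact win_le _
  · refine Eventually.of_forall fun y => ?_
    simp only [gaborFun_apply]
    fun_prop

/-- The weight `exp (R |x|) exp (R |ξ|)`. -/
def expw (R : ℝ) (z : RR ι × RR ι) : ℝ := Real.exp (R * ‖z.1‖) * Real.exp (R * ‖z.2‖)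

theorem expw_pos (R : ℝ) (z : RR ι × RR ι) : 0 < expw R z := by unfold expw; positivity

theorem expw_add (R S : ℝ) (z : RR ι × RR ι) : expw (R + S) z = expw R z * expw S z := by
  unfold expw; rw [add_mul, add_mul, Real.exp_add, Real.exp_add]; ring

theorem expw_mul_neg (R : ℝ) (z : RR ι × RR ι) : expw R z * expw (-R) z = 1 := by
  rw [← expw_add]; simp [expw]

theorem expw_mono {R S : ℝ} (h : R ≤ S) (z : RR ι × RR ι) : expw R z ≤ expw S z := by
  unfold expw; gcongr

theorem one_le_expw {R : ℝ} (h : 0 ≤ R) (z : RR ι × RR ι) : 1 ≤ expw R z := by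
  refine (le_of_eq ?_).trans (expw_mono h z); simp [expw]

theorem expw_add_le {R : ℝ} (hR : 0 ≤ R) (z w : RR ι × RR ι) :
    expw R (z + w) ≤ expw R z * expw R w := by
  unfold expw
  rw [Prod.fst_add, Prod.snd_add]
  calc _ ≤ Real.exp (R * (‖z.1‖ + ‖w.1‖)) * Real.exp (R * (‖z.2‖ + ‖w.2‖)) := by
        gcongr <;> exact norm_add_le _ _
    _ = _ := by rw [mul_add, mul_add, Real.exp_add, Real.exp_add]; ring

@[fun_prop]
theorem continuous_expw (R : ℝ) : Continuous (expw R : RR ι × RR ι → ℝ) := by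
  unfold expw; fun_prop

theorem expw_neg_arg (R : ℝ) (x ξ : RR ι) : expw R (x, -ξ) = expw R (x, ξ) := by simp [expw]

theorem integrable_expw {R : ℝ} (hR : R < 0) : Integrable (expw R : RR ι × RR ι → ℝ) := by
  have h := integrable_exp_neg_norm (ι := ι) (b := -R) (by linarith)
  rw [neg_neg] at h
  exact h.mul_prod h

theorem stft_decay' (R : ℝ) (hR : 0 ≤ R) : ∃ (h : Set.Ioi (0 : ℝ)) (C : ℝ), 0 < C ∧
    ∀ (f : GS ι) (z : RR ι × RR ι), ‖stft f.toDual z‖ ≤ C * gsSeminorm ι h f * expw (-R) z := by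
  obtain ⟨h, C, hC, H⟩ := stft_decay (ι := ι) R hR
  refine ⟨h, C, hC, fun f z => (H f z).trans (le_of_eq ?_)⟩
  simp [expw]

theorem integrable_stft (f : GS ι) : Integrable (stft f.toDual) := by
  obtain ⟨h, C, hC, H⟩ := stft_decay' (ι := ι) 1 zero_le_one
  exact ((integrable_expw (by norm_num : (-1 : ℝ) < 0)).const_mul _).mono'
    (continuous_stft_toDual f).aestronglyMeasurable (Eventually.of_forall fun z => H f z)

theorem integrable_stft_snd (f : GS ι) (x : RR ι) : Integrable fun ξ => stft f.toDual (x, ξ) := by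
  obtain ⟨h, C, hC, H⟩ := stft_decay (ι := ι) 1 zero_le_one
  have h1 := (integrable_exp_neg_norm (ι := ι) (b := 1) one_pos).const_mul
    (C * gsSeminorm ι h f * Real.exp (-(1 * ‖x‖)))
  refine h1.mono' ((continuous_stft_toDual f).comp (by fun_prop)).aestronglyMeasurable
    (Eventually.of_forall fun ξ => (H f (x, ξ)).trans (le_of_eq ?_))
  simp only
  rw [neg_mul]; ring

/-- Reconstruction of `f ∈ Σ₁` from its short-time Fourier transform, with an arbitrary bounded
continuous synthesis window. -/
theorem stft_inversion (f : GS ι) {g : RR ι → ℝ} (hg : Continuous g) {M : ℝ} (hM : ∀ y, |g y| ≤ M)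
    (y : RR ι) :
    ∫ z, stft f.toDual z * ((g (y - z.1) : ℂ) * ecis y (-z.2)) =
      (((ftc ι)⁻¹ * ∫ x, win x * g x : ℝ) : ℂ) * f y := by
  have hInt : Integrable fun z : RR ι × RR ι =>
      stft f.toDual z * ((g (y - z.1) : ℂ) * ecis y (-z.2)) := by
    refine (integrable_stft f).mul_bdd (c := M)
      (Continuous.aestronglyMeasurable (by fun_prop)) (Eventually.of_forall fun z => ?_)
    rw [norm_mul, norm_ecis, mul_one, Complex.norm_real]
    exact hM _
  rw [Measure.volume_eq_prod, integral_prod _ hInt]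
  have hinner : ∀ x, ∫ ξ, stft f.toDual (x, ξ) * ((g (y - x) : ℂ) * ecis y (-ξ)) =
      ((ftc ι)⁻¹ : ℝ) * f y * ((win (y - x) * g (y - x) : ℝ) : ℂ) := by
    intro x
    set F := fun y => f y * (win (y - x) : ℂ) with hF
    have hFi : Integrable F := by
      have := f.integrable_iteratedFDeriv_mul_win x 0
      have h2 := this.norm
      simp only [norm_iteratedFDeriv_zero] at h2
      exact (integrable_norm_iff (f.contDiff_mul_win x).continuous.aestronglyMeasurable).1 h2
    have hst : ∀ ξ, stft f.toDual (x, ξ) = ftc ι * ft F ξ := fun ξ => stft_toDual f (x, ξ)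
    have hftc : (ftc ι : ℂ) ≠ 0 := by exact_mod_cast ftc_pos.ne'
    have hFt : Integrable (ft F) := by
      have := (integrable_stft_snd f x).const_mul ((ftc ι : ℂ)⁻¹)
      refine this.congr (Eventually.of_forall fun ξ => ?_)
      simp only [hst, inv_mul_cancel_left₀ hftc]
    have hinv := ft_inversion (f.contDiff_mul_win x).continuous hFi hFt y
    calc _ = ∫ ξ, (ftc ι * (g (y - x) : ℂ)) * (ft F ξ * ecis y (-ξ)) := by
          refine integral_congr_ae (Eventually.of_forall fun ξ => ?_)
          simp only [hst]; ring
      _ = (ftc ι * (g (y - x) : ℂ)) * (((2 * Real.pi) ^ Fintype.card ι : ℝ) * F y) := by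
          rw [integral_const_mul, hinv]
      _ = ((ftc ι * (2 * Real.pi) ^ Fintype.card ι : ℝ) : ℂ) * f y *
            ((win (y - x) * g (y - x) : ℝ) : ℂ) := by
          simp only [hF]; push_cast; ring
      _ = _ := by
          congr 3
          have := ftc_mul_self (ι := ι)
          refine eq_inv_of_mul_eq_one_left ?_
          linarith
  simp_rw [hinner]
  rw [integral_const_mul, integral_complex_ofReal,
    integral_sub_left_eq_self (fun x => win x * g x) volume y]
  push_cast; ring

theorem integral_win_sq : ∫ x : RR ι, win x * win x = 1 := by
  have e : ∀ x : RR ι, win x * win x = Real.pi ^ (-(Fintype.card ι : ℝ) / 2) *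
      Real.exp (-1 * ‖x‖ ^ 2) := by
    intro x
    unfold win
    rw [mul_mul_mul_comm, ← Real.rpow_add Real.pi_pos, ← Real.exp_add]
    ring_nf
  simp_rw [e]
  rw [integral_const_mul, GaussianFourier.integral_rexp_neg_mul_sq_norm one_pos,
    finrank_euclideanSpace, div_one, ← Real.rpow_add Real.pi_pos]
  ring_nf
  simp

theorem stft_inversion_win (f : GS ι) (y : RR ι) :
    ∫ z, stft f.toDual z * gaborFun z.1 (-z.2) y = ((ftc ι)⁻¹ : ℝ) * f y := by
  have := stft_inversion f continuous_win (M := Real.pi ^ (-(Fintype.card ι : ℝ) / 4))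
    (fun y => by rw [abs_of_pos (win_pos y)]; exact win_le y) y
  rwa [integral_win_sq, mul_one] at this

theorem exists_synthesis {F : RR ι × RR ι → ℂ} (hF : AEStronglyMeasurable F)
    (hdec : ∀ R : ℝ, Integrable fun z => ‖F z‖ * expw R z) :
    ∃ g : GS ι, (∀ y, g y = ∫ z, F z * gaborFun z.1 (-z.2) y) ∧
      ∀ (h : Set.Ioi (0 : ℝ)) (R C : ℝ), (∀ x ξ : RR ι, gsSeminorm ι h (gaborAtom x ξ) ≤
        C * expw R (x, ξ)) → gsSeminorm ι h g ≤ C * ∫ z, ‖F z‖ * expw R z := by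
  have hbd : ∀ h : Set.Ioi (0 : ℝ), ∃ R C : ℝ, ∀ x ξ : RR ι,
      gsSeminorm ι h (gaborAtom x ξ) ≤ C * expw R (x, ξ) := fun h => by
    obtain ⟨R, C, -, -, H⟩ := gaborAtom_seminorm_le (ι := ι) h
    exact ⟨R, C, H⟩
  have hm : ∀ l y, AEStronglyMeasurable (fun z : RR ι × RR ι =>
      iteratedFDeriv ℝ l ((F z • gaborAtom z.1 (-z.2) : GS ι) : RR ι → ℂ) y) := by
    intro l y
    have e : (fun z : RR ι × RR ι => iteratedFDeriv ℝ l
        ((F z • gaborAtom z.1 (-z.2) : GS ι) : RR ι → ℂ) y) =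
        fun z => F z • iteratedFDeriv ℝ l (gaborFun z.1 (-z.2)) y := by
      funext z
      exact iteratedFDeriv_const_smul_apply
        (((gaborFun_mem z.1 (-z.2)).1.of_le (mod_cast le_top)).contDiffAt)
    rw [e]
    exact hF.smul ((continuous_iteratedFDeriv_gaborFun l y).comp
      (by fun_prop : Continuous fun z : RR ι × RR ι => (z.1, -z.2))).aestronglyMeasurable
  have hse : ∀ (h : Set.Ioi (0 : ℝ)) (R C : ℝ), (∀ x ξ : RR ι, gsSeminorm ι h (gaborAtom x ξ) ≤
      C * expw R (x, ξ)) → ∀ z : RR ι × RR ι, gsSeminorm ι h (F z • gaborAtom z.1 (-z.2)) ≤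
      C * (‖F z‖ * expw R z) := by
    intro h R C H z
    rw [map_smul_eq_mul]
    calc _ ≤ ‖F z‖ * (C * expw R (z.1, -z.2)) := by gcongr; exact H _ _
      _ = _ := by rw [expw_neg_arg]; ring
  choose R₀ C₀ H₀ using hbd
  obtain ⟨g, hg, -⟩ := exists_gs_integral (fun z => F z • gaborAtom z.1 (-z.2)) hm
    (fun h z => C₀ h * (‖F z‖ * expw (R₀ h) z)) (fun h => (hdec _).const_mul _)
    (fun h z => hse h _ _ (H₀ h) z)
  refine ⟨g, hg, fun h R C H => ?_⟩
  classical
  obtain ⟨g', hg', hb'⟩ := exists_gs_integral (fun z => F z • gaborAtom z.1 (-z.2)) hm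
    (fun h' z => if h' = h then C * (‖F z‖ * expw R z) else C₀ h' * (‖F z‖ * expw (R₀ h') z))
    (fun h' => by split_ifs <;> exact (hdec _).const_mul _)
    (fun h' z => by
      split_ifs with hh
      · rw [hh]; exact hse h _ _ H z
      · exact hse h' _ _ (H₀ h') z)
  have e : g = g' := Subtype.ext (funext fun y => (hg y).trans (hg' y).symm)
  rw [e, ← integral_const_mul]
  simpa using hb' h

/-- `gsSeminorm` is dominated by weighted suprema of the short-time Fourier transform. -/
theorem gsSeminorm_le_stft (h : Set.Ioi (0 : ℝ)) : ∃ R₀ C : ℝ, 0 ≤ R₀ ∧ 0 ≤ C ∧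
    ∀ (f : GS ι) (R M : ℝ), R₀ ≤ R → (∀ z, ‖stft f.toDual z‖ * expw R z ≤ M) →
      gsSeminorm ι h f ≤ C * M := by
  obtain ⟨R₁, C₁, hR₁, hC₁, H⟩ := gaborAtom_seminorm_le (ι := ι) h
  have hK := integrable_expw (ι := ι) (by norm_num : (-1 : ℝ) < 0)
  have hftc := ftc_pos (ι := ι)
  refine ⟨R₁ + 1, ftc ι * (C₁ * ∫ z : RR ι × RR ι, expw (-1) z), by positivity,
    mul_nonneg hftc.le (mul_nonneg hC₁.le (integral_nonneg fun z => (expw_pos _ z).le)),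
    fun f R M hR hM => ?_⟩
  have hpt : ∀ z, ‖stft f.toDual z‖ * expw R₁ z ≤ M * expw (-1) z := by
    intro z
    have h1 : ‖stft f.toDual z‖ * expw (R₁ + 1) z ≤ M :=
      (mul_le_mul_of_nonneg_left (expw_mono hR z) (norm_nonneg _)).trans (hM z)
    calc _ = ‖stft f.toDual z‖ * expw (R₁ + 1) z * expw (-1) z := by
          rw [mul_assoc, ← expw_add]; simp
      _ ≤ _ := mul_le_mul_of_nonneg_right h1 (expw_pos _ _).le
  have hdec : ∀ R : ℝ, Integrable fun z => ‖stft f.toDual z‖ * expw R z := by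
    intro R
    obtain ⟨h', C', hC', H'⟩ := stft_decay' (ι := ι) (|R| + 1) (by positivity)
    refine (hK.const_mul (C' * gsSeminorm ι h' f)).mono'
      ((continuous_stft_toDual f).norm.mul (continuous_expw R)).aestronglyMeasurable
      (Eventually.of_forall fun z => ?_)
    rw [Real.norm_of_nonneg (mul_nonneg (norm_nonneg _) (expw_pos _ _).le)]
    have hp : 0 ≤ gsSeminorm ι h' f := apply_nonneg _ _
    calc _ ≤ C' * gsSeminorm ι h' f * expw (-(|R| + 1)) z * expw |R| z := by
          exact mul_le_mul (H' f z) (expw_mono (le_abs_self R) z) (expw_pos _ _).le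
            (mul_nonneg (mul_nonneg hC'.le hp) (expw_pos _ _).le)
      _ = _ := by rw [mul_assoc, ← expw_add]; ring_nf
  obtain ⟨g, hg, hgs⟩ := exists_synthesis (continuous_stft_toDual f).aestronglyMeasurable hdec
  have hfg : f = (ftc ι : ℂ) • g := by
    apply Subtype.ext
    funext y
    have h1 := hg y
    rw [stft_inversion_win] at h1
    change f y = (ftc ι : ℂ) * g y
    rw [h1, ← mul_assoc, ← Complex.ofReal_mul, mul_inv_cancel₀ hftc.ne', Complex.ofReal_one, one_mul]
  rw [hfg, map_smul_eq_mul, Complex.norm_real, Real.norm_of_nonneg hftc.le, mul_assoc]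
  gcongr
  refine (hgs h R₁ C₁ H).trans ?_
  rw [mul_assoc]
  gcongr
  rw [mul_comm, ← integral_const_mul]
  exact integral_mono (hdec _) (hK.const_mul _) hpt

end GS
end

open scoped ENNReal NNReal BoundedContinuousFunction

noncomputable section

section GS

variable {ι : Type} [Fintype ι]

/-! ### Short-time Fourier transforms of time-frequency shifts of the Gaussian -/

/-- The ambiguity function of the Gaussian window. -/
def ambig (w : RR ι × RR ι) : ℂ := stft (gaborAtom (0 : RR ι) 0).toDual w

theorem continuous_ambig : Continuous (ambig : RR ι × RR ι → ℂ) := continuous_stft_toDual _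

theorem stft_gaborAtom (z w : RR ι × RR ι) :
    stft (gaborAtom z.1 z.2).toDual w =
      ecis z.1 (z.2 + w.2) * ambig (w.1 - z.1, z.2 + w.2) := by
  rw [ambig, stft_toDual, stft_toDual, mul_left_comm]
  congr 1
  rw [ft, ft, ← integral_add_right_eq_self (fun y => (gaborAtom z.1 z.2 : RR ι → ℂ) y *
    (win (y - w.1) : ℂ) * ecis y w.2) z.1, ← integral_const_mul]
  refine integral_congr_ae (Eventually.of_forall fun y => ?_)
  change gaborFun z.1 z.2 (y + z.1) * (win (y + z.1 - w.1) : ℂ) * ecis (y + z.1) w.2 =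
    ecis z.1 (z.2 + w.2) * (gaborFun 0 0 y * (win (y - (w.1 - z.1)) : ℂ) * ecis y (z.2 + w.2))
  simp only [gaborFun_apply, add_sub_cancel_right, sub_zero, ecis_zero_right, ecis_add_left,
    ecis_add_right, mul_one]
  rw [show y + z.1 - w.1 = y - (w.1 - z.1) by abel]
  ring

theorem norm_stft_gaborAtom (z w : RR ι × RR ι) :
    ‖stft (gaborAtom z.1 z.2).toDual w‖ = ‖ambig (w.1 - z.1, z.2 + w.2)‖ := by
  rw [stft_gaborAtom, norm_mul, norm_ecis, one_mul]

theorem ambig_decay (R : ℝ) : ∃ C : ℝ, 0 < C ∧ ∀ w : RR ι × RR ι, ‖ambig w‖ ≤ C * expw (-R) w := by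
  obtain ⟨h, C, hC, H⟩ := stft_decay' (ι := ι) |R| (abs_nonneg R)
  have hp : 0 ≤ gsSeminorm ι h (gaborAtom 0 0) := apply_nonneg _ _
  refine ⟨C * gsSeminorm ι h (gaborAtom 0 0) + 1, by positivity, fun w => (H _ w).trans ?_⟩
  exact mul_le_mul (by linarith) (expw_mono (neg_le_neg (le_abs_self R)) w) (expw_pos _ _).le
    (by positivity)

theorem integrable_ambig_mul_expw (R : ℝ) :
    Integrable fun w : RR ι × RR ι => ‖ambig w‖ * expw R w := by
  obtain ⟨C, hC, H⟩ := ambig_decay (ι := ι) (R + 1)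
  refine ((integrable_expw (by norm_num : (-1 : ℝ) < 0)).const_mul C).mono'
    (continuous_ambig.norm.mul (continuous_expw R)).aestronglyMeasurable
    (Eventually.of_forall fun z => ?_)
  rw [Real.norm_of_nonneg (mul_nonneg (norm_nonneg _) (expw_pos _ _).le)]
  calc _ ≤ C * expw (-(R + 1)) z * expw R z :=
        mul_le_mul_of_nonneg_right (H z) (expw_pos _ _).le
    _ = _ := by rw [mul_assoc, ← expw_add]; ring_nf

/-! ### Continuity and inversion of the short-time Fourier transform on `Σ₁'` -/

theorem GS.toDual_add (f g : GS ι) : (f + g).toDual = f.toDual + g.toDual := by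
  ext ψ
  change ∫ y, (f y + g y) * ψ y = (∫ y, f y * ψ y) + ∫ y, g y * ψ y
  rw [← integral_add (f.integrable_mul ψ) (g.integrable_mul ψ)]
  simp only [add_mul]

theorem GS.toDual_smul (c : ℂ) (f : GS ι) : (c • f).toDual = c • f.toDual := by
  ext ψ
  change ∫ y, (c * f y) * ψ y = c * ∫ y, f y * ψ y
  rw [← integral_const_mul]
  simp only [mul_assoc]

/-- `ψ ↦ exp (R |x|) exp (R |ξ|) V ψ(x, ξ)` as a bounded continuous function. -/
def weightedStft (R : ℝ) : GS ι →ₗ[ℂ] (RR ι × RR ι →ᵇ ℂ) where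
  toFun ψ := BoundedContinuousFunction.ofNormedAddCommGroup
    (fun w => (expw R w : ℂ) * stft ψ.toDual w)
    ((Complex.continuous_ofReal.comp (continuous_expw R)).mul (continuous_stft_toDual ψ))
    ((stft_decay' (ι := ι) |R| (abs_nonneg R)).choose_spec.choose *
      gsSeminorm ι (stft_decay' (ι := ι) |R| (abs_nonneg R)).choose ψ) (by
      intro w
      have H := (stft_decay' (ι := ι) |R| (abs_nonneg R)).choose_spec.choose_spec.2 ψ w
      rw [norm_mul, Complex.norm_real, Real.norm_of_nonneg (expw_pos _ _).le]
      calc _ ≤ expw |R| w * (_ * expw (-|R|) w) :=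
            mul_le_mul (expw_mono (le_abs_self R) w) H (norm_nonneg _) (expw_pos _ _).le
        _ = _ := by rw [mul_left_comm, expw_mul_neg, mul_one])
  map_add' f g := by
    ext w
    simp [GS.toDual_add, stft_add, mul_add]
  map_smul' c f := by
    ext w
    simp [GS.toDual_smul, stft_smul, mul_left_comm]

theorem weightedStft_apply (R : ℝ) (ψ : GS ι) (w : RR ι × RR ι) :
    weightedStft R ψ w = (expw R w : ℂ) * stft ψ.toDual w := rfl

theorem norm_weightedStft_apply (R : ℝ) (ψ : GS ι) (w : RR ι × RR ι) :
    ‖weightedStft R ψ w‖ = ‖stft ψ.toDual w‖ * expw R w := by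
  rw [weightedStft_apply, norm_mul, Complex.norm_real, Real.norm_of_nonneg (expw_pos _ _).le,
    mul_comm]

theorem stft_toDual_injective (f : GS ι) (hf : ∀ z, stft f.toDual z = 0) : f = 0 := by
  apply Subtype.ext
  funext y
  have := stft_inversion_win f y
  simp only [hf, zero_mul, integral_zero] at this
  have h2 : (((ftc ι)⁻¹ : ℝ) : ℂ) ≠ 0 := by exact_mod_cast (inv_pos.2 ftc_pos).ne'
  exact (mul_eq_zero.1 this.symm).resolve_left h2

theorem weightedStft_injective (R : ℝ) : Function.Injective (weightedStft (ι := ι) R) := by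
  rw [← LinearMap.ker_eq_bot, LinearMap.ker_eq_bot']
  intro f hf
  refine stft_toDual_injective f fun z => ?_
  have := congrArg (fun g : RR ι × RR ι →ᵇ ℂ => g z) hf
  simp only [weightedStft_apply, BoundedContinuousFunction.coe_zero, Pi.zero_apply] at this
  exact (mul_eq_zero.1 this).resolve_left (by exact_mod_cast (expw_pos R z).ne')

theorem gsDual_bound (u : GSDual ι) : ∃ s : Finset (Set.Ioi (0 : ℝ)), ∃ C : ℝ, 0 ≤ C ∧
    ∀ f, ‖u f‖ ≤ C * (s.sup (gsSeminorm ι)) f := by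
  obtain ⟨s, C, -, h⟩ := Seminorm.bound_of_continuous (gs_withSeminorms ι)
    ((normSeminorm ℂ ℂ).comp u.toLinearMap) (continuous_norm.comp u.continuous)
  exact ⟨s, C, C.2, fun f => h f⟩

theorem finset_sup_gsSeminorm_le (s : Finset (Set.Ioi (0 : ℝ))) : ∃ R₀ C : ℝ, 0 ≤ R₀ ∧ 0 ≤ C ∧
    ∀ (f : GS ι) (R : ℝ), R₀ ≤ R → (s.sup (gsSeminorm ι)) f ≤ C * ‖weightedStft R f‖ := by
  classical
  induction s using Finset.induction_on with
  | empty =>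
    refine ⟨0, 0, le_rfl, le_rfl, fun f R _ => ?_⟩
    simp
  | insert h s _ ih =>
    obtain ⟨R₁, C₁, hR₁, hC₁, H₁⟩ := ih
    obtain ⟨R₂, C₂, hR₂, hC₂, H₂⟩ := gsSeminorm_le_stft (ι := ι) h
    refine ⟨max R₁ R₂, max C₁ C₂, hR₁.trans (le_max_left _ _), hC₁.trans (le_max_left _ _),
      fun f R hR => ?_⟩
    rw [Finset.sup_insert, Seminorm.sup_apply]
    refine max_le ?_ ?_
    · refine (H₂ f R _ ((le_max_right _ _).trans hR) (fun z => ?_)).trans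
        (mul_le_mul_of_nonneg_right (le_max_right _ _) (norm_nonneg (weightedStft R f)))
      rw [← norm_weightedStft_apply]
      exact (weightedStft R f).norm_coe_le_norm z
    · exact (H₁ f R ((le_max_left _ _).trans hR)).trans
        (mul_le_mul_of_nonneg_right (le_max_left _ _) (norm_nonneg _))

/-- Every `u ∈ Σ₁'` factors through a weighted short-time Fourier transform. -/
theorem exists_factor_weightedStft (u : GSDual ι) : ∃ (R : ℝ) (U : (RR ι × RR ι →ᵇ ℂ) →L[ℂ] ℂ),
    ∀ f, u f = U (weightedStft R f) := by
  obtain ⟨s, C, hC, hu⟩ := gsDual_bound u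
  obtain ⟨R, C', hR, hC', H⟩ := finset_sup_gsSeminorm_le (ι := ι) s
  let e := LinearEquiv.ofInjective (weightedStft (ι := ι) R) (weightedStft_injective R)
  let U₀ : LinearMap.range (weightedStft (ι := ι) R) →L[ℂ] ℂ :=
    LinearMap.mkContinuous (u.toLinearMap ∘ₗ e.symm.toLinearMap) (C * C') (by
      intro g
      obtain ⟨f, rfl⟩ := e.surjective g
      simp only [LinearMap.comp_apply, LinearEquiv.coe_coe, LinearEquiv.symm_apply_apply]
      refine (hu f).trans ?_
      rw [mul_assoc]
      exact mul_le_mul_of_nonneg_left (H f R le_rfl) hC)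
  obtain ⟨U, hU, -⟩ := exists_extension_norm_eq _ U₀
  refine ⟨R, U, fun f => ?_⟩
  have := hU (e f)
  rw [show ((e f : LinearMap.range (weightedStft (ι := ι) R)) : RR ι × RR ι →ᵇ ℂ) =
    weightedStft R f from rfl] at this
  rw [this]
  change u f = u (e.symm (e f))
  rw [LinearEquiv.symm_apply_apply]

theorem norm_weightedStft_gaborAtom_le {R : ℝ} (hR : 0 ≤ R) : ∃ C : ℝ, 0 < C ∧
    ∀ z w : RR ι × RR ι, ‖weightedStft R (gaborAtom z.1 z.2) w‖ ≤
      C * expw (R + 1) z * expw (-1) w := by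
  obtain ⟨C, hC, H⟩ := ambig_decay (ι := ι) (R + 1)
  refine ⟨C, hC, fun z w => ?_⟩
  rw [norm_weightedStft_apply, norm_stft_gaborAtom]
  have h1 : expw (R + 1) w ≤ expw (R + 1) z * expw (R + 1) (w.1 - z.1, z.2 + w.2) := by
    have := expw_add_le (by positivity : 0 ≤ R + 1) (z.1, -z.2) (w.1 - z.1, z.2 + w.2)
    rw [expw_neg_arg] at this
    convert this using 2
    ext1 <;> simp
  have h2 : expw R w = expw (R + 1) w * expw (-1) w := by rw [← expw_add]; simp
  calc _ ≤ C * expw (-(R + 1)) (w.1 - z.1, z.2 + w.2) * (expw (R + 1) z *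
        expw (R + 1) (w.1 - z.1, z.2 + w.2) * expw (-1) w) := by
        rw [h2]
        exact mul_le_mul (H _) (mul_le_mul_of_nonneg_right h1 (expw_pos _ _).le)
          (mul_pos (expw_pos _ _) (expw_pos _ _)).le (mul_nonneg hC.le (expw_pos _ _).le)
    _ = C * expw (R + 1) z * expw (-1) w * (expw (R + 1) (w.1 - z.1, z.2 + w.2) *
        expw (-(R + 1)) (w.1 - z.1, z.2 + w.2)) := by ring
    _ = _ := by rw [expw_mul_neg, mul_one]

theorem continuous_weightedStft_gaborAtom (R : ℝ) :
    Continuous fun z : RR ι × RR ι => weightedStft R (gaborAtom z.1 z.2) := by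
  wlog hR : 0 ≤ R generalizing R
  · have h0 := this 0 le_rfl
    rw [continuous_iff_continuousAt] at h0 ⊢
    intro z₀
    refine tendsto_iff_dist_tendsto_zero.2 (squeeze_zero (fun _ => dist_nonneg) (fun z => ?_)
      (tendsto_iff_dist_tendsto_zero.1 (h0 z₀)))
    rw [dist_eq_norm, dist_eq_norm, ← map_sub, ← map_sub]
    refine (BoundedContinuousFunction.norm_le (norm_nonneg _)).2 fun w => ?_
    refine le_trans ?_ ((weightedStft 0 _).norm_coe_le_norm w)
    rw [norm_weightedStft_apply, norm_weightedStft_apply]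
    exact mul_le_mul_of_nonneg_left (expw_mono (not_le.1 hR).le w) (norm_nonneg _)
  obtain ⟨C, hC, H⟩ := norm_weightedStft_gaborAtom_le (ι := ι) hR
  have hjoint : Continuous fun p : (RR ι × RR ι) × (RR ι × RR ι) =>
      weightedStft R (gaborAtom p.1.1 p.1.2) p.2 := by
    simp only [weightedStft_apply, stft_gaborAtom]
    have := continuous_ambig (ι := ι)
    have := continuous_expw (ι := ι) R
    fun_prop
  rw [continuous_iff_continuousAt]
  intro z₀
  rw [ContinuousAt, BoundedContinuousFunction.tendsto_iff_tendstoUniformly,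
    Metric.tendstoUniformly_iff]
  intro ε hε
  have hloc : ∀ᶠ z in 𝓝 z₀, expw (R + 1) z < expw (R + 1) z₀ + 1 :=
    (continuous_expw (R + 1)).continuousAt.eventually (gt_mem_nhds (by linarith))
  set M := C * (expw (R + 1) z₀ + 1) with hM
  have hMpos : 0 < M := mul_pos hC (by linarith [expw_pos (R + 1) z₀])
  have htail : ∀ᶠ w in cocompact (RR ι × RR ι), M * expw (-1) w < ε / 2 := by
    have h1 : Tendsto (fun w : RR ι × RR ι => M * Real.exp (-‖w‖)) (cocompact _) (𝓝 0) := by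
      have := (Real.tendsto_exp_neg_atTop_nhds_zero.comp
        (tendsto_norm_cocompact_atTop (E := RR ι × RR ι))).const_mul M
      simpa using this
    filter_upwards [h1.eventually (gt_mem_nhds (half_pos hε))] with w hw
    refine lt_of_le_of_lt ?_ hw
    gcongr
    unfold expw
    rw [← Real.exp_add]
    apply Real.exp_le_exp.2
    have : ‖w‖ ≤ ‖w.1‖ + ‖w.2‖ := by
      rw [Prod.norm_def]
      exact max_le (by linarith [norm_nonneg w.2]) (by linarith [norm_nonneg w.1])
    linarith
  obtain ⟨K, hK, hKt⟩ := Filter.mem_cocompact.1 htail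
  have hunif := (ContinuousMap.tendsto_iff_forall_isCompact_tendstoUniformlyOn.1
    ((ContinuousMap.curry ⟨_, hjoint⟩).continuous.tendsto z₀)) K hK
  rw [Metric.tendstoUniformlyOn_iff] at hunif
  filter_upwards [hloc, hunif ε hε] with z hz hzK w
  by_cases hw : w ∈ K
  · exact hzK w hw
  · have hw' : M * expw (-1) w < ε / 2 := hKt hw
    have b1 : ‖weightedStft R (gaborAtom z.1 z.2) w‖ ≤ M * expw (-1) w :=
      (H z w).trans (mul_le_mul_of_nonneg_right (mul_le_mul_of_nonneg_left hz.le hC.le)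
        (expw_pos _ _).le)
    have b2 : ‖weightedStft R (gaborAtom z₀.1 z₀.2) w‖ ≤ M * expw (-1) w :=
      (H z₀ w).trans (mul_le_mul_of_nonneg_right (mul_le_mul_of_nonneg_left (by linarith) hC.le)
        (expw_pos _ _).le)
    rw [dist_eq_norm]
    have := norm_sub_le (weightedStft R (gaborAtom z₀.1 z₀.2) w)
      (weightedStft R (gaborAtom z.1 z.2) w)
    linarith

theorem continuous_stft (u : GSDual ι) : Continuous (stft u) := by
  obtain ⟨R, U, hU⟩ := exists_factor_weightedStft u
  have : stft u = fun z => (ftc ι : ℂ) * U (weightedStft R (gaborAtom z.1 z.2)) := by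
    funext z; rw [stft_eq, hU]
  rw [this]
  exact continuous_const.mul (U.continuous.comp (continuous_weightedStft_gaborAtom R))

theorem norm_stft_le_expw (u : GSDual ι) : ∃ R C : ℝ, 0 ≤ R ∧ 0 ≤ C ∧
    ∀ z, ‖stft u z‖ ≤ C * expw R z := by
  obtain ⟨R, U, hU⟩ := exists_factor_weightedStft u
  obtain ⟨C, hC, H⟩ := norm_weightedStft_gaborAtom_le (ι := ι) (abs_nonneg R)
  refine ⟨|R| + 1, ftc ι * (‖U‖ * C), by positivity,
    mul_nonneg ftc_pos.le (by positivity), fun z => ?_⟩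
  rw [stft_eq, hU, norm_mul, Complex.norm_real, Real.norm_of_nonneg ftc_pos.le, mul_assoc]
  refine mul_le_mul_of_nonneg_left ((U.le_opNorm _).trans ?_) ftc_pos.le
  rw [mul_assoc]
  refine mul_le_mul_of_nonneg_left ?_ (norm_nonneg _)
  refine (BoundedContinuousFunction.norm_le (mul_nonneg hC.le (expw_pos _ _).le)).2 fun w => ?_
  refine le_trans ?_ ((H z w).trans (mul_le_of_le_one_right
    (mul_nonneg hC.le (expw_pos _ _).le) ?_))
  · rw [norm_weightedStft_apply, norm_weightedStft_apply]
    exact mul_le_mul_of_nonneg_left (expw_mono (le_abs_self R) w) (norm_nonneg _)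
  · exact (expw_mono (by norm_num : (-1 : ℝ) ≤ 0) w).trans (by simp [expw])

theorem stft_synthesis {F : RR ι × RR ι → ℂ} (hF0 : Integrable F) (g : GS ι)
    (hg : ∀ y, g y = ∫ z, F z * gaborFun z.1 (-z.2) y) (w : RR ι × RR ι) :
    stft g.toDual w = ∫ z, F z * stft (gaborAtom z.1 (-z.2)).toDual w := by
  change (ftc ι : ℂ) * ∫ y, g y * gaborFun w.1 w.2 y = _
  simp_rw [hg, ← integral_mul_const]
  rw [integral_integral_swap, ← integral_const_mul]
  · refine integral_congr_ae (Eventually.of_forall fun z => ?_)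
    change (ftc ι : ℂ) * ∫ y, F z * gaborFun z.1 (-z.2) y * gaborFun w.1 w.2 y =
      F z * ((ftc ι : ℂ) * ∫ y, gaborFun z.1 (-z.2) y * gaborFun w.1 w.2 y)
    simp_rw [mul_assoc]
    rw [integral_const_mul]
    ring
  · have hb := (gaborAtom w.1 w.2).integrable.norm.mul_prod (hF0.norm)
    refine (hb.const_mul (Real.pi ^ (-(Fintype.card ι : ℝ) / 4))).mono' ?_
      (Eventually.of_forall fun p => ?_)
    · refine AEStronglyMeasurable.mul (AEStronglyMeasurable.mul hF0.1.comp_snd ?_) ?_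
      · refine Continuous.aestronglyMeasurable ?_
        simp only [gaborFun_apply]
        fun_prop
      · exact ((gaborFun_mem w.1 w.2).1.continuous.comp continuous_fst).aestronglyMeasurable
    · change ‖F p.2 * gaborFun p.2.1 (-p.2.2) p.1 * gaborFun w.1 w.2 p.1‖ ≤
        Real.pi ^ (-(Fintype.card ι : ℝ) / 4) * (‖gaborFun w.1 w.2 p.1‖ * ‖F p.2‖)
      rw [norm_mul, norm_mul, gaborFun_apply p.2.1, norm_mul, norm_ecis, mul_one,
        Complex.norm_real, Real.norm_of_nonneg (win_pos _).le]
      calc _ ≤ ‖F p.2‖ * Real.pi ^ (-(Fintype.card ι : ℝ) / 4) * ‖gaborFun w.1 w.2 p.1‖ := by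
            gcongr; exact win_le _
        _ = _ := by ring

theorem norm_weightedStft_gaborAtom_neg_le (R : ℝ) : ∃ C : ℝ, 0 < C ∧ ∀ z : RR ι × RR ι,
    ‖weightedStft R (gaborAtom z.1 (-z.2))‖ ≤ C * expw (|R| + 1) z := by
  obtain ⟨C, hC, H⟩ := norm_weightedStft_gaborAtom_le (ι := ι) (abs_nonneg R)
  refine ⟨C, hC, fun z => ?_⟩
  refine (BoundedContinuousFunction.norm_le (mul_nonneg hC.le (expw_pos _ _).le)).2 fun w => ?_
  have h1 := H (z.1, -z.2) w
  rw [expw_neg_arg] at h1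
  refine le_trans ?_ (h1.trans (mul_le_of_le_one_right
    (mul_nonneg hC.le (expw_pos _ _).le) ?_))
  · rw [norm_weightedStft_apply, norm_weightedStft_apply]
    exact mul_le_mul_of_nonneg_left (expw_mono (le_abs_self R) w) (norm_nonneg _)
  · exact (expw_mono (by norm_num : (-1 : ℝ) ≤ 0) w).trans (by simp [expw])

theorem integrable_smul_weightedStft (R : ℝ) {F : RR ι × RR ι → ℂ} (hF : AEStronglyMeasurable F)
    (hdec : ∀ R : ℝ, Integrable fun z => ‖F z‖ * expw R z) :
    Integrable fun z => F z • weightedStft R (gaborAtom z.1 (-z.2)) := by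
  have hatom : Continuous fun z : RR ι × RR ι => weightedStft R (gaborAtom z.1 (-z.2)) :=
    Continuous.comp (g := fun z : RR ι × RR ι => weightedStft R (gaborAtom z.1 z.2))
      (f := fun z : RR ι × RR ι => (z.1, -z.2)) (continuous_weightedStft_gaborAtom R) (by fun_prop)
  obtain ⟨C, hC, hnorm⟩ := norm_weightedStft_gaborAtom_neg_le (ι := ι) R
  refine ((hdec (|R| + 1)).const_mul C).mono' (hF.smul hatom.aestronglyMeasurable)
    (Eventually.of_forall fun z => ?_)
  rw [norm_smul]
  calc _ ≤ ‖F z‖ * (C * expw (|R| + 1) z) :=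
        mul_le_mul_of_nonneg_left (hnorm z) (norm_nonneg _)
    _ = _ := by ring

theorem weightedStft_synthesis (R : ℝ) {F : RR ι × RR ι → ℂ} (hF : AEStronglyMeasurable F)
    (hdec : ∀ R : ℝ, Integrable fun z => ‖F z‖ * expw R z) (g : GS ι)
    (hg : ∀ y, g y = ∫ z, F z * gaborFun z.1 (-z.2) y) :
    weightedStft R g = ∫ z, F z • weightedStft R (gaborAtom z.1 (-z.2)) := by
  have hF0 : Integrable F := by
    have := hdec 0
    simp only [expw, zero_mul, Real.exp_zero, mul_one] at this
    exact (integrable_norm_iff hF).1 this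
  refine BoundedContinuousFunction.ext fun w => ?_
  have hev := (BoundedContinuousFunction.evalCLM (β := ℂ) ℂ w).integral_comp_comm
    (integrable_smul_weightedStft R hF hdec)
  rw [BoundedContinuousFunction.evalCLM_apply] at hev
  rw [← hev, weightedStft_apply, stft_synthesis hF0 g hg w, ← integral_const_mul]
  refine integral_congr_ae (Eventually.of_forall fun z => ?_)
  change _ = F z * ((expw R w : ℂ) * stft (gaborAtom z.1 (-z.2)).toDual w)
  simp only; ring

/-- Applying `u ∈ Σ₁'` to a superposition of time-frequency shifts of the Gaussian. -/
theorem dual_synthesis (u : GSDual ι) {F : RR ι × RR ι → ℂ} (hF : AEStronglyMeasurable F)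
    (hdec : ∀ R : ℝ, Integrable fun z => ‖F z‖ * expw R z) (g : GS ι)
    (hg : ∀ y, g y = ∫ z, F z * gaborFun z.1 (-z.2) y) :
    u g = ((ftc ι)⁻¹ : ℝ) * ∫ z, F z * stft u (z.1, -z.2) := by
  obtain ⟨R, U, hU⟩ := exists_factor_weightedStft u
  rw [hU, weightedStft_synthesis R hF hdec g hg,
    ← U.integral_comp_comm (integrable_smul_weightedStft R hF hdec), ← integral_const_mul]
  refine integral_congr_ae (Eventually.of_forall fun z => ?_)
  simp only [map_smul, smul_eq_mul, ← hU]
  rw [stft_eq]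
  have hf : (ftc ι : ℂ) ≠ 0 := by exact_mod_cast ftc_pos.ne'
  push_cast
  field_simp

theorem integrable_stft_mul_expw (f : GS ι) (R : ℝ) :
    Integrable fun z => ‖stft f.toDual z‖ * expw R z := by
  obtain ⟨h, C, hC, H⟩ := stft_decay' (ι := ι) (|R| + 1) (by positivity)
  have hp : 0 ≤ gsSeminorm ι h f := apply_nonneg _ _
  refine ((integrable_expw (by norm_num : (-1 : ℝ) < 0)).const_mul (C * gsSeminorm ι h f)).mono'
    ((continuous_stft_toDual f).norm.mul (continuous_expw R)).aestronglyMeasurable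
    (Eventually.of_forall fun z => ?_)
  rw [Real.norm_of_nonneg (mul_nonneg (norm_nonneg _) (expw_pos _ _).le)]
  calc _ ≤ C * gsSeminorm ι h f * expw (-(|R| + 1)) z * expw |R| z :=
        mul_le_mul (H f z) (expw_mono (le_abs_self R) z) (expw_pos _ _).le
          (mul_nonneg (mul_nonneg hC.le hp) (expw_pos _ _).le)
    _ = _ := by rw [mul_assoc, ← expw_add]; ring_nf

/-- Inversion of the short-time Fourier transform on `Σ₁'`. -/
theorem dual_inversion (u : GSDual ι) (ψ : GS ι) :
    u ψ = ∫ z, stft u z * stft ψ.toDual (z.1, -z.2) := by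
  have hf : (ftc ι : ℂ) ≠ 0 := by exact_mod_cast ftc_pos.ne'
  have h1 := dual_synthesis u (F := fun z => (ftc ι : ℂ) * stft ψ.toDual z)
    (continuous_const.mul (continuous_stft_toDual ψ)).aestronglyMeasurable
    (fun R => by
      simp only [norm_mul, mul_assoc]
      exact (integrable_stft_mul_expw ψ R).const_mul _) ψ (fun y => by
      simp_rw [mul_assoc]
      rw [integral_const_mul, stft_inversion_win]
      push_cast
      rw [mul_inv_cancel_left₀ hf])
  rw [h1, ← integral_const_mul]
  let e : (RR ι × RR ι) ≃ᵐ (RR ι × RR ι) :=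
    (MeasurableEquiv.refl (RR ι)).prodCongr (MeasurableEquiv.neg (RR ι))
  have he : MeasurePreserving e volume volume :=
    (MeasurePreserving.id volume).prod (Measure.measurePreserving_neg volume)
  rw [← he.integral_comp']
  refine integral_congr_ae (Eventually.of_forall fun z => ?_)
  change ((ftc ι)⁻¹ : ℝ) * ((ftc ι : ℂ) * stft ψ.toDual (z.1, -z.2) * stft u (z.1, - -z.2)) =
    stft u z * stft ψ.toDual (z.1, -z.2)
  rw [neg_neg]
  push_cast
  field_simp

end GS
end

noncomputable section

/-! ### Moderate weights -/

theorem rpow_le_one_add {t s : ℝ} (ht : 0 ≤ t) (hs : 1 < s) : t ^ (1 / s) ≤ 1 + t := by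
  have h1 : 0 ≤ 1 / s := by positivity
  rcases le_or_gt t 1 with h | h
  · exact (Real.rpow_le_one ht h h1).trans (by linarith)
  · have : 1 / s ≤ 1 := by rw [div_le_one (by linarith)]; exact hs.le
    have h2 := Real.rpow_le_rpow_of_exponent_le h.le this
    rw [Real.rpow_one] at h2
    linarith

theorem Weight.IsP.exists_exp_bound {V : Type} [NormedAddCommGroup V] [MeasurableSpace V] {s : ℝ}
    (hs : 1 < s) {ω : Weight V} (h : ω.IsP s) :
    ∃ r C : ℝ, 0 ≤ r ∧ 0 < C ∧ ∀ x y : V, ω (x + y) ≤ C * (ω x * Real.exp (r * ‖y‖)) := by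
  obtain ⟨r, hr, C, hC, H⟩ := h
  refine ⟨r, C * Real.exp r, hr.le, by positivity, fun x y => (H x y).trans ?_⟩
  have hx := ω.pos' x
  calc C * (ω x * Real.exp (r * ‖y‖ ^ (1 / s))) ≤ C * (ω x * Real.exp (r * (1 + ‖y‖))) := by
        gcongr
        exact rpow_le_one_add (norm_nonneg y) hs
    _ = _ := by rw [mul_add, mul_one, Real.exp_add]; ring

/-- Weights on phase space that are moderate with respect to `exp (r |x|) exp (r |ξ|)`. -/
def Weight.IsModerate {ι : Type} [Fintype ι] (ω : Weight (RR ι × RR ι)) (r C : ℝ) : Prop :=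
  0 ≤ r ∧ 0 < C ∧ ∀ z w, ω (z + w) ≤ C * ω z * expw r w

section

variable {ι : Type} [Fintype ι]

theorem exp_mul_norm_le_expw {r : ℝ} (hr : 0 ≤ r) (w : RR ι × RR ι) :
    Real.exp (r * ‖w‖) ≤ expw r w := by
  unfold expw
  rw [← Real.exp_add, ← mul_add]
  apply Real.exp_le_exp.2
  refine mul_le_mul_of_nonneg_left ?_ hr
  rw [Prod.norm_def]
  exact max_le (by linarith [norm_nonneg w.2]) (by linarith [norm_nonneg w.1])

theorem Weight.IsP.exists_isModerate {s : ℝ} (hs : 1 < s) {ω : Weight (RR ι × RR ι)}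
    (h : ω.IsP s) : ∃ r C : ℝ, ω.IsModerate r C := by
  obtain ⟨r, C, hr, hC, H⟩ := h.exists_exp_bound hs
  refine ⟨r, C, hr, hC, fun z w => (H z w).trans ?_⟩
  rw [← mul_assoc]
  exact mul_le_mul_of_nonneg_left (exp_mul_norm_le_expw hr w) (mul_pos hC (ω.pos' z)).le

theorem Weight.IsModerate.le_sub {ω : Weight (RR ι × RR ι)} {r C : ℝ} (h : ω.IsModerate r C)
    (z w : RR ι × RR ι) : ω z ≤ C * ω w * expw r (z - w) := by
  have := h.2.2 w (z - w)
  rwa [add_sub_cancel] at this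

theorem expw_neg' (r : ℝ) (w : RR ι × RR ι) : expw r (-w) = expw r w := by simp [expw]

/-- The bound by the essential supremum holds at every point, up to a constant. -/
theorem stft_mul_weight_le_supProfile {ω : Weight (RR ι × RR ι)} {r C : ℝ} (h : ω.IsModerate r C)
    (u : GSDual ι) (X Ξ : RR ι) : ENNReal.ofReal (‖stft u (X, Ξ)‖ * ω (X, Ξ)) ≤
      ENNReal.ofReal C * supProfile ω (stft u) Ξ := by
  obtain ⟨hr, hC, H⟩ := h
  have hae : ∀ᵐ Y : RR ι, ENNReal.ofReal (‖stft u (Y, Ξ)‖ * (ω (X, Ξ) * expw (-r) (X - Y, (0 : RR ι)))) ≤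
      ENNReal.ofReal C * supProfile ω (stft u) Ξ := by
    have h1 := ae_le_eLpNormEssSup (f := fun Y => stft u (Y, Ξ) * (ω (Y, Ξ) : ℂ))
      (μ := (volume : Measure (RR ι)))
    filter_upwards [h1] with Y hY
    rw [← eLpNorm_exponent_top] at hY
    refine le_trans ?_ (mul_le_mul_right hY (ENNReal.ofReal C))
    rw [← ofReal_norm, ← ENNReal.ofReal_mul hC.le, norm_mul, Complex.norm_real,
      Real.norm_of_nonneg (ω.pos' _).le]
    refine ENNReal.ofReal_le_ofReal ?_
    have h2 := H (Y, Ξ) (X - Y, 0)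
    rw [Prod.mk_add_mk, add_sub_cancel, add_zero] at h2
    have h3 : ω (X, Ξ) * expw (-r) (X - Y, (0 : RR ι)) ≤ C * ω (Y, Ξ) := by
      calc _ ≤ C * ω (Y, Ξ) * expw r (X - Y, 0) * expw (-r) (X - Y, 0) :=
            mul_le_mul_of_nonneg_right h2 (expw_pos _ _).le
        _ = _ := by rw [mul_assoc, expw_mul_neg, mul_one]
    calc _ ≤ ‖stft u (Y, Ξ)‖ * (C * ω (Y, Ξ)) := by gcongr
      _ = C * (‖stft u (Y, Ξ)‖ * ω (Y, Ξ)) := by ring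
  have hcl : IsClosed {Y : RR ι | ENNReal.ofReal (‖stft u (Y, Ξ)‖ *
      (ω (X, Ξ) * expw (-r) (X - Y, (0 : RR ι)))) ≤ ENNReal.ofReal C * supProfile ω (stft u) Ξ} := by
    refine isClosed_le (ENNReal.continuous_ofReal.comp ?_) continuous_const
    have := continuous_stft u
    have := continuous_expw (ι := ι) (-r)
    fun_prop
  have hd := (Measure.dense_of_ae hae).closure_eq
  rw [hcl.closure_eq] at hd
  have hX : X ∈ (Set.univ : Set (RR ι)) := Set.mem_univ X
  rw [← hd] at hX
  simpa [expw] using hX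

end
end

noncomputable section

/-! ### Young functions with finite upper exponent -/

namespace YoungFunction

variable {Φ : YoungFunction}

theorem monotone (Φ : YoungFunction) : Monotone Φ := by
  intro a b hab
  induction b with
  | top => rw [Φ.map_top']; exact le_top
  | coe b =>
    lift a to ℝ≥0 using (hab.trans_lt ENNReal.coe_lt_top).ne
    exact Φ.mono (by exact_mod_cast hab)

theorem measurable (Φ : YoungFunction) : Measurable Φ := Φ.monotone.measurable

theorem ne_zero_of_upperExp (hp : Φ.upperExp < ∞) {t : ℝ≥0} (ht : 0 < t) : Φ t ≠ 0 := by
  intro h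
  have h1 : Φ.expQuot t ≤ Φ.upperExp := le_iSup₂_of_le t ht le_rfl
  rw [expQuot, if_pos (Or.inl h)] at h1
  exact (h1.trans_lt hp).ne rfl

theorem ne_top_of_upperExp (hp : Φ.upperExp < ∞) (t : ℝ≥0) : Φ t ≠ ∞ := by
  rcases eq_or_ne t 0 with rfl | ht
  · rw [ENNReal.coe_zero, Φ.map_zero']; exact ENNReal.zero_ne_top
  intro h
  have h1 : Φ.expQuot t ≤ Φ.upperExp := le_iSup₂_of_le t (pos_iff_ne_zero.2 ht) le_rfl
  rw [expQuot, if_pos (Or.inr h)] at h1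
  exact (h1.trans_lt hp).ne rfl

/-- Three-chord inequality. -/
theorem chord_le (Φ : YoungFunction) (s e h : ℝ≥0) (hh : 0 < h) :
    (h + e : ℝ≥0) * Φ ((s + e : ℝ≥0) : ℝ≥0∞) ≤
      h * Φ s + e * Φ ((s + e + h : ℝ≥0) : ℝ≥0∞) := by
  have hne : h + e ≠ 0 := (add_pos_of_pos_of_nonneg hh zero_le).ne'
  have h1 := Φ.convex' (h / (h + e)) (e / (h + e)) s (s + e + h)
    (by rw [← add_div, div_self hne])
  have h2 : h / (h + e) * s + e / (h + e) * (s + e + h) = s + e := by field_simp; ring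
  rw [h2] at h1
  refine (mul_le_mul_right h1 _).trans (le_of_eq ?_)
  rw [mul_add, ← mul_assoc, ← mul_assoc, ← ENNReal.coe_mul, ← ENNReal.coe_mul,
    mul_div_cancel₀ _ hne, mul_div_cancel₀ _ hne]

theorem le_add_mul_rightDeriv (hp : Φ.upperExp < ∞) (s e : ℝ≥0) (he : 0 < e) :
    Φ ((s + e : ℝ≥0) : ℝ≥0∞) ≤ Φ s + e * Φ.rightDeriv (s + e) := by
  rw [← tsub_le_iff_left, mul_comm, ← ENNReal.div_le_iff_le_mul (Or.inl (by simpa using he.ne'))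
    (Or.inl ENNReal.coe_ne_top)]
  refine le_iInf₂ fun h hh => ?_
  rw [ENNReal.le_div_iff_mul_le (Or.inl (by simpa using hh.ne')) (Or.inl ENNReal.coe_ne_top),
    mul_comm, ← mul_div_assoc, ENNReal.div_le_iff_le_mul (Or.inl (by simpa using he.ne'))
      (Or.inl ENNReal.coe_ne_top)]
  have h1 := chord_le Φ s e h hh
  have f1 := ne_top_of_upperExp hp s
  have f2 := ne_top_of_upperExp hp (s + e)
  have f3 := ne_top_of_upperExp hp (s + e + h)
  lift Φ s to ℝ≥0 using f1 with a
  lift Φ ((s + e : ℝ≥0) : ℝ≥0∞) to ℝ≥0 using f2 with b hb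
  lift Φ ((s + e + h : ℝ≥0) : ℝ≥0∞) to ℝ≥0 using f3 with c hc
  have hbc : b ≤ c := by
    have := Φ.mono (show s + e ≤ s + e + h from le_self_add)
    simp only [← hb, ← hc] at this
    exact_mod_cast this
  norm_cast at h1 ⊢
  rcases le_total a b with hab | hab
  · have e1 : ((b - a : ℝ≥0) : ℝ) = b - a := NNReal.coe_sub hab
    have e2 : ((c - b : ℝ≥0) : ℝ) = c - b := NNReal.coe_sub hbc
    rw [← NNReal.coe_le_coe] at h1 ⊢
    push_cast [e1, e2] at h1 ⊢
    nlinarith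
  · rw [tsub_eq_zero_of_le hab, mul_zero]
    exact zero_le

theorem add_mul_rightDeriv_le (Φ : YoungFunction) (t h : ℝ≥0) :
    Φ t + h * Φ.rightDeriv t ≤ Φ ((t + h : ℝ≥0) : ℝ≥0∞) := by
  rcases eq_or_ne h 0 with rfl | hh
  · simp
  have h1 : Φ.rightDeriv t ≤ (Φ ((t + h : ℝ≥0) : ℝ≥0∞) - Φ t) / h :=
    iInf₂_le h (pos_iff_ne_zero.2 hh)
  have hm : Φ t ≤ Φ ((t + h : ℝ≥0) : ℝ≥0∞) := Φ.mono (le_self_add)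
  calc _ ≤ Φ t + h * ((Φ ((t + h : ℝ≥0) : ℝ≥0∞) - Φ t) / h) := by gcongr
    _ = Φ t + (Φ ((t + h : ℝ≥0) : ℝ≥0∞) - Φ t) := by
      rw [ENNReal.mul_div_cancel (by simpa using hh) ENNReal.coe_ne_top]
    _ = _ := add_tsub_cancel_of_le hm

theorem rightDeriv_ne_top (hp : Φ.upperExp < ∞) (t : ℝ≥0) : Φ.rightDeriv t ≠ ∞ := by
  have := (le_add_self).trans (add_mul_rightDeriv_le Φ t 1)
  rw [ENNReal.coe_one, one_mul] at this
  exact (this.trans_lt (ne_top_of_upperExp hp _).lt_top).ne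

/-- Supporting line at `t`. -/
theorem support_line (hp : Φ.upperExp < ∞) (t : ℝ≥0) (x : ℝ≥0∞) :
    Φ t + Φ.rightDeriv t * x ≤ Φ x + Φ.rightDeriv t * t := by
  induction x with
  | top => rw [Φ.map_top']; simp
  | coe x =>
    rcases le_total t x with h | h
    · obtain ⟨e, rfl⟩ := exists_add_of_le h
      have := add_mul_rightDeriv_le Φ t e
      rw [ENNReal.coe_add, mul_add, ← ENNReal.coe_add, mul_comm _ (e : ℝ≥0∞)]
      calc _ = Φ t + e * Φ.rightDeriv t + Φ.rightDeriv t * t := by ring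
        _ ≤ _ := by gcongr
    · obtain ⟨e, rfl⟩ := exists_add_of_le h
      rcases eq_or_ne e 0 with rfl | he
      · simp
      have := le_add_mul_rightDeriv hp x e (pos_iff_ne_zero.2 he)
      calc _ ≤ Φ x + e * Φ.rightDeriv (x + e) + Φ.rightDeriv (x + e) * x := by gcongr
        _ = _ := by rw [ENNReal.coe_add]; ring

theorem apply_one_mul_le (Φ : YoungFunction) (x : ℝ≥0∞) : Φ 1 * x ≤ Φ x + Φ 1 := by
  induction x with
  | top => rw [Φ.map_top']; simp
  | coe x =>
    rcases le_total x 1 with h | h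
    · calc Φ 1 * x ≤ Φ 1 * 1 := by gcongr; exact_mod_cast h
        _ ≤ _ := by rw [mul_one]; exact le_add_self
    · have hx : x ≠ 0 := (zero_lt_one.trans_le h).ne'
      have h1 := Φ.convex' x⁻¹ (1 - x⁻¹) x 0 (add_tsub_cancel_of_le (inv_le_one_of_one_le₀ h))
      rw [inv_mul_cancel₀ hx, mul_zero, add_zero, ENNReal.coe_zero, Φ.map_zero', mul_zero,
        add_zero, ENNReal.coe_one] at h1
      calc Φ 1 * x ≤ ((x⁻¹ : ℝ≥0) : ℝ≥0∞) * Φ x * x := by gcongr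
        _ = ((x⁻¹ * x : ℝ≥0) : ℝ≥0∞) * Φ x := by push_cast; ring
        _ ≤ _ := by rw [inv_mul_cancel₀ hx, ENNReal.coe_one, one_mul]; exact le_self_add

/-- Jensen's inequality for measures of mass at most one. -/
theorem jensen (hp : Φ.upperExp < ∞) {α : Type} [MeasurableSpace α] {ν : Measure α}
    (hν : ν Set.univ ≤ 1) {f : α → ℝ≥0∞} (hf : Measurable f) :
    Φ (∫⁻ x, f x ∂ν) ≤ ∫⁻ x, Φ (f x) ∂ν := by
  have hνt : ν Set.univ ≠ ∞ := (hν.trans_lt ENNReal.one_lt_top).ne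
  have hΦ1 : Φ 1 ≠ ∞ := by simpa using ne_top_of_upperExp hp 1
  have hΦ0 : Φ 1 ≠ 0 := by simpa using ne_zero_of_upperExp hp one_pos
  by_cases htop : ∫⁻ x, f x ∂ν = ∞
  · have h1 : ∫⁻ x, Φ 1 * f x ∂ν ≤ ∫⁻ x, (Φ (f x) + Φ 1) ∂ν :=
      lintegral_mono fun x => Φ.apply_one_mul_le (f x)
    rw [lintegral_const_mul _ hf, htop, ENNReal.mul_top hΦ0,
      lintegral_add_right _ measurable_const, lintegral_const, top_le_iff, ENNReal.add_eq_top] at h1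
    rcases h1 with h1 | h1
    · rw [h1]; exact le_top
    · exact absurd h1 (ENNReal.mul_ne_top hΦ1 hνt)
  · obtain ⟨t, ht⟩ : ∃ t : ℝ≥0, (t : ℝ≥0∞) = ∫⁻ x, f x ∂ν := ⟨_, ENNReal.coe_toNNReal htop⟩
    have ha := rightDeriv_ne_top hp t
    have h1 : ∫⁻ x, (Φ t + Φ.rightDeriv t * f x) ∂ν ≤
        ∫⁻ x, (Φ (f x) + Φ.rightDeriv t * t) ∂ν :=
      lintegral_mono fun x => support_line hp t (f x)
    rw [lintegral_add_left measurable_const, lintegral_const_mul _ hf,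
      lintegral_add_right _ measurable_const, lintegral_const, lintegral_const, ← ht] at h1
    have h0 : Φ t ≤ Φ.rightDeriv t * t := by
      have := support_line hp t 0
      rwa [Φ.map_zero', mul_zero, add_zero, zero_add] at this
    rw [← ht]
    obtain ⟨q, hq⟩ := exists_add_of_le hν
    have hat : Φ.rightDeriv t * t ≠ ∞ := ENNReal.mul_ne_top ha ENNReal.coe_ne_top
    refine (ENNReal.add_le_add_iff_right hat).1 ?_
    calc Φ t + Φ.rightDeriv t * t = Φ t * (ν Set.univ + q) + Φ.rightDeriv t * t := by
          rw [← hq, mul_one]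
      _ = (Φ t * ν Set.univ + Φ.rightDeriv t * t) + Φ t * q := by ring
      _ ≤ ((∫⁻ x, Φ (f x) ∂ν) + Φ.rightDeriv t * t * ν Set.univ) + Φ.rightDeriv t * t * q := by
          gcongr
      _ = (∫⁻ x, Φ (f x) ∂ν) + Φ.rightDeriv t * t * (ν Set.univ + q) := by ring
      _ = _ := by rw [← hq, mul_one]

/-- The doubling property. -/
theorem exists_dilation_bound (hp : Φ.upperExp < ∞) (L : ℝ≥0) :
    ∃ K : ℝ≥0, ∀ t : ℝ≥0, Φ ((L * t : ℝ≥0) : ℝ≥0∞) ≤ K * Φ t := by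
  obtain ⟨P, hP⟩ : ∃ P : ℝ≥0, (P : ℝ≥0∞) = Φ.upperExp := ⟨_, ENNReal.coe_toNNReal hp.ne⟩
  set a : ℝ≥0 := 1 / (2 * (P + 1)) with ha
  have ha1 : a < 1 := by
    rw [ha, div_lt_one (by positivity)]
    calc (1 : ℝ≥0) < 2 * 1 := by norm_num
      _ ≤ _ := by gcongr; exact le_add_self
  have ha0 : 0 < a := by positivity
  have step : ∀ t : ℝ≥0, Φ t ≤ 2 * Φ (((1 - a) * t : ℝ≥0) : ℝ≥0∞) := by
    intro t
    rcases eq_or_ne t 0 with rfl | ht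
    · simp [Φ.map_zero']
    have htp : 0 < t := pos_iff_ne_zero.2 ht
    have e1 : (1 - a) * t + a * t = t := by
      rw [← add_mul, tsub_add_cancel_of_le ha1.le, one_mul]
    have h1 := le_add_mul_rightDeriv hp ((1 - a) * t) (a * t) (mul_pos ha0 htp)
    rw [e1] at h1
    have h2 : Φ.expQuot t ≤ P := by rw [hP]; exact le_iSup₂_of_le t htp le_rfl
    have hn0 := ne_zero_of_upperExp hp htp
    have hnt := ne_top_of_upperExp hp t
    rw [expQuot, if_neg (by simp [hn0, hnt]),
      ENNReal.div_le_iff_le_mul (Or.inl hn0) (Or.inl hnt)] at h2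
    have h3 : Φ t ≤ Φ (((1 - a) * t : ℝ≥0) : ℝ≥0∞) + ((a * P : ℝ≥0) : ℝ≥0∞) * Φ t := by
      refine h1.trans (add_le_add le_rfl ?_)
      calc ((a * t : ℝ≥0) : ℝ≥0∞) * Φ.rightDeriv t = a * (t * Φ.rightDeriv t) := by
            push_cast; ring
        _ ≤ a * (P * Φ t) := by gcongr
        _ = _ := by push_cast; ring
    have h4 : a * P ≤ 1 / 2 := by
      rw [ha, div_mul_eq_mul_div, one_mul, div_le_div_iff₀ (by positivity) (by norm_num), one_mul,
        mul_comm]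
      gcongr
      exact le_self_add
    have f2 := ne_top_of_upperExp hp ((1 - a) * t)
    lift Φ t to ℝ≥0 using hnt with x
    lift Φ (((1 - a) * t : ℝ≥0) : ℝ≥0∞) to ℝ≥0 using f2 with y
    norm_cast at h3 ⊢
    rw [← NNReal.coe_le_coe] at h3 h4 ⊢
    push_cast at h3 h4 ⊢
    nlinarith [x.2]
  have iter : ∀ (k : ℕ) (t : ℝ≥0), Φ t ≤ 2 ^ k * Φ (((1 - a) ^ k * t : ℝ≥0) : ℝ≥0∞) := by
    intro k
    induction k with
    | zero => intro t; simp
    | succ k ih =>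
      intro t
      refine (ih t).trans ?_
      rw [pow_succ, mul_assoc]
      gcongr
      refine (step _).trans (le_of_eq ?_)
      rw [pow_succ' (1 - a), mul_assoc]
  obtain ⟨k, hk⟩ : ∃ k : ℕ, (1 - a) ^ k * L ≤ 1 := by
    have hlt : (1 - a) < 1 := tsub_lt_self one_pos ha0
    rcases eq_or_ne L 0 with rfl | hL
    · exact ⟨0, by simp⟩
    obtain ⟨k, hk⟩ := exists_pow_lt_of_lt_one (inv_pos.2 (pos_iff_ne_zero.2 hL)) hlt
    refine ⟨k, ?_⟩
    calc _ ≤ L⁻¹ * L := by gcongr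
      _ = 1 := inv_mul_cancel₀ hL
  refine ⟨2 ^ k, fun t => (iter k _).trans ?_⟩
  push_cast
  gcongr
  refine Φ.mono ?_
  calc (1 - a) ^ k * (L * t) = (1 - a) ^ k * L * t := by ring
    _ ≤ 1 * t := by gcongr
    _ = t := one_mul t

end YoungFunction

/-! ### Orlicz norms -/

section

variable {α β : Type} [MeasureSpace α] [MeasureSpace β] {Φ : YoungFunction}

theorem exists_mem_luxSet {F : α → ℂ} {c : ℝ≥0∞} (h : luxNorm Φ F < c) :
    ∃ a ∈ luxSet Φ F, (a : ℝ≥0∞) < c := by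
  unfold luxNorm at h
  simpa [iInf_lt_iff] using h

/-- Schur's test in Orlicz spaces. -/
theorem luxNorm_le_of_kernel [SFinite (volume : Measure α)] [SFinite (volume : Measure β)]
    (hp : Φ.upperExp < ∞) {k : α → β → ℝ≥0∞}
    (hk : Measurable (Function.uncurry k)) {M : ℝ≥0} (hM : 0 < M)
    (hrow : ∀ z, ∫⁻ w, k z w ≤ M) (hcol : ∀ w, ∫⁻ z, k z w ≤ M)
    {F : α → ℂ} {G : β → ℂ} (hG : Measurable G)
    (h : ∀ z, ‖F z‖ₑ ≤ ∫⁻ w, k z w * ‖G w‖ₑ) : luxNorm Φ F ≤ M * luxNorm Φ G := by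
  have hM0 : (M : ℝ≥0∞) ≠ 0 := by simpa using hM.ne'
  have key : ∀ c ∈ luxSet Φ G, M * c ∈ luxSet Φ F := by
    rintro c ⟨hc, hcG⟩
    refine ⟨mul_pos hM hc, ?_⟩
    have hc0 : (c : ℝ≥0∞) ≠ 0 := by simpa using hc.ne'
    have hg : Measurable fun w => ((‖G w‖₊ / c : ℝ≥0) : ℝ≥0∞) := by fun_prop
    have hkz : ∀ z, Measurable fun w => (M : ℝ≥0∞)⁻¹ * k z w := fun z =>
      (hk.comp measurable_prodMk_left).const_mul _
    have h1 : ∀ z, Φ ((‖F z‖₊ / (M * c) : ℝ≥0) : ℝ≥0∞) ≤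
        ∫⁻ w, (M : ℝ≥0∞)⁻¹ * k z w * Φ ((‖G w‖₊ / c : ℝ≥0) : ℝ≥0∞) := by
      intro z
      set ν : Measure β := volume.withDensity fun w => (M : ℝ≥0∞)⁻¹ * k z w with hν
      have hν1 : ν Set.univ ≤ 1 := by
        rw [hν, withDensity_apply _ MeasurableSet.univ, setLIntegral_univ,
          lintegral_const_mul' _ _ (ENNReal.inv_ne_top.2 hM0)]
        calc _ ≤ (M : ℝ≥0∞)⁻¹ * M := by gcongr; exact hrow z
          _ = 1 := ENNReal.inv_mul_cancel hM0 ENNReal.coe_ne_top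
      have hJ := YoungFunction.jensen hp hν1 hg
      rw [hν, lintegral_withDensity_eq_lintegral_mul _ (hkz z) hg,
        lintegral_withDensity_eq_lintegral_mul _ (hkz z)
          (g := fun w => Φ ((‖G w‖₊ / c : ℝ≥0) : ℝ≥0∞)) (Φ.measurable.comp hg)] at hJ
      refine le_trans (Φ.monotone ?_) hJ
      rw [ENNReal.coe_div (mul_pos hM hc).ne', ENNReal.coe_mul]
      calc (‖F z‖₊ : ℝ≥0∞) / (M * c) ≤ (∫⁻ w, k z w * ‖G w‖ₑ) / (M * c) := by
            gcongr; exact h z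
        _ = (M * c : ℝ≥0∞)⁻¹ * ∫⁻ w, k z w * ‖G w‖ₑ := by rw [ENNReal.div_eq_inv_mul]
        _ = ∫⁻ w, (M * c : ℝ≥0∞)⁻¹ * (k z w * ‖G w‖ₑ) := by
            rw [lintegral_const_mul]
            exact (hk.comp measurable_prodMk_left).mul hG.enorm
        _ = _ := by
            refine lintegral_congr fun w => ?_
            simp only [Pi.mul_apply]
            rw [ENNReal.coe_div hc.ne', ENNReal.div_eq_inv_mul,
              ENNReal.mul_inv (Or.inl hM0) (Or.inl ENNReal.coe_ne_top)]
            change _ * (k z w * (‖G w‖₊ : ℝ≥0∞)) = _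
            ring
    have hmeas : Measurable (Function.uncurry fun (z : α) (w : β) =>
        (M : ℝ≥0∞)⁻¹ * k z w * Φ ((‖G w‖₊ / c : ℝ≥0) : ℝ≥0∞)) :=
      (hk.const_mul _).mul ((Φ.measurable.comp hg).comp measurable_snd)
    calc ∫⁻ z, Φ ((‖F z‖₊ / (M * c) : ℝ≥0) : ℝ≥0∞)
        ≤ ∫⁻ z, ∫⁻ w, (M : ℝ≥0∞)⁻¹ * k z w * Φ ((‖G w‖₊ / c : ℝ≥0) : ℝ≥0∞) :=
          lintegral_mono h1
      _ = ∫⁻ w, ∫⁻ z, (M : ℝ≥0∞)⁻¹ * k z w * Φ ((‖G w‖₊ / c : ℝ≥0) : ℝ≥0∞) :=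
          lintegral_lintegral_swap hmeas.aemeasurable
      _ ≤ ∫⁻ w, 1 * Φ ((‖G w‖₊ / c : ℝ≥0) : ℝ≥0∞) := by
          refine lintegral_mono fun w => ?_
          have hkw : Measurable fun z => k z w := hk.comp measurable_prodMk_right
          rw [lintegral_mul_const _ (hkw.const_mul _), lintegral_const_mul _ hkw]
          gcongr
          calc _ ≤ (M : ℝ≥0∞)⁻¹ * M := by gcongr; exact hcol w
            _ = 1 := ENNReal.inv_mul_cancel hM0 ENNReal.coe_ne_top
      _ ≤ 1 := by simpa using hcG
  unfold luxNorm
  rw [ENNReal.mul_iInf_of_ne hM0 ENNReal.coe_ne_top]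
  refine le_iInf fun c => ?_
  by_cases hc : c ∈ luxSet Φ G
  · simp only [hc, iInf_pos]
    exact (iInf₂_le _ (key c hc)).trans (by rw [ENNReal.coe_mul])
  · simp only [hc, iInf_false]
    rw [ENNReal.mul_top hM0]
    exact le_top

theorem lintegral_young_ne_top (hp : Φ.upperExp < ∞) {F : α → ℂ} (hF : luxNorm Φ F < ∞)
    {ε : ℝ≥0} (hε : 0 < ε) : ∫⁻ x, Φ ((‖F x‖₊ / ε : ℝ≥0) : ℝ≥0∞) ≠ ∞ := by
  obtain ⟨c, ⟨hc, hc1⟩, -⟩ := exists_mem_luxSet hF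
  obtain ⟨K, hK⟩ := YoungFunction.exists_dilation_bound hp (c / ε)
  refine ((lintegral_mono fun x => ?_).trans_lt
    (?_ : ∫⁻ x, K * Φ ((‖F x‖₊ / c : ℝ≥0) : ℝ≥0∞) < ∞)).ne
  · refine le_trans (le_of_eq ?_) (hK _)
    congr 2
    field_simp
  · rw [lintegral_const_mul' _ _ ENNReal.coe_ne_top]
    exact ENNReal.mul_lt_top ENNReal.coe_lt_top (hc1.trans_lt ENNReal.one_lt_top)

/-- Truncations of a function of finite Orlicz norm converge to it. -/
theorem exists_luxNorm_indicator_le (hp : Φ.upperExp < ∞) {F : α → ℂ} (hm : Measurable F)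
    (hF : luxNorm Φ F < ∞) {s : ℕ → Set α} (hs : ∀ j, MeasurableSet (s j))
    (hs' : ∀ x, ∀ᶠ j in atTop, x ∉ s j) {ε : ℝ≥0} (hε : 0 < ε) :
    ∃ j, luxNorm Φ ((s j).indicator F) ≤ ε := by
  have hz : ∀ j x, ‖(s j).indicator F x‖₊ ≤ ‖F x‖₊ := fun j x => by
    by_cases h : x ∈ s j <;> simp [h]
  have ht : Tendsto (fun j => ∫⁻ x, Φ ((‖(s j).indicator F x‖₊ / ε : ℝ≥0) : ℝ≥0∞)) atTop
      (𝓝 (∫⁻ _ : α, 0)) := by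
    refine tendsto_lintegral_of_dominated_convergence
      (fun x => Φ ((‖F x‖₊ / ε : ℝ≥0) : ℝ≥0∞)) ?_ ?_ (lintegral_young_ne_top hp hF hε) ?_
    · intro j
      refine Φ.measurable.comp ?_
      have := hm.indicator (hs j)
      fun_prop
    · refine fun j => Eventually.of_forall fun x => Φ.mono ?_
      gcongr
      exact hz j x
    · refine Eventually.of_forall fun x => tendsto_const_nhds.congr' ?_
      filter_upwards [hs' x] with j hj
      simp [hj, Φ.map_zero']
  rw [lintegral_zero] at ht
  obtain ⟨j, hj⟩ := (ht.eventually (gt_mem_nhds zero_lt_one)).exists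
  exact ⟨j, iInf₂_le ε ⟨hε, hj.le⟩⟩

theorem lintegral_enorm_mul_le_of_luxNorm (hp : Φ.upperExp < ∞) {F : α → ℂ} (hF : Measurable F)
    {k : α → ℝ≥0∞} (hk : Measurable k) {A B : ℝ≥0} (hA : ∀ x, k x ≤ A) (hB : ∫⁻ x, k x ≤ B) :
    ∫⁻ x, k x * ‖F x‖ₑ ≤ ((Φ 1)⁻¹ * A + B) * luxNorm Φ F := by
  have hΦ1 : Φ 1 ≠ ∞ := by simpa using YoungFunction.ne_top_of_upperExp hp 1
  have hΦ0 : Φ 1 ≠ 0 := by simpa using YoungFunction.ne_zero_of_upperExp hp one_pos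
  have key : ∀ c ∈ luxSet Φ F, ∫⁻ x, k x * ‖F x‖ₑ ≤ ((Φ 1)⁻¹ * A + B) * c := by
    rintro c ⟨hc, hc1⟩
    have hg : Measurable fun w => ((‖F w‖₊ / c : ℝ≥0) : ℝ≥0∞) := by fun_prop
    have h1 : ∀ x, k x * ‖F x‖ₑ ≤
        c * ((Φ 1)⁻¹ * A * Φ ((‖F x‖₊ / c : ℝ≥0) : ℝ≥0∞) + k x) := by
      intro x
      have h2 := Φ.apply_one_mul_le ((‖F x‖₊ / c : ℝ≥0) : ℝ≥0∞)
      have h3 : ((‖F x‖₊ / c : ℝ≥0) : ℝ≥0∞) ≤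
          (Φ 1)⁻¹ * Φ ((‖F x‖₊ / c : ℝ≥0) : ℝ≥0∞) + 1 := by
        calc _ = (Φ 1)⁻¹ * (Φ 1 * ((‖F x‖₊ / c : ℝ≥0) : ℝ≥0∞)) := by
              rw [← mul_assoc, ENNReal.inv_mul_cancel hΦ0 hΦ1, one_mul]
          _ ≤ (Φ 1)⁻¹ * (Φ ((‖F x‖₊ / c : ℝ≥0) : ℝ≥0∞) + Φ 1) := by gcongr
          _ = _ := by rw [mul_add, ENNReal.inv_mul_cancel hΦ0 hΦ1]
      have h4 : ‖F x‖ₑ = c * ((‖F x‖₊ / c : ℝ≥0) : ℝ≥0∞) := by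
        rw [← ENNReal.coe_mul, mul_div_cancel₀ _ hc.ne']; rfl
      calc k x * ‖F x‖ₑ = c * (k x * ((‖F x‖₊ / c : ℝ≥0) : ℝ≥0∞)) := by rw [h4]; ring
        _ ≤ c * (k x * ((Φ 1)⁻¹ * Φ ((‖F x‖₊ / c : ℝ≥0) : ℝ≥0∞) + 1)) := by gcongr
        _ = c * ((Φ 1)⁻¹ * k x * Φ ((‖F x‖₊ / c : ℝ≥0) : ℝ≥0∞) + k x) := by ring
        _ ≤ _ := by gcongr; exact hA x
    calc ∫⁻ x, k x * ‖F x‖ₑ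
        ≤ ∫⁻ x, c * ((Φ 1)⁻¹ * A * Φ ((‖F x‖₊ / c : ℝ≥0) : ℝ≥0∞) + k x) := lintegral_mono h1
      _ = c * ((Φ 1)⁻¹ * A * (∫⁻ x, Φ ((‖F x‖₊ / c : ℝ≥0) : ℝ≥0∞)) + ∫⁻ x, k x) := by
          rw [lintegral_const_mul' _ _ ENNReal.coe_ne_top, lintegral_add_right _ hk,
            lintegral_const_mul' _ _ (ENNReal.mul_ne_top (ENNReal.inv_ne_top.2 hΦ0)
              ENNReal.coe_ne_top)]
      _ ≤ c * ((Φ 1)⁻¹ * A * 1 + B) := by gcongr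
      _ = _ := by rw [mul_one, mul_comm]
  by_cases h0 : (Φ 1)⁻¹ * A + B = 0
  · have hA0 : (A : ℝ≥0∞) = 0 := by
      have := (add_eq_zero.1 h0).1
      rcases mul_eq_zero.1 this with h | h
      · exact absurd (ENNReal.inv_eq_zero.1 h) hΦ1
      · exact h
    have : ∀ x, k x = 0 := fun x => le_antisymm (hA0 ▸ hA x) zero_le
    simp [this]
  have ht : (Φ 1)⁻¹ * A + B ≠ ∞ := ENNReal.add_ne_top.2
    ⟨ENNReal.mul_ne_top (ENNReal.inv_ne_top.2 hΦ0) ENNReal.coe_ne_top, ENNReal.coe_ne_top⟩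
  unfold luxNorm
  rw [ENNReal.mul_iInf_of_ne h0 ht]
  refine le_iInf fun c => ?_
  by_cases hc : c ∈ luxSet Φ F
  · simp only [hc, iInf_pos]
    exact key c hc
  · simp only [hc, iInf_false]
    rw [ENNReal.mul_top h0]
    exact le_top

end
end

noncomputable section

section

variable {ι : Type} [Fintype ι]

/-! ### Functionals given by functions on phase space -/

/-- `u ∈ Σ₁'` is the superposition of time-frequency shifts with coefficients `F`. -/
def IsSynthesis (u : GSDual ι) (F : RR ι × RR ι → ℂ) : Prop :=
  ∀ ψ : GS ι, u ψ = ∫ z, F z * stft ψ.toDual (z.1, -z.2)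

theorem isSynthesis_stft (u : GSDual ι) : IsSynthesis u (stft u) := dual_inversion u

theorem IsSynthesis.stft_eq {u : GSDual ι} {F : RR ι × RR ι → ℂ} (h : IsSynthesis u F)
    (w : RR ι × RR ι) :
    stft u w = ftc ι * ∫ z, F z * stft (gaborAtom w.1 w.2).toDual (z.1, -z.2) := by
  rw [_root_.stft_eq, h]

theorem integrable_mul_stft_flip {F : RR ι × RR ι → ℂ} (hF : AEStronglyMeasurable F) {K R : ℝ}
    (hb : ∀ z, ‖F z‖ ≤ K * expw R z) (ψ : GS ι) :
    Integrable fun z => F z * stft ψ.toDual (z.1, -z.2) := by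
  have hc : Continuous fun z : RR ι × RR ι => stft ψ.toDual (z.1, -z.2) :=
    (continuous_stft_toDual ψ).comp (by fun_prop)
  obtain ⟨h, C, hC, H⟩ := stft_decay' (ι := ι) (|R| + 1) (by positivity)
  have hp : 0 ≤ gsSeminorm ι h ψ := apply_nonneg _ _
  refine ((integrable_expw (by norm_num : (-1 : ℝ) < 0)).const_mul
    (K * (C * gsSeminorm ι h ψ))).mono' (hF.mul hc.aestronglyMeasurable)
    (Eventually.of_forall fun z => ?_)
  have hK : 0 ≤ K := nonneg_of_mul_nonneg_left ((norm_nonneg _).trans (hb z)) (expw_pos R z)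
  have h1 := H ψ (z.1, -z.2)
  rw [expw_neg_arg] at h1
  rw [norm_mul]
  calc _ ≤ (K * expw |R| z) * (C * gsSeminorm ι h ψ * expw (-(|R| + 1)) z) :=
        mul_le_mul ((hb z).trans (mul_le_mul_of_nonneg_left (expw_mono (le_abs_self R) z) hK)) h1
          (norm_nonneg _) (mul_nonneg hK (expw_pos _ _).le)
    _ = K * (C * gsSeminorm ι h ψ) * (expw |R| z * expw (-(|R| + 1)) z) := by ring
    _ = _ := by rw [← expw_add]; ring_nf

theorem exists_isSynthesis {F : RR ι × RR ι → ℂ} (hF : AEStronglyMeasurable F) {K R : ℝ}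
    (hb : ∀ z, ‖F z‖ ≤ K * expw R z) : ∃ u : GSDual ι, IsSynthesis u F := by
  obtain ⟨h, C, hC, H⟩ := stft_decay' (ι := ι) (|R| + 1) (by positivity)
  let L : GS ι →ₗ[ℂ] ℂ :=
    { toFun := fun ψ => ∫ z, F z * stft ψ.toDual (z.1, -z.2)
      map_add' := fun f g => by
        rw [← integral_add (integrable_mul_stft_flip hF hb f) (integrable_mul_stft_flip hF hb g)]
        refine integral_congr_ae (Eventually.of_forall fun z => ?_)
        simp only [GS.toDual_add, stft_add, Pi.add_apply, mul_add]
      map_smul' := fun c f => by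
        rw [RingHom.id_apply, smul_eq_mul, ← integral_const_mul]
        refine integral_congr_ae (Eventually.of_forall fun z => ?_)
        simp only [GS.toDual_smul, stft_smul, Pi.smul_apply, smul_eq_mul]
        ring }
  have hK : 0 ≤ K := nonneg_of_mul_nonneg_left ((norm_nonneg _).trans (hb 0)) (expw_pos R 0)
  have hI : 0 ≤ ∫ z : RR ι × RR ι, expw (-1) z := integral_nonneg fun z => (expw_pos _ _).le
  refine ⟨⟨L, ?_⟩, fun ψ => rfl⟩
  refine (gs_withSeminorms ι).continuous_normedSpace_rng _ L
    ⟨{h}, ⟨K * C * ∫ z : RR ι × RR ι, expw (-1) z, by positivity⟩, fun ψ => ?_⟩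
  simp only [Finset.sup_singleton, Seminorm.comp_apply, coe_normSeminorm]
  change ‖∫ z, F z * stft ψ.toDual (z.1, -z.2)‖ ≤ (K * C * ∫ z : RR ι × RR ι, expw (-1) z) *
    gsSeminorm ι h ψ
  rw [mul_right_comm, ← integral_const_mul]
  refine norm_integral_le_of_norm_le ((integrable_expw (by norm_num)).const_mul _)
    (Eventually.of_forall fun z => ?_)
  have hp : 0 ≤ gsSeminorm ι h ψ := apply_nonneg _ _
  have h1 := H ψ (z.1, -z.2)
  rw [expw_neg_arg] at h1
  rw [norm_mul]
  calc _ ≤ (K * expw |R| z) * (C * gsSeminorm ι h ψ * expw (-(|R| + 1)) z) :=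
        mul_le_mul ((hb z).trans (mul_le_mul_of_nonneg_left (expw_mono (le_abs_self R) z) hK)) h1
          (norm_nonneg _) (mul_nonneg hK (expw_pos _ _).le)
    _ = K * C * gsSeminorm ι h ψ * (expw |R| z * expw (-(|R| + 1)) z) := by ring
    _ = _ := by rw [← expw_add]; ring_nf

theorem exists_gs_isSynthesis {F : RR ι × RR ι → ℂ} (hF : AEStronglyMeasurable F)
    (hdec : ∀ R : ℝ, Integrable fun z => ‖F z‖ * expw R z) :
    ∃ g : GS ι, IsSynthesis g.toDual F := by
  have hf : (ftc ι : ℂ) ≠ 0 := by exact_mod_cast ftc_pos.ne'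
  obtain ⟨g, hg, -⟩ := exists_synthesis hF hdec
  refine ⟨(ftc ι : ℂ) • g, fun ψ => ?_⟩
  have h1 : g.toDual ψ = ψ.toDual g := by
    change ∫ y, g y * ψ y = ∫ y, ψ y * g y
    simp only [mul_comm]
  rw [GS.toDual_smul, smul_apply, h1, dual_synthesis ψ.toDual hF hdec g hg,
    smul_eq_mul]
  push_cast
  field_simp

/-- Truncations of the short-time Fourier transform give elements of `Σ₁`. -/
theorem exists_gs_truncation (u : GSDual ι) (n : ℕ) :
    ∃ g : GS ι, IsSynthesis g.toDual ((Metric.closedBall 0 n).indicator (stft u)) := by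
  have hm : Measurable ((Metric.closedBall 0 n).indicator (stft u)) :=
    (continuous_stft u).measurable.indicator Metric.isClosed_closedBall.measurableSet
  refine exists_gs_isSynthesis hm.aestronglyMeasurable fun R => ?_
  have hc : Continuous fun z => ‖stft u z‖ * expw R z :=
    (continuous_stft u).norm.mul (continuous_expw R)
  have h1 := (hc.continuousOn (s := Metric.closedBall 0 n)).integrableOn_compact
    (μ := volume) (isCompact_closedBall 0 (n : ℝ))
  rw [← integrable_indicator_iff Metric.isClosed_closedBall.measurableSet] at h1
  refine h1.congr (Eventually.of_forall fun z => ?_)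
  by_cases hz : z ∈ Metric.closedBall (0 : RR ι × RR ι) n <;> simp [hz]

/-! ### The reproducing kernel -/

/-- The kernel `|A(-x, ξ)| exp (r |x|) exp (r |ξ|)` with `A` the transform of the Gaussian. -/
def ambKer (r : ℝ) (t : RR ι × RR ι) : ℝ≥0∞ := ENNReal.ofReal (‖ambig (-t.1, t.2)‖ * expw r t)

theorem continuous_ambKer_aux (r : ℝ) :
    Continuous fun t : RR ι × RR ι => ‖ambig (-t.1, t.2)‖ * expw r t :=
  (continuous_ambig.comp (by fun_prop)).norm.mul (continuous_expw r)

theorem measurable_ambKer (r : ℝ) : Measurable (ambKer (ι := ι) r) :=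
  (continuous_ambKer_aux r).measurable.ennreal_ofReal

theorem exists_ambKer_le (r : ℝ) : ∃ A : ℝ≥0, ∀ t : RR ι × RR ι, ambKer r t ≤ A := by
  obtain ⟨C, hC, H⟩ := ambig_decay (ι := ι) r
  refine ⟨C.toNNReal, fun t => ENNReal.ofReal_le_ofReal ?_⟩
  have h1 := H (-t.1, t.2)
  have e : expw (-r) (-t.1, t.2) = expw (-r) t := by simp [expw]
  rw [e] at h1
  calc _ ≤ C * expw (-r) t * expw r t := mul_le_mul_of_nonneg_right h1 (expw_pos _ _).le
    _ = C := by rw [mul_assoc, mul_comm (expw (-r) t), expw_mul_neg, mul_one]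

theorem exists_lintegral_ambKer_le (r : ℝ) :
    ∃ B : ℝ≥0, ∫⁻ t : RR ι × RR ι, ambKer r t ≤ B := by
  let e : (RR ι × RR ι) ≃ᵐ (RR ι × RR ι) :=
    (MeasurableEquiv.neg (RR ι)).prodCongr (MeasurableEquiv.refl (RR ι))
  have he : MeasurePreserving e volume volume :=
    (Measure.measurePreserving_neg volume).prod (MeasurePreserving.id volume)
  have h1 : Integrable fun t : RR ι × RR ι => ‖ambig (-t.1, t.2)‖ * expw r t := by
    have := (he.integrable_comp_emb e.measurableEmbedding).2 (integrable_ambig_mul_expw (ι := ι) r)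
    refine this.congr (Eventually.of_forall fun t => ?_)
    change ‖ambig (-t.1, t.2)‖ * expw r (-t.1, t.2) = ‖ambig (-t.1, t.2)‖ * expw r t
    simp [expw]
  refine ⟨(∫⁻ t : RR ι × RR ι, ambKer r t).toNNReal, ?_⟩
  rw [ENNReal.coe_toNNReal]
  exact h1.lintegral_lt_top.ne

theorem enorm_pairing_mul_weight_le {ω : Weight (RR ι × RR ι)} {r C : ℝ} (h : ω.IsModerate r C)
    (F : RR ι × RR ι → ℂ) (w : RR ι × RR ι) :
    ‖(∫ z, F z * stft (gaborAtom w.1 w.2).toDual (z.1, -z.2)) * (ω w : ℂ)‖ₑ ≤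
      ∫⁻ z, ENNReal.ofReal C * ambKer r (w - z) * ‖F z * (ω z : ℂ)‖ₑ := by
  rw [← integral_mul_const]
  refine (enorm_integral_le_lintegral_enorm _).trans (lintegral_mono fun z => ?_)
  rw [ambKer, ← ENNReal.ofReal_mul h.2.1.le, ← ofReal_norm, ← ofReal_norm,
    ← ENNReal.ofReal_mul (mul_nonneg h.2.1.le (mul_nonneg (norm_nonneg _) (expw_pos _ _).le))]
  refine ENNReal.ofReal_le_ofReal ?_
  rw [norm_mul, norm_mul, norm_stft_gaborAtom, norm_mul, Complex.norm_real, Complex.norm_real,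
    Real.norm_of_nonneg (ω.pos' _).le, Real.norm_of_nonneg (ω.pos' _).le]
  have e : ambig (z.1 - w.1, w.2 + -z.2) = ambig (-(w - z).1, (w - z).2) := by
    simp [sub_eq_add_neg]
  simp only [e]
  have hω := h.le_sub w z
  calc _ ≤ ‖F z‖ * ‖ambig (-(w - z).1, (w - z).2)‖ * (C * ω z * expw r (w - z)) := by gcongr
    _ = _ := by ring

instance : (volume : Measure (RR ι × RR ι)).IsAddHaarMeasure :=
  inferInstanceAs (((volume : Measure (RR ι)).prod (volume : Measure (RR ι))).IsAddHaarMeasure)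

instance : (volume : Measure (RR ι × RR ι)).IsNegInvariant :=
  Measure.IsAddHaarMeasure.isNegInvariant_of_regular _

theorem lintegral_ambKer_sub_left (r : ℝ) (w : RR ι × RR ι) :
    ∫⁻ z, ambKer r (w - z) = ∫⁻ t : RR ι × RR ι, ambKer r t :=
  lintegral_sub_left_eq_self (ambKer r) w

theorem lintegral_ambKer_sub_right (r : ℝ) (w : RR ι × RR ι) :
    ∫⁻ z, ambKer r (z - w) = ∫⁻ t : RR ι × RR ι, ambKer r t :=
  lintegral_sub_right_eq_self (ambKer r) w

theorem measurable_mul_weight {F : RR ι × RR ι → ℂ} (hF : Measurable F)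
    (ω : Weight (RR ι × RR ι)) : Measurable fun z => F z * (ω z : ℂ) :=
  hF.mul (Complex.measurable_ofReal.comp ω.measurable')

theorem IsSynthesis.enorm_stft_mul_weight_le {ω : Weight (RR ι × RR ι)} {r C : ℝ}
    (h : ω.IsModerate r C) {u : GSDual ι} {F : RR ι × RR ι → ℂ} (hu : IsSynthesis u F)
    (w : RR ι × RR ι) : ‖stft u w * (ω w : ℂ)‖ₑ ≤
      ∫⁻ z, ENNReal.ofReal (ftc ι * C) * ambKer r (w - z) * ‖F z * (ω z : ℂ)‖ₑ := by
  rw [hu.stft_eq, mul_assoc, enorm_mul, ENNReal.ofReal_mul ftc_pos.le]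
  simp only [mul_assoc]
  rw [lintegral_const_mul' _ _ ENNReal.ofReal_ne_top, ← ofReal_norm, Complex.norm_real,
    Real.norm_of_nonneg ftc_pos.le]
  refine mul_le_mul_right ?_ _
  refine (enorm_pairing_mul_weight_le h F w).trans (le_of_eq ?_)
  simp only [mul_assoc]

/-- Superpositions with coefficients in `L^Φ_{(ω)}` belong to `M^Φ_{(ω)}`. -/
theorem exists_normOrlicz_synthesis_le {ω : Weight (RR ι × RR ι)} {r C : ℝ}
    (h : ω.IsModerate r C) : ∃ M : ℝ≥0, 0 < M ∧ ∀ (Φ : YoungFunction) (u : GSDual ι)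
      (F : RR ι × RR ι → ℂ), Φ.upperExp < ∞ → Measurable F → IsSynthesis u F →
      normOrlicz Φ ω (stft u) ≤ M * normOrlicz Φ ω F := by
  obtain ⟨B, hB⟩ := exists_lintegral_ambKer_le (ι := ι) r
  refine ⟨(ftc ι * C).toNNReal * B + 1, by positivity, fun Φ u F hp hF hu => ?_⟩
  have hle : ∀ x : ℝ≥0∞, x ≤ B → ENNReal.ofReal (ftc ι * C) * x ≤
      (((ftc ι * C).toNNReal * B + 1 : ℝ≥0) : ℝ≥0∞) := fun x hx => by
    push_cast
    refine (mul_le_mul_right hx _).trans le_self_add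
  refine luxNorm_le_of_kernel hp
    (k := fun w z => ENNReal.ofReal (ftc ι * C) * ambKer r (w - z)) ?_ (by positivity) ?_ ?_
    (measurable_mul_weight hF ω) (hu.enorm_stft_mul_weight_le h)
  · exact ((measurable_ambKer r).comp (measurable_fst.sub measurable_snd)).const_mul _
  · intro w
    rw [lintegral_const_mul' _ _ ENNReal.ofReal_ne_top, lintegral_ambKer_sub_left]
    exact hle _ hB
  · intro w
    rw [lintegral_const_mul' _ _ ENNReal.ofReal_ne_top, lintegral_ambKer_sub_right]
    exact hle _ hB

/-- `M^Φ_{(ω)} ⊆ M^∞_{(ω)}`. -/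
theorem exists_enorm_stft_le_normOrlicz {ω : Weight (RR ι × RR ι)} {r C : ℝ}
    (h : ω.IsModerate r C) {Φ : YoungFunction} (hp : Φ.upperExp < ∞) : ∃ M : ℝ≥0,
      ∀ (u : GSDual ι) (w : RR ι × RR ι),
      ‖stft u w * (ω w : ℂ)‖ₑ ≤ M * normOrlicz Φ ω (stft u) := by
  obtain ⟨A, hA⟩ := exists_ambKer_le (ι := ι) r
  obtain ⟨B, hB⟩ := exists_lintegral_ambKer_le (ι := ι) r
  have hΦ0 : Φ 1 ≠ 0 := by simpa using YoungFunction.ne_zero_of_upperExp hp one_pos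
  refine ⟨(ENNReal.ofReal (ftc ι * C) * ((Φ 1)⁻¹ * A + B)).toNNReal, fun u w => ?_⟩
  rw [ENNReal.coe_toNNReal (ENNReal.mul_ne_top ENNReal.ofReal_ne_top (ENNReal.add_ne_top.2
    ⟨ENNReal.mul_ne_top (ENNReal.inv_ne_top.2 hΦ0) ENNReal.coe_ne_top, ENNReal.coe_ne_top⟩))]
  refine ((isSynthesis_stft u).enorm_stft_mul_weight_le h w).trans ?_
  simp only [mul_assoc]
  rw [lintegral_const_mul' _ _ ENNReal.ofReal_ne_top]
  refine mul_le_mul_right ?_ _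
  refine lintegral_enorm_mul_le_of_luxNorm hp
    (measurable_mul_weight (continuous_stft u).measurable ω)
    ((measurable_ambKer r).comp (measurable_const.sub measurable_id)) (fun z => hA _) ?_
  exact (lintegral_ambKer_sub_left r w).le.trans hB

theorem IsSynthesis.sub {u v : GSDual ι} {F G : RR ι × RR ι → ℂ} (hu : IsSynthesis u F)
    (hv : IsSynthesis v G)
    (hF : ∀ ψ : GS ι, Integrable fun z => F z * stft ψ.toDual (z.1, -z.2))
    (hG : ∀ ψ : GS ι, Integrable fun z => G z * stft ψ.toDual (z.1, -z.2)) :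
    IsSynthesis (u - v) (F - G) := by
  intro ψ
  rw [sub_apply, hu, hv, ← integral_sub (hF ψ) (hG ψ)]
  simp only [Pi.sub_apply, sub_mul]

theorem integrable_indicator_stft_mul (u : GSDual ι) {s : Set (RR ι × RR ι)}
    (hs : MeasurableSet s) (ψ : GS ι) :
    Integrable fun z => s.indicator (stft u) z * stft ψ.toDual (z.1, -z.2) := by
  obtain ⟨R, K, hR, hK, H⟩ := norm_stft_le_expw u
  refine integrable_mul_stft_flip ((continuous_stft u).measurable.indicator hs).aestronglyMeasurable
    (K := K) (R := R) (fun z => ?_) ψ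
  by_cases hz : z ∈ s
  · simpa [hz] using H z
  · simpa [hz] using mul_nonneg hK (expw_pos _ _).le

/-- `Σ₁` is dense in `M^Φ_{(ω)}`. -/
theorem exists_gs_normOrlicz_sub_le {ω : Weight (RR ι × RR ι)} {r C : ℝ}
    (h : ω.IsModerate r C) {Φ : YoungFunction} (hp : Φ.upperExp < ∞) (u : GSDual ι)
    (hu : normOrlicz Φ ω (stft u) < ∞) {ε : ℝ≥0} (hε : 0 < ε) :
    ∃ g : GS ι, normOrlicz Φ ω (stft (u - g.toDual)) ≤ ε := by
  obtain ⟨M, hM, H⟩ := exists_normOrlicz_synthesis_le h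
  obtain ⟨j, hj⟩ := exists_luxNorm_indicator_le hp
    (measurable_mul_weight (continuous_stft u).measurable ω) hu
    (s := fun n : ℕ => (Metric.closedBall (0 : RR ι × RR ι) n)ᶜ)
    (fun n => Metric.isClosed_closedBall.measurableSet.compl) (fun z => by
      filter_upwards [eventually_ge_atTop ⌈‖z‖⌉₊] with n hn
      simpa using (Nat.le_ceil ‖z‖).trans (by exact_mod_cast hn)) (ε := ε / M) (by positivity)
  obtain ⟨g, hg⟩ := exists_gs_truncation u j
  refine ⟨g, ?_⟩
  have hms : MeasurableSet (Metric.closedBall (0 : RR ι × RR ι) j) :=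
    Metric.isClosed_closedBall.measurableSet
  have hsub := (isSynthesis_stft u).sub hg (fun ψ => by
    simpa using integrable_indicator_stft_mul u MeasurableSet.univ ψ)
    (integrable_indicator_stft_mul u hms)
  have hm : Measurable (stft u - (Metric.closedBall 0 j).indicator (stft u)) :=
    (continuous_stft u).measurable.sub ((continuous_stft u).measurable.indicator hms)
  refine (H Φ _ _ hp hm hsub).trans ?_
  have e : (fun z => (stft u - (Metric.closedBall 0 (j : ℝ)).indicator (stft u)) z * (ω z : ℂ)) =
      ((Metric.closedBall (0 : RR ι × RR ι) (j : ℝ))ᶜ).indicator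
        fun z => stft u z * (ω z : ℂ) := by
    funext z
    by_cases hz : z ∈ Metric.closedBall (0 : RR ι × RR ι) (j : ℝ) <;> simp [hz]
  rw [normOrlicz, e]
  calc _ ≤ (M : ℝ≥0∞) * ((ε / M : ℝ≥0) : ℝ≥0∞) := by gcongr
    _ = ε := by rw [← ENNReal.coe_mul, mul_div_cancel₀ _ hM.ne']

/-- The truncations of `u` are narrowly bounded. -/
theorem exists_profile_truncation {ω : Weight (RR ι × RR ι)} {r C : ℝ}
    (h : ω.IsModerate r C) (u : GSDual ι) (hu : normInf1 ω (stft u) < ∞) :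
    ∃ G : RR ι → ℝ≥0∞, Measurable G ∧ ∫⁻ ξ, G ξ < ∞ ∧ ∀ (n : ℕ) (g : GS ι),
      IsSynthesis g.toDual ((Metric.closedBall 0 n).indicator (stft u)) →
      ∀ ξ, supProfile ω (stft g.toDual) ξ ≤ G ξ := by
  obtain ⟨B, hB⟩ := exists_lintegral_ambKer_le (ι := ι) r
  have hmp := measurable_supProfile ω (continuous_stft u).measurable
  set P : RR ι → ℝ≥0∞ := supProfile ω (stft u) with hP
  set c : ℝ≥0∞ := ENNReal.ofReal (ftc ι * C) * ENNReal.ofReal C with hc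
  have hct : c ≠ ∞ := ENNReal.mul_ne_top ENNReal.ofReal_ne_top ENNReal.ofReal_ne_top
  have hmeas : Measurable fun q : RR ι × RR ι × RR ι =>
      ambKer r (q.2.1, q.1 - q.2.2) * P q.2.2 :=
    ((measurable_ambKer r).comp (by fun_prop)).mul (hmp.comp (by fun_prop))
  refine ⟨fun ξ => c * ∫⁻ z : RR ι × RR ι, ambKer r (z.1, ξ - z.2) * P z.2, ?_, ?_, ?_⟩
  · exact (hmeas.lintegral_prod_right').const_mul c
  · rw [lintegral_const_mul' _ _ hct, lintegral_lintegral_swap hmeas.aemeasurable]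
    refine ENNReal.mul_lt_top hct.lt_top ?_
    have hK2 : Measurable fun ξ => ∫⁻ x, ambKer r ((x, ξ) : RR ι × RR ι) :=
      (measurable_ambKer r).lintegral_prod_left'
    calc ∫⁻ z : RR ι × RR ι, ∫⁻ ξ, ambKer r (z.1, ξ - z.2) * P z.2
        = ∫⁻ z : RR ι × RR ι, (∫⁻ ξ, ambKer r (z.1, ξ)) * P z.2 := by
          refine lintegral_congr fun z => ?_
          have hmz : Measurable fun ξ => ambKer r (z.1, ξ - z.2) :=
            (measurable_ambKer r).comp (by fun_prop)
          rw [lintegral_mul_const _ hmz,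
            lintegral_sub_right_eq_self (fun ξ => ambKer r (z.1, ξ))]
      _ = (∫⁻ x, ∫⁻ ξ, ambKer r (x, ξ)) * ∫⁻ ξ, P ξ :=
          lintegral_prod_mul (measurable_ambKer r).lintegral_prod_right'.aemeasurable
            hmp.aemeasurable
      _ < ∞ := by
          refine ENNReal.mul_lt_top ?_ hu
          rw [← lintegral_prod _ (measurable_ambKer r).aemeasurable]
          exact hB.trans_lt ENNReal.coe_lt_top
  · intro n g hg ξ
    refine (eLpNorm_exponent_top (f := fun x => stft g.toDual (x, ξ) * (ω (x, ξ) : ℂ))).le.trans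
      (essSup_le_of_ae_le _ (Eventually.of_forall fun x => ?_))
    refine (hg.enorm_stft_mul_weight_le h (x, ξ)).trans ?_
    have h1 : ∀ z : RR ι × RR ι, ‖(Metric.closedBall 0 (n : ℝ)).indicator (stft u) z *
        (ω z : ℂ)‖ₑ ≤ ENNReal.ofReal C * P z.2 := by
      intro z
      refine le_trans ?_ (stft_mul_weight_le_supProfile h u z.1 z.2)
      rw [← ofReal_norm, norm_mul, Complex.norm_real, Real.norm_of_nonneg (ω.pos' z).le]
      refine ENNReal.ofReal_le_ofReal (mul_le_mul_of_nonneg_right ?_ (ω.pos' z).le)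
      exact norm_indicator_le_norm_self _ _
    calc _ ≤ ∫⁻ z, ENNReal.ofReal (ftc ι * C) * ambKer r ((x, ξ) - z) *
          (ENNReal.ofReal C * P z.2) := lintegral_mono fun z => by gcongr; exact h1 z
      _ = c * ∫⁻ z : RR ι × RR ι, ambKer r ((x, ξ) - z) * P z.2 := by
          rw [← lintegral_const_mul' _ _ hct]
          refine lintegral_congr fun z => ?_
          rw [hc]; ring
      _ = _ := by
          congr 1
          let e : (RR ι × RR ι) ≃ᵐ (RR ι × RR ι) :=
            (MeasurableEquiv.subLeft x).prodCongr (MeasurableEquiv.refl (RR ι))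
          have he : MeasurePreserving e volume volume :=
            (Measure.measurePreserving_sub_left volume x).prod (MeasurePreserving.id volume)
          rw [← he.lintegral_comp_emb e.measurableEmbedding]
          refine lintegral_congr fun z => ?_
          change ambKer r (x - (x - z.1), ξ - z.2) * P z.2 = _
          rw [sub_sub_cancel]

/-! ### `Σ₁` is contained in the modulation spaces -/

theorem norm_stft_mul_weight_le {ω : Weight (RR ι × RR ι)} {r C : ℝ} (h : ω.IsModerate r C)
    (f : GS ι) : ∃ K : ℝ, 0 < K ∧ ∀ z, ‖stft f.toDual z * (ω z : ℂ)‖ ≤ K * expw (-1) z := by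
  obtain ⟨p, A, hA, H⟩ := stft_decay' (ι := ι) (r + 1) (by linarith [h.1])
  have hp : 0 ≤ gsSeminorm ι p f := apply_nonneg _ _
  have hω := ω.pos' 0
  refine ⟨A * gsSeminorm ι p f * (C * ω 0) + 1, by have := h.2.1; positivity, fun z => ?_⟩
  have h1 := h.2.2 0 z
  rw [zero_add] at h1
  rw [norm_mul, Complex.norm_real, Real.norm_of_nonneg (ω.pos' _).le]
  have hC := h.2.1
  calc _ ≤ (A * gsSeminorm ι p f * expw (-(r + 1)) z) * (C * ω 0 * expw r z) :=
        mul_le_mul (H f z) h1 (ω.pos' z).le (mul_nonneg (by positivity) (expw_pos _ _).le)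
    _ = A * gsSeminorm ι p f * (C * ω 0) * (expw (-(r + 1)) z * expw r z) := by ring
    _ = A * gsSeminorm ι p f * (C * ω 0) * expw (-1) z := by rw [← expw_add]; ring_nf
    _ ≤ _ := mul_le_mul_of_nonneg_right (by linarith) (expw_pos _ _).le

theorem normInf1_toDual_lt_top {ω : Weight (RR ι × RR ι)} {r C : ℝ} (h : ω.IsModerate r C)
    (f : GS ι) : normInf1 ω (stft f.toDual) < ∞ := by
  obtain ⟨K, hK, H⟩ := norm_stft_mul_weight_le h f
  have h1 := (integrable_exp_neg_norm (ι := ι) (b := 1) one_pos).const_mul K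
  refine lt_of_le_of_lt (lintegral_mono fun ξ => ?_) h1.lintegral_lt_top
  refine (eLpNorm_exponent_top (f := fun x => stft f.toDual (x, ξ) * (ω (x, ξ) : ℂ))).le.trans
    (essSup_le_of_ae_le _ (Eventually.of_forall fun x => ?_))
  simp only
  rw [← ofReal_norm]
  refine ENNReal.ofReal_le_ofReal ((H (x, ξ)).trans ?_)
  refine mul_le_mul_of_nonneg_left ?_ hK.le
  unfold expw
  refine mul_le_of_le_one_left (Real.exp_pos _).le (Real.exp_le_one_iff.2 ?_)
  nlinarith [norm_nonneg x]

theorem YoungFunction.apply_mul_le (Φ : YoungFunction) {s : ℝ≥0} (hs : s ≤ 1) :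
    Φ s ≤ s * Φ 1 := by
  have h1 := Φ.convex' s (1 - s) 1 0 (add_tsub_cancel_of_le hs)
  simpa [Φ.map_zero'] using h1

theorem normOrlicz_toDual_lt_top {ω : Weight (RR ι × RR ι)} {r C : ℝ} (h : ω.IsModerate r C)
    {Φ : YoungFunction} (hp : Φ.upperExp < ∞) (f : GS ι) :
    normOrlicz Φ ω (stft f.toDual) < ∞ := by
  obtain ⟨K, hK, H⟩ := norm_stft_mul_weight_le h f
  have hΦ1 : Φ 1 ≠ ∞ := by simpa using YoungFunction.ne_top_of_upperExp hp 1
  have hI := (integrable_expw (ι := ι) (R := -1) (by norm_num)).lintegral_lt_top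
  set I : ℝ≥0∞ := ∫⁻ z : RR ι × RR ι, ENNReal.ofReal (expw (-1) z) with hIdef
  set L : ℝ≥0 := (Φ 1 * I).toNNReal + 1 with hL
  have hL1 : Φ 1 * I ≤ L := by
    rw [hL]; push_cast
    rw [ENNReal.coe_toNNReal (ENNReal.mul_ne_top hΦ1 hI.ne)]
    exact le_self_add
  have hLp : 0 < L := by positivity
  have hL1' : 1 ≤ L := le_add_self
  refine lt_of_le_of_lt (iInf₂_le (K.toNNReal * L) ⟨mul_pos (Real.toNNReal_pos.2 hK) hLp, ?_⟩)
    ENNReal.coe_lt_top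
  have hle : ∀ z : RR ι × RR ι, Φ ((‖stft f.toDual z * (ω z : ℂ)‖₊ / (K.toNNReal * L) : ℝ≥0) :
      ℝ≥0∞) ≤ ((L⁻¹ : ℝ≥0) : ℝ≥0∞) * Φ 1 * ENNReal.ofReal (expw (-1) z) := by
    intro z
    have h1 : ‖stft f.toDual z * (ω z : ℂ)‖₊ / (K.toNNReal * L) ≤
        (expw (-1) z).toNNReal * L⁻¹ := by
      rw [div_le_iff₀ (mul_pos (Real.toNNReal_pos.2 hK) hLp)]
      have e : (expw (-1) z).toNNReal * L⁻¹ * (K.toNNReal * L) =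
          K.toNNReal * (expw (-1) z).toNNReal := by field_simp
      rw [e, ← NNReal.coe_le_coe]
      push_cast
      rw [Real.coe_toNNReal _ hK.le, Real.coe_toNNReal _ (expw_pos _ _).le]
      exact H z
    have h2 : (expw (-1) z).toNNReal ≤ 1 := by
      rw [Real.toNNReal_le_one]
      have := expw_mono (show (-1 : ℝ) ≤ 0 by norm_num) z
      simpa [expw] using this
    have h3 : (expw (-1) z).toNNReal * L⁻¹ ≤ 1 :=
      mul_le_one₀ h2 zero_le (inv_le_one_of_one_le₀ hL1')
    refine ((Φ.mono h1).trans (Φ.apply_mul_le h3)).trans (le_of_eq ?_)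
    rw [ENNReal.coe_mul]
    change ENNReal.ofReal (expw (-1) z) * _ * _ = _
    ring
  refine (lintegral_mono hle).trans ?_
  rw [lintegral_const_mul' _ _ (ENNReal.mul_ne_top ENNReal.coe_ne_top hΦ1), ← hIdef, mul_assoc]
  calc _ ≤ ((L⁻¹ : ℝ≥0) : ℝ≥0∞) * (L : ℝ≥0∞) := by gcongr
    _ = 1 := by rw [← ENNReal.coe_mul, inv_mul_cancel₀ hLp.ne', ENNReal.coe_one]

end
end

noncomputable section

section

variable {ι : Type} [Fintype ι]

/-! ### Entire windows and shifts of the contour of integration -/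

theorem differentiable_integral_of_bound {F : RR ι → ℂ → ℂ}
    (hc : Continuous (Function.uncurry F)) (hd : ∀ Z, Differentiable ℂ (F Z))
    (hb : ∀ R : ℝ, ∃ B : RR ι → ℝ, Integrable B ∧ ∀ Z τ, ‖τ‖ ≤ R → ‖F Z τ‖ ≤ B Z) :
    Differentiable ℂ fun τ => ∫ Z, F Z τ := by
  intro τ₀
  obtain ⟨B, hB, H⟩ := hb (‖τ₀‖ + 2)
  have hm : ∀ τ, AEStronglyMeasurable (fun Z => F Z τ) := fun τ =>
    (hc.comp (by fun_prop : Continuous fun Z : RR ι => (Z, τ))).aestronglyMeasurable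
  have hder := hasDerivAt_integral_of_dominated_loc_of_deriv_le (μ := (volume : Measure (RR ι)))
    (F := fun τ Z => F Z τ) (F' := fun τ Z => deriv (F Z) τ) (bound := B)
    (Metric.ball_mem_nhds τ₀ one_pos) (Eventually.of_forall hm)
    (hB.mono' (hm τ₀) (Eventually.of_forall fun Z => H Z τ₀ (by linarith)))
    ((measurable_deriv_with_param hc).comp
      (measurable_id.prodMk measurable_const)).aestronglyMeasurable
    (Eventually.of_forall fun Z τ hτ => ?_) hB
    (Eventually.of_forall fun Z τ _ => (hd Z τ).hasDerivAt)
  · exact hder.2.differentiableAt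
  · have := Complex.norm_deriv_le_of_forall_mem_sphere_norm_le (f := F Z) (c := τ) (R := 1)
      (C := B Z) one_pos (hd Z).diffContOnCl (fun z hz => H Z z ?_)
    · simpa using this
    · have h1 : ‖τ - τ₀‖ < 1 := by simpa [dist_eq_norm] using hτ
      have h2 : ‖z - τ‖ = 1 := by simpa [dist_eq_norm] using hz
      have : z = τ₀ + (τ - τ₀) + (z - τ) := by ring
      rw [this]
      refine (norm_add₃_le).trans ?_
      linarith

/-- The point `Z + τ W` of `ℂ^n`. -/
def cpt (Z : RR ι) (τ : ℂ) (W : RR ι) : ι → ℂ := fun i => (Z i : ℂ) + τ * (W i : ℂ)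

/-- The point `Z` of `ℝ^n` as a point of `ℂ^n`. -/
def rpt (Z : RR ι) : ι → ℂ := fun i => (Z i : ℂ)

theorem cpt_zero (Z : RR ι) (τ : ℂ) : cpt Z τ 0 = rpt Z := by
  funext i; simp [cpt, rpt]

theorem cpt_ofReal (Z W : RR ι) (t : ℝ) : cpt Z t W = rpt (Z + t • W) := by
  funext i; simp [cpt, rpt]

theorem cpt_eq (Z W : RR ι) (τ : ℂ) :
    cpt Z τ W = cpt (Z + τ.re • W) Complex.I (τ.im • W) := by
  funext i
  simp only [cpt, PiLp.add_apply, PiLp.smul_apply, smul_eq_mul]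
  push_cast
  conv_lhs => rw [← Complex.re_add_im τ]
  ring

theorem continuous_rpt : Continuous (rpt : RR ι → ι → ℂ) := by
  unfold rpt; fun_prop

/-- Entire functions on `ℂ^n` that decay faster than all exponentials in the real directions, and
are bounded by `wS` on the strip `|Im z| ≤ ρ`. -/
structure EntireWindow (ρ : ℝ) (w : (ι → ℂ) → ℂ) (wS : RR ι → ℝ) : Prop where
  diff : Differentiable ℂ w
  meas : Measurable wS
  bound : ∀ Z W : RR ι, ‖W‖ ≤ ρ → ‖w (cpt Z Complex.I W)‖ ≤ wS Z
  decay : ∀ R M : ℝ, ∃ C : ℝ, 0 ≤ C ∧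
    ∀ Z W : RR ι, ‖W‖ ≤ R → ‖w (cpt Z Complex.I W)‖ ≤ C * Real.exp (-M * ‖Z‖)

theorem EntireWindow.norm_ft_le {ρ : ℝ} (hρ : 0 ≤ ρ) {w : (ι → ℂ) → ℂ} {wS : RR ι → ℝ}
    (hw : EntireWindow ρ w wS) (Θ : RR ι) :
    ‖ft (fun Z => w (rpt Z)) Θ‖ₑ ≤
      ENNReal.ofReal (Real.exp (-ρ * ‖Θ‖)) * ∫⁻ Z, ENNReal.ofReal (wS Z) := by
  set W : RR ι := -(ρ * ‖Θ‖⁻¹) • Θ with hW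
  have hWn : ‖W‖ ≤ ρ := by
    rw [hW, norm_smul, Real.norm_eq_abs, abs_neg, abs_of_nonneg (by positivity), mul_assoc]
    refine mul_le_of_le_one_right hρ ?_
    rcases eq_or_ne ‖Θ‖ 0 with h | h
    · simp [h]
    · rw [inv_mul_cancel₀ h]
  have hWΘ : inner ℝ W Θ = -(ρ * ‖Θ‖) := by
    rw [hW, inner_smul_left, real_inner_self_eq_norm_sq]
    rcases eq_or_ne ‖Θ‖ 0 with h | h
    · simp [h]
    · simp; field_simp
  set F : RR ι → ℂ → ℂ := fun Z τ => w (cpt Z τ W) *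
    Complex.exp (-(Complex.I * ((inner ℝ Z Θ : ℝ) + τ * (inner ℝ W Θ : ℝ)))) with hF
  have hcp : Continuous fun q : RR ι × ℂ => cpt q.1 q.2 W := by unfold cpt; fun_prop
  have hFc : Continuous (Function.uncurry F) := by
    have := hw.diff.continuous.comp hcp
    refine Continuous.mul this ?_
    fun_prop
  have hFd : ∀ Z, Differentiable ℂ (F Z) := by
    intro Z
    have h1 : Differentiable ℂ fun τ : ℂ => cpt Z τ W := by
      rw [differentiable_pi]; intro i; unfold cpt; fun_prop
    have := hw.diff.comp h1
    refine Differentiable.mul this ?_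
    fun_prop
  have hFn : ∀ Z τ, ‖F Z τ‖ = ‖w (cpt Z τ W)‖ * Real.exp (τ.im * inner ℝ W Θ) := by
    intro Z τ
    simp only [hF, norm_mul, Complex.norm_exp]
    simp
  have hFb : ∀ R : ℝ, ∃ B : RR ι → ℝ, Integrable B ∧ ∀ Z τ, ‖τ‖ ≤ R → ‖F Z τ‖ ≤ B Z := by
    intro R
    obtain ⟨C, hC, H⟩ := hw.decay (R * ‖W‖) 1
    refine ⟨fun Z => C * Real.exp (R * ‖W‖) * Real.exp (R * |inner ℝ W Θ|) *
      Real.exp (-1 * ‖Z‖), (integrable_exp_neg_norm one_pos).const_mul _, fun Z τ hτ => ?_⟩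
    have h1 : |τ.re| ≤ R := (Complex.abs_re_le_norm τ).trans hτ
    have h2 : |τ.im| ≤ R := (Complex.abs_im_le_norm τ).trans hτ
    have h3 := H (Z + τ.re • W) (τ.im • W) (by
      rw [norm_smul]; exact mul_le_mul_of_nonneg_right h2 (norm_nonneg _))
    rw [← cpt_eq] at h3
    have h4 : ‖Z‖ - R * ‖W‖ ≤ ‖Z + τ.re • W‖ := by
      have := norm_sub_le (Z + τ.re • W) (τ.re • W)
      rw [add_sub_cancel_right, norm_smul] at this
      have := mul_le_mul_of_nonneg_right h1 (norm_nonneg W)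
      rw [Real.norm_eq_abs] at *
      linarith
    have h5 : τ.im * inner ℝ W Θ ≤ R * |inner ℝ W Θ| := by
      refine (le_abs_self _).trans ?_
      rw [abs_mul]
      exact mul_le_mul_of_nonneg_right h2 (abs_nonneg _)
    rw [hFn]
    calc _ ≤ (C * Real.exp (-1 * ‖Z + τ.re • W‖)) * Real.exp (R * |inner ℝ W Θ|) := by gcongr
      _ ≤ (C * Real.exp (-1 * ‖Z‖ + R * ‖W‖)) * Real.exp (R * |inner ℝ W Θ|) := by
          gcongr; linarith
      _ = _ := by rw [Real.exp_add]; ring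
  have hg := differentiable_integral_of_bound hFc hFd hFb
  set g : ℂ → ℂ := fun τ => ∫ Z, F Z τ with hgdef
  have hreal : ∀ t : ℝ, g t = ft (fun Z => w (rpt Z)) Θ := by
    intro t
    rw [ft, ← integral_add_right_eq_self (fun Z => w (rpt Z) * ecis Z Θ) (t • W)]
    refine integral_congr_ae (Eventually.of_forall fun Z => ?_)
    simp only [hF, cpt_ofReal, ecis, inner_add_left, inner_smul_left]
    simp
  have hconst : g = fun _ => ft (fun Z => w (rpt Z)) Θ := by
    have ha : AnalyticOnNhd ℂ g Set.univ := fun z _ =>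
      (hg.differentiableOn (s := Set.univ)).analyticAt univ_mem
    refine ha.eq_of_frequently_eq (z₀ := 0) analyticOnNhd_const ?_
    have ht : Tendsto (fun n : ℕ => ((1 / ((n : ℝ) + 1) : ℝ) : ℂ)) atTop (𝓝[≠] 0) := by
      refine tendsto_nhdsWithin_iff.2 ⟨?_, Eventually.of_forall fun n => ?_⟩
      · exact (Complex.continuous_ofReal.tendsto' 0 0 Complex.ofReal_zero).comp
          tendsto_one_div_add_atTop_nhds_zero_nat
      · have : (0 : ℝ) < 1 / ((n : ℝ) + 1) := by positivity
        simpa using (by positivity : ((n : ℝ) + 1) ≠ 0) |> fun h => by exact_mod_cast h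
    exact ht.frequently (Frequently.of_forall fun n => hreal _)
  have hI : ft (fun Z => w (rpt Z)) Θ = ∫ Z, F Z Complex.I := by
    rw [← congrFun hconst Complex.I]
  rw [hI]
  refine (enorm_integral_le_lintegral_enorm _).trans ?_
  rw [← lintegral_const_mul' _ _ ENNReal.ofReal_ne_top]
  refine lintegral_mono fun Z => ?_
  rw [← ofReal_norm, hFn, ← ENNReal.ofReal_mul (Real.exp_pos _).le, Complex.I_im, one_mul, hWΘ,
    mul_comm, neg_mul]
  exact ENNReal.ofReal_le_ofReal (mul_le_mul_of_nonneg_left (hw.bound Z W hWn) (Real.exp_pos _).le)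

/-! ### Products of windows with quadratic forms and Gaussians -/

/-- The complexified Gaussian window. -/
def winC (z : ι → ℂ) : ℂ :=
  ((Real.pi ^ (-(Fintype.card ι : ℝ) / 4) : ℝ) : ℂ) * Complex.exp (-(∑ i, z i ^ 2) / 2)

theorem norm_exp_neg_sum_sq (c : ℝ) (Z W : RR ι) :
    ‖Complex.exp (-(c : ℂ) * ∑ i, cpt Z Complex.I W i ^ 2)‖ =
      Real.exp (-c * (‖Z‖ ^ 2 - ‖W‖ ^ 2)) := by
  rw [Complex.norm_exp]
  congr 1
  have e : (∑ i, cpt Z Complex.I W i ^ 2).re = ‖Z‖ ^ 2 - ‖W‖ ^ 2 := by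
    rw [EuclideanSpace.norm_sq_eq, EuclideanSpace.norm_sq_eq, ← Finset.sum_sub_distrib,
      Complex.re_sum]
    refine Finset.sum_congr rfl fun i _ => ?_
    simp [cpt, pow_two]
  rw [← e, ← Complex.ofReal_neg, Complex.re_ofReal_mul]

theorem winC_rpt (Z : RR ι) : winC (rpt Z) = (win Z : ℂ) := by
  simp only [winC, win, rpt, EuclideanSpace.norm_sq_eq, Real.norm_eq_abs, sq_abs]
  push_cast
  ring_nf

theorem norm_winC (Z W : RR ι) :
    ‖winC (cpt Z Complex.I W)‖ = win Z * Real.exp (‖W‖ ^ 2 / 2) := by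
  have h := norm_exp_neg_sum_sq (1 / 2) Z W
  rw [winC, norm_mul, Complex.norm_real, Real.norm_of_nonneg (by positivity), win, mul_assoc,
    ← Real.exp_add]
  congr 1
  convert h using 2
  · congr 1; push_cast; ring
  · ring

theorem differentiable_winC : Differentiable ℂ (winC : (ι → ℂ) → ℂ) := by
  unfold winC; fun_prop

/-- The quadratic form with coefficients `b`. -/
def quad (b : ι → ι → ℂ) (z : ι → ℂ) : ℂ := ∑ i, ∑ j, b i j * (z i * z j)

theorem differentiable_quad (b : ι → ι → ℂ) : Differentiable ℂ (quad b) := by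
  unfold quad; fun_prop

theorem norm_cpt_apply_le (Z W : RR ι) (i : ι) : ‖cpt Z Complex.I W i‖ ≤ ‖Z‖ + ‖W‖ := by
  refine (norm_add_le _ _).trans (add_le_add ?_ ?_)
  · simpa using PiLp.norm_apply_le Z i
  · simpa using PiLp.norm_apply_le W i

theorem norm_quad_le (b : ι → ι → ℂ) (Z W : RR ι) :
    ‖quad b (cpt Z Complex.I W)‖ ≤ (∑ i, ∑ j, ‖b i j‖) * (‖Z‖ + ‖W‖) ^ 2 := by
  unfold quad
  rw [Finset.sum_mul]
  refine (norm_sum_le _ _).trans (Finset.sum_le_sum fun i _ => ?_)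
  rw [Finset.sum_mul]
  refine (norm_sum_le _ _).trans (Finset.sum_le_sum fun j _ => ?_)
  rw [norm_mul, norm_mul, pow_two]
  gcongr <;> exact norm_cpt_apply_le Z W _

theorem sq_le_two_mul_exp {x : ℝ} (hx : 0 ≤ x) : x ^ 2 ≤ 2 * Real.exp x := by
  have := Real.pow_div_factorial_le_exp x hx 2
  simp at this
  linarith

theorem EntireWindow.mul_quad_win {ρ : ℝ} {w : (ι → ℂ) → ℂ} {wS : RR ι → ℝ}
    (hw : EntireWindow ρ w wS) (b : ι → ι → ℂ) {t : ℝ} (ht : t ∈ Set.Icc (0 : ℝ) 1) (Y : RR ι) :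
    EntireWindow ρ
      (fun z => w z * (((1 - t : ℝ) : ℂ) * quad b z * winC fun i => (t : ℂ) * z i - (Y i : ℂ)))
      (fun Z => wS Z * ((∑ i, ∑ j, ‖b i j‖) * (‖Z‖ + ρ) ^ 2 *
        (win (t • Z - Y) * Real.exp (ρ ^ 2 / 2)))) := by
  have hcpt : ∀ Z W : RR ι, (fun i => (t : ℂ) * cpt Z Complex.I W i - (Y i : ℂ)) =
      cpt (t • Z - Y) Complex.I (t • W) := by
    intro Z W; funext i
    simp [cpt]; ring
  have hb : 0 ≤ ∑ i, ∑ j, ‖b i j‖ := Finset.sum_nonneg fun i _ => Finset.sum_nonneg fun j _ =>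
    norm_nonneg _
  have htn : ‖((1 - t : ℝ) : ℂ)‖ ≤ 1 := by
    rw [Complex.norm_real, Real.norm_of_nonneg (by linarith [ht.2])]; linarith [ht.1]
  have key : ∀ (R : ℝ) (Z W : RR ι), ‖W‖ ≤ R → ‖((1 - t : ℝ) : ℂ) * quad b (cpt Z Complex.I W) *
      winC fun i => (t : ℂ) * cpt Z Complex.I W i - (Y i : ℂ)‖ ≤
      (∑ i, ∑ j, ‖b i j‖) * (‖Z‖ + R) ^ 2 * (win (t • Z - Y) * Real.exp (R ^ 2 / 2)) := by
    intro R Z W hW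
    have hR : 0 ≤ R := (norm_nonneg W).trans hW
    rw [hcpt, norm_mul, norm_mul, norm_winC, norm_smul, Real.norm_of_nonneg ht.1]
    have h1 : t * ‖W‖ ≤ R := (mul_le_of_le_one_left (norm_nonneg _) ht.2).trans hW
    have h2 : 0 ≤ t * ‖W‖ := mul_nonneg ht.1 (norm_nonneg _)
    have h3 := (win_pos (t • Z - Y)).le
    calc _ ≤ 1 * ((∑ i, ∑ j, ‖b i j‖) * (‖Z‖ + ‖W‖) ^ 2) *
          (win (t • Z - Y) * Real.exp ((t * ‖W‖) ^ 2 / 2)) := by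
          gcongr
          exact norm_quad_le b Z W
      _ ≤ _ := by rw [one_mul]; gcongr
  refine ⟨?_, ?_, ?_, ?_⟩
  · have h1 : Differentiable ℂ fun z : ι → ℂ => fun i => (t : ℂ) * z i - (Y i : ℂ) := by fun_prop
    have h2 : Differentiable ℂ fun z : ι → ℂ => winC fun i => (t : ℂ) * z i - (Y i : ℂ) :=
      Differentiable.comp (g := winC) differentiable_winC h1
    exact hw.diff.mul (((differentiable_const _).mul (differentiable_quad b)).mul h2)
  · refine hw.meas.mul (Continuous.measurable ?_)
    have : Continuous fun Z : RR ι => win (t • Z - Y) := continuous_win.comp (by fun_prop)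
    fun_prop
  · intro Z W hW
    rw [norm_mul]
    exact mul_le_mul (hw.bound Z W hW) (key ρ Z W hW) (norm_nonneg _)
      ((norm_nonneg _).trans (hw.bound Z W hW))
  · intro R M
    obtain ⟨C, hC, H⟩ := hw.decay |R| (M + 1)
    refine ⟨C * ((∑ i, ∑ j, ‖b i j‖) * (2 * Real.exp |R|) *
      (Real.pi ^ (-(Fintype.card ι : ℝ) / 4) * Real.exp (|R| ^ 2 / 2))), by positivity,
      fun Z W hW => ?_⟩
    have hW' := hW.trans (le_abs_self R)
    rw [norm_mul]
    have h1 : (‖Z‖ + |R|) ^ 2 ≤ 2 * Real.exp |R| * Real.exp ‖Z‖ := by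
      refine (sq_le_two_mul_exp (by positivity)).trans (le_of_eq ?_)
      rw [Real.exp_add]; ring
    calc _ ≤ (C * Real.exp (-(M + 1) * ‖Z‖)) * ((∑ i, ∑ j, ‖b i j‖) * (‖Z‖ + |R|) ^ 2 *
          (win (t • Z - Y) * Real.exp (|R| ^ 2 / 2))) :=
          mul_le_mul (H Z W hW') (key |R| Z W hW') (norm_nonneg _) (by positivity)
      _ ≤ (C * Real.exp (-(M + 1) * ‖Z‖)) * ((∑ i, ∑ j, ‖b i j‖) *
          (2 * Real.exp |R| * Real.exp ‖Z‖) *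
          (Real.pi ^ (-(Fintype.card ι : ℝ) / 4) * Real.exp (|R| ^ 2 / 2))) := by
          have := (win_pos (t • Z - Y)).le
          gcongr
          exact win_le _
      _ = C * ((∑ i, ∑ j, ‖b i j‖) * (2 * Real.exp |R|) *
          (Real.pi ^ (-(Fintype.card ι : ℝ) / 4) * Real.exp (|R| ^ 2 / 2))) *
          (Real.exp (-(M + 1) * ‖Z‖) * Real.exp ‖Z‖) := by ring
      _ = _ := by rw [← Real.exp_add]; ring_nf

theorem entireWindow_gauss (ρ : ℝ) {β : ℝ} (hβ : 0 < β) :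
    EntireWindow (ι := ι) ρ (fun z => Complex.exp (-(β : ℂ) * ∑ i, z i ^ 2))
      (fun Z => Real.exp (-β * (‖Z‖ ^ 2 - ρ ^ 2))) := by
  have key : ∀ (R : ℝ) (Z W : RR ι), ‖W‖ ≤ R →
      ‖Complex.exp (-(β : ℂ) * ∑ i, cpt Z Complex.I W i ^ 2)‖ ≤
        Real.exp (-β * (‖Z‖ ^ 2 - R ^ 2)) := by
    intro R Z W hW
    rw [norm_exp_neg_sum_sq]
    apply Real.exp_le_exp.2
    have : ‖W‖ ^ 2 ≤ R ^ 2 := by gcongr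
    nlinarith
  refine ⟨by fun_prop, Continuous.measurable (by fun_prop), fun Z W hW => key ρ Z W hW, ?_⟩
  intro R M
  refine ⟨Real.exp (β * R ^ 2 + M ^ 2 / (4 * β)), (Real.exp_pos _).le, fun Z W hW => ?_⟩
  refine (key R Z W hW).trans ?_
  rw [← Real.exp_add]
  apply Real.exp_le_exp.2
  have h1 : M ^ 2 / (4 * β) - M * ‖Z‖ + β * ‖Z‖ ^ 2 = (M - 2 * β * ‖Z‖) ^ 2 / (4 * β) := by
    field_simp; ring
  have h2 : 0 ≤ (M - 2 * β * ‖Z‖) ^ 2 / (4 * β) := by positivity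
  linarith

end
end

noncomputable section

section

variable {ι : Type} [Fintype ι]

/-! ### Fourier transforms of powers of the Taylor remainder -/

/-- The measure `dt dY dΞ` with `0 ≤ t ≤ 1`. -/
def remMeasure (ι : Type) [Fintype ι] : Measure (ℝ × RR ι × RR ι) :=
  (volume.restrict (Set.Icc (0 : ℝ) 1)).prod volume

instance : SFinite (remMeasure ι) := by unfold remMeasure; infer_instance

/-- The integrand of the Taylor remainder of order two in its phase space representation. -/
def remKer (b : RR ι × RR ι → ι → ι → ℂ) (q : ℝ × RR ι × RR ι) (Z : RR ι) : ℂ :=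
  ((1 - q.1 : ℝ) : ℂ) * quad (b q.2) (rpt Z) * (win (q.1 • Z - q.2.1) : ℂ) *
    ecis (q.1 • Z) (-q.2.2)

/-- The Taylor remainder of order two with phase space coefficients `b`. -/
def remFun (b : RR ι × RR ι → ι → ι → ℂ) (Z : RR ι) : ℂ := ∫ q, remKer b q Z ∂remMeasure ι

/-- Continuous coefficients with an integrable bound depending on the frequency only. -/
structure CoefBound (b : RR ι × RR ι → ι → ι → ℂ) (N : RR ι → ℝ≥0∞) : Prop where
  cont : ∀ i j, Continuous fun z => b z i j
  meas : Measurable N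
  bound : ∀ z, ENNReal.ofReal (∑ i, ∑ j, ‖b z i j‖) ≤ N z.2
  fin : ∫⁻ Ξ, N Ξ ≠ ∞

/-- The integral of the Gaussian window. -/
def winInt (ι : Type) [Fintype ι] : ℝ≥0∞ := ∫⁻ Y : RR ι, ENNReal.ofReal (win Y)

theorem integrable_win : Integrable (win : RR ι → ℝ) := by
  have := (integrable_exp_neg_mul_sq_norm (ι := ι) (b := 1 / 2) (by norm_num)).const_mul
    (Real.pi ^ (-(Fintype.card ι : ℝ) / 4))
  refine this.congr (Eventually.of_forall fun y => ?_)
  simp only [win]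
  ring_nf

theorem winInt_ne_top : winInt ι ≠ ∞ := integrable_win.lintegral_lt_top.ne

theorem lintegral_win_sub (x : RR ι) :
    ∫⁻ Y, ENNReal.ofReal (win (x - Y)) = winInt ι :=
  lintegral_sub_left_eq_self (fun Y => ENNReal.ofReal (win Y)) x

theorem ae_remMeasure {p : ℝ × RR ι × RR ι → Prop} (h : ∀ q, q.1 ∈ Set.Icc (0 : ℝ) 1 → p q) :
    ∀ᵐ q ∂remMeasure ι, p q := by
  have e : remMeasure ι = (volume : Measure (ℝ × RR ι × RR ι)).restrict
      (Set.Icc (0 : ℝ) 1 ×ˢ Set.univ) := by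
    rw [remMeasure, Measure.volume_eq_prod ℝ (RR ι × RR ι), ← Measure.prod_restrict,
      Measure.restrict_univ]
  rw [e]
  refine (ae_restrict_iff' (measurableSet_Icc.prod MeasurableSet.univ)).2
    (Eventually.of_forall fun q hq => h q hq.1)

theorem lintegral_remMeasure {f : ℝ × RR ι × RR ι → ℝ≥0∞} (hf : Measurable f) :
    ∫⁻ q, f q ∂remMeasure ι = ∫⁻ t in Set.Icc (0 : ℝ) 1, ∫⁻ z, f (t, z) :=
  lintegral_prod _ hf.aemeasurable

theorem lintegral_remMeasure_mul {f : ℝ → RR ι → ℝ≥0∞} {g : ℝ → RR ι → ℝ≥0∞}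
    (hf : Measurable (Function.uncurry f)) (hg : Measurable (Function.uncurry g)) :
    ∫⁻ q, f q.1 q.2.1 * g q.1 q.2.2 ∂remMeasure ι =
      ∫⁻ t in Set.Icc (0 : ℝ) 1, (∫⁻ Y, f t Y) * ∫⁻ Ξ, g t Ξ := by
  rw [lintegral_remMeasure]
  · refine lintegral_congr fun t => ?_
    exact lintegral_prod_mul (f := f t) (g := g t) (hf.comp measurable_prodMk_left).aemeasurable
      (hg.comp measurable_prodMk_left).aemeasurable
  · exact (hf.comp (measurable_fst.prodMk measurable_snd.fst)).mul
      (hg.comp (measurable_fst.prodMk measurable_snd.snd))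

theorem continuous_remKer {b : RR ι × RR ι → ι → ι → ℂ} {N : RR ι → ℝ≥0∞} (hb : CoefBound b N) :
    Continuous fun p : RR ι × ℝ × RR ι × RR ι => remKer b p.2 p.1 := by
  have h1 : Continuous fun p : RR ι × ℝ × RR ι × RR ι => quad (b p.2.2) (rpt p.1) := by
    unfold quad rpt
    refine continuous_finsetSum _ fun i _ => continuous_finsetSum _ fun j _ => ?_
    have := hb.cont i j
    fun_prop
  have h2 : Continuous fun p : RR ι × ℝ × RR ι × RR ι => win (p.2.1 • p.1 - p.2.2.1) :=
    continuous_win.comp (by fun_prop)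
  unfold remKer
  fun_prop

theorem norm_quad_rpt_le (b : ι → ι → ℂ) (Z : RR ι) :
    ‖quad b (rpt Z)‖ ≤ (∑ i, ∑ j, ‖b i j‖) * ‖Z‖ ^ 2 := by
  have := norm_quad_le b Z 0
  rwa [cpt_zero, norm_zero, add_zero] at this

theorem enorm_remKer_le {b : RR ι × RR ι → ι → ι → ℂ} {N : RR ι → ℝ≥0∞} (hb : CoefBound b N)
    (q : ℝ × RR ι × RR ι) (hq : q.1 ∈ Set.Icc (0 : ℝ) 1) (Z : RR ι) :
    ‖remKer b q Z‖ₑ ≤ ENNReal.ofReal (‖Z‖ ^ 2) *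
      (ENNReal.ofReal (win (q.1 • Z - q.2.1)) * N q.2.2) := by
  have h1 : ‖remKer b q Z‖ ≤ ‖Z‖ ^ 2 * (win (q.1 • Z - q.2.1) * ∑ i, ∑ j, ‖b q.2 i j‖) := by
    have h2 := (win_pos (q.1 • Z - q.2.1)).le
    unfold remKer
    rw [norm_mul, norm_mul, norm_mul, norm_ecis, mul_one, Complex.norm_real, Complex.norm_real,
      Real.norm_of_nonneg h2, Real.norm_of_nonneg (by linarith [hq.2])]
    calc _ ≤ 1 * ((∑ i, ∑ j, ‖b q.2 i j‖) * ‖Z‖ ^ 2) * win (q.1 • Z - q.2.1) := by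
          gcongr
          · linarith [hq.1]
          · exact norm_quad_rpt_le _ _
      _ = _ := by ring
  rw [← ofReal_norm]
  refine (ENNReal.ofReal_le_ofReal h1).trans ?_
  rw [ENNReal.ofReal_mul (by positivity), ENNReal.ofReal_mul (win_pos _).le]
  gcongr
  exact hb.bound q.2

theorem lintegral_enorm_remKer_le {b : RR ι × RR ι → ι → ι → ℂ} {N : RR ι → ℝ≥0∞}
    (hb : CoefBound b N) (Z : RR ι) : ∫⁻ q, ‖remKer b q Z‖ₑ ∂remMeasure ι ≤
      winInt ι * (∫⁻ Ξ, N Ξ) * ENNReal.ofReal (‖Z‖ ^ 2) := by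
  refine (lintegral_mono_ae (ae_remMeasure fun q hq => enorm_remKer_le hb q hq Z)).trans ?_
  rw [lintegral_const_mul' _ _ ENNReal.ofReal_ne_top]
  have := lintegral_remMeasure_mul (f := fun t Y => ENNReal.ofReal (win (t • Z - Y)))
    (g := fun _ Ξ => N Ξ) (by
      refine Measurable.ennreal_ofReal (Continuous.measurable ?_)
      exact continuous_win.comp (by fun_prop)) (hb.meas.comp measurable_snd)
  rw [this]
  simp only [lintegral_win_sub]
  rw [lintegral_const, Measure.restrict_apply_univ, Real.volume_Icc, sub_zero, ENNReal.ofReal_one,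
    mul_one, mul_comm]

theorem enorm_remFun_le {b : RR ι × RR ι → ι → ι → ℂ} {N : RR ι → ℝ≥0∞}
    (hb : CoefBound b N) (Z : RR ι) :
    ‖remFun b Z‖ₑ ≤ winInt ι * (∫⁻ Ξ, N Ξ) * ENNReal.ofReal (‖Z‖ ^ 2) :=
  (enorm_integral_le_lintegral_enorm _).trans (lintegral_enorm_remKer_le hb Z)

theorem stronglyMeasurable_remFun {b : RR ι × RR ι → ι → ι → ℂ} {N : RR ι → ℝ≥0∞}
    (hb : CoefBound b N) : StronglyMeasurable (remFun b) :=
  (continuous_remKer hb).stronglyMeasurable.integral_prod_right'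

theorem EntireWindow.lintegral_mul_pow_lt_top {ρ : ℝ} {w : (ι → ℂ) → ℂ} {wS : RR ι → ℝ}
    (hw : EntireWindow ρ w wS) (k : ℕ) :
    ∫⁻ Z, ‖w (rpt Z)‖ₑ * ENNReal.ofReal (‖Z‖ ^ 2) ^ k < ∞ := by
  obtain ⟨C, hC, H⟩ := hw.decay 0 2
  have h1 := (integrable_exp_neg_norm (ι := ι) (b := 1) one_pos).const_mul
    (C * (2 * k).factorial)
  refine lt_of_le_of_lt (lintegral_mono fun Z => ?_) h1.lintegral_lt_top
  have h2 := H Z 0 (by simp)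
  rw [cpt_zero] at h2
  rw [← ENNReal.ofReal_pow (by positivity), ← ofReal_norm, ← ENNReal.ofReal_mul (norm_nonneg _)]
  refine ENNReal.ofReal_le_ofReal ?_
  have h3 : (‖Z‖ ^ 2) ^ k ≤ (2 * k).factorial * Real.exp ‖Z‖ := by
    have := Real.pow_div_factorial_le_exp ‖Z‖ (norm_nonneg Z) (2 * k)
    rw [div_le_iff₀ (by positivity)] at this
    rw [← pow_mul]; linarith
  calc _ ≤ C * Real.exp (-2 * ‖Z‖) * ((2 * k).factorial * Real.exp ‖Z‖) := by gcongr
    _ = C * (2 * k).factorial * (Real.exp (-2 * ‖Z‖) * Real.exp ‖Z‖) := by ring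
    _ = _ := by rw [← Real.exp_add]; ring_nf

theorem EntireWindow.continuous_rpt {ρ : ℝ} {w : (ι → ℂ) → ℂ} {wS : RR ι → ℝ}
    (hw : EntireWindow ρ w wS) : Continuous fun Z : RR ι => w (rpt Z) :=
  hw.diff.continuous.comp _root_.continuous_rpt

theorem enorm_ft_pow_succ_le {b : RR ι × RR ι → ι → ι → ℂ} {N : RR ι → ℝ≥0∞}
    (hb : CoefBound b N) {ρ : ℝ} {w : (ι → ℂ) → ℂ} {wS : RR ι → ℝ} (hw : EntireWindow ρ w wS)
    (k : ℕ) (Θ : RR ι) :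
    ‖ft (fun Z => w (rpt Z) * remFun b Z ^ (k + 1)) Θ‖ₑ ≤
      ∫⁻ q, ‖ft (fun Z => w (rpt Z) * (((1 - q.1 : ℝ) : ℂ) * quad (b q.2) (rpt Z) *
        winC fun i => (q.1 : ℂ) * rpt Z i - (q.2.1 i : ℂ)) * remFun b Z ^ k)
          (Θ - q.1 • q.2.2)‖ₑ ∂remMeasure ι := by
  have hwc := hw.continuous_rpt
  have hψm := (stronglyMeasurable_remFun hb)
  set c : ℝ≥0∞ := winInt ι * ∫⁻ Ξ, N Ξ with hc
  have hct : c ≠ ∞ := ENNReal.mul_ne_top winInt_ne_top hb.fin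
  have hInt : Integrable (Function.uncurry fun (Z : RR ι) (q : ℝ × RR ι × RR ι) =>
      w (rpt Z) * remFun b Z ^ k * ecis Z Θ * remKer b q Z) (volume.prod (remMeasure ι)) := by
    have hm1 : StronglyMeasurable fun Z => w (rpt Z) * remFun b Z ^ k * ecis Z Θ :=
      (hwc.stronglyMeasurable.mul (hψm.pow k)).mul
        (by fun_prop : Continuous fun Z : RR ι => ecis Z Θ).stronglyMeasurable
    have hm : StronglyMeasurable (Function.uncurry fun (Z : RR ι) (q : ℝ × RR ι × RR ι) =>
        w (rpt Z) * remFun b Z ^ k * ecis Z Θ * remKer b q Z) :=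
      (hm1.comp_measurable measurable_fst).mul (continuous_remKer hb).stronglyMeasurable
    refine ⟨hm.aestronglyMeasurable, ?_⟩
    rw [hasFiniteIntegral_iff_enorm, lintegral_prod _ hm.enorm.aemeasurable]
    have h1 := hw.lintegral_mul_pow_lt_top (k + 1)
    refine lt_of_le_of_lt (lintegral_mono fun Z => ?_) (?_ : ∫⁻ Z, c ^ (k + 1) *
      (‖w (rpt Z)‖ₑ * ENNReal.ofReal (‖Z‖ ^ 2) ^ (k + 1)) < ∞)
    · simp only [Function.uncurry_apply_pair, enorm_mul, enorm_pow]
      rw [lintegral_const_mul' _ _ (by finiteness)]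
      have he : ‖ecis Z Θ‖ₑ = 1 := by rw [← ofReal_norm, norm_ecis, ENNReal.ofReal_one]
      rw [he, mul_one]
      calc _ ≤ ‖w (rpt Z)‖ₑ * (c * ENNReal.ofReal (‖Z‖ ^ 2)) ^ k *
            (c * ENNReal.ofReal (‖Z‖ ^ 2)) := by
            gcongr
            · exact enorm_remFun_le hb Z
            · exact lintegral_enorm_remKer_le hb Z
        _ = _ := by ring
    · rw [lintegral_const_mul' _ _ (ENNReal.pow_ne_top hct)]
      exact ENNReal.mul_lt_top (ENNReal.pow_lt_top hct.lt_top) h1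
  have e1 : ft (fun Z => w (rpt Z) * remFun b Z ^ (k + 1)) Θ =
      ∫ q, ∫ Z, w (rpt Z) * remFun b Z ^ k * ecis Z Θ * remKer b q Z ∂volume ∂remMeasure ι := by
    rw [← integral_integral_swap hInt, ft]
    refine integral_congr_ae (Eventually.of_forall fun Z => ?_)
    simp only
    rw [integral_const_mul, ← remFun]
    ring
  rw [e1]
  refine (enorm_integral_le_lintegral_enorm _).trans (le_of_eq ?_)
  refine lintegral_congr fun q => ?_
  rw [ft]
  congr 1
  refine integral_congr_ae (Eventually.of_forall fun Z => ?_)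
  have h2 : (fun i => (q.1 : ℂ) * rpt Z i - (q.2.1 i : ℂ)) = rpt (q.1 • Z - q.2.1) := by
    funext i; simp [rpt]
  simp only [h2, winC_rpt, remKer]
  have h3 : ecis Z (Θ - q.1 • q.2.2) = ecis Z Θ * ecis (q.1 • Z) (-q.2.2) := by
    rw [ecis, ecis, ecis, ← Complex.exp_add]
    congr 1
    rw [inner_sub_right, inner_smul_right, inner_neg_right, inner_smul_left]
    simp; ring
  rw [h3]
  ring

/-- The iterated dilated convolutions of `G` with `E₀`. -/
def iterConv (G E₀ : RR ι → ℝ≥0∞) : ℕ → RR ι → ℝ≥0∞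
  | 0 => E₀
  | k + 1 => fun Θ => ∫⁻ t in Set.Icc (0 : ℝ) 1, ∫⁻ Ξ, G Ξ * iterConv G E₀ k (Θ - t • Ξ)

theorem measurable_iterConv {G E₀ : RR ι → ℝ≥0∞} (hG : Measurable G) (hE : Measurable E₀) (k : ℕ) :
    Measurable (iterConv G E₀ k) := by
  induction k with
  | zero => exact hE
  | succ k ih =>
    have h1 : Measurable fun p : (RR ι × ℝ) × RR ι =>
        G p.2 * iterConv G E₀ k (p.1.1 - p.1.2 • p.2) :=
      (hG.comp measurable_snd).mul (ih.comp (Continuous.measurable (by fun_prop)))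
    exact h1.lintegral_prod_right'.lintegral_prod_right'

theorem lintegral_iterConv_le {G E₀ : RR ι → ℝ≥0∞} (hG : Measurable G) (hE : Measurable E₀)
    (k : ℕ) : ∫⁻ Θ, iterConv G E₀ k Θ ≤ (∫⁻ Ξ, G Ξ) ^ k * ∫⁻ Θ, E₀ Θ := by
  induction k with
  | zero => simp [iterConv]
  | succ k ih =>
    have hm := measurable_iterConv hG hE k
    have h1 : Measurable fun p : (RR ι × ℝ) × RR ι =>
        G p.2 * iterConv G E₀ k (p.1.1 - p.1.2 • p.2) :=
      (hG.comp measurable_snd).mul (hm.comp (Continuous.measurable (by fun_prop)))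
    simp only [iterConv]
    rw [lintegral_lintegral_swap h1.lintegral_prod_right'.aemeasurable]
    calc ∫⁻ t in Set.Icc (0 : ℝ) 1, ∫⁻ Θ, ∫⁻ Ξ, G Ξ * iterConv G E₀ k (Θ - t • Ξ)
        = ∫⁻ t in Set.Icc (0 : ℝ) 1, (∫⁻ Ξ, G Ξ) * ∫⁻ Θ, iterConv G E₀ k Θ := by
          refine lintegral_congr fun t => ?_
          have h2 : Measurable fun p : RR ι × RR ι => G p.2 * iterConv G E₀ k (p.1 - t • p.2) :=
            (hG.comp measurable_snd).mul (hm.comp (Continuous.measurable (by fun_prop)))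
          rw [lintegral_lintegral_swap h2.aemeasurable, ← lintegral_mul_const _ hG]
          refine lintegral_congr fun Ξ => ?_
          have h3 : Measurable fun Θ => iterConv G E₀ k (Θ - t • Ξ) :=
            hm.comp (Continuous.measurable (by fun_prop))
          rw [lintegral_const_mul _ h3, lintegral_sub_right_eq_self (iterConv G E₀ k)]
      _ = (∫⁻ Ξ, G Ξ) * ∫⁻ Θ, iterConv G E₀ k Θ := by
          rw [lintegral_const, Measure.restrict_apply_univ, Real.volume_Icc, sub_zero,
            ENNReal.ofReal_one, mul_one]
      _ ≤ (∫⁻ Ξ, G Ξ) * ((∫⁻ Ξ, G Ξ) ^ k * ∫⁻ Θ, E₀ Θ) := by gcongr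
      _ = _ := by ring

theorem iterConv_le {G E₀ : RR ι → ℝ≥0∞} (hG : Measurable G) {S : ℝ≥0∞} (hS : ∀ Θ, E₀ Θ ≤ S)
    (k : ℕ) (Θ : RR ι) : iterConv G E₀ k Θ ≤ (∫⁻ Ξ, G Ξ) ^ k * S := by
  induction k generalizing Θ with
  | zero => simpa [iterConv] using hS Θ
  | succ k ih =>
    simp only [iterConv]
    calc _ ≤ ∫⁻ _ in Set.Icc (0 : ℝ) 1, ∫⁻ Ξ, G Ξ * ((∫⁻ Ξ, G Ξ) ^ k * S) := by
          gcongr with t Ξ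
          exact ih _
      _ = _ := by
          rw [lintegral_const, Measure.restrict_apply_univ, Real.volume_Icc, sub_zero,
            ENNReal.ofReal_one, mul_one, lintegral_mul_const _ hG]
          ring

/-- Weighted bound for the Fourier transform of a window times a power of the remainder. -/
theorem EntireWindow.weight_mul_enorm_ft_pow_le {b : RR ι × RR ι → ι → ι → ℂ} {N : RR ι → ℝ≥0∞}
    (hb : CoefBound b N) {v : RR ι → ℝ} (hv : Measurable v) (hv0 : ∀ Θ, 0 < v Θ) {c₁ : ℝ}
    (hc₁ : 0 ≤ c₁) (hvv : ∀ t ∈ Set.Icc (0 : ℝ) 1, ∀ Θ Ξ, v Θ ≤ c₁ * (v (Θ - t • Ξ) * v Ξ))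
    {ρ : ℝ} (hρ : 0 ≤ ρ) (k : ℕ) {w : (ι → ℂ) → ℂ} {wS : RR ι → ℝ} (hw : EntireWindow ρ w wS)
    (Θ : RR ι) :
    ENNReal.ofReal (v Θ) * ‖ft (fun Z => w (rpt Z) * remFun b Z ^ k) Θ‖ₑ ≤
      (ENNReal.ofReal (c₁ * Real.exp (ρ ^ 2 / 2)) * winInt ι) ^ k *
      (∫⁻ Z, ENNReal.ofReal (wS Z * (‖Z‖ + ρ) ^ (2 * k))) *
      iterConv (fun Ξ => ENNReal.ofReal (v Ξ) * N Ξ)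
        (fun Ξ => ENNReal.ofReal (v Ξ * Real.exp (-ρ * ‖Ξ‖))) k Θ := by
  induction k generalizing w wS Θ with
  | zero =>
    simp only [pow_zero, mul_one, mul_zero, one_mul, iterConv]
    refine (mul_le_mul_right (hw.norm_ft_le hρ Θ) _).trans (le_of_eq ?_)
    rw [ENNReal.ofReal_mul (hv0 Θ).le]
    ring
  | succ k ih =>
    set G : RR ι → ℝ≥0∞ := fun Ξ => ENNReal.ofReal (v Ξ) * N Ξ with hG
    set E₀ : RR ι → ℝ≥0∞ := fun Ξ => ENNReal.ofReal (v Ξ * Real.exp (-ρ * ‖Ξ‖)) with hE₀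
    have hGm : Measurable G := hv.ennreal_ofReal.mul hb.meas
    have hEm : Measurable E₀ := (hv.mul (Continuous.measurable (by fun_prop))).ennreal_ofReal
    have hIm := measurable_iterConv hGm hEm k
    set c : ℝ≥0∞ := ENNReal.ofReal (c₁ * Real.exp (ρ ^ 2 / 2)) * winInt ι with hc
    set A : RR ι → ℝ≥0∞ := fun Z => ENNReal.ofReal (wS Z * (‖Z‖ + ρ) ^ (2 * (k + 1))) with hA
    have hAm : Measurable A :=
      (hw.meas.mul (Continuous.measurable (by fun_prop))).ennreal_ofReal
    have hwin : Measurable fun p : (ℝ × RR ι) × RR ι =>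
        A p.2 * ENNReal.ofReal (win (p.1.1 • p.2 - p.1.2)) :=
      (hAm.comp measurable_snd).mul (Measurable.ennreal_ofReal (Continuous.measurable
        (continuous_win.comp (by fun_prop))))
    have hstep : ∀ q : ℝ × RR ι × RR ι, q.1 ∈ Set.Icc (0 : ℝ) 1 →
        ENNReal.ofReal (v Θ) * ‖ft (fun Z => w (rpt Z) * (((1 - q.1 : ℝ) : ℂ) *
          quad (b q.2) (rpt Z) * winC fun i => (q.1 : ℂ) * rpt Z i - (q.2.1 i : ℂ)) *
            remFun b Z ^ k) (Θ - q.1 • q.2.2)‖ₑ ≤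
        ENNReal.ofReal (c₁ * Real.exp (ρ ^ 2 / 2)) * c ^ k *
          ((∫⁻ Z, A Z * ENNReal.ofReal (win (q.1 • Z - q.2.1))) *
          (G q.2.2 * iterConv G E₀ k (Θ - q.1 • q.2.2))) := by
      intro q hq
      have h1 := ih (hw.mul_quad_win (b q.2) hq q.2.1) (Θ - q.1 • q.2.2)
      have h2 : ENNReal.ofReal (v Θ) ≤ ENNReal.ofReal c₁ *
          (ENNReal.ofReal (v (Θ - q.1 • q.2.2)) * ENNReal.ofReal (v q.2.2)) := by
        rw [← ENNReal.ofReal_mul (hv0 _).le, ← ENNReal.ofReal_mul hc₁]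
        exact ENNReal.ofReal_le_ofReal (hvv q.1 hq Θ q.2.2)
      have h3 : ∫⁻ Z, ENNReal.ofReal (wS Z * ((∑ i, ∑ j, ‖b q.2 i j‖) * (‖Z‖ + ρ) ^ 2 *
          (win (q.1 • Z - q.2.1) * Real.exp (ρ ^ 2 / 2))) * (‖Z‖ + ρ) ^ (2 * k)) ≤
          N q.2.2 * ENNReal.ofReal (Real.exp (ρ ^ 2 / 2)) *
            ∫⁻ Z, A Z * ENNReal.ofReal (win (q.1 • Z - q.2.1)) := by
        have hb0 : 0 ≤ ∑ i, ∑ j, ‖b q.2 i j‖ := Finset.sum_nonneg fun i _ =>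
          Finset.sum_nonneg fun j _ => norm_nonneg _
        have hm3 : Measurable fun Z => A Z * ENNReal.ofReal (win (q.1 • Z - q.2.1)) :=
          hwin.comp (measurable_const.prodMk measurable_id :
            Measurable fun Z => (((q.1, q.2.1), Z) : (ℝ × RR ι) × RR ι))
        rw [← lintegral_const_mul _ hm3]
        refine lintegral_mono fun Z => ?_
        have e : wS Z * ((∑ i, ∑ j, ‖b q.2 i j‖) * (‖Z‖ + ρ) ^ 2 *
          (win (q.1 • Z - q.2.1) * Real.exp (ρ ^ 2 / 2))) * (‖Z‖ + ρ) ^ (2 * k) =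
          (∑ i, ∑ j, ‖b q.2 i j‖) * (Real.exp (ρ ^ 2 / 2) * ((win (q.1 • Z - q.2.1)) *
            (wS Z * (‖Z‖ + ρ) ^ (2 * (k + 1))))) := by ring
        rw [e, ENNReal.ofReal_mul hb0, ENNReal.ofReal_mul (Real.exp_pos _).le,
          ENNReal.ofReal_mul (win_pos _).le]
        calc _ ≤ N q.2.2 * (ENNReal.ofReal (Real.exp (ρ ^ 2 / 2)) *
              (ENNReal.ofReal (win (q.1 • Z - q.2.1)) * A Z)) := by
              gcongr
              exact hb.bound q.2
          _ = _ := by ring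
      calc _ ≤ ENNReal.ofReal c₁ * (ENNReal.ofReal (v (Θ - q.1 • q.2.2)) *
            ENNReal.ofReal (v q.2.2)) * _ := mul_le_mul_left h2 _
        _ = ENNReal.ofReal c₁ * ENNReal.ofReal (v q.2.2) *
            (ENNReal.ofReal (v (Θ - q.1 • q.2.2)) * _) := by ring
        _ ≤ ENNReal.ofReal c₁ * ENNReal.ofReal (v q.2.2) * _ := mul_le_mul_right h1 _
        _ ≤ ENNReal.ofReal c₁ * ENNReal.ofReal (v q.2.2) * (c ^ k *
            (N q.2.2 * ENNReal.ofReal (Real.exp (ρ ^ 2 / 2)) *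
            ∫⁻ Z, A Z * ENNReal.ofReal (win (q.1 • Z - q.2.1))) *
              iterConv G E₀ k (Θ - q.1 • q.2.2)) := by gcongr
        _ = _ := by
            rw [ENNReal.ofReal_mul hc₁]
            simp only [hG]
            ring
    have hf : Measurable (Function.uncurry fun (t : ℝ) (Y : RR ι) =>
        ∫⁻ Z, A Z * ENNReal.ofReal (win (t • Z - Y))) := hwin.lintegral_prod_right'
    have hg : Measurable (Function.uncurry fun (t : ℝ) (Ξ : RR ι) =>
        G Ξ * iterConv G E₀ k (Θ - t • Ξ)) :=
      (hGm.comp measurable_snd).mul (hIm.comp (Continuous.measurable (by fun_prop)))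
    calc _ ≤ ENNReal.ofReal (v Θ) * _ := mul_le_mul_right (enorm_ft_pow_succ_le hb hw k Θ) _
      _ = ∫⁻ q, ENNReal.ofReal (v Θ) * _ ∂remMeasure ι :=
          (lintegral_const_mul' _ _ ENNReal.ofReal_ne_top).symm
      _ ≤ ∫⁻ q, ENNReal.ofReal (c₁ * Real.exp (ρ ^ 2 / 2)) * c ^ k *
          ((∫⁻ Z, A Z * ENNReal.ofReal (win (q.1 • Z - q.2.1))) *
          (G q.2.2 * iterConv G E₀ k (Θ - q.1 • q.2.2))) ∂remMeasure ι :=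
          lintegral_mono_ae (ae_remMeasure hstep)
      _ = ENNReal.ofReal (c₁ * Real.exp (ρ ^ 2 / 2)) * c ^ k *
          ∫⁻ t in Set.Icc (0 : ℝ) 1, (∫⁻ Y, ∫⁻ Z, A Z * ENNReal.ofReal (win (t • Z - Y))) *
            ∫⁻ Ξ, G Ξ * iterConv G E₀ k (Θ - t • Ξ) := by
          rw [lintegral_const_mul' _ _ (ENNReal.mul_ne_top ENNReal.ofReal_ne_top
            (ENNReal.pow_ne_top (ENNReal.mul_ne_top ENNReal.ofReal_ne_top winInt_ne_top))),
            ← lintegral_remMeasure_mul hf hg]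
      _ = ENNReal.ofReal (c₁ * Real.exp (ρ ^ 2 / 2)) * c ^ k *
          ∫⁻ t in Set.Icc (0 : ℝ) 1, (winInt ι * ∫⁻ Z, A Z) *
            ∫⁻ Ξ, G Ξ * iterConv G E₀ k (Θ - t • Ξ) := by
          congr 1
          refine lintegral_congr fun t => ?_
          congr 1
          have hm4 : Measurable (Function.uncurry fun (Y Z : RR ι) =>
              A Z * ENNReal.ofReal (win (t • Z - Y))) :=
            hwin.comp ((measurable_const.prodMk measurable_fst).prodMk measurable_snd :
              Measurable fun p : RR ι × RR ι => (((t, p.1), p.2) : (ℝ × RR ι) × RR ι))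
          rw [lintegral_lintegral_swap hm4.aemeasurable, mul_comm, ← lintegral_mul_const _ hAm]
          refine lintegral_congr fun Z => ?_
          have hm5 : Measurable fun Y => ENNReal.ofReal (win (t • Z - Y)) :=
            Measurable.ennreal_ofReal (Continuous.measurable (continuous_win.comp (by fun_prop)))
          rw [lintegral_const_mul _ hm5, lintegral_win_sub]
      _ = _ := by
          have hm6 : Measurable fun t : ℝ => ∫⁻ Ξ, G Ξ * iterConv G E₀ k (Θ - t • Ξ) :=
            hg.lintegral_prod_right'
          rw [lintegral_const_mul _ hm6]
          simp only [iterConv, hc]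
          ring

end
end

noncomputable section

section

variable {ι : Type} [Fintype ι]

theorem pow_div_factorial_le {x μ : ℝ} (hx : 0 ≤ x) (hμ : 0 < μ) (k : ℕ) :
    x ^ k / k.factorial ≤ Real.exp (μ * x) / μ ^ k := by
  have := Real.pow_div_factorial_le_exp (μ * x) (by positivity) k
  rw [le_div_iff₀ (by positivity)]
  calc _ = (μ * x) ^ k / k.factorial := by rw [mul_pow]; ring
    _ ≤ _ := this

theorem tsum_half_pow_le : ∑' k : ℕ, ENNReal.ofReal ((1 / 2) ^ k) = 2 := by
  have h : ∀ k : ℕ, ENNReal.ofReal ((1 / 2 : ℝ) ^ k) = (2⁻¹ : ℝ≥0∞) ^ k := fun k => by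
    rw [ENNReal.ofReal_pow (by norm_num), one_div, ENNReal.ofReal_inv_of_pos two_pos]
    simp
  simp_rw [h]
  rw [ENNReal.tsum_geometric, ENNReal.one_sub_inv_two, inv_inv]

/-- The integral of a Gaussian window times `exp (μ (|Z| + ρ)^2)`. -/
theorem lintegral_gauss_mul_exp_le {ρ μ : ℝ} (hμ : 0 ≤ μ) :
    ∫⁻ Z : RR ι, ENNReal.ofReal (Real.exp (-(2 * μ + 1) * (‖Z‖ ^ 2 - ρ ^ 2)) *
      Real.exp (μ * (‖Z‖ + ρ) ^ 2)) ≤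
      ENNReal.ofReal (Real.exp (2 * (2 * μ + 1) * ρ ^ 2) *
        ∫ Z : RR ι, Real.exp (-1 * ‖Z‖ ^ 2)) := by
  have hI := integrable_exp_neg_mul_sq_norm (ι := ι) (b := 1) one_pos
  rw [ENNReal.ofReal_mul (Real.exp_pos _).le,
    ofReal_integral_eq_lintegral_ofReal hI (Eventually.of_forall fun Z => (Real.exp_pos _).le),
    ← lintegral_const_mul' _ _ ENNReal.ofReal_ne_top]
  refine lintegral_mono fun Z => ?_
  rw [← ENNReal.ofReal_mul (Real.exp_pos _).le, ← Real.exp_add, ← Real.exp_add]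
  refine ENNReal.ofReal_le_ofReal (Real.exp_le_exp.2 ?_)
  nlinarith [sq_nonneg (‖Z‖ - ρ), mul_nonneg hμ (sq_nonneg (‖Z‖ - ρ)), sq_nonneg ρ]

theorem tsum_ofReal_pow_le {x : ℕ → ℝ≥0∞} {c A μ : ℝ} (hc : 0 ≤ c) (hA : 0 ≤ A)
    (hμ : 2 * c * A ≤ μ) (hμ0 : 0 < μ) {J S : ℝ≥0∞}
    (hx : ∀ k, x k ≤ ENNReal.ofReal (c ^ k) * ENNReal.ofReal (1 / μ ^ k) * J *
      (ENNReal.ofReal A ^ k * S)) : ∑' k, x k ≤ 2 * (J * S) := by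
  calc ∑' k, x k ≤ ∑' k, ENNReal.ofReal ((1 / 2) ^ k) * (J * S) := by
        refine ENNReal.tsum_le_tsum fun k => (hx k).trans ?_
        calc _ = ENNReal.ofReal (c ^ k) * ENNReal.ofReal (1 / μ ^ k) * ENNReal.ofReal (A ^ k) *
              (J * S) := by rw [ENNReal.ofReal_pow hA]; ring
          _ = ENNReal.ofReal ((c * A / μ) ^ k) * (J * S) := by
              rw [← ENNReal.ofReal_mul (by positivity), ← ENNReal.ofReal_mul (by positivity)]
              congr 2
              rw [div_pow, mul_pow]; ring
          _ ≤ _ := by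
              have h : c * A / μ ≤ 1 / 2 := by
                rw [div_le_div_iff₀ hμ0 two_pos]
                linarith
              have h0 : 0 ≤ c * A / μ := by positivity
              exact mul_le_mul_left (ENNReal.ofReal_le_ofReal (pow_le_pow_left₀ h0 h k)) _
    _ = 2 * (J * S) := by rw [ENNReal.tsum_mul_right, tsum_half_pow_le]

theorem norm_gauss_rpt (β : ℝ) (Z : RR ι) :
    Complex.exp (-(β : ℂ) * ∑ i, rpt Z i ^ 2) = ((Real.exp (-β * ‖Z‖ ^ 2) : ℝ) : ℂ) := by
  simp only [rpt, EuclideanSpace.norm_sq_eq, Real.norm_eq_abs, sq_abs]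
  push_cast
  ring_nf

/-- The Fourier transform of `exp (-β |Z|^2 + i ψ (Z))` is the sum of the series of its Taylor
coefficients in `ψ`. -/
theorem enorm_ft_exp_le {ψ : RR ι → ℂ} (hψ : StronglyMeasurable ψ) {μ B : ℝ} (hμ : 0 < μ)
    (hB : 0 ≤ B) (hBμ : 2 * B ≤ μ) (hψB : ∀ Z, ‖ψ Z‖ ≤ B * ‖Z‖ ^ 2) (Θ : RR ι) :
    ‖ft (fun Z => ((Real.exp (-(2 * μ + 1) * ‖Z‖ ^ 2) : ℝ) : ℂ) *
        Complex.exp (Complex.I * ψ Z)) Θ‖ₑ ≤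
      ∑' k : ℕ, ENNReal.ofReal (1 / k.factorial) *
        ‖ft (fun Z => Complex.exp (-((2 * μ + 1 : ℝ) : ℂ) * ∑ i, rpt Z i ^ 2) * ψ Z ^ k) Θ‖ₑ := by
  set χ : RR ι → ℂ := fun Z => ((Real.exp (-(2 * μ + 1) * ‖Z‖ ^ 2) : ℝ) : ℂ) with hχ
  have hχc : Continuous χ := by fun_prop
  set f : ℕ → RR ι → ℂ := fun k Z => χ Z * ((Complex.I * ψ Z) ^ k / (k.factorial : ℂ)) * ecis Z Θ
    with hf
  have hfm : ∀ k, AEStronglyMeasurable (f k) := fun k => by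
    have h1 : StronglyMeasurable fun Z => (Complex.I * ψ Z) ^ k / (k.factorial : ℂ) :=
      ((stronglyMeasurable_const.mul hψ).pow k).div stronglyMeasurable_const
    exact ((hχc.stronglyMeasurable.mul h1).mul
      (by fun_prop : Continuous fun Z : RR ι => ecis Z Θ).stronglyMeasurable).aestronglyMeasurable
  have hfe : ∀ Z, ∑' k, f k Z = χ Z * Complex.exp (Complex.I * ψ Z) * ecis Z Θ := by
    intro Z
    simp only [hf]
    rw [tsum_mul_right, tsum_mul_left]
    congr 2
    rw [Complex.exp_eq_exp_ℂ, NormedSpace.exp_eq_tsum_div]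
  have hI := integrable_exp_neg_mul_sq_norm (ι := ι) (b := 1) one_pos
  have hfb : ∀ k, ∫⁻ Z, ‖f k Z‖ₑ ≤ ENNReal.ofReal ((1 / 2) ^ k) *
      ∫⁻ Z : RR ι, ENNReal.ofReal (Real.exp (-1 * ‖Z‖ ^ 2)) := by
    intro k
    rw [← lintegral_const_mul' _ _ ENNReal.ofReal_ne_top]
    refine lintegral_mono fun Z => ?_
    rw [← ofReal_norm, ← ENNReal.ofReal_mul (by positivity)]
    refine ENNReal.ofReal_le_ofReal ?_
    simp only [hf, hχ, norm_mul, norm_div, norm_pow, norm_ecis, Complex.norm_I, one_mul, mul_one,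
      Complex.norm_real, Complex.norm_natCast, Real.norm_eq_abs, abs_of_pos (Real.exp_pos _)]
    calc _ ≤ Real.exp (-(2 * μ + 1) * ‖Z‖ ^ 2) * ((B * ‖Z‖ ^ 2) ^ k / k.factorial) := by
          gcongr; exact hψB Z
      _ = Real.exp (-(2 * μ + 1) * ‖Z‖ ^ 2) * (B ^ k * ((‖Z‖ ^ 2) ^ k / k.factorial)) := by
          rw [mul_pow]; ring
      _ ≤ Real.exp (-(2 * μ + 1) * ‖Z‖ ^ 2) * (B ^ k * (Real.exp (μ * ‖Z‖ ^ 2) / μ ^ k)) := by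
          have := pow_div_factorial_le (x := ‖Z‖ ^ 2) (by positivity) hμ k
          exact mul_le_mul_of_nonneg_left (mul_le_mul_of_nonneg_left this (by positivity))
            (by positivity)
      _ = (B / μ) ^ k * (Real.exp (-(2 * μ + 1) * ‖Z‖ ^ 2) * Real.exp (μ * ‖Z‖ ^ 2)) := by
          rw [div_pow]; ring
      _ ≤ (1 / 2) ^ k * Real.exp (-1 * ‖Z‖ ^ 2) := by
          rw [← Real.exp_add]
          have h : B / μ ≤ 1 / 2 := by rw [div_le_div_iff₀ hμ two_pos]; linarith
          refine mul_le_mul (pow_le_pow_left₀ (by positivity) h k) (Real.exp_le_exp.2 ?_)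
            (by positivity) (by positivity)
          nlinarith [mul_nonneg hμ.le (sq_nonneg ‖Z‖)]
  have hsum : ∑' k, ∫⁻ Z, ‖f k Z‖ₑ ≠ ∞ := by
    refine ne_top_of_le_ne_top ?_ (ENNReal.tsum_le_tsum hfb)
    rw [ENNReal.tsum_mul_right, tsum_half_pow_le]
    exact ENNReal.mul_ne_top (by norm_num) hI.lintegral_lt_top.ne
  have e1 : ft (fun Z => χ Z * Complex.exp (Complex.I * ψ Z)) Θ = ∑' k, ∫ Z, f k Z := by
    rw [← integral_tsum hfm hsum, ft]
    exact integral_congr_ae (Eventually.of_forall fun Z => (hfe Z).symm)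
  rw [e1]
  refine enorm_tsum_le_tsum_enorm.trans (ENNReal.tsum_le_tsum fun k => le_of_eq ?_)
  have e2 : ∫ Z, f k Z = (Complex.I ^ k / (k.factorial : ℂ)) *
      ft (fun Z => Complex.exp (-((2 * μ + 1 : ℝ) : ℂ) * ∑ i, rpt Z i ^ 2) * ψ Z ^ k) Θ := by
    rw [ft, ← integral_const_mul]
    refine integral_congr_ae (Eventually.of_forall fun Z => ?_)
    simp only [hf, hχ, norm_gauss_rpt, mul_pow]
    ring
  rw [e2, enorm_mul]
  congr 1
  rw [← ofReal_norm, norm_div, norm_pow, Complex.norm_I, one_pow, Complex.norm_natCast]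

/-- The main estimate: the Fourier transforms of `exp (-β |Z|^2 + i ψ (Z))`, where `ψ` is a Taylor
remainder of order two, have a common weighted integrable bound. -/
theorem exists_gaussian_oscillation_bound {v : RR ι → ℝ} (hv : Measurable v)
    {c₀ : ℝ} (hc₀ : 0 < c₀) (hv0 : ∀ Θ, c₀ ≤ v Θ) {c₁ : ℝ}
    (hc₁ : 0 ≤ c₁) (hvv : ∀ t ∈ Set.Icc (0 : ℝ) 1, ∀ Θ Ξ, v Θ ≤ c₁ * (v (Θ - t • Ξ) * v Ξ))
    {ρ c₂ : ℝ} (hρ : 0 ≤ ρ) (hv2 : ∀ Θ, v Θ * Real.exp (-ρ * ‖Θ‖) ≤ c₂ * Real.exp (-1 * ‖Θ‖)) :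
    ∃ C : ℝ, 0 < C ∧ ∀ A : ℝ, 0 ≤ A → ∃ β : ℝ, 0 < β ∧ β ≤ C * (1 + A) ∧
      ∀ N : RR ι → ℝ≥0∞, Measurable N →
      ∫⁻ Ξ, ENNReal.ofReal (v Ξ) * N Ξ ≤ ENNReal.ofReal A → ∃ Ht : RR ι → ℝ≥0∞, Measurable Ht ∧
        ∫⁻ Θ, Ht Θ ≤ ENNReal.ofReal (C * Real.exp (C * A)) ∧
        (∀ Θ, Ht Θ ≤ ENNReal.ofReal (C * Real.exp (C * A))) ∧
        ∀ b, CoefBound b N → ∀ Θ, ENNReal.ofReal (v Θ) *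
          ‖ft (fun Z => ((Real.exp (-β * ‖Z‖ ^ 2) : ℝ) : ℂ) *
            Complex.exp (Complex.I * remFun b Z)) Θ‖ₑ ≤ Ht Θ := by
  have hvp : ∀ Θ, 0 < v Θ := fun Θ => hc₀.trans_le (hv0 Θ)
  have hc₂ : 0 ≤ c₂ := nonneg_of_mul_nonneg_left
    ((mul_pos (hvp 0) (Real.exp_pos _)).le.trans (hv2 0)) (Real.exp_pos _)
  set W : ℝ := (winInt ι).toReal with hW
  have hW0 : 0 ≤ W := ENNReal.toReal_nonneg
  have hWe : winInt ι = ENNReal.ofReal W := (ENNReal.ofReal_toReal winInt_ne_top).symm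
  set c : ℝ := c₁ * Real.exp (ρ ^ 2 / 2) * W + W / c₀ + 1 with hc
  have hcp : 0 < c := by positivity
  set K : ℝ := ∫ Z : RR ι, Real.exp (-1 * ‖Z‖ ^ 2) with hK
  have hK0 : 0 ≤ K := integral_nonneg fun Z => (Real.exp_pos _).le
  set L : ℝ := ∫ Z : RR ι, Real.exp (-1 * ‖Z‖) with hL
  have hL0 : 0 ≤ L := integral_nonneg fun Z => (Real.exp_pos _).le
  set a : ℝ := 2 * (4 * c + 1) * ρ ^ 2 with ha
  have ha0 : 0 ≤ a := by positivity
  set C : ℝ := (4 * c + 1) + 2 * (Real.exp a * K * (c₂ * (L + 1))) + 8 * c * ρ ^ 2 + 1 with hC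
  have hC0 : 0 < C := by positivity
  refine ⟨C, hC0, fun A hA => ?_⟩
  set μ : ℝ := 2 * c * (A + 1) with hμ
  have hμ0 : 0 < μ := by positivity
  have h2cA : 2 * c * A ≤ μ := by rw [hμ]; nlinarith
  refine ⟨2 * μ + 1, by positivity, ?_, ?_⟩
  · have h1 : 4 * c + 1 ≤ C := by
      have h2 : 0 ≤ 2 * (Real.exp a * K * (c₂ * (L + 1))) := by positivity
      have h3 : 0 ≤ 8 * c * ρ ^ 2 := by positivity
      rw [hC]; linarith
    calc 2 * μ + 1 ≤ (4 * c + 1) * (1 + A) := by rw [hμ]; nlinarith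
      _ ≤ C * (1 + A) := by gcongr
  intro N hNm hN
  set G : RR ι → ℝ≥0∞ := fun Ξ => ENNReal.ofReal (v Ξ) * N Ξ with hG
  set E₀ : RR ι → ℝ≥0∞ := fun Ξ => ENNReal.ofReal (v Ξ * Real.exp (-ρ * ‖Ξ‖)) with hE₀
  have hGm : Measurable G := hv.ennreal_ofReal.mul hNm
  have hEm : Measurable E₀ := (hv.mul (Continuous.measurable (by fun_prop))).ennreal_ofReal
  set cc : ℝ≥0∞ := ENNReal.ofReal (c₁ * Real.exp (ρ ^ 2 / 2)) * winInt ι with hcc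
  have hccle : ∀ k, cc ^ k ≤ ENNReal.ofReal (c ^ k) := fun k => by
    rw [ENNReal.ofReal_pow hcp.le]
    gcongr
    rw [hcc, hWe, ← ENNReal.ofReal_mul (by positivity)]
    refine ENNReal.ofReal_le_ofReal ?_
    rw [hc]; linarith [show 0 ≤ W / c₀ by positivity]
  set χS : RR ι → ℝ := fun Z => Real.exp (-(2 * μ + 1) * (‖Z‖ ^ 2 - ρ ^ 2)) with hχS
  set I : ℕ → ℝ≥0∞ := fun k => ∫⁻ Z, ENNReal.ofReal (χS Z * (‖Z‖ + ρ) ^ (2 * k)) with hI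
  set J : ℝ≥0∞ := ∫⁻ Z : RR ι, ENNReal.ofReal (χS Z * Real.exp (μ * (‖Z‖ + ρ) ^ 2)) with hJ
  have hIJ : ∀ k : ℕ, ENNReal.ofReal (1 / k.factorial) * I k ≤ ENNReal.ofReal (1 / μ ^ k) * J := by
    intro k
    rw [hI, hJ, ← lintegral_const_mul' _ _ ENNReal.ofReal_ne_top,
      ← lintegral_const_mul' _ _ ENNReal.ofReal_ne_top]
    refine lintegral_mono fun Z => ?_
    rw [← ENNReal.ofReal_mul (by positivity), ← ENNReal.ofReal_mul (by positivity)]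
    refine ENNReal.ofReal_le_ofReal ?_
    have h1 := pow_div_factorial_le (x := (‖Z‖ + ρ) ^ 2) (by positivity) hμ0 k
    have h2 : 0 ≤ χS Z := (Real.exp_pos _).le
    calc _ = χS Z * (((‖Z‖ + ρ) ^ 2) ^ k / k.factorial) := by rw [pow_mul]; ring
      _ ≤ χS Z * (Real.exp (μ * (‖Z‖ + ρ) ^ 2) / μ ^ k) := by gcongr
      _ = _ := by ring
  have hJle : J ≤ ENNReal.ofReal (Real.exp (2 * (2 * μ + 1) * ρ ^ 2) * K) :=
    lintegral_gauss_mul_exp_le hμ0.le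
  set Ht : RR ι → ℝ≥0∞ := fun Θ => ∑' k : ℕ, ENNReal.ofReal (1 / k.factorial) *
    (cc ^ k * I k * iterConv G E₀ k Θ) with hHt
  have hterm : ∀ (k : ℕ) (x y : ℝ≥0∞), y ≤ (∫⁻ Ξ, G Ξ) ^ k * x →
      ENNReal.ofReal (1 / k.factorial) * (cc ^ k * I k * y) ≤
      ENNReal.ofReal (c ^ k) * ENNReal.ofReal (1 / μ ^ k) * J * (ENNReal.ofReal A ^ k * x) := by
    intro k x y hy
    calc _ = cc ^ k * (ENNReal.ofReal (1 / k.factorial) * I k) * y := by ring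
      _ ≤ ENNReal.ofReal (c ^ k) * (ENNReal.ofReal (1 / μ ^ k) * J) *
          (ENNReal.ofReal A ^ k * x) := by
          have hy' : y ≤ ENNReal.ofReal A ^ k * x := hy.trans (by gcongr)
          exact mul_le_mul' (mul_le_mul' (hccle k) (hIJ k)) hy'
      _ = _ := by ring
  have hfinal : ∀ x : ℝ, 0 ≤ x → x ≤ c₂ * (L + 1) →
      2 * (J * ENNReal.ofReal x) ≤ ENNReal.ofReal (C * Real.exp (C * A)) := by
    intro x hx0 hx
    have h2 : (2 : ℝ≥0∞) = ENNReal.ofReal 2 := by norm_num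
    calc _ ≤ ENNReal.ofReal 2 * (ENNReal.ofReal (Real.exp (2 * (2 * μ + 1) * ρ ^ 2) * K) *
          ENNReal.ofReal x) := by rw [h2]; gcongr
      _ = ENNReal.ofReal (2 * ((Real.exp (2 * (2 * μ + 1) * ρ ^ 2) * K) * x)) := by
          rw [← ENNReal.ofReal_mul (by positivity), ← ENNReal.ofReal_mul (by positivity)]
      _ ≤ _ := by
          refine ENNReal.ofReal_le_ofReal ?_
          have e : 2 * (2 * μ + 1) * ρ ^ 2 = a + 8 * c * ρ ^ 2 * A := by rw [hμ, ha]; ring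
          rw [e, Real.exp_add]
          have h3 : 8 * c * ρ ^ 2 ≤ C := by
            rw [hC]; linarith [show 0 ≤ 2 * (Real.exp a * K * (c₂ * (L + 1))) by positivity]
          have h4 : 2 * (Real.exp a * K * (c₂ * (L + 1))) ≤ C := by
            rw [hC]; linarith [show 0 ≤ 8 * c * ρ ^ 2 by positivity]
          calc _ = 2 * (Real.exp a * K * x) * Real.exp (8 * c * ρ ^ 2 * A) := by ring
            _ ≤ 2 * (Real.exp a * K * (c₂ * (L + 1))) * Real.exp (C * A) := by gcongr
            _ ≤ _ := by gcongr
  refine ⟨Ht, ?_, ?_, ?_, ?_⟩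
  · exact Measurable.tsum fun k => ((measurable_iterConv hGm hEm k).const_mul _).const_mul _
  · have hLe : ∫⁻ Θ, E₀ Θ ≤ ENNReal.ofReal (c₂ * L) := by
      have hIL := integrable_exp_neg_norm (ι := ι) (b := 1) one_pos
      rw [hL, ENNReal.ofReal_mul hc₂, ofReal_integral_eq_lintegral_ofReal hIL
        (Eventually.of_forall fun Z => (Real.exp_pos _).le),
        ← lintegral_const_mul' _ _ ENNReal.ofReal_ne_top]
      refine lintegral_mono fun Θ => ?_
      rw [← ENNReal.ofReal_mul hc₂]
      exact ENNReal.ofReal_le_ofReal (hv2 Θ)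
    rw [hHt, lintegral_tsum fun k =>
      (((measurable_iterConv hGm hEm k).const_mul _).const_mul _).aemeasurable]
    refine (tsum_ofReal_pow_le (S := ENNReal.ofReal (c₂ * L)) hcp.le hA h2cA hμ0 fun k => ?_).trans
      (hfinal (c₂ * L) (by positivity) (by nlinarith))
    rw [lintegral_const_mul _ ((measurable_iterConv hGm hEm k).const_mul _),
      lintegral_const_mul _ (measurable_iterConv hGm hEm k)]
    exact hterm k _ _ ((lintegral_iterConv_le hGm hEm k).trans (by gcongr))
  · intro Θ
    refine (tsum_ofReal_pow_le (S := ENNReal.ofReal c₂) hcp.le hA h2cA hμ0 fun k => ?_).trans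
      (hfinal c₂ hc₂ (by nlinarith))
    refine hterm k _ _ (iterConv_le hGm (fun Ξ => ENNReal.ofReal_le_ofReal ((hv2 Ξ).trans ?_)) k Θ)
    refine mul_le_of_le_one_right hc₂ (Real.exp_le_one_iff.2 ?_)
    linarith [norm_nonneg Ξ]
  · intro b hb Θ
    have hN' : ∫⁻ Ξ, N Ξ ≤ ENNReal.ofReal (A / c₀) := by
      rw [ENNReal.ofReal_div_of_pos hc₀, ENNReal.le_div_iff_mul_le (by simp [hc₀]) (by simp),
        mul_comm, ← lintegral_const_mul _ hNm]
      refine le_trans (lintegral_mono fun Ξ => ?_) hN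
      gcongr
      exact hv0 Ξ
    have hψB : ∀ Z, ‖remFun b Z‖ ≤ W * (A / c₀) * ‖Z‖ ^ 2 := by
      intro Z
      have h1 := (enorm_remFun_le hb Z).trans (mul_le_mul_left (mul_le_mul_right hN' _) _)
      rw [hWe, ← ENNReal.ofReal_mul hW0, ← ENNReal.ofReal_mul (by positivity), ← ofReal_norm] at h1
      exact (ENNReal.ofReal_le_ofReal_iff (by positivity)).1 h1
    have hBμ : 2 * (W * (A / c₀)) ≤ μ := by
      refine le_trans ?_ h2cA
      have : W / c₀ ≤ c := by
        rw [hc]; linarith [show 0 ≤ c₁ * Real.exp (ρ ^ 2 / 2) * W by positivity]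
      calc 2 * (W * (A / c₀)) = 2 * (W / c₀) * A := by ring
        _ ≤ _ := by gcongr
    refine (mul_le_mul_right (enorm_ft_exp_le (stronglyMeasurable_remFun hb) hμ0 (by positivity)
      hBμ hψB Θ) _).trans ?_
    rw [← ENNReal.tsum_mul_left]
    refine ENNReal.tsum_le_tsum fun k => ?_
    rw [mul_left_comm]
    refine mul_le_mul_right ?_ _
    have hw := entireWindow_gauss (ι := ι) ρ (β := 2 * μ + 1) (by positivity)
    exact hw.weight_mul_enorm_ft_pow_le hb hv hvp hc₁ hvv hρ k Θ

end
end

noncomputable section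

section

variable {ι : Type} [Fintype ι]

/-! ### Functions given by their short-time Fourier transform -/

/-- A smooth function of compact support has an integrable Fourier transform. -/
theorem integrable_ft_of_hasCompactSupport {g : RR ι → ℂ} (hg : ContDiff ℝ (⊤ : ℕ∞) g)
    (hs : HasCompactSupport g) : Integrable (ft g) := by
  have h1 := (FourierTransform.fourier (hs.toSchwartzMap hg) : SchwartzMap (RR ι) ℂ).integrable
    (μ := volume)
  have h2 := h1.comp_smul (R := (2 * Real.pi)⁻¹) (by positivity)
  refine h2.congr (Eventually.of_forall fun ξ => ?_)
  rw [ft_eq_fourier]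
  rfl

/-- Uniqueness for the Fourier transform of integrable functions. -/
theorem ae_eq_zero_of_ft_eq_zero {F : RR ι → ℂ} (hF : Integrable F) (h : ∀ ξ, ft F ξ = 0) :
    ∀ᵐ y, F y = 0 := by
  refine ae_eq_zero_of_integral_contDiff_smul_eq_zero hF.locallyIntegrable fun g hg hs => ?_
  set G : RR ι → ℂ := fun y => (g y : ℂ) with hG
  have hGc : ContDiff ℝ (⊤ : ℕ∞) G := Complex.ofRealCLM.contDiff.comp hg
  have hGs : HasCompactSupport G := hs.comp_left (g := ((↑) : ℝ → ℂ)) Complex.ofReal_zero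
  have hGi : Integrable G := hGc.continuous.integrable_of_hasCompactSupport hGs
  have hft := integrable_ft_of_hasCompactSupport hGc hGs
  have hinv := ft_inversion hGc.continuous hGi hft
  have hc : (((2 * Real.pi) ^ Fintype.card ι : ℝ) : ℂ) ≠ 0 := by
    exact_mod_cast (by positivity : (0 : ℝ) < (2 * Real.pi) ^ Fintype.card ι).ne'
  have hInt : Integrable (Function.uncurry fun (y ξ : RR ι) => F y * (ft G ξ * ecis y (-ξ)))
      (volume.prod volume) := by
    have h1 := hF.mul_prod hft
    have h2 := h1.mul_bdd (c := 1) (g := fun p : RR ι × RR ι => ecis p.1 (-p.2))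
      (by fun_prop : Continuous fun p : RR ι × RR ι => ecis p.1 (-p.2)).aestronglyMeasurable
      (Eventually.of_forall fun p => (norm_ecis _ _).le)
    refine h2.congr (Eventually.of_forall fun p => ?_)
    simp only [Function.uncurry]
    ring
  have key : (((2 * Real.pi) ^ Fintype.card ι : ℝ) : ℂ) * ∫ y, g y • F y = 0 := by
    calc _ = ∫ y, ∫ ξ, F y * (ft G ξ * ecis y (-ξ)) := by
          rw [← integral_const_mul]
          refine integral_congr_ae (Eventually.of_forall fun y => ?_)
          simp only
          rw [integral_const_mul, hinv y, Complex.real_smul]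
          ring
      _ = ∫ ξ, ∫ y, F y * (ft G ξ * ecis y (-ξ)) := integral_integral_swap hInt
      _ = ∫ ξ : RR ι, (0 : ℂ) := by
          refine integral_congr_ae (Eventually.of_forall fun ξ => ?_)
          have := h (-ξ)
          rw [ft] at this
          simp only
          rw [← mul_zero (ft G ξ), ← this, ← integral_const_mul]
          refine integral_congr_ae (Eventually.of_forall fun y => ?_)
          simp only; ring
      _ = 0 := integral_zero _ _
  exact (mul_eq_zero.1 key).resolve_left hc

theorem ae_eq_zero_of_forall_gs {k : RR ι → ℂ} (hk : ∀ ψ : GS ι, Integrable fun x => k x * ψ x)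
    (h : ∀ ψ : GS ι, ∫ x, k x * ψ x = 0) : ∀ᵐ x, k x = 0 := by
  have h0 : ∀ y : RR ι, (gaborAtom 0 0 : GS ι) y = (win y : ℂ) := fun y => by
    change gaborFun 0 0 y = _
    rw [gaborFun_apply, sub_zero, ecis_zero_right, mul_one]
  have h1 : ∀ᵐ x, k x * (gaborAtom 0 0 : GS ι) x = 0 := by
    refine ae_eq_zero_of_ft_eq_zero (hk _) fun ξ => ?_
    rw [← h (gaborAtom 0 ξ), ft]
    refine integral_congr_ae (Eventually.of_forall fun y => ?_)
    simp only [h0]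
    change _ = k y * gaborFun 0 ξ y
    rw [gaborFun_apply, sub_zero, mul_assoc]
  filter_upwards [h1] with x hx
  rw [h0] at hx
  exact (mul_eq_zero.1 hx).resolve_right (by exact_mod_cast (win_pos x).ne')

/-- Continuous functions on phase space with an integrable bound depending on the frequency only. -/
structure FreqBound (V : RR ι × RR ι → ℂ) (N : RR ι → ℝ≥0∞) : Prop where
  cont : Continuous V
  meas : Measurable N
  bound : ∀ z, ‖V z‖ₑ ≤ N z.2
  fin : ∫⁻ Ξ, N Ξ ≠ ∞

/-- The function with short-time Fourier transform `V`. -/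
def synthFun (V : RR ι × RR ι → ℂ) (X : RR ι) : ℂ :=
  ftc ι * ∫ z, V z * gaborFun z.1 (-z.2) X

theorem measurable_win_sub (X : RR ι) : Measurable fun Y : RR ι => ENNReal.ofReal (win (X - Y)) :=
  (continuous_win.comp (by fun_prop)).measurable.ennreal_ofReal

theorem continuous_gaborFun_flip :
    Continuous fun p : RR ι × RR ι × RR ι => gaborFun p.2.1 (-p.2.2) p.1 := by
  have h1 : Continuous fun p : RR ι × RR ι × RR ι => win (p.1 - p.2.1) :=
    continuous_win.comp (by fun_prop)
  simp only [gaborFun_apply]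
  fun_prop

theorem continuous_gaborFun_apply (X : RR ι) :
    Continuous fun z : RR ι × RR ι => gaborFun z.1 (-z.2) X :=
  Continuous.comp (g := fun p : RR ι × RR ι × RR ι => gaborFun p.2.1 (-p.2.2) p.1)
    (f := fun z : RR ι × RR ι => (X, z)) continuous_gaborFun_flip (by fun_prop)

theorem enorm_gaborFun (x ξ y : RR ι) : ‖gaborFun x ξ y‖ₑ = ENNReal.ofReal (win (y - x)) := by
  rw [← ofReal_norm, gaborFun_apply, norm_mul, norm_ecis, mul_one, Complex.norm_real,
    Real.norm_of_nonneg (win_pos _).le]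

namespace FreqBound

variable {V : RR ι × RR ι → ℂ} {N : RR ι → ℝ≥0∞}

theorem lintegral_le (h : FreqBound V N) (X : RR ι) :
    ∫⁻ z : RR ι × RR ι, ‖V z * gaborFun z.1 (-z.2) X‖ₑ ≤ winInt ι * ∫⁻ Ξ, N Ξ := by
  calc _ ≤ ∫⁻ z : RR ι × RR ι, ENNReal.ofReal (win (X - z.1)) * N z.2 := by
        refine lintegral_mono fun z => ?_
        rw [enorm_mul, enorm_gaborFun, mul_comm]
        gcongr
        exact h.bound z
    _ = _ := by
        rw [← lintegral_win_sub X]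
        exact lintegral_prod_mul (measurable_win_sub X).aemeasurable h.meas.aemeasurable

theorem integrable (h : FreqBound V N) (X : RR ι) :
    Integrable fun z : RR ι × RR ι => V z * gaborFun z.1 (-z.2) X := by
  have hc : Continuous fun z : RR ι × RR ι => V z * gaborFun z.1 (-z.2) X :=
    h.cont.mul (continuous_gaborFun_apply X)
  refine ⟨hc.aestronglyMeasurable, ?_⟩
  rw [hasFiniteIntegral_iff_enorm]
  exact (h.lintegral_le X).trans_lt (ENNReal.mul_lt_top winInt_ne_top.lt_top h.fin.lt_top)

theorem enorm_synthFun_le (h : FreqBound V N) (X : RR ι) :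
    ‖synthFun V X‖ₑ ≤ ENNReal.ofReal (ftc ι) * (winInt ι * ∫⁻ Ξ, N Ξ) := by
  rw [synthFun, enorm_mul, ← ofReal_norm, Complex.norm_real, Real.norm_of_nonneg ftc_pos.le]
  gcongr
  exact (enorm_integral_le_lintegral_enorm _).trans (h.lintegral_le X)

/-- The modulus of continuity of synthesized functions. -/
theorem tendsto_modulus (hN : Measurable N) (hfin : ∫⁻ Ξ, N Ξ ≠ ∞) :
    Tendsto (fun Z : RR ι => ∫⁻ z : RR ι × RR ι, N z.2 *
      ‖gaborFun z.1 (-z.2) Z - gaborFun z.1 (-z.2) 0‖ₑ) (𝓝 0) (𝓝 0) := by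
  set c : ℝ := Real.pi ^ (-(Fintype.card ι : ℝ) / 4) with hc
  set B : RR ι → ℝ≥0∞ := fun Y =>
    ENNReal.ofReal (2 * c * Real.exp (1 / 2) * Real.exp (-(1 / 4) * ‖Y‖ ^ 2)) with hB
  have hBm : Measurable B := by fun_prop
  have hBint : ∫⁻ Y, B Y ≠ ∞ := ((integrable_exp_neg_mul_sq_norm (ι := ι) (b := 1 / 4)
    (by norm_num)).const_mul _).lintegral_lt_top.ne
  have hNt : ∀ᵐ z : RR ι × RR ι, N z.2 < ∞ :=
    Measure.quasiMeasurePreserving_snd.ae (ae_lt_top hN hfin)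
  have h0 : ∫⁻ z : RR ι × RR ι, (0 : ℝ≥0∞) = 0 := lintegral_zero
  rw [← h0]
  have hwin : ∀ Z Y : RR ι, ‖Z‖ ≤ 1 → win (Z - Y) ≤
      c * Real.exp (1 / 2) * Real.exp (-(1 / 4) * ‖Y‖ ^ 2) := by
    intro Z Y hZ
    rw [win, mul_assoc, ← Real.exp_add]
    refine mul_le_mul_of_nonneg_left (Real.exp_le_exp.2 ?_) (by positivity)
    have h1 : ‖Y‖ ≤ ‖Z - Y‖ + 1 := by
      have := norm_sub_norm_le Y Z
      rw [norm_sub_rev] at this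
      linarith
    nlinarith [norm_nonneg Y, norm_nonneg (Z - Y), sq_nonneg (‖Z - Y‖ - 1),
      mul_self_le_mul_self (norm_nonneg Y) h1]
  refine tendsto_lintegral_filter_of_dominated_convergence (fun z => B z.1 * N z.2) ?_ ?_ ?_ ?_
  · refine Eventually.of_forall fun Z => (hN.comp measurable_snd).mul (Measurable.enorm ?_)
    exact ((continuous_gaborFun_apply Z).sub (continuous_gaborFun_apply 0)).measurable
  · filter_upwards [Metric.closedBall_mem_nhds (0 : RR ι) one_pos] with Z hZ
    refine Eventually.of_forall fun z => ?_
    rw [mul_comm]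
    gcongr
    refine enorm_sub_le.trans ?_
    rw [enorm_gaborFun, enorm_gaborFun, ← ENNReal.ofReal_add (win_pos _).le (win_pos _).le, hB]
    refine ENNReal.ofReal_le_ofReal ?_
    have h1 := hwin Z z.1 (by simpa using hZ)
    have h2 := hwin 0 z.1 (by simp)
    linarith
  · rw [Measure.volume_eq_prod, lintegral_prod_mul hBm.aemeasurable hN.aemeasurable]
    exact ENNReal.mul_ne_top hBint hfin
  · filter_upwards [hNt] with z hz
    have h1 : Continuous fun Z : RR ι => gaborFun z.1 (-z.2) Z - gaborFun z.1 (-z.2) 0 :=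
      (continuous_gaborFun_flip.comp (by fun_prop : Continuous fun Z : RR ι => (Z, z))).sub
        continuous_const
    have h2 : Tendsto (fun Z : RR ι => ‖gaborFun z.1 (-z.2) Z - gaborFun z.1 (-z.2) 0‖ₑ) (𝓝 0)
        (𝓝 0) := by
      have := (continuous_enorm.comp h1).tendsto (0 : RR ι)
      simpa [Function.comp_def] using this
    have := ENNReal.Tendsto.const_mul (a := N z.2) h2 (Or.inr hz.ne)
    simpa using this

theorem enorm_synthFun_sub_le (h : FreqBound V N) (X Z : RR ι) :
    ‖synthFun V (X + Z) - synthFun V X‖ₑ ≤ ENNReal.ofReal (ftc ι) *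
      ∫⁻ z : RR ι × RR ι, N z.2 * ‖gaborFun z.1 (-z.2) Z - gaborFun z.1 (-z.2) 0‖ₑ := by
  rw [synthFun, synthFun, ← mul_sub, ← integral_sub (h.integrable _) (h.integrable _), enorm_mul,
    ← ofReal_norm (ftc ι : ℂ), Complex.norm_real, Real.norm_of_nonneg ftc_pos.le]
  gcongr
  refine (enorm_integral_le_lintegral_enorm _).trans ?_
  let e : (RR ι × RR ι) ≃ᵐ (RR ι × RR ι) :=
    (MeasurableEquiv.addRight X).prodCongr (MeasurableEquiv.refl (RR ι))
  have he : MeasurePreserving e volume volume :=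
    (measurePreserving_add_right volume X).prod (MeasurePreserving.id volume)
  rw [← he.lintegral_comp_emb e.measurableEmbedding]
  refine lintegral_mono fun z => ?_
  change ‖V (z.1 + X, z.2) * gaborFun (z.1 + X) (-z.2) (X + Z) -
    V (z.1 + X, z.2) * gaborFun (z.1 + X) (-z.2) X‖ₑ ≤ _
  rw [← mul_sub, enorm_mul]
  refine mul_le_mul' (h.bound _) (le_of_eq ?_)
  rw [gaborFun_apply, gaborFun_apply, gaborFun_apply, gaborFun_apply, ecis_add_left,
    ecis_zero_left]
  have e1 : X + Z - (z.1 + X) = Z - z.1 := by abel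
  have e2 : X - (z.1 + X) = 0 - z.1 := by abel
  rw [e1, e2, mul_one, mul_left_comm, mul_comm ((win (0 - z.1) : ℝ) : ℂ), ← mul_sub, enorm_mul,
    ← ofReal_norm (ecis X (-z.2)), norm_ecis, ENNReal.ofReal_one, one_mul]

theorem uniformContinuous_synthFun (h : FreqBound V N) : UniformContinuous (synthFun V) := by
  have ht := ENNReal.Tendsto.const_mul (a := ENNReal.ofReal (ftc ι))
    (tendsto_modulus h.meas h.fin) (Or.inr ENNReal.ofReal_ne_top)
  rw [mul_zero] at ht
  rw [Metric.uniformContinuous_iff]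
  intro ε hε
  have h1 := (ht.eventually (gt_mem_nhds (ENNReal.ofReal_pos.2 hε)))
  obtain ⟨δ, hδ, H⟩ := Metric.eventually_nhds_iff.1 h1
  refine ⟨δ, hδ, fun {a b} hab => ?_⟩
  have h2 := (h.enorm_synthFun_sub_le b (a - b)).trans_lt (H (by simpa [dist_eq_norm] using hab))
  rw [add_sub_cancel, ← ofReal_norm, ENNReal.ofReal_lt_ofReal_iff hε] at h2
  rwa [dist_eq_norm]

theorem continuous_synthFun (h : FreqBound V N) : Continuous (synthFun V) :=
  h.uniformContinuous_synthFun.continuous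

theorem isGivenBy_synthFun {u : GSDual ι} (h : FreqBound (stft u) N) :
    IsGivenBy u (synthFun (stft u)) := by
  intro ψ
  have hψ := ψ.integrable
  have hψc : Continuous (ψ : RR ι → ℂ) := ψ.2.1.continuous
  set c : ℝ := (ENNReal.ofReal (ftc ι) * (winInt ι * ∫⁻ Ξ, N Ξ)).toReal with hc
  have hct : ENNReal.ofReal (ftc ι) * (winInt ι * ∫⁻ Ξ, N Ξ) ≠ ∞ :=
    ENNReal.mul_ne_top ENNReal.ofReal_ne_top (ENNReal.mul_ne_top winInt_ne_top h.fin)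
  have hb : ∀ X, ‖synthFun (stft u) X‖ ≤ c := fun X => by
    have := ENNReal.toReal_mono hct (h.enorm_synthFun_le X)
    rwa [toReal_enorm] at this
  refine ⟨hψ.bdd_mul (c := c) h.continuous_synthFun.aestronglyMeasurable
    (Eventually.of_forall hb), ?_⟩
  have hInt : Integrable (Function.uncurry fun (X : RR ι) (z : RR ι × RR ι) =>
      ψ X * (stft u z * gaborFun z.1 (-z.2) X)) (volume.prod volume) := by
    have hcont : Continuous (Function.uncurry fun (X : RR ι) (z : RR ι × RR ι) =>
        ψ X * (stft u z * gaborFun z.1 (-z.2) X)) :=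
      (hψc.comp continuous_fst).mul ((h.cont.comp continuous_snd).mul continuous_gaborFun_flip)
    refine ⟨hcont.aestronglyMeasurable, ?_⟩
    rw [hasFiniteIntegral_iff_enorm, lintegral_prod _ hcont.measurable.enorm.aemeasurable]
    refine lt_of_le_of_lt (lintegral_mono fun X => ?_) (?_ : ∫⁻ X, ‖ψ X‖ₑ *
      (winInt ι * ∫⁻ Ξ, N Ξ) < ∞)
    · simp only [Function.uncurry_apply_pair, enorm_mul (ψ X)]
      rw [lintegral_const_mul' _ _ enorm_ne_top]
      gcongr
      exact h.lintegral_le X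
    · rw [lintegral_mul_const' _ _ (ENNReal.mul_ne_top winInt_ne_top h.fin)]
      exact ENNReal.mul_lt_top hψ.2 (ENNReal.mul_lt_top winInt_ne_top.lt_top h.fin.lt_top)
  calc u ψ = ∫ z, stft u z * stft ψ.toDual (z.1, -z.2) := dual_inversion u ψ
    _ = ftc ι * ∫ z, ∫ X, ψ X * (stft u z * gaborFun z.1 (-z.2) X) := by
        rw [← integral_const_mul]
        refine integral_congr_ae (Eventually.of_forall fun z => ?_)
        simp only
        rw [stft_eq ψ.toDual, mul_left_comm]
        congr 1
        change stft u z * ∫ X, ψ X * gaborFun z.1 (-z.2) X = _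
        rw [← integral_const_mul]
        refine integral_congr_ae (Eventually.of_forall fun X => ?_)
        simp only; ring
    _ = ftc ι * ∫ X, ∫ z, ψ X * (stft u z * gaborFun z.1 (-z.2) X) := by
        rw [integral_integral_swap hInt]
    _ = _ := by
        rw [← integral_const_mul]
        refine integral_congr_ae (Eventually.of_forall fun X => ?_)
        simp only
        rw [integral_const_mul, synthFun]
        ring

end FreqBound

theorem IsGivenBy.ae_eq {u : GSDual ι} {f g : RR ι → ℂ} (hf : IsGivenBy u f)
    (hg : IsGivenBy u g) : ∀ᵐ x, f x = g x := by
  have h := ae_eq_zero_of_forall_gs (k := fun x => f x - g x)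
    (fun ψ => by simpa only [sub_mul] using! (hf ψ).1.sub (hg ψ).1)
    (fun ψ => by
      simp only [sub_mul]
      rw [integral_sub (hf ψ).1 (hg ψ).1, ← (hf ψ).2, ← (hg ψ).2, sub_self])
  filter_upwards [h] with x hx
  exact sub_eq_zero.1 hx

end
end

noncomputable section

section

variable {ι : Type} [Fintype ι]

/-! ### Regularity of functions with bounded continuous second derivatives -/

/-- The convolution of `φ` with `ρ`. -/
def mollify (φ ρ : RR ι → ℝ) (X : RR ι) : ℝ := ∫ Y, φ Y * ρ (X - Y)

theorem hasFDerivAt_mollify {φ ρ : RR ι → ℝ} (hφ : LocallyIntegrable φ)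
    (hρ : ContDiff ℝ (⊤ : ℕ∞) ρ) (hs : HasCompactSupport ρ) (X : RR ι) :
    ∃ L : RR ι →L[ℝ] ℝ, HasFDerivAt (mollify φ ρ) L X ∧
      ∀ e, L e = mollify φ (fun Y => fderiv ℝ ρ Y e) X := by
  have h1 := hs.hasFDerivAt_convolution_right (ContinuousLinearMap.mul ℝ ℝ) (μ := volume) hφ
    (hρ.of_le (by exact_mod_cast le_top)) X
  refine ⟨_, h1, fun e => ?_⟩
  rw [convolution_precompR_apply (ContinuousLinearMap.mul ℝ ℝ) hφ (hs.fderiv ℝ)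
    (hρ.continuous_fderiv (by simp))]
  rfl

theorem sum_single_smul [DecidableEq ι] (Z : RR ι) :
    Z = ∑ i, Z i • (EuclideanSpace.single i (1 : ℝ) : RR ι) := by
  ext k
  simp [Pi.single_apply]

/-- `φ` is twice differentiable with gradient `p` and bounded continuous Hessian `h`, and satisfies
Taylor's formula of order two. -/
structure IsRegularPhase (φ : RR ι → ℝ) (p : RR ι → RR ι) (h : ι → ι → RR ι → ℝ) : Prop where
  continuous : Continuous φ
  cont_hess : ∀ i j, Continuous (h i j)
  symm : ∀ i j X, h i j X = h j i X
  hasGradientAt : ∀ X, HasGradientAt φ (p X) X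
  hasFDerivAt : ∀ j X, HasFDerivAt (fun X => p X j)
    (∑ i, h i j X • (EuclideanSpace.proj i : RR ι →L[ℝ] ℝ)) X
  taylor : ∀ X Z, φ (X + Z) - φ X - inner ℝ (p X) Z =
    ∫ t in (0 : ℝ)..1, (1 - t) * ∑ i, ∑ j, h i j (X + t • Z) * (Z i * Z j)

theorem abs_mollify_le {h ρ : RR ι → ℝ} {M : ℝ} (hM : ∀ X, |h X| ≤ M) (hρ0 : ∀ X, 0 ≤ ρ X)
    (hρi : Integrable ρ) (hρ1 : ∫ X, ρ X = 1) (X : RR ι) : |mollify h ρ X| ≤ M := by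
  have h1 : ∫ Y, ρ (X - Y) = 1 := by rw [integral_sub_left_eq_self (fun Y => ρ Y) volume X, hρ1]
  rw [mollify, ← Real.norm_eq_abs]
  calc _ ≤ ∫ Y, M * ρ (X - Y) := by
        refine norm_integral_le_of_norm_le ((hρi.comp_sub_left X).const_mul M)
          (Eventually.of_forall fun Y => ?_)
        rw [norm_mul, Real.norm_eq_abs, Real.norm_of_nonneg (hρ0 _)]
        exact mul_le_mul_of_nonneg_right (hM Y) (hρ0 _)
    _ = M := by rw [integral_const_mul, h1, mul_one]

theorem continuous_mollify {φ ρ : RR ι → ℝ} (hφ : LocallyIntegrable φ)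
    (hρ : ContDiff ℝ (⊤ : ℕ∞) ρ) (hs : HasCompactSupport ρ) : Continuous (mollify φ ρ) :=
  continuous_iff_continuousAt.2 fun X => by
    obtain ⟨L, hL, -⟩ := hasFDerivAt_mollify hφ hρ hs X
    exact hL.continuousAt

theorem hasDerivAt_line (X Z : RR ι) (t : ℝ) :
    HasDerivAt (fun t : ℝ => X + t • Z) Z t := by
  simpa using ((hasDerivAt_id t).smul_const Z).const_add X

theorem contDiff_fderiv_apply {ρ : RR ι → ℝ} (hρ : ContDiff ℝ (⊤ : ℕ∞) ρ) (e : RR ι) :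
    ContDiff ℝ (⊤ : ℕ∞) fun Y => fderiv ℝ ρ Y e :=
  (hρ.fderiv_right (m := (⊤ : ℕ∞)) (by simp)).clm_apply contDiff_const

theorem exists_mollifier : ∃ ρ : ℕ → RR ι → ℝ, (∀ n, ContDiff ℝ (⊤ : ℕ∞) (ρ n)) ∧
    (∀ n, HasCompactSupport (ρ n)) ∧ (∀ n X, 0 ≤ ρ n X) ∧ (∀ n, ∫ X, ρ n X = 1) ∧
    ∀ g : RR ι → ℝ, Continuous g → ∀ X, Tendsto (fun n => mollify g (ρ n) X) atTop (𝓝 (g X)) := by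
  let B : ℕ → ContDiffBump (0 : RR ι) := fun n =>
    ⟨1 / ((n : ℝ) + 1) / 2, 1 / ((n : ℝ) + 1), by positivity, half_lt_self (by positivity)⟩
  refine ⟨fun n => (B n).normed volume, fun n => (B n).contDiff_normed,
    fun n => (B n).hasCompactSupport_normed, fun n X => (B n).nonneg_normed X,
    fun n => (B n).integral_normed, fun g hg X => ?_⟩
  have := ContDiffBump.convolution_tendsto_right_of_continuous (φ := B) (l := atTop)
    (μ := (volume : Measure (RR ι))) tendsto_one_div_add_atTop_nhds_zero_nat hg X
  refine this.congr fun n => ?_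
  rw [convolution_lsmul_swap, mollify]
  exact integral_congr_ae (Eventually.of_forall fun Y => mul_comm _ _)

theorem hasFDerivAt_of_line_integral {f : RR ι → ℝ} {k : ι → RR ι → ℝ} (hk : ∀ i, Continuous (k i))
    {X : RR ι} (hf : ∀ Z, f (X + Z) - f X = ∫ t in (0 : ℝ)..1, ∑ i, k i (X + t • Z) * Z i) :
    HasFDerivAt f (∑ i, k i X • (EuclideanSpace.proj i : RR ι →L[ℝ] ℝ)) X := by
  rw [hasFDerivAt_iff_isLittleO_nhds_zero, Asymptotics.isLittleO_iff]
  intro ε hε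
  have hε' : 0 < ε / (Fintype.card ι + 1) := by positivity
  have h1 : ∀ᶠ Y in 𝓝 X, ∀ i, |k i Y - k i X| < ε / (Fintype.card ι + 1) :=
    eventually_all.2 fun i => by
      have := Metric.tendsto_nhds.1 ((hk i).tendsto X) _ hε'
      simpa [Real.dist_eq] using this
  obtain ⟨r, hr, hr'⟩ := Metric.eventually_nhds_iff.1 h1
  filter_upwards [Metric.ball_mem_nhds (0 : RR ι) hr] with Z hZ
  have hZ' : ‖Z‖ < r := by simpa using hZ
  have hL : (∑ i, k i X • (EuclideanSpace.proj i : RR ι →L[ℝ] ℝ)) Z =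
      ∫ t in (0 : ℝ)..1, ∑ i, k i X * Z i := by
    simp [sum_apply]
  have hi : ∀ g : ι → ℝ → ℝ, (∀ i, Continuous (g i)) →
      IntervalIntegrable (fun t => ∑ i, g i t * Z i) volume 0 1 := fun g hg =>
    (continuous_finsetSum _ fun i _ => (hg i).mul continuous_const).intervalIntegrable _ _
  rw [hf Z, hL, ← intervalIntegral.integral_sub
    (hi (fun i t => k i (X + t • Z)) fun i => (hk i).comp (by fun_prop))
    (hi (fun i _ => k i X) fun i => continuous_const)]
  have := intervalIntegral.norm_integral_le_of_norm_le_const (a := (0 : ℝ)) (b := 1)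
    (f := fun t => ∑ i, k i (X + t • Z) * Z i - ∑ i, k i X * Z i) (C := ε * ‖Z‖) ?_
  · simpa using this
  intro t ht
  rw [Set.uIoc_of_le zero_le_one] at ht
  rw [← Finset.sum_sub_distrib]
  calc ‖∑ i, (k i (X + t • Z) * Z i - k i X * Z i)‖
      ≤ ∑ i : ι, ε / (Fintype.card ι + 1) * ‖Z‖ := by
        refine norm_sum_le_of_le _ fun i _ => ?_
        rw [← sub_mul, norm_mul]
        refine mul_le_mul (hr' ?_ i).le (PiLp.norm_apply_le Z i) (norm_nonneg _) hε'.le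
        rw [dist_eq_norm, add_sub_cancel_left, norm_smul, Real.norm_of_nonneg ht.1.le]
        exact (mul_le_of_le_one_left (norm_nonneg _) ht.2).trans_lt hZ'
    _ ≤ ε * ‖Z‖ := by
        rw [Finset.sum_const, Finset.card_univ, nsmul_eq_mul, ← mul_assoc]
        refine mul_le_mul_of_nonneg_right ?_ (norm_nonneg _)
        rw [mul_div_assoc', div_le_iff₀ (by positivity)]
        nlinarith

/-- The continuous functions `h i j` are the weak second derivatives of `φ`. -/
structure HasWeakHessian [DecidableEq ι] (φ : RR ι → ℝ) (h : ι → ι → RR ι → ℝ) : Prop where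
  continuous : Continuous φ
  cont_hess : ∀ i j, Continuous (h i j)
  weakDeriv : ∀ i j, ∀ ψ : RR ι → ℝ, ContDiff ℝ (⊤ : ℕ∞) ψ → HasCompactSupport ψ →
    ∫ X, φ X * fderiv ℝ (fun Y => fderiv ℝ ψ Y (EuclideanSpace.single j 1)) X
      (EuclideanSpace.single i 1) = ∫ X, h i j X * ψ X

namespace HasWeakHessian

variable [DecidableEq ι] {φ : RR ι → ℝ} {h : ι → ι → RR ι → ℝ} {ρ : RR ι → ℝ}

theorem mollify_hess (H : HasWeakHessian φ h) (hρ : ContDiff ℝ (⊤ : ℕ∞) ρ)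
    (hs : HasCompactSupport ρ) (i j : ι) (X : RR ι) :
    mollify φ (fun Y => fderiv ℝ (fun Y => fderiv ℝ ρ Y (EuclideanSpace.single j 1)) Y
      (EuclideanSpace.single i 1)) X = mollify (h i j) ρ X := by
  have hd : ∀ g : RR ι → ℝ, ContDiff ℝ (⊤ : ℕ∞) g → ∀ e Y,
      fderiv ℝ (fun Y => g (X - Y)) Y e = -fderiv ℝ g (X - Y) e := by
    intro g hg e Y
    have h1 : HasFDerivAt (fun Y : RR ι => X - Y) (-ContinuousLinearMap.id ℝ (RR ι)) Y := by
      simpa using (hasFDerivAt_id Y).const_sub X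
    have h2 := ((hg.differentiable (by simp)) (X - Y)).hasFDerivAt.comp Y h1
    rw [show (fun Y => g (X - Y)) = g ∘ fun Y => X - Y from rfl, h2.fderiv]
    simp
  have hψ : ContDiff ℝ (⊤ : ℕ∞) fun Y => ρ (X - Y) := hρ.comp (contDiff_const.sub contDiff_id)
  have hψs : HasCompactSupport fun Y => ρ (X - Y) :=
    hs.comp_homeomorph (Homeomorph.subLeft X)
  rw [mollify, mollify, ← H.weakDeriv i j _ hψ hψs]
  refine integral_congr_ae (Eventually.of_forall fun Y => ?_)
  simp only
  congr 1
  have e1 : (fun Y => fderiv ℝ (fun Y => ρ (X - Y)) Y (EuclideanSpace.single j 1)) =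
      fun Y => -fderiv ℝ ρ (X - Y) (EuclideanSpace.single j 1) :=
    funext fun Y => hd ρ hρ _ Y
  rw [e1, fderiv_fun_neg, neg_apply, hd (fun Y => fderiv ℝ ρ Y (EuclideanSpace.single j 1))
    (contDiff_fderiv_apply hρ _), neg_neg]

theorem hasDerivAt_mollify_line (hφ : Continuous φ) (hρ : ContDiff ℝ (⊤ : ℕ∞) ρ)
    (hs : HasCompactSupport ρ) (X Z : RR ι) (t : ℝ) :
    HasDerivAt (fun t : ℝ => mollify φ ρ (X + t • Z))
      (∑ j, mollify φ (fun Y => fderiv ℝ ρ Y (EuclideanSpace.single j 1)) (X + t • Z) * Z j) t := by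
  obtain ⟨L, hL, hLe⟩ := hasFDerivAt_mollify hφ.locallyIntegrable hρ hs (X + t • Z)
  have := hL.comp_hasDerivAt t (hasDerivAt_line X Z t)
  refine this.congr_deriv ?_
  rw [show L Z = L (∑ i, Z i • (EuclideanSpace.single i (1 : ℝ) : RR ι)) from
    congrArg L (sum_single_smul Z), map_sum]
  refine Finset.sum_congr rfl fun j _ => ?_
  rw [map_smul, hLe, smul_eq_mul, mul_comm]

theorem hasDerivAt_mollify_grad_line (H : HasWeakHessian φ h) (hρ : ContDiff ℝ (⊤ : ℕ∞) ρ)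
    (hs : HasCompactSupport ρ) (j : ι) (X Z : RR ι) (t : ℝ) :
    HasDerivAt (fun t : ℝ =>
      mollify φ (fun Y => fderiv ℝ ρ Y (EuclideanSpace.single j 1)) (X + t • Z))
      (∑ i, mollify (h i j) ρ (X + t • Z) * Z i) t := by
  have := hasDerivAt_mollify_line H.continuous (contDiff_fderiv_apply hρ (EuclideanSpace.single j 1))
    (hs.fderiv_apply ℝ _) X Z t
  simpa only [H.mollify_hess hρ hs] using this

theorem mollify_grad_sub (H : HasWeakHessian φ h) (hρ : ContDiff ℝ (⊤ : ℕ∞) ρ)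
    (hs : HasCompactSupport ρ) (j : ι) (X Z : RR ι) :
    mollify φ (fun Y => fderiv ℝ ρ Y (EuclideanSpace.single j 1)) (X + Z) -
      mollify φ (fun Y => fderiv ℝ ρ Y (EuclideanSpace.single j 1)) X =
      ∫ t in (0 : ℝ)..1, ∑ i, mollify (h i j) ρ (X + t • Z) * Z i := by
  have hcont : Continuous fun t : ℝ => ∑ i, mollify (h i j) ρ (X + t • Z) * Z i :=
    continuous_finsetSum _ fun i _ =>
      ((continuous_mollify (H.cont_hess i j).locallyIntegrable hρ hs).comp (by fun_prop)).mul
        continuous_const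
  rw [intervalIntegral.integral_eq_sub_of_hasDerivAt
    (fun t _ => H.hasDerivAt_mollify_grad_line hρ hs j X Z t)
    (hcont.intervalIntegrable _ _)]
  simp

theorem mollify_taylor (H : HasWeakHessian φ h) (hρ : ContDiff ℝ (⊤ : ℕ∞) ρ)
    (hs : HasCompactSupport ρ) (X Z : RR ι) :
    mollify φ ρ (X + Z) - mollify φ ρ X -
      ∑ j, mollify φ (fun Y => fderiv ℝ ρ Y (EuclideanSpace.single j 1)) X * Z j =
      ∫ t in (0 : ℝ)..1, (1 - t) * ∑ i, ∑ j, mollify (h i j) ρ (X + t • Z) * (Z i * Z j) := by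
  have hcont : Continuous fun t : ℝ =>
      (1 - t) * ∑ i, ∑ j, mollify (h i j) ρ (X + t • Z) * (Z i * Z j) :=
    (by fun_prop : Continuous fun t : ℝ => 1 - t).mul
      (continuous_finsetSum _ fun i _ => continuous_finsetSum _ fun j _ =>
      ((continuous_mollify (H.cont_hess i j).locallyIntegrable hρ hs).comp (by fun_prop)).mul
        continuous_const)
  have hd : ∀ t : ℝ, HasDerivAt (fun t : ℝ => mollify φ ρ (X + t • Z) + (1 - t) *
      ∑ j, mollify φ (fun Y => fderiv ℝ ρ Y (EuclideanSpace.single j 1)) (X + t • Z) * Z j)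
      ((1 - t) * ∑ i, ∑ j, mollify (h i j) ρ (X + t • Z) * (Z i * Z j)) t := by
    intro t
    have h1 := hasDerivAt_mollify_line H.continuous hρ hs X Z t
    have h2 := HasDerivAt.fun_sum (u := Finset.univ) fun j _ =>
      (H.hasDerivAt_mollify_grad_line hρ hs j X Z t).mul_const (Z j)
    have h3 := ((hasDerivAt_id t).const_sub 1).mul h2
    have h4 := h1.add h3
    refine h4.congr_deriv ?_
    simp only [id_eq, Finset.sum_mul]
    rw [Finset.sum_comm, neg_one_mul, ← add_assoc, add_neg_cancel, zero_add]
    congr 1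
    refine Finset.sum_congr rfl fun i _ => Finset.sum_congr rfl fun j _ => by ring
  rw [intervalIntegral.integral_eq_sub_of_hasDerivAt (fun t _ => hd t)
    (hcont.intervalIntegrable _ _)]
  simp
  ring

theorem mollify_hess_symm (H : HasWeakHessian φ h) (hρ : ContDiff ℝ (⊤ : ℕ∞) ρ)
    (hs : HasCompactSupport ρ) (i j : ι) (X : RR ι) :
    mollify (h i j) ρ X = mollify (h j i) ρ X := by
  rw [← H.mollify_hess hρ hs, ← H.mollify_hess hρ hs]
  congr 1
  funext Y
  have hsymm : IsSymmSndFDerivAt ℝ ρ Y :=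
    hρ.contDiffAt.isSymmSndFDerivAt (by simpa using (mod_cast le_top : ((2 : ℕ∞) : WithTop ℕ∞) ≤ ((⊤ : ℕ∞) : WithTop ℕ∞)))
  have hd : DifferentiableAt ℝ (fderiv ℝ ρ) Y :=
    (hρ.fderiv_right (m := (⊤ : ℕ∞)) (by simp)).differentiable (by simp) Y
  have e : ∀ a b : RR ι, fderiv ℝ (fun Y => fderiv ℝ ρ Y a) Y b = fderiv ℝ (fderiv ℝ ρ) Y b a := by
    intro a b
    have := (hd.hasFDerivAt.clm_apply (hasFDerivAt_const a Y)).fderiv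
    rw [this]
    simp
  rw [e, e]
  exact hsymm _ _

theorem exists_isRegularPhase (H : HasWeakHessian φ h) {M : ℝ} (hM : ∀ i j X, |h i j X| ≤ M) :
    ∃ p, IsRegularPhase φ p h := by
  obtain ⟨ρ, hρ, hs, hρ0, hρ1, hlim⟩ := exists_mollifier (ι := ι)
  have hρi : ∀ n, Integrable (ρ n) := fun n =>
    (hρ n).continuous.integrable_of_hasCompactSupport (hs n)
  have hml : ∀ n i j X, |mollify (h i j) (ρ n) X| ≤ M := fun n i j X =>
    abs_mollify_le (hM i j) (hρ0 n) (hρi n) (hρ1 n) X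
  have hmc : ∀ n i j, Continuous (mollify (h i j) (ρ n)) := fun n i j =>
    continuous_mollify (H.cont_hess i j).locallyIntegrable (hρ n) (hs n)
  set R : RR ι → RR ι → ℝ := fun X Z =>
    ∫ t in (0 : ℝ)..1, (1 - t) * ∑ i, ∑ j, h i j (X + t • Z) * (Z i * Z j) with hR
  have hquad : ∀ (g : ι → ι → ℝ) (Z : RR ι), (∀ i j, |g i j| ≤ M) → ∀ t ∈ Set.Ioc (0 : ℝ) 1,
      ‖(1 - t) * ∑ i, ∑ j, g i j * (Z i * Z j)‖ ≤ ∑ i : ι, ∑ j : ι, M * (‖Z‖ * ‖Z‖) := by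
    intro g Z hg t ht
    rw [norm_mul, Real.norm_of_nonneg (by linarith [ht.2] : 0 ≤ 1 - t)]
    refine (mul_le_of_le_one_left (norm_nonneg _) (by linarith [ht.1])).trans ?_
    refine norm_sum_le_of_le _ fun i _ => norm_sum_le_of_le _ fun j _ => ?_
    rw [norm_mul, norm_mul]
    exact mul_le_mul (hg i j) (mul_le_mul (PiLp.norm_apply_le Z i) (PiLp.norm_apply_le Z j)
      (norm_nonneg _) (norm_nonneg _)) (by positivity) ((abs_nonneg _).trans (hg i j))
  have hRlim : ∀ X Z, Tendsto (fun n => ∫ t in (0 : ℝ)..1, (1 - t) *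
      ∑ i, ∑ j, mollify (h i j) (ρ n) (X + t • Z) * (Z i * Z j)) atTop (𝓝 (R X Z)) := by
    intro X Z
    refine intervalIntegral.tendsto_integral_filter_of_dominated_convergence
      (fun _ => ∑ i : ι, ∑ j : ι, M * (‖Z‖ * ‖Z‖)) ?_ ?_ (by simp) ?_
    · refine Eventually.of_forall fun n => Continuous.aestronglyMeasurable ?_
      exact (by fun_prop : Continuous fun t : ℝ => 1 - t).mul
        (continuous_finsetSum _ fun i _ => continuous_finsetSum _ fun j _ =>
          ((hmc n i j).comp (by fun_prop)).mul continuous_const)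
    · refine Eventually.of_forall fun n => Eventually.of_forall fun t ht => ?_
      rw [Set.uIoc_of_le zero_le_one] at ht
      exact hquad _ Z (fun i j => hml n i j _) t ht
    · refine Eventually.of_forall fun t _ => ?_
      exact (tendsto_finsetSum _ fun i _ => tendsto_finsetSum _ fun j _ =>
        (hlim _ (H.cont_hess i j) _).mul_const _).const_mul _
  set p : RR ι → RR ι := fun X => WithLp.toLp 2 fun j =>
    φ (X + EuclideanSpace.single j 1) - φ X - R X (EuclideanSpace.single j 1) with hp
  have hgrad : ∀ X j, Tendsto (fun n =>
      mollify φ (fun Y => fderiv ℝ (ρ n) Y (EuclideanSpace.single j 1)) X) atTop (𝓝 (p X j)) := by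
    intro X j
    have h1 := ((hlim φ H.continuous (X + EuclideanSpace.single j 1)).sub
      (hlim φ H.continuous X)).sub (hRlim X (EuclideanSpace.single j 1))
    refine h1.congr fun n => ?_
    rw [← H.mollify_taylor (hρ n) (hs n)]
    simp
  have htaylor : ∀ X Z, φ (X + Z) - φ X - inner ℝ (p X) Z = R X Z := by
    intro X Z
    have h1 := ((hlim φ H.continuous (X + Z)).sub (hlim φ H.continuous X)).sub
      (tendsto_finsetSum Finset.univ fun j _ => (hgrad X j).mul_const (Z j))
    have h2 := tendsto_nhds_unique h1 ((hRlim X Z).congr fun n =>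
      (H.mollify_taylor (hρ n) (hs n) X Z).symm)
    rw [← h2, PiLp.inner_apply]
    simp [mul_comm]
  have hdiff : ∀ j X Z, p (X + Z) j - p X j =
      ∫ t in (0 : ℝ)..1, ∑ i, h i j (X + t • Z) * Z i := by
    intro j X Z
    refine tendsto_nhds_unique ((hgrad (X + Z) j).sub (hgrad X j)) ?_
    simp only [H.mollify_grad_sub (hρ _) (hs _)]
    refine intervalIntegral.tendsto_integral_filter_of_dominated_convergence
      (fun _ => ∑ i : ι, M * ‖Z‖) ?_ ?_ (by simp) ?_
    · refine Eventually.of_forall fun n => Continuous.aestronglyMeasurable ?_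
      exact continuous_finsetSum _ fun i _ => ((hmc n i j).comp (by fun_prop)).mul continuous_const
    · refine Eventually.of_forall fun n => Eventually.of_forall fun t _ => ?_
      refine norm_sum_le_of_le _ fun i _ => ?_
      rw [norm_mul]
      exact mul_le_mul (hml n i j _) (PiLp.norm_apply_le Z i) (norm_nonneg _)
        ((abs_nonneg _).trans (hml n i j X))
    · refine Eventually.of_forall fun t _ => ?_
      exact tendsto_finsetSum _ fun i _ => (hlim _ (H.cont_hess i j) _).mul_const _
  refine ⟨p, H.continuous, H.cont_hess, fun i j X => ?_, fun X => ?_, fun j X => ?_, htaylor⟩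
  · exact tendsto_nhds_unique (hlim _ (H.cont_hess i j) X)
      ((hlim _ (H.cont_hess j i) X).congr fun n => H.mollify_hess_symm (hρ n) (hs n) j i X)
  · rw [hasGradientAt_iff_hasFDerivAt, hasFDerivAt_iff_isLittleO_nhds_zero]
    have hb : ∀ Z, ‖φ (X + Z) - φ X - (InnerProductSpace.toDual ℝ (RR ι)) (p X) Z‖ ≤
        (∑ i : ι, ∑ j : ι, M) * ‖‖Z‖ ^ 2‖ := by
      intro Z
      rw [InnerProductSpace.toDual_apply_apply, htaylor]
      have := intervalIntegral.norm_integral_le_of_norm_le_const (a := (0 : ℝ)) (b := 1)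
        (f := fun t => (1 - t) * ∑ i, ∑ j, h i j (X + t • Z) * (Z i * Z j))
        (C := ∑ i : ι, ∑ j : ι, M * (‖Z‖ * ‖Z‖)) ?_
      · refine this.trans (le_of_eq ?_)
        rw [Real.norm_of_nonneg (by positivity : 0 ≤ ‖Z‖ ^ 2)]
        simp only [sub_zero, abs_one, mul_one, Finset.sum_mul, pow_two]
      · intro t ht
        rw [Set.uIoc_of_le zero_le_one] at ht
        exact hquad _ Z (fun i j => hM i j _) t ht
    have h1 : (fun Z => φ (X + Z) - φ X - (InnerProductSpace.toDual ℝ (RR ι)) (p X) Z) =O[𝓝 0]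
        fun Z : RR ι => ‖Z‖ ^ 2 := Asymptotics.IsBigO.of_bound _ (Eventually.of_forall hb)
    exact h1.trans_isLittleO (Asymptotics.isLittleO_norm_pow_id one_lt_two)
  · exact hasFDerivAt_of_line_integral (fun i => H.cont_hess i j) (hdiff j X)

end HasWeakHessian

end
end

noncomputable section

section

variable {ι : Type} [Fintype ι]

/-! ### Submultiplicative weights -/

/-- Weights that are bounded from below, compatible with dilations by factors in `[0, 1]`, and of
exponential growth. -/
structure IsDilationWeight (v : RR ι → ℝ) (c₀ c₁ c₂ ρ : ℝ) : Prop where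
  pos : 0 < c₀
  nonneg : 0 ≤ c₁
  rate : 0 ≤ ρ
  le : ∀ Θ, c₀ ≤ v Θ
  dilation : ∀ t ∈ Set.Icc (0 : ℝ) 1, ∀ Θ Ξ, v Θ ≤ c₁ * (v (Θ - t • Ξ) * v Ξ)
  growth : ∀ Θ, v Θ * Real.exp (-ρ * ‖Θ‖) ≤ c₂ * Real.exp (-1 * ‖Θ‖)

theorem Weight.IsP.exists_isDilationWeight {s : ℝ} (hs : 1 < s) {v : Weight (RR ι)} (hv : v.IsP s)
    (hsub : v.IsSubmultiplicative)
    (hdil : ∃ D : ℝ, ∀ t ∈ Set.Icc (0 : ℝ) 1, ∀ᵐ Ξ, v (t • Ξ) / v Ξ ≤ D) :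
    ∃ c₀ c₁ c₂ ρ, IsDilationWeight v c₀ c₁ c₂ ρ := by
  obtain ⟨r, C, hr, hC, H⟩ := hv.exists_exp_bound hs
  obtain ⟨heven, K, hK, hK'⟩ := hsub
  obtain ⟨D, hD⟩ := hdil
  have hlow : ∀ Θ, Real.sqrt (v 0 / K) ≤ v Θ := fun Θ => by
    refine Real.sqrt_le_iff.2 ⟨(v.pos' Θ).le, ?_⟩
    have := hK' Θ (-Θ)
    rw [add_neg_cancel, heven] at this
    rw [div_le_iff₀ hK]
    linarith
  have hdil' : ∀ t ∈ Set.Icc (0 : ℝ) 1, ∀ Ξ,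
      v (t • Ξ) ≤ C * Real.exp r * (|D| * (C * Real.exp r)) * v Ξ := by
    intro t ht Ξ
    obtain ⟨Ξ', h1, h2⟩ := (Measure.dense_of_ae (hD t ht)).exists_dist_lt Ξ one_pos
    have h1' : v (t • Ξ') ≤ |D| * v Ξ' := by
      have := h1
      rw [Set.mem_ofPred_eq, div_le_iff₀ (v.pos' _)] at this
      exact this.trans (mul_le_mul_of_nonneg_right (le_abs_self D) (v.pos' _).le)
    have hn : ‖Ξ - Ξ'‖ ≤ 1 := by rw [← dist_eq_norm]; exact h2.le
    have a1 := H (t • Ξ') (t • (Ξ - Ξ'))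
    rw [← smul_add, add_sub_cancel] at a1
    have a2 := H Ξ (Ξ' - Ξ)
    rw [add_sub_cancel] at a2
    have e1 : Real.exp (r * ‖t • (Ξ - Ξ')‖) ≤ Real.exp r := by
      refine Real.exp_le_exp.2 (mul_le_of_le_one_right hr ?_)
      rw [norm_smul, Real.norm_of_nonneg ht.1]
      exact mul_le_one₀ ht.2 (norm_nonneg _) hn
    have e2 : Real.exp (r * ‖Ξ' - Ξ‖) ≤ Real.exp r := by
      rw [norm_sub_rev]
      exact Real.exp_le_exp.2 (mul_le_of_le_one_right hr hn)
    have p1 := v.pos' Ξ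
    have p2 := v.pos' (t • Ξ')
    calc v (t • Ξ) ≤ C * (v (t • Ξ') * Real.exp (r * ‖t • (Ξ - Ξ')‖)) := a1
      _ ≤ C * (|D| * v Ξ' * Real.exp r) := by
          refine mul_le_mul_of_nonneg_left ?_ hC.le
          exact mul_le_mul h1' e1 (Real.exp_pos _).le (p2.le.trans h1')
      _ ≤ C * (|D| * (C * (v Ξ * Real.exp r)) * Real.exp r) := by
          refine mul_le_mul_of_nonneg_left (mul_le_mul_of_nonneg_right
            (mul_le_mul_of_nonneg_left (a2.trans ?_) (abs_nonneg D)) (Real.exp_pos _).le) hC.le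
          exact mul_le_mul_of_nonneg_left (mul_le_mul_of_nonneg_left e2 p1.le) hC.le
      _ = _ := by ring
  refine ⟨Real.sqrt (v 0 / K), K * (C * Real.exp r * (|D| * (C * Real.exp r))), C * v 0, r + 1,
    Real.sqrt_pos.2 (div_pos (v.pos' 0) hK), by positivity, by positivity, hlow, ?_, fun Θ => ?_⟩
  · intro t ht Θ Ξ
    have h1 := hK' (Θ - t • Ξ) (t • Ξ)
    rw [sub_add_cancel] at h1
    have p1 := v.pos' (Θ - t • Ξ)
    calc _ ≤ K * (v (Θ - t • Ξ) * (C * Real.exp r * (|D| * (C * Real.exp r)) * v Ξ)) := by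
          refine h1.trans (mul_le_mul_of_nonneg_left (mul_le_mul_of_nonneg_left
            (hdil' t ht Ξ) p1.le) hK.le)
      _ = _ := by ring
  · have h1 := H 0 Θ
    rw [zero_add] at h1
    calc _ ≤ C * (v 0 * Real.exp (r * ‖Θ‖)) * Real.exp (-(r + 1) * ‖Θ‖) :=
          mul_le_mul_of_nonneg_right h1 (Real.exp_pos _).le
      _ = C * v 0 * (Real.exp (r * ‖Θ‖) * Real.exp (-(r + 1) * ‖Θ‖)) := by ring
      _ = _ := by
          rw [← Real.exp_add]
          congr 2
          ring

theorem Weight.IsP.exists_isModerate_onSnd {s : ℝ} (hs : 1 < s) {v : Weight (RR ι)} (hv : v.IsP s) :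
    ∃ r C : ℝ, v.onSnd.IsModerate r C := by
  obtain ⟨r, C, hr, hC, H⟩ := hv.exists_exp_bound hs
  refine ⟨r, C, hr, hC, fun z w => (H z.2 w.2).trans ?_⟩
  rw [← mul_assoc]
  refine mul_le_mul_of_nonneg_left ?_ (mul_pos hC (v.pos' z.2)).le
  unfold expw
  exact le_mul_of_one_le_left (Real.exp_pos _).le (Real.one_le_exp (by positivity))

/-- The frequency bound of an element of `M^{∞,1}_{(v)}`. -/
def freqProfile (v : Weight (RR ι)) (C : ℝ) (u : GSDual ι) (Ξ : RR ι) : ℝ≥0∞ :=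
  ENNReal.ofReal (C / v Ξ) * supProfile v.onSnd (stft u) Ξ

theorem measurable_freqProfile (v : Weight (RR ι)) (C : ℝ) (u : GSDual ι) :
    Measurable (freqProfile v C u) :=
  (measurable_const.div v.measurable').ennreal_ofReal.mul
    (measurable_supProfile _ (continuous_stft u).measurable)

theorem weight_mul_freqProfile (v : Weight (RR ι)) {C : ℝ} (u : GSDual ι)
    (Ξ : RR ι) : ENNReal.ofReal (v Ξ) * freqProfile v C u Ξ =
      ENNReal.ofReal C * supProfile v.onSnd (stft u) Ξ := by
  rw [freqProfile, ← mul_assoc, ← ENNReal.ofReal_mul (v.pos' Ξ).le,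
    mul_div_cancel₀ _ (v.pos' Ξ).ne']

theorem freqBound_stft {v : Weight (RR ι)} {r C : ℝ} (h : v.onSnd.IsModerate r C) {c₀ : ℝ}
    (hc₀ : 0 < c₀) (hv : ∀ Θ, c₀ ≤ v Θ) (U : ModInf1 v.onSnd) :
    FreqBound (stft U.1) (freqProfile v C U.1) where
  cont := continuous_stft U.1
  meas := measurable_freqProfile v C U.1
  bound z := by
    have h1 := stft_mul_weight_le_supProfile h U.1 z.1 z.2
    rw [← weight_mul_freqProfile] at h1
    have e : ENNReal.ofReal (‖stft U.1 (z.1, z.2)‖ * v.onSnd (z.1, z.2)) =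
        ENNReal.ofReal (v z.2) * ‖stft U.1 z‖ₑ := by
      rw [mul_comm, ← ofReal_norm, ← ENNReal.ofReal_mul (v.pos' z.2).le]
      rfl
    rw [e] at h1
    exact (ENNReal.mul_le_mul_iff_right (ENNReal.ofReal_pos.2 (v.pos' _)).ne'
      ENNReal.ofReal_ne_top).1 h1
  fin := by
    refine ne_top_of_le_ne_top (?_ : ENNReal.ofReal (C / c₀) * normInf1 v.onSnd (stft U.1) ≠ ∞) ?_
    · exact ENNReal.mul_ne_top ENNReal.ofReal_ne_top U.2.2.ne
    · rw [normInf1, ← lintegral_const_mul' _ _ ENNReal.ofReal_ne_top]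
      refine lintegral_mono fun Ξ => mul_le_mul_left (ENNReal.ofReal_le_ofReal ?_) _
      exact div_le_div_of_nonneg_left h.2.1.le hc₀ (hv Ξ)

/-! ### The Taylor remainder in phase space -/

/-- The phase space coefficients at `X` of the Hessian with short-time Fourier transforms `V`. -/
def taylorCoef (V : ι → ι → RR ι × RR ι → ℂ) (X : RR ι) (z : RR ι × RR ι) (i j : ι) : ℂ :=
  ftc ι * V i j (X + z.1, z.2) * ecis X (-z.2)

theorem coefBound_taylorCoef {V : ι → ι → RR ι × RR ι → ℂ} {N : ι → ι → RR ι → ℝ≥0∞}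
    (h : ∀ i j, FreqBound (V i j) (N i j)) (X : RR ι) :
    CoefBound (taylorCoef V X) (fun Ξ => ENNReal.ofReal (ftc ι) * ∑ i, ∑ j, N i j Ξ) where
  cont i j := by
    have h1 : Continuous fun z : RR ι × RR ι => V i j (X + z.1, z.2) :=
      (h i j).cont.comp (by fun_prop)
    exact (continuous_const.mul h1).mul (by fun_prop)
  meas := (Finset.measurable_fun_sum _ fun i _ => Finset.measurable_fun_sum _ fun j _ =>
    (h i j).meas).const_mul _
  bound z := by
    rw [ENNReal.ofReal_sum_of_nonneg fun i _ => Finset.sum_nonneg fun j _ => norm_nonneg _,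
      Finset.mul_sum]
    refine Finset.sum_le_sum fun i _ => ?_
    rw [ENNReal.ofReal_sum_of_nonneg fun j _ => norm_nonneg _, Finset.mul_sum]
    refine Finset.sum_le_sum fun j _ => ?_
    rw [taylorCoef, norm_mul, norm_mul, norm_ecis, mul_one, Complex.norm_real,
      Real.norm_of_nonneg ftc_pos.le, ENNReal.ofReal_mul ftc_pos.le, ofReal_norm]
    exact mul_le_mul_right ((h i j).bound (X + z.1, z.2)) _
  fin := by
    rw [lintegral_const_mul' _ _ ENNReal.ofReal_ne_top, lintegral_finsetSum _
      fun i _ => Finset.measurable_fun_sum _ fun j _ => (h i j).meas]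
    refine ENNReal.mul_ne_top ENNReal.ofReal_ne_top (ENNReal.sum_ne_top.2 fun i _ => ?_)
    rw [lintegral_finsetSum _ fun j _ => (h i j).meas]
    exact ENNReal.sum_ne_top.2 fun j _ => (h i j).fin

theorem integral_taylorCoef_mul {V : RR ι × RR ι → ℂ} (X Y : RR ι) :
    ∫ z : RR ι × RR ι, ftc ι * V (X + z.1, z.2) * ecis X (-z.2) * (win (Y - z.1) * ecis Y (-z.2)) =
      synthFun V (X + Y) := by
  rw [synthFun, ← integral_add_left_eq_self (fun z => V z * gaborFun z.1 (-z.2) (X + Y))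
    ((X, 0) : RR ι × RR ι), ← integral_const_mul]
  refine integral_congr_ae (Eventually.of_forall fun z => ?_)
  simp only [Prod.fst_add, Prod.snd_add, zero_add]
  rw [gaborFun_apply, ecis_add_left, add_sub_add_left_eq_sub,
    show (X, (0 : RR ι)) + z = (X + z.1, z.2) by ext <;> simp]
  ring

theorem remFun_taylorCoef {V : ι → ι → RR ι × RR ι → ℂ} {N : ι → ι → RR ι → ℝ≥0∞}
    (h : ∀ i j, FreqBound (V i j) (N i j)) (X Z : RR ι) :
    remFun (taylorCoef V X) Z = ∫ t in (0 : ℝ)..1, ((1 - t : ℝ) : ℂ) *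
      ∑ i, ∑ j, synthFun (V i j) (X + t • Z) * ((Z i * Z j : ℝ) : ℂ) := by
  have hb := coefBound_taylorCoef h X
  have hInt : Integrable (fun q => remKer (taylorCoef V X) q Z) (remMeasure ι) := by
    have hm : Continuous fun q : ℝ × RR ι × RR ι => remKer (taylorCoef V X) q Z :=
      Continuous.comp (g := fun p : RR ι × (ℝ × RR ι × RR ι) => remKer (taylorCoef V X) p.2 p.1)
        (f := fun q : ℝ × RR ι × RR ι => (Z, q)) (continuous_remKer hb) (by fun_prop)
    refine ⟨hm.aestronglyMeasurable, ?_⟩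
    rw [hasFiniteIntegral_iff_enorm]
    exact (lintegral_enorm_remKer_le hb Z).trans_lt (ENNReal.mul_lt_top (ENNReal.mul_lt_top
      winInt_ne_top.lt_top hb.fin.lt_top) ENNReal.ofReal_lt_top)
  rw [remFun, remMeasure, integral_prod _ hInt, intervalIntegral.integral_of_le zero_le_one,
    integral_Icc_eq_integral_Ioc]
  refine integral_congr_ae (Eventually.of_forall fun t => ?_)
  simp only
  have hi : ∀ i j, Integrable fun z : RR ι × RR ι => ftc ι * V i j (X + z.1, z.2) * ecis X (-z.2) *
      (win (t • Z - z.1) * ecis (t • Z) (-z.2)) := by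
    intro i j
    have h1 := ((h i j).integrable (X + t • Z)).comp_add_left ((X, 0) : RR ι × RR ι)
    refine (h1.const_mul (ftc ι : ℂ)).congr (Eventually.of_forall fun z => ?_)
    simp only [Prod.fst_add, Prod.snd_add, zero_add]
    rw [gaborFun_apply, ecis_add_left, add_sub_add_left_eq_sub,
      show (X, (0 : RR ι)) + z = (X + z.1, z.2) by ext <;> simp]
    ring
  have e : ∀ z : RR ι × RR ι, remKer (taylorCoef V X) (t, z) Z = ((1 - t : ℝ) : ℂ) *
      ∑ i, ∑ j, (ftc ι * V i j (X + z.1, z.2) * ecis X (-z.2) *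
      (win (t • Z - z.1) * ecis (t • Z) (-z.2))) * ((Z i * Z j : ℝ) : ℂ) := by
    intro z
    simp only [remKer, quad, taylorCoef, rpt]
    rw [mul_assoc, mul_assoc, Finset.sum_mul]
    congr 1
    refine Finset.sum_congr rfl fun i _ => ?_
    rw [Finset.sum_mul]
    refine Finset.sum_congr rfl fun j _ => ?_
    push_cast
    ring
  simp only [e]
  rw [integral_const_mul, integral_finsetSum _ fun i _ => integrable_finsetSum _ fun j _ =>
    (hi i j).mul_const _]
  congr 1
  refine Finset.sum_congr rfl fun i _ => ?_
  rw [integral_finsetSum _ fun j _ => (hi i j).mul_const _]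
  refine Finset.sum_congr rfl fun j _ => ?_
  rw [integral_mul_const, integral_taylorCoef_mul]

/-- A function with second derivatives in `M^{∞,1}_{(v)}` is regular, and its Taylor remainders
have phase space coefficients with a common frequency bound. -/
theorem IsPhase.exists_isRegularPhase [DecidableEq ι] {v : Weight (RR ι)} {r C : ℝ}
    (hm : v.onSnd.IsModerate r C) {c₀ : ℝ} (hc₀ : 0 < c₀) (hv : ∀ Θ, c₀ ≤ v Θ) {φ : RR ι → ℝ}
    {H : ι → ι → RR ι → ℝ} {U : ι → ι → ModInf1 v.onSnd} (hφ : IsPhase v.onSnd φ H U) :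
    ∃ p h, IsRegularPhase φ p h ∧ (∀ i j, UniformContinuous (h i j)) ∧
      (∃ M, ∀ i j X, |h i j X| ≤ M) ∧ (∀ᵐ X, ∀ i j, h i j X = H i j X) ∧
      ∃ N : RR ι → ℝ≥0∞, Measurable N ∧
        ∫⁻ Ξ, ENNReal.ofReal (v Ξ) * N Ξ ≤ ENNReal.ofReal (ftc ι * C * hessNorm U) ∧
        ∀ X, ∃ b, CoefBound b N ∧
          ∀ Z, remFun b Z = ((φ (X + Z) - φ X - inner ℝ (p X) Z : ℝ) : ℂ) := by
  have hF : ∀ i j, FreqBound (stft (U i j).1) (freqProfile v C (U i j).1) := fun i j =>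
    freqBound_stft hm hc₀ hv (U i j)
  have hae : ∀ i j, ∀ᵐ X, synthFun (stft (U i j).1) X = (H i j X : ℂ) := fun i j =>
    (hF i j).isGivenBy_synthFun.ae_eq (hφ.isGivenBy i j)
  set h : ι → ι → RR ι → ℝ := fun i j X => (synthFun (stft (U i j).1) X).re with hh
  have huc : ∀ i j, UniformContinuous (h i j) := fun i j =>
    Complex.uniformContinuous_re.comp (hF i j).uniformContinuous_synthFun
  have hreal : ∀ i j X, synthFun (stft (U i j).1) X = (h i j X : ℂ) := by
    intro i j X
    have h1 : ∀ᵐ X, (synthFun (stft (U i j).1) X).im = 0 := (hae i j).mono fun X hX => by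
      rw [hX, Complex.ofReal_im]
    have h2 := Measure.eq_of_ae_eq h1
      (Complex.continuous_im.comp (hF i j).continuous_synthFun) continuous_const
    refine Complex.ext (by simp [hh]) ?_
    rw [Complex.ofReal_im]
    exact congrFun h2 X
  have hhH : ∀ i j, ∀ᵐ X, h i j X = H i j X := fun i j => (hae i j).mono fun X hX => by
    simp only [hh, hX, Complex.ofReal_re]
  have hbd : ∃ M, ∀ i j X, |h i j X| ≤ M := by
    have hK : ∀ i j, ENNReal.ofReal (ftc ι) *
        (winInt ι * ∫⁻ Ξ, freqProfile v C (U i j).1 Ξ) ≠ ∞ := fun i j =>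
      ENNReal.mul_ne_top ENNReal.ofReal_ne_top (ENNReal.mul_ne_top winInt_ne_top (hF i j).fin)
    refine ⟨∑ i, ∑ j, (ENNReal.ofReal (ftc ι) *
      (winInt ι * ∫⁻ Ξ, freqProfile v C (U i j).1 Ξ)).toReal, fun i j X => ?_⟩
    have h1 := ENNReal.toReal_mono (hK i j) ((hF i j).enorm_synthFun_le X)
    rw [toReal_enorm] at h1
    refine (Complex.abs_re_le_norm _).trans (h1.trans ?_)
    refine (Finset.single_le_sum (f := fun j => (ENNReal.ofReal (ftc ι) *
      (winInt ι * ∫⁻ Ξ, freqProfile v C (U i j).1 Ξ)).toReal)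
      (fun _ _ => ENNReal.toReal_nonneg) (Finset.mem_univ j)).trans ?_
    exact Finset.single_le_sum (f := fun i => ∑ j, (ENNReal.ofReal (ftc ι) *
      (winInt ι * ∫⁻ Ξ, freqProfile v C (U i j).1 Ξ)).toReal)
      (fun _ _ => Finset.sum_nonneg fun _ _ => ENNReal.toReal_nonneg) (Finset.mem_univ i)
  have hweak : HasWeakHessian φ h := by
    refine ⟨hφ.continuous, fun i j => (huc i j).continuous, fun i j ψ hψ hs => ?_⟩
    rw [hφ.weakDeriv i j ψ hψ hs]
    exact integral_congr_ae ((hhH i j).mono fun X hX => by simp only [hX])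
  obtain ⟨M, hM⟩ := hbd
  obtain ⟨p, hp⟩ := hweak.exists_isRegularPhase hM
  refine ⟨p, h, hp, huc, ⟨M, hM⟩, ae_all_iff.2 fun i => ae_all_iff.2 fun j => hhH i j,
    fun Ξ => ENNReal.ofReal (ftc ι) * ∑ i, ∑ j, freqProfile v C (U i j).1 Ξ,
    (coefBound_taylorCoef hF 0).meas, ?_, fun X => ⟨_, coefBound_taylorCoef hF X, fun Z => ?_⟩⟩
  · have e : ∀ Ξ, ENNReal.ofReal (v Ξ) * (ENNReal.ofReal (ftc ι) *
        ∑ i, ∑ j, freqProfile v C (U i j).1 Ξ) = ENNReal.ofReal (ftc ι * C) *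
        ∑ i, ∑ j, supProfile v.onSnd (stft (U i j).1) Ξ := by
      intro Ξ
      rw [ENNReal.ofReal_mul ftc_pos.le, mul_left_comm, mul_assoc]
      congr 1
      simp only [Finset.mul_sum, weight_mul_freqProfile]
    have hsm : ∀ i j, Measurable (supProfile v.onSnd (stft (U i j).1)) := fun i j =>
      measurable_supProfile _ (U i j).2.1
    simp only [e]
    rw [lintegral_const_mul' _ _ ENNReal.ofReal_ne_top, lintegral_finsetSum _
      fun i _ => Finset.measurable_fun_sum _ fun j _ => hsm i j,
      ENNReal.ofReal_mul (mul_pos ftc_pos hm.2.1).le, hessNorm,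
      ENNReal.ofReal_sum_of_nonneg fun i _ => Finset.sum_nonneg fun j _ => norm_nonneg _]
    refine mul_le_mul_right (Finset.sum_le_sum fun i _ => ?_) _
    rw [lintegral_finsetSum _ fun j _ => hsm i j,
      ENNReal.ofReal_sum_of_nonneg fun j _ => norm_nonneg _]
    refine Finset.sum_le_sum fun j _ => ?_
    change normInf1 v.onSnd (stft (U i j).1) ≤
      ENNReal.ofReal (normInf1 v.onSnd (stft (U i j).1)).toReal
    rw [ENNReal.ofReal_toReal (U i j).2.2.ne]
  · rw [remFun_taylorCoef hF, hp.taylor, ← intervalIntegral.integral_ofReal]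
    simp only [hreal]
    push_cast
    rfl

end
end

noncomputable section

section

variable {ι : Type} [Fintype ι]

/-! ### Short-time Fourier transforms of oscillating distributions -/

/-- The Gaussian `exp (-β |Z|^2)` times the exponential of the Taylor remainder of `φ` at `X`. -/
def oscWin (φ : RR ι → ℝ) (p : RR ι → RR ι) (β : ℝ) (X Z : RR ι) : ℂ :=
  ((Real.exp (-β * ‖Z‖ ^ 2) : ℝ) : ℂ) *
    Complex.exp (Complex.I * ((φ (X + Z) - φ X - inner ℝ (p X) Z : ℝ) : ℂ))

/-- The Fourier transform of `oscWin`. -/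
def oscFt (φ : RR ι → ℝ) (p : RR ι → RR ι) (β : ℝ) (X Θ : RR ι) : ℂ := ft (oscWin φ p β X) Θ

/-- The short-time Fourier transform of `u exp (i φ)` with the window `exp (-β |Y|^2) win Y`. -/
def oscStft (φ : RR ι → ℝ) (p : RR ι → RR ι) (β : ℝ) (u : GSDual ι) (z : RR ι × RR ι) : ℂ :=
  ftc ι * Complex.exp (Complex.I * (φ z.1 : ℂ)) *
    ∫ Θ, oscFt φ p β z.1 Θ * (ecis z.1 (p z.1 + Θ) * stft u (z.1, z.2 - p z.1 - Θ))

theorem norm_exp_I_mul (t : ℝ) : ‖Complex.exp (Complex.I * (t : ℂ))‖ = 1 := by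
  rw [mul_comm, Complex.norm_exp_ofReal_mul_I]

variable {φ : RR ι → ℝ} {p : RR ι → RR ι} {β : ℝ}

theorem norm_oscWin (X Z : RR ι) : ‖oscWin φ p β X Z‖ = Real.exp (-β * ‖Z‖ ^ 2) := by
  rw [oscWin, norm_mul, norm_exp_I_mul, mul_one, Complex.norm_real,
    Real.norm_of_nonneg (Real.exp_pos _).le]

theorem continuous_oscWin (hφ : Continuous φ) (hp : Continuous p) :
    Continuous fun q : RR ι × RR ι => oscWin φ p β q.1 q.2 := by
  unfold oscWin
  have h1 : Continuous fun q : RR ι × RR ι => φ (q.1 + q.2) - φ q.1 - inner ℝ (p q.1) q.2 := by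
    fun_prop
  exact (Complex.continuous_ofReal.comp (by fun_prop)).mul
    (Complex.continuous_exp.comp (continuous_const.mul (Complex.continuous_ofReal.comp h1)))

theorem continuous_oscWin_right (hφ : Continuous φ) (X : RR ι) :
    Continuous (oscWin φ p β X) := by
  unfold oscWin
  have h1 : Continuous fun Z : RR ι => φ (X + Z) - φ X - inner ℝ (p X) Z := by
    fun_prop
  exact (Complex.continuous_ofReal.comp (by fun_prop)).mul
    (Complex.continuous_exp.comp (continuous_const.mul (Complex.continuous_ofReal.comp h1)))

theorem integrable_oscWin (hφ : Continuous φ) (hβ : 0 < β) (X : RR ι) :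
    Integrable (oscWin φ p β X) :=
  (integrable_exp_neg_mul_sq_norm hβ).mono'
    (continuous_oscWin_right hφ X).aestronglyMeasurable
    (Eventually.of_forall fun Z => (norm_oscWin X Z).le)

theorem continuous_oscFt (hφ : Continuous φ) (hp : Continuous p) (hβ : 0 < β) :
    Continuous fun q : RR ι × RR ι => oscFt φ p β q.1 q.2 := by
  unfold oscFt ft
  refine continuous_of_dominated (bound := fun Z => Real.exp (-β * ‖Z‖ ^ 2)) (fun q => ?_)
    (fun q => Eventually.of_forall fun Z => ?_) (integrable_exp_neg_mul_sq_norm hβ)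
    (Eventually.of_forall fun Z => ?_)
  · exact ((continuous_oscWin_right hφ q.1).mul (by fun_prop)).aestronglyMeasurable
  · rw [norm_mul, norm_ecis, mul_one, norm_oscWin]
  · exact ((continuous_oscWin hφ hp).comp (by fun_prop : Continuous fun q : RR ι × RR ι =>
      (q.1, Z))).mul (by fun_prop)

theorem continuous_oscStft_integrand (hφ : Continuous φ) (hp : Continuous p) (hβ : 0 < β)
    (u : GSDual ι) : Continuous fun q : (RR ι × RR ι) × RR ι => oscFt φ p β q.1.1 q.2 *
      (ecis q.1.1 (p q.1.1 + q.2) * stft u (q.1.1, q.1.2 - p q.1.1 - q.2)) := by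
  have h1 := (continuous_oscFt hφ hp hβ).comp
    (by fun_prop : Continuous fun q : (RR ι × RR ι) × RR ι => (q.1.1, q.2))
  have h2 := (continuous_stft u).comp
    (by fun_prop : Continuous fun q : (RR ι × RR ι) × RR ι => (q.1.1, q.1.2 - p q.1.1 - q.2))
  exact h1.mul ((by fun_prop : Continuous fun q : (RR ι × RR ι) × RR ι =>
    ecis q.1.1 (p q.1.1 + q.2)).mul h2)

theorem measurable_oscStft (hφ : Continuous φ) (hp : Continuous p) (hβ : 0 < β) (u : GSDual ι) :
    Measurable (oscStft φ p β u) := by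
  have h1 := (continuous_oscStft_integrand hφ hp hβ u).stronglyMeasurable.integral_prod_right'
    (ν := (volume : Measure (RR ι)))
  have h2 : Measurable fun z : RR ι × RR ι => (ftc ι : ℂ) * Complex.exp (Complex.I * (φ z.1 : ℂ)) := by
    have : Continuous fun z : RR ι × RR ι => (φ z.1 : ℂ) :=
      Complex.continuous_ofReal.comp (hφ.comp continuous_fst)
    exact (continuous_const.mul (Complex.continuous_exp.comp
      (continuous_const.mul this))).measurable
  exact h2.mul h1.measurable

/-- Common bounds for the functions `oscFt φ p β X`. -/
structure OscBound (φ : RR ι → ℝ) (p : RR ι → RR ι) (β : ℝ) (v : Weight (RR ι))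
    (Ht : RR ι → ℝ≥0∞) (K : ℝ≥0) : Prop where
  contPhase : Continuous φ
  contGrad : Continuous p
  pos : 0 < β
  meas : Measurable Ht
  bound : ∀ X Θ, ENNReal.ofReal (v Θ) * ‖oscFt φ p β X Θ‖ₑ ≤ Ht Θ
  lintegral_le : ∫⁻ Θ, Ht Θ ≤ K
  le : ∀ Θ, Ht Θ ≤ K

/-- The frequency profile of `oscStft` for `u` with frequency profile `G`. -/
def oscProfile (Ht G : RR ι → ℝ≥0∞) (Ξ : RR ι) : ℝ≥0∞ := ∫⁻ Θ, Ht Θ * G (Ξ - Θ)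

theorem measurable_oscProfile {Ht G : RR ι → ℝ≥0∞} (hH : Measurable Ht) (hG : Measurable G) :
    Measurable (oscProfile Ht G) := by
  have h : Measurable fun q : RR ι × RR ι => Ht q.2 * G (q.1 - q.2) :=
    (hH.comp measurable_snd).mul (hG.comp (measurable_fst.sub measurable_snd))
  exact h.lintegral_prod_right'

theorem lintegral_oscProfile {Ht G : RR ι → ℝ≥0∞} (hH : Measurable Ht) (hG : Measurable G) :
    ∫⁻ Ξ, oscProfile Ht G Ξ = (∫⁻ Θ, Ht Θ) * ∫⁻ Ξ, G Ξ := by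
  have h : Measurable fun q : RR ι × RR ι => Ht q.2 * G (q.1 - q.2) :=
    (hH.comp measurable_snd).mul (hG.comp (measurable_fst.sub measurable_snd))
  unfold oscProfile
  rw [lintegral_lintegral_swap (f := fun Ξ Θ => Ht Θ * G (Ξ - Θ)) h.aemeasurable,
    ← lintegral_mul_const _ hH]
  refine lintegral_congr fun Θ => ?_
  have hm : Measurable fun Ξ => G (Ξ - Θ) := hG.comp (measurable_id.sub_const Θ)
  rw [lintegral_const_mul _ hm, lintegral_sub_right_eq_self]

theorem oscProfile_le {Ht G : RR ι → ℝ≥0∞} {K : ℝ≥0∞} (hK : ∀ Θ, Ht Θ ≤ K) (hG : Measurable G)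
    (Ξ : RR ι) : oscProfile Ht G Ξ ≤ K * ∫⁻ Ξ, G Ξ := by
  have hm : Measurable fun Θ => G (Ξ - Θ) := hG.comp (measurable_const.sub measurable_id)
  calc _ ≤ ∫⁻ Θ, K * G (Ξ - Θ) := lintegral_mono fun Θ => mul_le_mul_left (hK Θ) _
    _ = _ := by rw [lintegral_const_mul _ hm, lintegral_sub_left_eq_self]

/-- `G` dominates the weighted short-time Fourier transform of `u` at almost every frequency. -/
def FreqDominated (ω : Weight (RR ι × RR ι)) (u : GSDual ι) (G : RR ι → ℝ≥0∞) : Prop :=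
  ∀ᵐ Ξ, ∀ X, ENNReal.ofReal (‖stft u (X, Ξ)‖ * ω (X, Ξ)) ≤ G Ξ

namespace OscBound

variable {v : Weight (RR ι)} {Ht : RR ι → ℝ≥0∞} {K : ℝ≥0} {ω : Weight (RR ι × RR ι)} {D : ℝ}
  {u : GSDual ι} {G : RR ι → ℝ≥0∞}

theorem ae_bound (h : OscBound φ p β v Ht K) (hD : 0 ≤ D)
    (hmod : ∀ X Ξ₁ Ξ₂, ω (X, Ξ₁ + Ξ₂) ≤ D * (ω (X, Ξ₁) * v Ξ₂)) (hG : FreqDominated ω u G)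
    (z : RR ι × RR ι) :
    ∀ᵐ Θ, ‖oscFt φ p β z.1 Θ * (ecis z.1 (p z.1 + Θ) * stft u (z.1, z.2 - p z.1 - Θ))‖ₑ *
      ENNReal.ofReal (ω (z.1, z.2 - p z.1)) ≤
      ENNReal.ofReal D * (Ht Θ * G (z.2 - p z.1 - Θ)) := by
  have hG' : ∀ᵐ Θ, ∀ X, ENNReal.ofReal (‖stft u (X, z.2 - p z.1 - Θ)‖ *
      ω (X, z.2 - p z.1 - Θ)) ≤ G (z.2 - p z.1 - Θ) :=
    (Measure.measurePreserving_sub_left volume (z.2 - p z.1)).quasiMeasurePreserving.ae hG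
  filter_upwards [hG'] with Θ hΘ
  have h1 := h.bound z.1 Θ
  have h2 := hΘ z.1
  have h3 := hmod z.1 (z.2 - p z.1 - Θ) Θ
  rw [sub_add_cancel] at h3
  rw [enorm_mul, enorm_mul, ← ofReal_norm (ecis _ _), norm_ecis, ENNReal.ofReal_one, one_mul]
  rw [ENNReal.ofReal_mul (norm_nonneg _), ofReal_norm] at h2
  calc _ ≤ ‖oscFt φ p β z.1 Θ‖ₑ * ‖stft u (z.1, z.2 - p z.1 - Θ)‖ₑ * ENNReal.ofReal
        (D * (ω (z.1, z.2 - p z.1 - Θ) * v Θ)) := mul_le_mul_right (ENNReal.ofReal_le_ofReal h3) _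
    _ = ENNReal.ofReal D * ((ENNReal.ofReal (v Θ) * ‖oscFt φ p β z.1 Θ‖ₑ) *
          (‖stft u (z.1, z.2 - p z.1 - Θ)‖ₑ * ENNReal.ofReal (ω (z.1, z.2 - p z.1 - Θ)))) := by
        rw [ENNReal.ofReal_mul hD, ENNReal.ofReal_mul (ω.pos' _).le]
        ring
    _ ≤ _ := mul_le_mul_right (mul_le_mul' h1 h2) _

theorem lintegral_mul_le (h : OscBound φ p β v Ht K) (hD : 0 ≤ D)
    (hmod : ∀ X Ξ₁ Ξ₂, ω (X, Ξ₁ + Ξ₂) ≤ D * (ω (X, Ξ₁) * v Ξ₂)) (hG : FreqDominated ω u G)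
    (z : RR ι × RR ι) :
    (∫⁻ Θ, ‖oscFt φ p β z.1 Θ * (ecis z.1 (p z.1 + Θ) * stft u (z.1, z.2 - p z.1 - Θ))‖ₑ) *
      ENNReal.ofReal (ω (z.1, z.2 - p z.1)) ≤
      ENNReal.ofReal D * oscProfile Ht G (z.2 - p z.1) := by
  rw [← lintegral_mul_const' _ _ ENNReal.ofReal_ne_top, oscProfile,
    ← lintegral_const_mul' _ _ ENNReal.ofReal_ne_top]
  exact lintegral_mono_ae (h.ae_bound hD hmod hG z)

theorem enorm_oscStft_le (h : OscBound φ p β v Ht K) (hD : 0 ≤ D)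
    (hmod : ∀ X Ξ₁ Ξ₂, ω (X, Ξ₁ + Ξ₂) ≤ D * (ω (X, Ξ₁) * v Ξ₂)) (hG : FreqDominated ω u G)
    (z : RR ι × RR ι) :
    ‖oscStft φ p β u z‖ₑ * ENNReal.ofReal (ω (z.1, z.2 - p z.1)) ≤
      ENNReal.ofReal (ftc ι * D) * oscProfile Ht G (z.2 - p z.1) := by
  rw [oscStft, enorm_mul, enorm_mul, ← ofReal_norm (Complex.exp _), norm_exp_I_mul,
    ENNReal.ofReal_one, mul_one, ← ofReal_norm (ftc ι : ℂ), Complex.norm_real,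
    Real.norm_of_nonneg ftc_pos.le, ENNReal.ofReal_mul ftc_pos.le, mul_assoc, mul_assoc]
  refine mul_le_mul_right ?_ _
  exact (mul_le_mul_left (enorm_integral_le_lintegral_enorm _) _).trans
    (h.lintegral_mul_le hD hmod hG z)

theorem integrable (h : OscBound φ p β v Ht K) (hD : 0 ≤ D)
    (hmod : ∀ X Ξ₁ Ξ₂, ω (X, Ξ₁ + Ξ₂) ≤ D * (ω (X, Ξ₁) * v Ξ₂)) (hG : FreqDominated ω u G)
    (hGm : Measurable G) (hGi : ∫⁻ Ξ, G Ξ ≠ ∞) (z : RR ι × RR ι) :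
    Integrable fun Θ => oscFt φ p β z.1 Θ *
      (ecis z.1 (p z.1 + Θ) * stft u (z.1, z.2 - p z.1 - Θ)) := by
  have hc := (continuous_oscStft_integrand h.contPhase h.contGrad h.pos u).comp
    (by fun_prop : Continuous fun Θ : RR ι => (z, Θ))
  refine ⟨hc.aestronglyMeasurable, ?_⟩
  rw [hasFiniteIntegral_iff_enorm]
  have h1 := (h.lintegral_mul_le hD hmod hG z).trans_lt (ENNReal.mul_lt_top ENNReal.ofReal_lt_top
    ((oscProfile_le h.le hGm _).trans_lt (ENNReal.mul_lt_top ENNReal.coe_lt_top hGi.lt_top)))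
  exact ENNReal.lt_top_of_mul_ne_top_left h1.ne
    (ENNReal.ofReal_pos.2 (ω.pos' _)).ne'

theorem oscStft_add (h : OscBound φ p β v Ht K) (hD : 0 ≤ D)
    (hmod : ∀ X Ξ₁ Ξ₂, ω (X, Ξ₁ + Ξ₂) ≤ D * (ω (X, Ξ₁) * v Ξ₂)) (hG : FreqDominated ω u G)
    (hGm : Measurable G) (hGi : ∫⁻ Ξ, G Ξ ≠ ∞) {u' : GSDual ι} {G' : RR ι → ℝ≥0∞}
    (hG' : FreqDominated ω u' G') (hGm' : Measurable G') (hGi' : ∫⁻ Ξ, G' Ξ ≠ ∞)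
    (z : RR ι × RR ι) :
    oscStft φ p β (u + u') z = oscStft φ p β u z + oscStft φ p β u' z := by
  simp only [oscStft]
  rw [← mul_add, ← integral_add (h.integrable hD hmod hG hGm hGi z)
    (h.integrable hD hmod hG' hGm' hGi' z)]
  congr 1
  refine integral_congr_ae (Eventually.of_forall fun Θ => ?_)
  simp only [stft_add, Pi.add_apply]
  ring

/-- Convergence of `oscStft` along dominated weakly convergent sequences. -/
theorem tendsto_oscStft (h : OscBound φ p β v Ht K) (hD : 0 ≤ D)
    (hmod : ∀ X Ξ₁ Ξ₂, ω (X, Ξ₁ + Ξ₂) ≤ D * (ω (X, Ξ₁) * v Ξ₂)) {a : ℕ → GSDual ι}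
    (hG : ∀ n, FreqDominated ω (a n) G) (hGm : Measurable G) (hGi : ∫⁻ Ξ, G Ξ ≠ ∞)
    (ha : ∀ ψ, Tendsto (fun n => a n ψ) atTop (𝓝 (u ψ))) (z : RR ι × RR ι) :
    Tendsto (fun n => oscStft φ p β (a n) z) atTop (𝓝 (oscStft φ p β u z)) := by
  unfold oscStft
  refine Tendsto.const_mul _ ?_
  set c : ℝ≥0∞ := (ENNReal.ofReal (ω (z.1, z.2 - p z.1)))⁻¹ with hc
  have hc0 := (ENNReal.ofReal_pos.2 (ω.pos' (z.1, z.2 - p z.1))).ne'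
  have hm : Measurable fun Θ => c * (ENNReal.ofReal D * (Ht Θ * G (z.2 - p z.1 - Θ))) :=
    ((h.meas.mul (hGm.comp (measurable_const.sub measurable_id))).const_mul _).const_mul _
  have hfin : ∫⁻ Θ, c * (ENNReal.ofReal D * (Ht Θ * G (z.2 - p z.1 - Θ))) ≠ ∞ := by
    rw [lintegral_const_mul' _ _ (ENNReal.inv_ne_top.2 hc0),
      lintegral_const_mul' _ _ ENNReal.ofReal_ne_top]
    exact ENNReal.mul_ne_top (ENNReal.inv_ne_top.2 hc0) (ENNReal.mul_ne_top ENNReal.ofReal_ne_top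
      ((oscProfile_le h.le hGm _).trans_lt (ENNReal.mul_lt_top ENNReal.coe_lt_top hGi.lt_top)).ne)
  refine tendsto_integral_of_dominated_convergence
    (fun Θ => (c * (ENNReal.ofReal D * (Ht Θ * G (z.2 - p z.1 - Θ)))).toReal) (fun n => ?_)
    (integrable_toReal_of_lintegral_ne_top hm.aemeasurable hfin) (fun n => ?_)
    (Eventually.of_forall fun Θ => ?_)
  · exact ((continuous_oscStft_integrand h.contPhase h.contGrad h.pos (a n)).comp
      (by fun_prop : Continuous fun Θ : RR ι => (z, Θ))).aestronglyMeasurable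
  · filter_upwards [h.ae_bound hD hmod (hG n) z, ae_lt_top hm hfin] with Θ h1 h2
    rw [← toReal_enorm]
    refine ENNReal.toReal_mono h2.ne ?_
    rw [hc, mul_comm (ENNReal.ofReal _)⁻¹, ← div_eq_mul_inv]
    exact (ENNReal.le_div_iff_mul_le (Or.inl hc0) (Or.inl ENNReal.ofReal_ne_top)).2 h1
  · simp only [stft_eq]
    exact (((ha _).const_mul _).const_mul _).const_mul _

end OscBound

theorem oscStft_smul (c : ℂ) (u : GSDual ι) (z : RR ι × RR ι) :
    oscStft φ p β (c • u) z = c * oscStft φ p β u z := by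
  simp only [oscStft, stft_smul, Pi.smul_apply, smul_eq_mul]
  rw [mul_left_comm c, ← integral_const_mul c]
  congr 1
  refine integral_congr_ae (Eventually.of_forall fun Θ => ?_)
  simp only
  ring

/-- For `a ∈ Σ₁` the function `oscStft` is the short-time Fourier transform of `a exp (i φ)`. -/
theorem oscStft_toDual (hφ : Continuous φ) (hβ : 0 < β) (a : GS ι) (z : RR ι × RR ι)
    (hInt : Integrable (oscFt φ p β z.1)) :
    oscStft φ p β a.toDual z = ∫ Y, a Y * Complex.exp (Complex.I * (φ Y : ℂ)) *
      ((win (Y - z.1) * Real.exp (-β * ‖Y - z.1‖ ^ 2) : ℝ) : ℂ) * ecis Y z.2 := by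
  obtain ⟨X, Ξ⟩ := z
  simp only at hInt ⊢
  have hinv := ft_inversion (continuous_oscWin_right (p := p) (β := β) hφ X)
    (integrable_oscWin hφ hβ X) hInt
  have hf : Integrable fun Y => a Y * (win (Y - X) : ℂ) := by
    refine a.integrable.mul_bdd (c := Real.pi ^ (-(Fintype.card ι : ℝ) / 4)) ?_ (Eventually.of_forall fun Y => ?_)
    · exact (contDiff_win_sub X).continuous.aestronglyMeasurable
    · rw [Complex.norm_real, Real.norm_of_nonneg (win_pos _).le]
      exact win_le _
  have hswap : Integrable (Function.uncurry fun Θ Y : RR ι => oscFt φ p β X Θ *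
      (ecis X (p X + Θ) * (a Y * (win (Y - X) : ℂ) * ecis Y (Ξ - p X - Θ)))) := by
    have h1 := (hInt.mul_prod hf).mul_bdd (c := 1)
      (g := fun q : RR ι × RR ι => ecis X (p X + q.1) * ecis q.2 (Ξ - p X - q.1))
      (by fun_prop : Continuous fun q : RR ι × RR ι =>
        ecis X (p X + q.1) * ecis q.2 (Ξ - p X - q.1)).aestronglyMeasurable
      (Eventually.of_forall fun q => by rw [norm_mul, norm_ecis, norm_ecis, one_mul])
    refine h1.congr (Eventually.of_forall fun q => ?_)
    simp only [Function.uncurry]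
    ring
  have hcne : (ftc ι : ℂ) * ftc ι * (((2 * Real.pi) ^ Fintype.card ι : ℝ) : ℂ) = 1 := by
    exact_mod_cast ftc_mul_self (ι := ι)
  calc _ = ftc ι * ftc ι * Complex.exp (Complex.I * (φ X : ℂ)) * ∫ Θ, ∫ Y, oscFt φ p β X Θ *
        (ecis X (p X + Θ) * (a Y * (win (Y - X) : ℂ) * ecis Y (Ξ - p X - Θ))) := by
        simp only [oscStft, stft_toDual, ft]
        have e : ∀ Θ, oscFt φ p β X Θ * (ecis X (p X + Θ) * (ftc ι * ∫ Y, a Y * (win (Y - X) : ℂ) *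
            ecis Y (Ξ - p X - Θ))) = ftc ι * ∫ Y, oscFt φ p β X Θ *
              (ecis X (p X + Θ) * (a Y * (win (Y - X) : ℂ) * ecis Y (Ξ - p X - Θ))) := by
          intro Θ
          rw [integral_const_mul, integral_const_mul]
          ring
        simp only [e]
        rw [integral_const_mul]
        ring
    _ = ftc ι * ftc ι * Complex.exp (Complex.I * (φ X : ℂ)) * ∫ Y, ∫ Θ, oscFt φ p β X Θ *
        (ecis X (p X + Θ) * (a Y * (win (Y - X) : ℂ) * ecis Y (Ξ - p X - Θ))) := by
        rw [integral_integral_swap hswap]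
    _ = ∫ Y, a Y * Complex.exp (Complex.I * (φ X : ℂ)) * (win (Y - X) : ℂ) *
        (ecis X (p X) * ecis Y (Ξ - p X)) * oscWin φ p β X (Y - X) := by
        rw [← integral_const_mul]
        refine integral_congr_ae (Eventually.of_forall fun Y => ?_)
        simp only
        have e : ∀ Θ, oscFt φ p β X Θ *
            (ecis X (p X + Θ) * (a Y * (win (Y - X) : ℂ) * ecis Y (Ξ - p X - Θ))) =
            (a Y * (win (Y - X) : ℂ) * (ecis X (p X) * ecis Y (Ξ - p X))) *
              (ft (oscWin φ p β X) Θ * ecis (Y - X) (-Θ)) := by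
          intro Θ
          have e1 : ecis X Θ * ecis Y (-Θ) = ecis (Y - X) (-Θ) := by
            rw [sub_eq_add_neg Y X, ecis_add_left, ecis_neg_left, neg_neg, mul_comm]
          rw [← e1, ecis_add_right, sub_eq_add_neg _ Θ, ecis_add_right Y, oscFt]
          ring
        simp only [e]
        rw [integral_const_mul, hinv]
        linear_combination (a Y * Complex.exp (Complex.I * (φ X : ℂ)) * (win (Y - X) : ℂ) *
          (ecis X (p X) * ecis Y (Ξ - p X)) * oscWin φ p β X (Y - X)) * hcne
    _ = _ := by
        refine integral_congr_ae (Eventually.of_forall fun Y => ?_)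
        simp only [oscWin]
        rw [add_sub_cancel, sub_eq_add_neg Ξ, ecis_add_right]
        have e1 : Complex.exp (Complex.I * (φ X : ℂ)) * (ecis X (p X) * ecis Y (-p X)) *
            Complex.exp (Complex.I * ((φ Y - φ X - inner ℝ (p X) (Y - X) : ℝ) : ℂ)) =
            Complex.exp (Complex.I * (φ Y : ℂ)) := by
          simp only [ecis, ← Complex.exp_add]
          congr 1
          rw [inner_sub_right, inner_neg_right, real_inner_comm X, real_inner_comm Y]
          push_cast
          ring
        rw [← e1]
        push_cast
        ring

end
end

noncomputable section

section

variable {ι κ : Type} [Fintype ι] [Fintype κ]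

/-! ### Operators given by kernels on phase space -/

/-- Kernels `B (z, w, ζ)` that satisfy the hypotheses of Schur's test with respect to the weights
`ω₁` and `ω₂`, after integration over the parameter `ζ`. -/
structure IsSchurKernel (ω₁ ω₂ : Weight (RR ι × RR ι))
    (B : (RR ι × RR ι) × (RR ι × RR ι) × RR κ → ℂ)
    (q : (RR ι × RR ι) × (RR ι × RR ι) × RR κ → ℝ≥0∞) (M : ℝ≥0) : Prop where
  meas : Measurable B
  measMaj : Measurable q
  bound : ∀ z w ζ, ‖B (z, w, ζ)‖ₑ * ENNReal.ofReal (ω₂ z) ≤ ENNReal.ofReal (ω₁ w) * q (z, w, ζ)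
  row : ∀ z, ∫⁻ w, ∫⁻ ζ, q (z, w, ζ) ≤ M
  col : ∀ w, ∫⁻ z, ∫⁻ ζ, q (z, w, ζ) ≤ M

/-- The function `z ↦ ∫∫ B (z, w, ζ) F (w) dw dζ`. -/
def kerApply (B : (RR ι × RR ι) × (RR ι × RR ι) × RR κ → ℂ) (F : RR ι × RR ι → ℂ)
    (z : RR ι × RR ι) : ℂ :=
  ∫ r : (RR ι × RR ι) × RR κ, B (z, r) * F r.1

/-- The mass of a kernel with respect to an exponentially decaying density. -/
def kerMass (R : ℝ) (B : (RR ι × RR ι) × (RR ι × RR ι) × RR κ → ℂ) : ℝ≥0∞ :=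
  ∫⁻ z : RR ι × RR ι, ∫⁻ r : (RR ι × RR ι) × RR κ,
    ‖B (z, r)‖ₑ * ENNReal.ofReal (expw (-R) r.1 * expw (-R) z)

theorem enorm_mul_weight (a : ℂ) (ω : Weight (RR ι × RR ι)) (z : RR ι × RR ι) :
    ‖a * (ω z : ℂ)‖ₑ = ‖a‖ₑ * ENNReal.ofReal (ω z) := by
  rw [enorm_mul, ← ofReal_norm (ω z : ℂ), Complex.norm_real, Real.norm_of_nonneg (ω.pos' z).le]

theorem measurable_kerApply {B : (RR ι × RR ι) × (RR ι × RR ι) × RR κ → ℂ} (hB : Measurable B)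
    {F : RR ι × RR ι → ℂ} (hF : Measurable F) : Measurable (kerApply B F) := by
  have h : Measurable fun q : (RR ι × RR ι) × (RR ι × RR ι) × RR κ => B q * F q.2.1 :=
    hB.mul (hF.comp (measurable_fst.comp measurable_snd))
  exact h.stronglyMeasurable.integral_prod_right'.measurable

namespace IsSchurKernel

variable {ω₁ ω₂ : Weight (RR ι × RR ι)} {B : (RR ι × RR ι) × (RR ι × RR ι) × RR κ → ℂ}
  {q : (RR ι × RR ι) × (RR ι × RR ι) × RR κ → ℝ≥0∞} {M : ℝ≥0} {F : RR ι × RR ι → ℂ}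

theorem lintegral_mul_le (h : IsSchurKernel ω₁ ω₂ B q M) (F : RR ι × RR ι → ℂ) (hF : Measurable F)
    (z : RR ι × RR ι) :
    (∫⁻ r : (RR ι × RR ι) × RR κ, ‖B (z, r) * F r.1‖ₑ) * ENNReal.ofReal (ω₂ z) ≤
      ∫⁻ w, (∫⁻ ζ, q (z, w, ζ)) * ‖F w * (ω₁ w : ℂ)‖ₑ := by
  have hm : Measurable fun r : (RR ι × RR ι) × RR κ => q (z, r) * ‖F r.1 * (ω₁ r.1 : ℂ)‖ₑ :=
    (h.measMaj.comp measurable_prodMk_left).mul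
      ((measurable_mul_weight hF ω₁).comp measurable_fst).enorm
  calc _ ≤ ∫⁻ r : (RR ι × RR ι) × RR κ, q (z, r) * ‖F r.1 * (ω₁ r.1 : ℂ)‖ₑ := by
        rw [← lintegral_mul_const' _ _ ENNReal.ofReal_ne_top]
        refine lintegral_mono fun r => ?_
        rw [enorm_mul_weight, enorm_mul]
        calc _ = ‖B (z, r.1, r.2)‖ₑ * ENNReal.ofReal (ω₂ z) * ‖F r.1‖ₑ := by ring_nf
          _ ≤ ENNReal.ofReal (ω₁ r.1) * q (z, r.1, r.2) * ‖F r.1‖ₑ :=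
              mul_le_mul_left (h.bound z r.1 r.2) _
          _ = _ := by ring
    _ = _ := by
        rw [Measure.volume_eq_prod, lintegral_prod _ hm.aemeasurable]
        refine lintegral_congr fun w => ?_
        have hm' : Measurable fun ζ => q (z, w, ζ) :=
          h.measMaj.comp (measurable_prodMk_left.comp measurable_prodMk_left)
        exact lintegral_mul_const ‖F w * (ω₁ w : ℂ)‖ₑ hm'

theorem lintegral_mul_le_of_bound (h : IsSchurKernel ω₁ ω₂ B q M) (hF : Measurable F) {S : ℝ≥0∞}
    (hS : ∀ w, ‖F w * (ω₁ w : ℂ)‖ₑ ≤ S) (z : RR ι × RR ι) :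
    (∫⁻ r : (RR ι × RR ι) × RR κ, ‖B (z, r) * F r.1‖ₑ) * ENNReal.ofReal (ω₂ z) ≤ M * S := by
  have hm : Measurable fun w => ∫⁻ ζ, q (z, w, ζ) :=
    (h.measMaj.comp measurable_prodMk_left).lintegral_prod_right'
      (f := fun r : (RR ι × RR ι) × RR κ => q (z, r))
  refine (h.lintegral_mul_le F hF z).trans ?_
  calc _ ≤ ∫⁻ w, (∫⁻ ζ, q (z, w, ζ)) * S := lintegral_mono fun w => mul_le_mul_right (hS w) _
    _ = (∫⁻ w, ∫⁻ ζ, q (z, w, ζ)) * S := lintegral_mul_const _ hm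
    _ ≤ _ := mul_le_mul_left (h.row z) _

theorem integrable (h : IsSchurKernel ω₁ ω₂ B q M) (hF : Measurable F) {S : ℝ≥0∞} (hSt : S ≠ ∞)
    (hS : ∀ w, ‖F w * (ω₁ w : ℂ)‖ₑ ≤ S) (z : RR ι × RR ι) :
    Integrable fun r : (RR ι × RR ι) × RR κ => B (z, r) * F r.1 := by
  have hm : Measurable fun r : (RR ι × RR ι) × RR κ => B (z, r) * F r.1 :=
    (h.meas.comp measurable_prodMk_left).mul (hF.comp measurable_fst)
  refine ⟨hm.aestronglyMeasurable, ?_⟩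
  rw [hasFiniteIntegral_iff_enorm]
  exact ENNReal.lt_top_of_mul_ne_top_left ((h.lintegral_mul_le_of_bound hF hS z).trans_lt
    (ENNReal.mul_lt_top ENNReal.coe_lt_top hSt.lt_top)).ne
    (ENNReal.ofReal_pos.2 (ω₂.pos' z)).ne'

theorem exists_norm_kerApply_le (h : IsSchurKernel ω₁ ω₂ B q M) {r C : ℝ} (h₂ : ω₂.IsModerate r C)
    (hF : Measurable F) {S : ℝ≥0∞} (hSt : S ≠ ∞) (hS : ∀ w, ‖F w * (ω₁ w : ℂ)‖ₑ ≤ S) :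
    ∃ A, ∀ z, ‖kerApply B F z‖ ≤ A * expw r z := by
  refine ⟨((M : ℝ≥0∞) * S).toReal * (C / ω₂ 0), fun z => ?_⟩
  have h1 : ‖kerApply B F z‖ * ω₂ z ≤ ((M : ℝ≥0∞) * S).toReal := by
    have h2 := (mul_le_mul_left (enorm_integral_le_lintegral_enorm _) _).trans
      (h.lintegral_mul_le_of_bound hF hS z)
    rw [← enorm_mul_weight] at h2
    have h3 := ENNReal.toReal_mono (ENNReal.mul_ne_top ENNReal.coe_ne_top hSt) h2
    rwa [toReal_enorm, norm_mul, Complex.norm_real, Real.norm_of_nonneg (ω₂.pos' z).le] at h3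
  have h4 := h₂.le_sub 0 z
  rw [zero_sub, expw_neg'] at h4
  have p0 := ω₂.pos' 0
  have pz := ω₂.pos' z
  have pe := expw_pos r z
  calc ‖kerApply B F z‖ ≤ ((M : ℝ≥0∞) * S).toReal * (1 / ω₂ z) := by
        rw [mul_one_div, le_div_iff₀ pz]
        exact h1
    _ ≤ ((M : ℝ≥0∞) * S).toReal * (C / ω₂ 0 * expw r z) := by
        refine mul_le_mul_of_nonneg_left ?_ ENNReal.toReal_nonneg
        rw [div_mul_eq_mul_div, div_le_div_iff₀ pz p0]
        linarith
    _ = _ := by ring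

theorem exists_isSynthesis (h : IsSchurKernel ω₁ ω₂ B q M) {r C : ℝ} (h₂ : ω₂.IsModerate r C)
    (hF : Measurable F) {S : ℝ≥0∞} (hSt : S ≠ ∞) (hS : ∀ w, ‖F w * (ω₁ w : ℂ)‖ₑ ≤ S) :
    ∃ u : GSDual ι, IsSynthesis u (kerApply B F) := by
  obtain ⟨A, hA⟩ := h.exists_norm_kerApply_le h₂ hF hSt hS
  exact _root_.exists_isSynthesis (measurable_kerApply h.meas hF).aestronglyMeasurable hA

theorem integrable_kerApply_mul (h : IsSchurKernel ω₁ ω₂ B q M) {r C : ℝ} (h₂ : ω₂.IsModerate r C)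
    (hF : Measurable F) {S : ℝ≥0∞} (hSt : S ≠ ∞) (hS : ∀ w, ‖F w * (ω₁ w : ℂ)‖ₑ ≤ S) (ψ : GS ι) :
    Integrable fun z => kerApply B F z * stft ψ.toDual (z.1, -z.2) := by
  obtain ⟨A, hA⟩ := h.exists_norm_kerApply_le h₂ hF hSt hS
  exact integrable_mul_stft_flip (measurable_kerApply h.meas hF).aestronglyMeasurable hA ψ

theorem isSynthesis_add (h : IsSchurKernel ω₁ ω₂ B q M) {r C : ℝ} (h₂ : ω₂.IsModerate r C)
    (hF : Measurable F) {S : ℝ≥0∞} (hSt : S ≠ ∞) (hS : ∀ w, ‖F w * (ω₁ w : ℂ)‖ₑ ≤ S)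
    {G : RR ι × RR ι → ℂ} (hG : Measurable G) {S' : ℝ≥0∞} (hSt' : S' ≠ ∞)
    (hS' : ∀ w, ‖G w * (ω₁ w : ℂ)‖ₑ ≤ S') {u u' : GSDual ι} (hu : IsSynthesis u (kerApply B F))
    (hu' : IsSynthesis u' (kerApply B G)) : IsSynthesis (u + u') (kerApply B (F + G)) := by
  intro ψ
  rw [add_apply, hu ψ, hu' ψ, ← integral_add (h.integrable_kerApply_mul h₂ hF hSt hS ψ)
    (h.integrable_kerApply_mul h₂ hG hSt' hS' ψ)]
  refine integral_congr_ae (Eventually.of_forall fun z => ?_)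
  simp only [kerApply, Pi.add_apply, mul_add]
  rw [integral_add (h.integrable hF hSt hS z) (h.integrable hG hSt' hS' z), add_mul]

theorem isSynthesis_add_left (h : IsSchurKernel ω₁ ω₂ B q M) {r C : ℝ} (h₂ : ω₂.IsModerate r C)
    (hF : Measurable F) {S : ℝ≥0∞} (hSt : S ≠ ∞) (hS : ∀ w, ‖F w * (ω₁ w : ℂ)‖ₑ ≤ S)
    {B' : (RR ι × RR ι) × (RR ι × RR ι) × RR κ → ℂ}
    {q' : (RR ι × RR ι) × (RR ι × RR ι) × RR κ → ℝ≥0∞} {M' : ℝ≥0}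
    (h' : IsSchurKernel ω₁ ω₂ B' q' M') {u u' : GSDual ι} (hu : IsSynthesis u (kerApply B F))
    (hu' : IsSynthesis u' (kerApply B' F)) : IsSynthesis (u + u') (kerApply (B + B') F) := by
  intro ψ
  rw [add_apply, hu ψ, hu' ψ, ← integral_add (h.integrable_kerApply_mul h₂ hF hSt hS ψ)
    (h'.integrable_kerApply_mul h₂ hF hSt hS ψ)]
  refine integral_congr_ae (Eventually.of_forall fun z => ?_)
  simp only [kerApply, Pi.add_apply, add_mul]
  rw [integral_add (h.integrable hF hSt hS z) (h'.integrable hF hSt hS z), add_mul]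

theorem normOrlicz_kerApply_le (h : IsSchurKernel ω₁ ω₂ B q M) {Φ : YoungFunction}
    (hp : Φ.upperExp < ∞) (hF : Measurable F) (hfin : normOrlicz Φ ω₁ F ≠ ∞) :
    normOrlicz Φ ω₂ (kerApply B F) ≤ M * normOrlicz Φ ω₁ F := by
  have hk : Measurable (Function.uncurry fun z w : RR ι × RR ι => ∫⁻ ζ, q (z, w, ζ)) := by
    have hm : Measurable fun p : ((RR ι × RR ι) × (RR ι × RR ι)) × RR κ =>
        q (p.1.1, p.1.2, p.2) := h.measMaj.comp (by fun_prop)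
    exact hm.lintegral_prod_right'
  have key : ∀ ε : ℝ≥0, 0 < ε →
      normOrlicz Φ ω₂ (kerApply B F) ≤ (M + ε : ℝ≥0) * normOrlicz Φ ω₁ F := by
    intro ε hε
    refine luxNorm_le_of_kernel hp hk (M := M + ε) (by positivity)
      (fun z => (h.row z).trans (by exact_mod_cast le_self_add))
      (fun w => (h.col w).trans (by exact_mod_cast le_self_add))
      (measurable_mul_weight hF ω₁) fun z => ?_
    rw [enorm_mul_weight]
    exact (mul_le_mul_left (enorm_integral_le_lintegral_enorm _) _).trans
      (h.lintegral_mul_le F hF z)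
  set N := normOrlicz Φ ω₁ F with hN
  refine ENNReal.le_of_forall_pos_le_add fun ε hε _ => ?_
  have hN' : N = (N.toNNReal : ℝ≥0∞) := (ENNReal.coe_toNNReal hfin).symm
  refine (key (ε / (N.toNNReal + 1)) (by positivity)).trans ?_
  rw [ENNReal.coe_add, add_mul]
  refine add_le_add_right ?_ _
  rw [hN', ENNReal.toNNReal_coe]
  have h1 : ε / (N.toNNReal + 1) * N.toNNReal ≤ ε := by
    rw [div_mul_eq_mul_div, div_le_iff₀ (by positivity)]
    exact mul_le_mul_right le_self_add _
  exact_mod_cast h1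

theorem enorm_mul_expw_le (h : IsSchurKernel ω₁ ω₂ B q M) {R : ℝ} {c₁ c₂ : ℝ} (hc₁ : 0 ≤ c₁)
    (hc₂ : 0 ≤ c₂) (h₁ : ∀ w, ω₁ w * expw (-R) w ≤ c₁)
    (h₂ : ∀ z, expw (-R) z ≤ c₂ * (ω₂ z * expw (-1) z))
    (t : (RR ι × RR ι) × (RR ι × RR ι) × RR κ) :
    ‖B t‖ₑ * ENNReal.ofReal (expw (-R) t.2.1 * expw (-R) t.1) ≤
      ENNReal.ofReal (c₁ * c₂) * ENNReal.ofReal (expw (-1) t.1) * q t := by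
  have e1 : ENNReal.ofReal (expw (-R) t.2.1 * expw (-R) t.1) ≤
      ENNReal.ofReal (ω₂ t.1) * ENNReal.ofReal (expw (-R) t.2.1 * (c₂ * expw (-1) t.1)) := by
    rw [← ENNReal.ofReal_mul (ω₂.pos' t.1).le]
    refine ENNReal.ofReal_le_ofReal ?_
    calc _ ≤ expw (-R) t.2.1 * (c₂ * (ω₂ t.1 * expw (-1) t.1)) :=
          mul_le_mul_of_nonneg_left (h₂ t.1) (expw_pos _ _).le
      _ = _ := by ring
  calc _ ≤ ‖B t‖ₑ * (ENNReal.ofReal (ω₂ t.1) *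
        ENNReal.ofReal (expw (-R) t.2.1 * (c₂ * expw (-1) t.1))) := mul_le_mul_right e1 _
    _ = ‖B (t.1, t.2.1, t.2.2)‖ₑ * ENNReal.ofReal (ω₂ t.1) *
        ENNReal.ofReal (expw (-R) t.2.1 * (c₂ * expw (-1) t.1)) := by rw [mul_assoc]
    _ ≤ ENNReal.ofReal (ω₁ t.2.1) * q (t.1, t.2.1, t.2.2) *
        ENNReal.ofReal (expw (-R) t.2.1 * (c₂ * expw (-1) t.1)) :=
        mul_le_mul_left (h.bound t.1 t.2.1 t.2.2) _
    _ = ENNReal.ofReal (ω₁ t.2.1 * (expw (-R) t.2.1 * (c₂ * expw (-1) t.1))) * q t := by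
        rw [ENNReal.ofReal_mul (ω₁.pos' t.2.1).le]
        ring
    _ ≤ _ := by
        rw [← ENNReal.ofReal_mul (mul_nonneg hc₁ hc₂)]
        refine mul_le_mul_left (ENNReal.ofReal_le_ofReal ?_) _
        have := mul_le_mul_of_nonneg_right (h₁ t.2.1) (mul_nonneg hc₂ (expw_pos (-1) t.1).le)
        linarith

theorem lintegral_expw_mul_le (h : IsSchurKernel ω₁ ω₂ B q M) {c : ℝ≥0∞} (hc : c ≠ ∞) :
    ∫⁻ z : RR ι × RR ι, ∫⁻ r : (RR ι × RR ι) × RR κ,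
      c * ENNReal.ofReal (expw (-1) z) * q (z, r) ≤
      M * (c * ∫⁻ z : RR ι × RR ι, ENNReal.ofReal (expw (-1) z)) := by
  rw [mul_comm, ← lintegral_const_mul' _ _ hc, ← lintegral_mul_const' _ _ ENNReal.coe_ne_top]
  refine lintegral_mono fun z => ?_
  have hmq : Measurable fun r : (RR ι × RR ι) × RR κ => q (z, r) :=
    h.measMaj.comp measurable_prodMk_left
  simp only
  rw [lintegral_const_mul _ hmq, Measure.volume_eq_prod, lintegral_prod _ hmq.aemeasurable]
  exact mul_le_mul_right (h.row z) _

theorem kerMass_le (h : IsSchurKernel ω₁ ω₂ B q M) {R : ℝ} {c₁ c₂ : ℝ} (hc₁ : 0 ≤ c₁) (hc₂ : 0 ≤ c₂)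
    (h₁ : ∀ w, ω₁ w * expw (-R) w ≤ c₁) (h₂ : ∀ z, expw (-R) z ≤ c₂ * (ω₂ z * expw (-1) z)) :
    kerMass R B ≤ M * (ENNReal.ofReal (c₁ * c₂) *
      ∫⁻ z : RR ι × RR ι, ENNReal.ofReal (expw (-1) z)) :=
  (lintegral_mono fun z => lintegral_mono fun r =>
    h.enorm_mul_expw_le hc₁ hc₂ h₁ h₂ (z, r)).trans
    (h.lintegral_expw_mul_le ENNReal.ofReal_ne_top)

end IsSchurKernel

theorem isSynthesis_smul {B : (RR ι × RR ι) × (RR ι × RR ι) × RR κ → ℂ} {F : RR ι × RR ι → ℂ}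
    {u : GSDual ι} (hu : IsSynthesis u (kerApply B F)) (c : ℂ) :
    IsSynthesis (c • u) (kerApply B (c • F)) := by
  intro ψ
  rw [smul_apply, hu ψ, smul_eq_mul, ← integral_const_mul]
  refine integral_congr_ae (Eventually.of_forall fun z => ?_)
  simp only [kerApply, Pi.smul_apply, smul_eq_mul, mul_left_comm _ c]
  rw [integral_const_mul, mul_assoc]

theorem isSynthesis_smul_left {B : (RR ι × RR ι) × (RR ι × RR ι) × RR κ → ℂ}
    {F : RR ι × RR ι → ℂ} {u : GSDual ι} (hu : IsSynthesis u (kerApply B F)) (c : ℂ) :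
    IsSynthesis (c • u) (kerApply (c • B) F) := by
  convert isSynthesis_smul hu c using 1
  funext z
  simp only [kerApply, Pi.smul_apply, smul_eq_mul, mul_left_comm _ c, mul_assoc]

/-- The pairing of a synthesized distribution with test functions in terms of the kernel mass. -/
theorem IsSynthesis.enorm_kerApply_le {B : (RR ι × RR ι) × (RR ι × RR ι) × RR κ → ℂ}
    {R a b : ℝ} {F : RR ι × RR ι → ℂ} {u : GSDual ι}
    (hu : IsSynthesis u (kerApply B F)) (ha : 0 ≤ a) (hF : ∀ w, ‖F w‖ ≤ a * expw (-R) w) {ψ : GS ι}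
    (hb : 0 ≤ b) (hψ : ∀ z, ‖stft ψ.toDual z‖ ≤ b * expw (-R) z) :
    ‖u ψ‖ₑ ≤ ENNReal.ofReal (a * b) * kerMass R B := by
  rw [hu ψ, kerMass, ← lintegral_const_mul' _ _ ENNReal.ofReal_ne_top]
  refine (enorm_integral_le_lintegral_enorm _).trans (lintegral_mono fun z => ?_)
  rw [enorm_mul, ← lintegral_const_mul' _ _ ENNReal.ofReal_ne_top]
  refine (mul_le_mul_left (enorm_integral_le_lintegral_enorm _) _).trans ?_
  rw [← lintegral_mul_const' _ _ enorm_ne_top]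
  refine lintegral_mono fun r => ?_
  rw [enorm_mul, mul_assoc, mul_left_comm (ENNReal.ofReal (a * b))]
  refine mul_le_mul_right (a := ‖B (z, r)‖ₑ) ?_
  rw [← ofReal_norm, ← ofReal_norm, ← ENNReal.ofReal_mul (norm_nonneg _),
    ← ENNReal.ofReal_mul (mul_nonneg ha hb)]
  refine ENNReal.ofReal_le_ofReal ?_
  have h1 := hψ (z.1, -z.2)
  rw [expw_neg_arg] at h1
  calc _ ≤ (a * expw (-R) r.1) * (b * expw (-R) z) :=
        mul_le_mul (hF r.1) h1 (norm_nonneg _) (mul_nonneg ha (expw_pos _ _).le)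
    _ = _ := by ring

end
end

noncomputable section

section

variable {ι κ : Type} [Fintype ι] [Fintype κ]

/-! ### Concatenation of vectors -/

@[simp] theorem cat_inl (x : RR ι) (y : RR κ) (i : ι) : cat x y (Sum.inl i) = x i := rfl

@[simp] theorem cat_inr (x : RR ι) (y : RR κ) (j : κ) : cat x y (Sum.inr j) = y j := rfl

/-- The first component of a concatenated vector. -/
def catFst (X : RR (ι ⊕ κ)) : RR ι := WithLp.toLp 2 fun i => X (Sum.inl i)

/-- The second component of a concatenated vector. -/
def catSnd (X : RR (ι ⊕ κ)) : RR κ := WithLp.toLp 2 fun j => X (Sum.inr j)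

@[simp] theorem catFst_cat (x : RR ι) (y : RR κ) : catFst (cat x y) = x := rfl

@[simp] theorem catSnd_cat (x : RR ι) (y : RR κ) : catSnd (cat x y) = y := rfl

@[simp] theorem cat_catFst_catSnd (X : RR (ι ⊕ κ)) : cat (catFst X) (catSnd X) = X := by
  ext i
  rcases i with i | i <;> rfl

theorem cat_add_cat (x x' : RR ι) (y y' : RR κ) : cat x y + cat x' y' = cat (x + x') (y + y') := by
  ext i
  rcases i with i | i <;> rfl

theorem cat_sub_cat (x x' : RR ι) (y y' : RR κ) : cat x y - cat x' y' = cat (x - x') (y - y') := by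
  ext i
  rcases i with i | i <;> rfl

theorem smul_cat (c : ℝ) (x : RR ι) (y : RR κ) : c • cat x y = cat (c • x) (c • y) := by
  ext i
  rcases i with i | i <;> rfl

theorem continuous_cat : Continuous fun p : RR ι × RR κ => cat p.1 p.2 := by
  refine (PiLp.continuous_toLp 2 fun _ : ι ⊕ κ => ℝ).comp (continuous_pi fun i => ?_)
  rcases i with i | i
  · exact (EuclideanSpace.proj (𝕜 := ℝ) i).continuous.comp continuous_fst
  · exact (EuclideanSpace.proj (𝕜 := ℝ) i).continuous.comp continuous_snd

@[fun_prop]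
theorem Continuous.cat {α : Type*} [TopologicalSpace α] {f : α → RR ι} {g : α → RR κ}
    (hf : Continuous f) (hg : Continuous g) : Continuous fun a => cat (f a) (g a) :=
  continuous_cat.comp (hf.prodMk hg)

@[fun_prop]
theorem continuous_catFst : Continuous (catFst : RR (ι ⊕ κ) → RR ι) :=
  (PiLp.continuous_toLp 2 fun _ : ι => ℝ).comp (continuous_pi fun i =>
    (EuclideanSpace.proj (𝕜 := ℝ) (Sum.inl i : ι ⊕ κ)).continuous)

@[fun_prop]
theorem continuous_catSnd : Continuous (catSnd : RR (ι ⊕ κ) → RR κ) :=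
  (PiLp.continuous_toLp 2 fun _ : κ => ℝ).comp (continuous_pi fun i =>
    (EuclideanSpace.proj (𝕜 := ℝ) (Sum.inr i : ι ⊕ κ)).continuous)

/-- Concatenation as a homeomorphism. -/
def catHomeomorph (ι κ : Type) [Fintype ι] [Fintype κ] : RR ι × RR κ ≃ₜ RR (ι ⊕ κ) where
  toFun p := cat p.1 p.2
  invFun X := (catFst X, catSnd X)
  left_inv _ := rfl
  right_inv X := cat_catFst_catSnd X
  continuous_toFun := continuous_cat
  continuous_invFun := by fun_prop

theorem measurePreserving_cat :
    MeasurePreserving (fun p : RR ι × RR κ => cat p.1 p.2) volume volume := by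
  have h1 := (PiLp.volume_preserving_ofLp ι).prod (PiLp.volume_preserving_ofLp κ)
  have h2 := volume_measurePreserving_sumPiEquivProdPi_symm fun _ : ι ⊕ κ => ℝ
  have h3 := PiLp.volume_preserving_toLp (ι ⊕ κ)
  have h4 := h3.comp (h2.comp h1)
  have e : (WithLp.toLp 2 ∘ (MeasurableEquiv.sumPiEquivProdPi fun _ : ι ⊕ κ => ℝ).symm ∘
      Prod.map WithLp.ofLp WithLp.ofLp : RR ι × RR κ → RR (ι ⊕ κ)) =
      fun p => cat p.1 p.2 := by
    funext p
    ext i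
    rcases i with i | i <;> rfl
  rwa [e] at h4

theorem measurableEmbedding_cat : MeasurableEmbedding fun p : RR ι × RR κ => cat p.1 p.2 :=
  (catHomeomorph ι κ).measurableEmbedding

theorem lintegral_cat (f : RR (ι ⊕ κ) → ℝ≥0∞) :
    ∫⁻ X, f X = ∫⁻ p : RR ι × RR κ, f (cat p.1 p.2) :=
  (measurePreserving_cat.lintegral_comp_emb measurableEmbedding_cat f).symm

theorem integral_cat (f : RR (ι ⊕ κ) → ℂ) : ∫ X, f X = ∫ p : RR ι × RR κ, f (cat p.1 p.2) :=
  (measurePreserving_cat.integral_comp measurableEmbedding_cat f).symm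

theorem inner_cat (x x' : RR ι) (y y' : RR κ) :
    inner ℝ (cat x y) (cat x' y') = inner ℝ x x' + inner ℝ y y' := by
  simp only [PiLp.inner_apply, Fintype.sum_sum_type, cat_inl, cat_inr]

theorem norm_sq_cat (x : RR ι) (y : RR κ) : ‖cat x y‖ ^ 2 = ‖x‖ ^ 2 + ‖y‖ ^ 2 := by
  rw [← real_inner_self_eq_norm_sq, inner_cat, real_inner_self_eq_norm_sq,
    real_inner_self_eq_norm_sq]

theorem ecis_cat (x x' : RR ι) (y y' : RR κ) :
    ecis (cat x y) (cat x' y') = ecis x x' * ecis y y' := by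
  rw [ecis, ecis, ecis, inner_cat, ← Complex.exp_add]
  congr 1
  push_cast
  ring

theorem win_cat (x : RR ι) (y : RR κ) : win (cat x y) = win x * win y := by
  have h : (Real.pi : ℝ) ^ (-(Fintype.card (ι ⊕ κ) : ℝ) / 4) =
      Real.pi ^ (-(Fintype.card ι : ℝ) / 4) * Real.pi ^ (-(Fintype.card κ : ℝ) / 4) := by
    rw [← Real.rpow_add Real.pi_pos, Fintype.card_sum]
    congr 1
    push_cast
    ring
  rw [win, win, win, norm_sq_cat, h, mul_mul_mul_comm, ← Real.exp_add]
  congr 2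
  ring

/-! ### Changes of variables by partial gradients -/

/-- A bound for integrals along a map whose Jacobian is a matrix of second derivatives. -/
theorem IsRegularPhase.lintegral_comp_le {α : Type} [Fintype α] [DecidableEq α] {φ : RR ι → ℝ}
    {p : RR ι → RR ι} {h : ι → ι → RR ι → ℝ} (hφ : IsRegularPhase φ p h)
    (hu : ∀ i j, UniformContinuous (h i j)) {M : ℝ} (hM : ∀ i j X, |h i j X| ≤ M)
    {L : RR α →L[ℝ] RR ι} {e f : α → ι} (hL : ∀ (g : ι → ℝ) Z, ∑ i, g i * L Z i = ∑ j, g (e j) * Z j)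
    (X₀ : RR ι) {δ : ℝ} (hδ : 0 < δ)
    (hdet : ∀ X, δ ≤ |(Matrix.of fun i j => h (e j) (f i) X).det|) (g : RR α → ℝ≥0∞) :
    ∫⁻ Y, g (WithLp.toLp 2 fun i => p (X₀ + L Y) (f i)) ≤ ENNReal.ofReal δ⁻¹ * ∫⁻ Y, g Y := by
  let E : α → α → RR α →L[ℝ] RR α := fun i j =>
    (EuclideanSpace.proj j : RR α →L[ℝ] ℝ).smulRight (EuclideanSpace.single i (1 : ℝ))
  have hA : UniformContinuous fun Y : RR α => X₀ + L Y :=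
    uniformContinuous_const.add L.uniformContinuous
  have hE : ∀ (c : α → α → ℝ) (Z : RR α) (i : α),
      (∑ i, ∑ j, c i j • E i j) Z i = ∑ j, c i j * Z j := by
    intro c Z i
    simp [E, sum_apply, Pi.single_apply]
  refine lintegral_comp_le_of_det_bound volume
    (f' := fun Y => ∑ i, ∑ j, h (e j) (f i) (X₀ + L Y) • E i j) (M := ∑ i, ∑ j, M * ‖E i j‖)
    (fun Y => ?_) ?_ (fun Y => ?_) hδ (fun Y => ?_) g
  · rw [← hasFDerivWithinAt_univ, hasFDerivWithinAt_euclidean]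
    intro i
    rw [hasFDerivWithinAt_univ]
    have h1 : HasFDerivAt (fun Y : RR α => X₀ + L Y) L Y := L.hasFDerivAt.const_add X₀
    refine ((hφ.hasFDerivAt (f i) (X₀ + L Y)).comp Y h1).congr_fderiv ?_
    ext Z
    change (∑ k, h k (f i) (X₀ + L Y) • (EuclideanSpace.proj k : RR ι →L[ℝ] ℝ)) (L Z) =
      (∑ i, ∑ j, h (e j) (f i) (X₀ + L Y) • E i j) Z i
    rw [hE]
    simp only [sum_apply, smul_apply, smul_eq_mul]
    exact hL (fun k => h k (f i) (X₀ + L Y)) Z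
  · have hsum : ∀ (β : Type) [Fintype β] (F : β → RR α → RR α →L[ℝ] RR α),
        (∀ b, UniformContinuous (F b)) → UniformContinuous fun Y => ∑ b, F b Y := by
      intro β _ F hF
      have h1 : UniformContinuous fun Y (b : β) => F b Y := uniformContinuous_pi.2 hF
      have h2 : UniformContinuous fun G : β → RR α →L[ℝ] RR α => ∑ b, G b := by
        have e : (fun G : β → RR α →L[ℝ] RR α => ∑ b, G b) = (∑ b : β,
            ContinuousLinearMap.proj (R := ℝ) (φ := fun _ : β => RR α →L[ℝ] RR α) b) := by
          funext G
          simp [sum_apply]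
        rw [e]
        exact ContinuousLinearMap.uniformContinuous _
      exact h2.comp h1
    refine hsum α _ fun i => hsum α _ fun j => ?_
    have h1 : UniformContinuous fun Y => h (e j) (f i) (X₀ + L Y) := (hu _ _).comp hA
    exact (ContinuousLinearMap.toSpanSingleton ℝ (E i j)).uniformContinuous.comp h1
  · refine norm_sum_le_of_le _ fun i _ => norm_sum_le_of_le _ fun j _ => ?_
    rw [norm_smul]
    exact mul_le_mul_of_nonneg_right (hM _ _ _) (norm_nonneg _)
  · refine (hdet (X₀ + L Y)).trans (le_of_eq ?_)
    congr 1
    rw [ContinuousLinearMap.det, ← LinearMap.det_toMatrix (EuclideanSpace.basisFun α ℝ).toBasis]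
    congr 1
    ext i j
    rw [LinearMap.toMatrix_apply]
    simp only [OrthonormalBasis.coe_toBasis, EuclideanSpace.basisFun_apply,
      OrthonormalBasis.coe_toBasis_repr_apply, EuclideanSpace.basisFun_repr, Matrix.of_apply]
    rw [ContinuousLinearMap.coe_coe, hE]
    simp

end
end

noncomputable section

section

variable {ι κ : Type} [Fintype ι] [Fintype κ]

/-! ### Schur bounds for the kernels of Fourier integral operators -/

/-- Integration over one frequency variable followed by a change of variables in the others. -/
theorem lintegral_partial_comp_le {Q : RR ι → RR ι → RR κ → ℝ≥0∞}
    (hQ : Measurable fun t : RR ι × RR ι × RR κ => Q t.1 t.2.1 t.2.2)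
    {A S : RR ι × RR κ → RR ι} {T : RR ι × RR κ → RR κ} (hA : Continuous A) (hS : Continuous S)
    (hT : Continuous T) {e : RR ι → RR ι} (he : Continuous e)
    (he' : ∀ (f : RR ι → ℝ≥0∞) (s : RR ι), ∫⁻ η, f (e η - s) = ∫⁻ η, f η) {c : ℝ≥0∞}
    (hc : ∀ g : RR (ι ⊕ κ) → ℝ≥0∞, ∫⁻ Y : RR (ι ⊕ κ),
      g (cat (A (catFst Y, catSnd Y)) (T (catFst Y, catSnd Y))) ≤ c * ∫⁻ Y, g Y) (ξ : RR ι) :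
    ∫⁻ w : RR ι × RR ι, ∫⁻ ζ, Q (ξ - A (w.1, ζ)) (e w.2 - S (w.1, ζ)) (0 - T (w.1, ζ)) ≤
      c * ∫⁻ t : RR ι × RR κ, ∫⁻ η, Q t.1 η t.2 := by
  have hm3 : Measurable fun t : (RR ι × RR ι) × RR κ =>
      Q (ξ - A (t.1.1, t.2)) (e t.1.2 - S (t.1.1, t.2)) (0 - T (t.1.1, t.2)) := by
    have h1 : Continuous fun t : (RR ι × RR ι) × RR κ =>
        (ξ - A (t.1.1, t.2), e t.1.2 - S (t.1.1, t.2), 0 - T (t.1.1, t.2)) := by fun_prop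
    exact hQ.comp h1.measurable
  have hg : Measurable fun t : RR ι × RR κ => ∫⁻ η, Q t.1 η t.2 := by
    have h1 : Measurable fun t : (RR ι × RR κ) × RR ι => Q t.1.1 t.2 t.1.2 :=
      hQ.comp (by fun_prop : Measurable fun t : (RR ι × RR κ) × RR ι => (t.1.1, t.2, t.1.2))
    exact h1.lintegral_prod_right'
  calc _ = ∫⁻ y, ∫⁻ η, ∫⁻ ζ, Q (ξ - A (y, ζ)) (e η - S (y, ζ)) (0 - T (y, ζ)) := by
        rw [Measure.volume_eq_prod, lintegral_prod _ hm3.lintegral_prod_right'.aemeasurable]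
    _ = ∫⁻ y, ∫⁻ ζ, ∫⁻ η, Q (ξ - A (y, ζ)) (e η - S (y, ζ)) (0 - T (y, ζ)) := by
        refine lintegral_congr fun y => ?_
        rw [lintegral_lintegral_swap]
        exact (hm3.comp (by fun_prop :
          Measurable fun t : RR ι × RR κ => ((y, t.1), t.2))).aemeasurable
    _ = ∫⁻ y, ∫⁻ ζ, ∫⁻ η, Q (ξ - A (y, ζ)) η (0 - T (y, ζ)) := by
        refine lintegral_congr fun y => lintegral_congr fun ζ => ?_
        exact he' (fun η => Q (ξ - A (y, ζ)) η (0 - T (y, ζ))) (S (y, ζ))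
    _ = ∫⁻ Y : RR (ι ⊕ κ), (fun W : RR (ι ⊕ κ) => ∫⁻ η, Q (ξ - catFst W) η (0 - catSnd W))
          (cat (A (catFst Y, catSnd Y)) (T (catFst Y, catSnd Y))) := by
        simp only [catFst_cat, catSnd_cat]
        rw [lintegral_cat]
        simp only [catFst_cat, catSnd_cat]
        rw [Measure.volume_eq_prod, lintegral_prod]
        exact (hg.comp (by fun_prop : Continuous fun t : RR ι × RR κ =>
          (ξ - A t, 0 - T t)).measurable).aemeasurable
    _ ≤ c * ∫⁻ W : RR (ι ⊕ κ), ∫⁻ η, Q (ξ - catFst W) η (0 - catSnd W) := hc _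
    _ = _ := by
        congr 1
        rw [lintegral_cat]
        simp only [catFst_cat, catSnd_cat]
        rw [Measure.volume_eq_prod, lintegral_prod, lintegral_prod _ hg.aemeasurable]
        · calc _ = ∫⁻ x : RR ι, ∫⁻ ζ : RR κ, ∫⁻ η, Q (ξ - x) η ζ :=
                lintegral_congr fun x =>
                  lintegral_sub_left_eq_self (fun ζ : RR κ => ∫⁻ η, Q (ξ - x) η ζ) 0
            _ = _ := lintegral_sub_left_eq_self (fun x : RR ι => ∫⁻ ζ : RR κ, ∫⁻ η, Q x η ζ) ξ
        · exact (hg.comp (by fun_prop : Continuous fun t : RR ι × RR κ =>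
            (ξ - t.1, 0 - t.2)).measurable).aemeasurable

variable {d m : ℕ}

/-- The coordinates `(x, ζ)` of `X = (x, y, ζ)`. -/
def outerIx : Fin d ⊕ Fin m → Ix d m := Sum.elim Sum.inl (Sum.inr ∘ Sum.inr)

/-- The embedding `Y ↦ (0, Y)`. -/
def innerEmb (d m : ℕ) : RR (Fin d ⊕ Fin m) →L[ℝ] RR (Ix d m) :=
  LinearMap.toContinuousLinearMap
    { toFun := fun Y => cat 0 Y
      map_add' := fun Y Y' => by rw [cat_add_cat, add_zero]
      map_smul' := fun c Y => by rw [RingHom.id_apply, smul_cat, smul_zero] }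

/-- The embedding `(x, ζ) ↦ (x, 0, ζ)`. -/
def outerEmb (d m : ℕ) : RR (Fin d ⊕ Fin m) →L[ℝ] RR (Ix d m) :=
  LinearMap.toContinuousLinearMap
    { toFun := fun Y => cat (catFst Y) (cat 0 (catSnd Y))
      map_add' := fun Y Y' => by
        rw [cat_add_cat, cat_add_cat, add_zero]; rfl
      map_smul' := fun c Y => by
        rw [RingHom.id_apply, smul_cat, smul_cat, smul_zero]; rfl }

theorem innerEmb_apply (Y : RR (Fin d ⊕ Fin m)) : innerEmb d m Y = cat 0 Y := rfl

theorem outerEmb_apply (Y : RR (Fin d ⊕ Fin m)) :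
    outerEmb d m Y = cat (catFst Y) (cat 0 (catSnd Y)) := rfl

theorem mixedHessian_eq (H : Ix d m → Ix d m → RR (Ix d m) → ℝ) (X : RR (Ix d m)) :
    mixedHessian H X = Matrix.of fun i j => H (outerIx i) (Sum.inr j) X := by
  ext i j
  rcases i with i | i <;> rcases j with j | j <;> rfl

theorem continuous_det_mixedHessian {h : Ix d m → Ix d m → RR (Ix d m) → ℝ}
    (hc : ∀ i j, Continuous (h i j)) : Continuous fun X => (mixedHessian h X).det := by
  refine Continuous.matrix_det (continuous_pi fun i => continuous_pi fun j => ?_)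
  simp only [mixedHessian_eq, Matrix.of_apply]
  exact hc _ _

theorem le_abs_det_of_ae {h H : Ix d m → Ix d m → RR (Ix d m) → ℝ}
    (hc : ∀ i j, Continuous (h i j)) (hae : ∀ᵐ X, ∀ i j, h i j X = H i j X) {δ : ℝ}
    (hδ : ∀ᵐ X, δ ≤ |(mixedHessian H X).det|) (X : RR (Ix d m)) :
    δ ≤ |(mixedHessian h X).det| := by
  have h1 : ∀ᵐ X, δ ≤ |(mixedHessian h X).det| := by
    filter_upwards [hae, hδ] with X h1 h2
    have e : mixedHessian h X = mixedHessian H X := by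
      rw [mixedHessian_eq, mixedHessian_eq]
      ext i j
      exact h1 _ _
    rwa [e]
  have hcl : IsClosed {X | δ ≤ |(mixedHessian h X).det|} :=
    isClosed_le continuous_const (continuous_det_mixedHessian hc).abs
  have hd := (Measure.dense_of_ae h1).closure_eq
  rw [hcl.closure_eq] at hd
  have hX : X ∈ (Set.univ : Set (RR (Ix d m))) := Set.mem_univ X
  rw [← hd] at hX
  exact hX

theorem lintegral_cat₃ {Q : RR (Ix d m) → ℝ≥0∞} (hQ : Measurable Q) :
    ∫⁻ Ξ, Q Ξ = ∫⁻ x, ∫⁻ y, ∫⁻ ζ, Q (cat x (cat y ζ)) := by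
  have h1 : Measurable fun p : RR (Fin d) × RR (Fin d ⊕ Fin m) => Q (cat p.1 p.2) :=
    hQ.comp continuous_cat.measurable
  rw [lintegral_cat, Measure.volume_eq_prod, lintegral_prod _ h1.aemeasurable]
  refine lintegral_congr fun x => ?_
  have h2 : Measurable fun p : RR (Fin d) × RR (Fin m) => Q (cat x (cat p.1 p.2)) :=
    hQ.comp (by fun_prop : Continuous fun p : RR (Fin d) × RR (Fin m) =>
      (cat x (cat p.1 p.2) : RR (Ix d m))).measurable
  rw [lintegral_cat (fun Y => Q (cat x Y)), Measure.volume_eq_prod,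
    lintegral_prod _ h2.aemeasurable]

/-- The majorant of the kernel in the position and frequency variables. -/
def fioMaj (p : RR (Ix d m) → RR (Ix d m)) (Q : RR (Ix d m) → ℝ≥0∞)
    (t : (RR (Fin d) × RR (Fin d)) × (RR (Fin d) × RR (Fin d)) × RR (Fin m)) : ℝ≥0∞ :=
  Q (cat t.1.2 (cat (-t.2.1.2) 0) - p (cat t.1.1 (cat t.2.1.1 t.2.2)))

section

variable {φ : RR (Ix d m) → ℝ} {p : RR (Ix d m) → RR (Ix d m)}
  {h : Ix d m → Ix d m → RR (Ix d m) → ℝ}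

theorem IsRegularPhase.continuous_grad (hφ : IsRegularPhase φ p h) : Continuous p :=
  (PiLp.continuous_toLp 2 fun _ : Ix d m => ℝ).comp (continuous_pi fun j =>
    continuous_iff_continuousAt.2 fun X => (hφ.hasFDerivAt j X).continuousAt)

theorem measurable_fioMaj (hp : Continuous p) {Q : RR (Ix d m) → ℝ≥0∞} (hQ : Measurable Q) :
    Measurable (fioMaj p Q) :=
  hQ.comp (by fun_prop : Continuous fun t : (RR (Fin d) × RR (Fin d)) ×
    (RR (Fin d) × RR (Fin d)) × RR (Fin m) => (cat t.1.2 (cat (-t.2.1.2) 0) -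
      p (cat t.1.1 (cat t.2.1.1 t.2.2)) : RR (Ix d m))).measurable

theorem fioMaj_eq (p : RR (Ix d m) → RR (Ix d m)) (Q : RR (Ix d m) → ℝ≥0∞)
    (t : (RR (Fin d) × RR (Fin d)) × (RR (Fin d) × RR (Fin d)) × RR (Fin m)) :
    fioMaj p Q t = Q (cat (t.1.2 - catFst (p (cat t.1.1 (cat t.2.1.1 t.2.2))))
      (cat (-t.2.1.2 - catFst (catSnd (p (cat t.1.1 (cat t.2.1.1 t.2.2)))))
        (0 - catSnd (catSnd (p (cat t.1.1 (cat t.2.1.1 t.2.2))))))) := by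
  rw [fioMaj]
  conv_lhs => rw [← cat_catFst_catSnd (p (cat t.1.1 (cat t.2.1.1 t.2.2))),
    ← cat_catFst_catSnd (catSnd (p (cat t.1.1 (cat t.2.1.1 t.2.2)))), cat_sub_cat, cat_sub_cat]

theorem lintegral_neg_sub {ι : Type} [Fintype ι] (f : RR ι → ℝ≥0∞) (s : RR ι) :
    ∫⁻ η, f (-η - s) = ∫⁻ η, f η := by
  rw [← lintegral_sub_left_eq_self f (-s)]
  refine lintegral_congr fun η => congrArg f (by abel)

theorem lintegral_fioMaj_row (hφ : IsRegularPhase φ p h) (hu : ∀ i j, UniformContinuous (h i j))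
    {M : ℝ} (hM : ∀ i j X, |h i j X| ≤ M) {δ : ℝ} (hδ : 0 < δ)
    (hdet : ∀ X, δ ≤ |(mixedHessian h X).det|) {Q : RR (Ix d m) → ℝ≥0∞} (hQ : Measurable Q)
    (z : RR (Fin d) × RR (Fin d)) :
    ∫⁻ w, ∫⁻ ζ, fioMaj p Q (z, w, ζ) ≤ ENNReal.ofReal δ⁻¹ * ∫⁻ Ξ, Q Ξ := by
  have hp := hφ.continuous_grad
  have hQ' : Measurable fun t : RR (Fin d) × RR (Fin d) × RR (Fin m) =>
      Q (cat t.1 (cat t.2.1 t.2.2)) :=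
    hQ.comp (by fun_prop : Continuous fun t : RR (Fin d) × RR (Fin d) × RR (Fin m) =>
      (cat t.1 (cat t.2.1 t.2.2) : RR (Ix d m))).measurable
  have key := lintegral_partial_comp_le (Q := fun a η b => Q (cat a (cat η b))) hQ'
    (A := fun t => catFst (p (cat z.1 (cat t.1 t.2))))
    (S := fun t => catFst (catSnd (p (cat z.1 (cat t.1 t.2)))))
    (T := fun t => catSnd (catSnd (p (cat z.1 (cat t.1 t.2)))))
    (by fun_prop) (by fun_prop) (by fun_prop) (e := fun η => -η) (by fun_prop)
    lintegral_neg_sub (c := ENNReal.ofReal δ⁻¹) (fun g => ?_) z.2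
  · simp only [fioMaj_eq]
    refine key.trans (le_of_eq ?_)
    congr 1
    rw [lintegral_cat₃ hQ]
    have h1 : Measurable fun t : RR (Fin d) × RR (Fin m) =>
        ∫⁻ η, Q (cat t.1 (cat η t.2)) := by
      have h1 : Measurable fun t : (RR (Fin d) × RR (Fin m)) × RR (Fin d) =>
          Q (cat t.1.1 (cat t.2 t.1.2)) := hQ'.comp (by fun_prop : Measurable
            fun t : (RR (Fin d) × RR (Fin m)) × RR (Fin d) => (t.1.1, t.2, t.1.2))
      exact h1.lintegral_prod_right'
    rw [Measure.volume_eq_prod, lintegral_prod _ h1.aemeasurable]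
    refine lintegral_congr fun x => ?_
    rw [lintegral_lintegral_swap]
    exact (hQ'.comp (by fun_prop : Measurable fun t : RR (Fin m) × RR (Fin d) =>
      (x, t.2, t.1))).aemeasurable
  · have := hφ.lintegral_comp_le hu hM (L := innerEmb d m) (e := Sum.inr) (f := outerIx)
      (fun g Z => by rw [Fintype.sum_sum_type]; simp [innerEmb_apply]) (cat z.1 0) hδ
      (fun X => by
        have := hdet X
        rw [mixedHessian_eq] at this
        simpa only [hφ.symm (Sum.inr _)] using this) g
    refine le_trans (le_of_eq (lintegral_congr fun Y => ?_)) this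
    rw [innerEmb_apply, cat_add_cat, add_zero, zero_add, cat_catFst_catSnd]
    congr 1
    ext i
    rcases i with i | i <;> rfl

theorem lintegral_fioMaj_col (hφ : IsRegularPhase φ p h) (hu : ∀ i j, UniformContinuous (h i j))
    {M : ℝ} (hM : ∀ i j X, |h i j X| ≤ M) {δ : ℝ} (hδ : 0 < δ)
    (hdet : ∀ X, δ ≤ |(mixedHessian h X).det|) {Q : RR (Ix d m) → ℝ≥0∞} (hQ : Measurable Q)
    (w : RR (Fin d) × RR (Fin d)) :
    ∫⁻ z, ∫⁻ ζ, fioMaj p Q (z, w, ζ) ≤ ENNReal.ofReal δ⁻¹ * ∫⁻ Ξ, Q Ξ := by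
  have hp := hφ.continuous_grad
  have hQ' : Measurable fun t : RR (Fin d) × RR (Fin d) × RR (Fin m) =>
      Q (cat t.2.1 (cat t.1 t.2.2)) :=
    hQ.comp (by fun_prop : Continuous fun t : RR (Fin d) × RR (Fin d) × RR (Fin m) =>
      (cat t.2.1 (cat t.1 t.2.2) : RR (Ix d m))).measurable
  have key := lintegral_partial_comp_le (Q := fun a η b => Q (cat η (cat a b))) hQ'
    (A := fun t => catFst (catSnd (p (cat t.1 (cat w.1 t.2)))))
    (S := fun t => catFst (p (cat t.1 (cat w.1 t.2))))
    (T := fun t => catSnd (catSnd (p (cat t.1 (cat w.1 t.2)))))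
    (by fun_prop) (by fun_prop) (by fun_prop) (e := fun η => η) (by fun_prop)
    (fun f s => lintegral_sub_right_eq_self f s) (c := ENNReal.ofReal δ⁻¹) (fun g => ?_) (-w.2)
  · simp only [fioMaj_eq]
    refine key.trans (le_of_eq ?_)
    congr 1
    rw [lintegral_cat₃ hQ]
    have h1 : Measurable fun t : (RR (Fin d) × RR (Fin m)) × RR (Fin d) =>
        Q (cat t.2 (cat t.1.1 t.1.2)) := hQ'.comp (by fun_prop : Measurable
          fun t : (RR (Fin d) × RR (Fin m)) × RR (Fin d) => (t.1.1, t.2, t.1.2))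
    rw [lintegral_lintegral_swap (f := fun (t : RR (Fin d) × RR (Fin m)) (η : RR (Fin d)) =>
      Q (cat η (cat t.1 t.2))) h1.aemeasurable]
    refine lintegral_congr fun x => ?_
    rw [Measure.volume_eq_prod, lintegral_prod]
    exact (hQ'.comp (by fun_prop : Measurable fun t : RR (Fin d) × RR (Fin m) =>
      (t.1, x, t.2))).aemeasurable
  · have := hφ.lintegral_comp_le hu hM (L := outerEmb d m) (e := outerIx) (f := Sum.inr)
      (fun g Z => by
        rw [Fintype.sum_sum_type, Fintype.sum_sum_type, Fintype.sum_sum_type]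
        simp [outerEmb_apply, outerIx, catFst, catSnd]) (cat 0 (cat w.1 0)) hδ
      (fun X => by
        have := hdet X
        rw [mixedHessian_eq, ← Matrix.det_transpose] at this
        exact this) g
    refine le_trans (le_of_eq (lintegral_congr fun Y => ?_)) this
    rw [outerEmb_apply, cat_add_cat, cat_add_cat, add_zero, zero_add, zero_add]
    congr 1
    ext i
    rcases i with i | i <;> rfl

end

end
end

noncomputable section

section

variable {ι κ : Type} [Fintype ι] [Fintype κ]

/-! ### Gaussian windows of variable width -/

/-- The window `exp (-β |y|^2) win y`. -/
def bwin (β : ℝ) (y : RR ι) : ℝ := win y * Real.exp (-β * ‖y‖ ^ 2)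

theorem bwin_pos (β : ℝ) (y : RR ι) : 0 < bwin β y := mul_pos (win_pos y) (Real.exp_pos _)

theorem bwin_le_win {β : ℝ} (hβ : 0 ≤ β) (y : RR ι) : bwin β y ≤ win y := by
  refine mul_le_of_le_one_right (win_pos y).le (Real.exp_le_one_iff.2 ?_)
  have := mul_nonneg hβ (sq_nonneg ‖y‖)
  linarith

@[fun_prop]
theorem continuous_bwin (β : ℝ) : Continuous (bwin β : RR ι → ℝ) :=
  continuous_win.mul (by fun_prop)

theorem abs_bwin_le {β : ℝ} (hβ : 0 ≤ β) (y : RR ι) :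
    |bwin β y| ≤ Real.pi ^ (-(Fintype.card ι : ℝ) / 4) := by
  rw [abs_of_pos (bwin_pos β y)]
  exact (bwin_le_win hβ y).trans (win_le y)

theorem integrable_bwin {β : ℝ} (hβ : 0 ≤ β) : Integrable (bwin β : RR ι → ℝ) :=
  integrable_win.mono' (continuous_bwin β).aestronglyMeasurable (Eventually.of_forall fun y => by
    rw [Real.norm_of_nonneg (bwin_pos β y).le]
    exact bwin_le_win hβ y)

theorem bwin_cat (β : ℝ) (x : RR ι) (y : RR κ) : bwin β (cat x y) = bwin β x * bwin β y := by
  rw [bwin, bwin, bwin, win_cat, norm_sq_cat, mul_add, Real.exp_add]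
  ring

/-- The constant in the inversion formula with the window `bwin β`. -/
def bwinConst (ι : Type) [Fintype ι] (β : ℝ) : ℝ := (ftc ι)⁻¹ * ∫ x : RR ι, win x * bwin β x

theorem integral_exp_neg_sq (b : ℝ) (hb : 0 < b) :
    ∫ x : RR ι, Real.exp (-b * ‖x‖ ^ 2) = (Real.pi / b) ^ ((Fintype.card ι : ℝ) / 2) := by
  have := GaussianFourier.integral_rexp_neg_mul_sq_norm (V := RR ι) hb
  rw [finrank_euclideanSpace] at this
  exact this

theorem integral_bwin {β : ℝ} (hβ : 0 ≤ β) : ∫ x : RR ι, bwin β x =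
    Real.pi ^ (-(Fintype.card ι : ℝ) / 4) *
      (Real.pi / (1 / 2 + β)) ^ ((Fintype.card ι : ℝ) / 2) := by
  rw [← integral_exp_neg_sq _ (by positivity), ← integral_const_mul]
  refine integral_congr_ae (Eventually.of_forall fun x => ?_)
  simp only [bwin, win]
  rw [mul_assoc, ← Real.exp_add]
  congr 2
  ring

theorem integral_win_mul_bwin {β : ℝ} (hβ : 0 ≤ β) : ∫ x : RR ι, win x * bwin β x =
    Real.pi ^ (-(Fintype.card ι : ℝ) / 4) * Real.pi ^ (-(Fintype.card ι : ℝ) / 4) *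
      (Real.pi / (1 + β)) ^ ((Fintype.card ι : ℝ) / 2) := by
  rw [← integral_exp_neg_sq _ (by positivity), ← integral_const_mul]
  refine integral_congr_ae (Eventually.of_forall fun x => ?_)
  simp only [bwin, win]
  rw [mul_assoc, mul_assoc, mul_left_comm (Real.exp _), ← Real.exp_add, mul_assoc, ← Real.exp_add]
  congr 3
  ring

/-- The lower bound for the Gaussian integrals. -/
theorem rpow_neg_le_div_rpow {b n : ℝ} (hb : 0 < b) {β : ℝ} (hbβ : b ≤ 1 + β) (hn : 0 ≤ n)
    (hβ : 0 ≤ β) : (1 + β) ^ (-(n / 2)) ≤ (Real.pi / b) ^ (n / 2) := by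
  rw [Real.rpow_neg (by positivity), ← Real.inv_rpow (by positivity)]
  refine Real.rpow_le_rpow (by positivity) ?_ (by positivity)
  rw [inv_eq_one_div]
  exact div_le_div₀ Real.pi_pos.le (by linarith [Real.pi_gt_three]) hb hbβ

theorem bwinConst_pos {β : ℝ} (hβ : 0 ≤ β) : 0 < bwinConst ι β := by
  rw [bwinConst, integral_win_mul_bwin hβ]
  have := ftc_pos (ι := ι)
  positivity

/-- The normalizing constant of the kernel of a Fourier integral operator. -/
def fioConst (d m : ℕ) (β : ℝ) : ℝ :=
  (2 * Real.pi) ^ (-((d : ℝ) + m) / 2) /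
    (bwinConst (Fin d) β * bwinConst (Fin d) β * ∫ x : RR (Fin m), bwin β x)

theorem fioConst_pos (d m : ℕ) {β : ℝ} (hβ : 0 ≤ β) : 0 < fioConst d m β := by
  have h1 := bwinConst_pos (ι := Fin d) hβ
  unfold fioConst
  rw [integral_bwin hβ]
  positivity

theorem exists_fioConst_le (d m : ℕ) : ∃ C : ℝ, 0 < C ∧ ∀ β, 0 ≤ β →
    fioConst d m β ≤ C * (1 + β) ^ ((d : ℝ) + (m : ℝ) / 2) := by
  set c : ℝ := (ftc (Fin d))⁻¹ * (Real.pi ^ (-(Fintype.card (Fin d) : ℝ) / 4) *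
    Real.pi ^ (-(Fintype.card (Fin d) : ℝ) / 4)) with hc
  set c' : ℝ := Real.pi ^ (-(Fintype.card (Fin m) : ℝ) / 4) with hc'
  have hcp : 0 < c := by have := ftc_pos (ι := Fin d); positivity
  have hcp' : 0 < c' := by positivity
  refine ⟨(2 * Real.pi) ^ (-((d : ℝ) + m) / 2) / (c * c * c'), by positivity, fun β hβ => ?_⟩
  have h1 : c * (1 + β) ^ (-((d : ℝ) / 2)) ≤ bwinConst (Fin d) β := by
    rw [bwinConst, integral_win_mul_bwin hβ, ← mul_assoc]
    refine mul_le_mul_of_nonneg_left ?_ hcp.le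
    rw [Fintype.card_fin]
    exact rpow_neg_le_div_rpow (by positivity) le_rfl (Nat.cast_nonneg d) hβ
  have h2 : c' * (1 + β) ^ (-((m : ℝ) / 2)) ≤ ∫ x : RR (Fin m), bwin β x := by
    rw [integral_bwin hβ]
    refine mul_le_mul_of_nonneg_left ?_ hcp'.le
    rw [Fintype.card_fin]
    exact rpow_neg_le_div_rpow (by positivity) (by linarith) (Nat.cast_nonneg m) hβ
  have e : (1 + β) ^ ((d : ℝ) + (m : ℝ) / 2) = ((1 + β) ^ (-((d : ℝ) / 2)) *
      (1 + β) ^ (-((d : ℝ) / 2)) * (1 + β) ^ (-((m : ℝ) / 2)))⁻¹ := by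
    rw [← Real.rpow_add (by positivity), ← Real.rpow_add (by positivity),
      ← Real.rpow_neg (by positivity)]
    congr 1
    ring
  have p1 : 0 < (1 + β) ^ (-((d : ℝ) / 2)) := by positivity
  have p2 : 0 < (1 + β) ^ (-((m : ℝ) / 2)) := by positivity
  rw [fioConst, e]
  set a := (1 + β) ^ (-((d : ℝ) / 2)) with ha
  set b := (1 + β) ^ (-((m : ℝ) / 2)) with hb
  calc _ ≤ (2 * Real.pi) ^ (-((d : ℝ) + m) / 2) / ((c * a) * (c * a) * (c' * b)) := by
        refine div_le_div_of_nonneg_left (by positivity) (by positivity) ?_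
        exact mul_le_mul (mul_le_mul h1 h1 (by positivity) (h1.trans' (by positivity))) h2
          (by positivity) (mul_nonneg (h1.trans' (by positivity)) (h1.trans' (by positivity)))
    _ = _ := by
        field_simp

/-! ### The kernel of a Fourier integral operator -/

variable {d m : ℕ}

/-- The position `(x, y, ζ)`. -/
def fioPos (t : (RR (Fin d) × RR (Fin d)) × (RR (Fin d) × RR (Fin d)) × RR (Fin m)) :
    RR (Ix d m) := cat t.1.1 (cat t.2.1.1 t.2.2)

/-- The frequency `(ξ, -η, 0)`. -/
def fioFreq (t : (RR (Fin d) × RR (Fin d)) × (RR (Fin d) × RR (Fin d)) × RR (Fin m)) :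
    RR (Ix d m) := cat t.1.2 (cat (-t.2.1.2) 0)

@[fun_prop]
theorem continuous_fioPos : Continuous (fioPos (d := d) (m := m)) := by
  unfold fioPos; fun_prop

@[fun_prop]
theorem continuous_fioFreq : Continuous (fioFreq (d := d) (m := m)) := by
  unfold fioFreq; fun_prop

/-- The phase space kernel of the Fourier integral operator with phase `φ` and amplitude `u`. -/
def fioKer (φ : RR (Ix d m) → ℝ) (p : RR (Ix d m) → RR (Ix d m)) (β : ℝ) (u : GSDual (Ix d m))
    (t : (RR (Fin d) × RR (Fin d)) × (RR (Fin d) × RR (Fin d)) × RR (Fin m)) : ℂ :=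
  fioConst d m β * oscStft φ p β u (fioPos t, fioFreq t)

variable {φ : RR (Ix d m) → ℝ} {p : RR (Ix d m) → RR (Ix d m)} {β : ℝ} {v : Weight (RR (Ix d m))}
  {Ht : RR (Ix d m) → ℝ≥0∞} {K : ℝ≥0} {ω : Weight (RR (Ix d m) × RR (Ix d m))}
  {ω₁ ω₂ : Weight (RR (Fin d) × RR (Fin d))} {D E δ M : ℝ}
  {h : Ix d m → Ix d m → RR (Ix d m) → ℝ} {u : GSDual (Ix d m)} {G : RR (Ix d m) → ℝ≥0∞}

/-- The standing hypotheses on the phase function and the weights. -/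
structure FioData (φ : RR (Ix d m) → ℝ) (p : RR (Ix d m) → RR (Ix d m)) (β : ℝ)
    (v : Weight (RR (Ix d m))) (Ht : RR (Ix d m) → ℝ≥0∞) (K : ℝ≥0)
    (ω : Weight (RR (Ix d m) × RR (Ix d m))) (ω₁ ω₂ : Weight (RR (Fin d) × RR (Fin d)))
    (D E δ M : ℝ) (h : Ix d m → Ix d m → RR (Ix d m) → ℝ) : Prop where
  osc : OscBound φ p β v Ht K
  modNonneg : 0 ≤ D
  mod : ∀ X Ξ₁ Ξ₂, ω (X, Ξ₁ + Ξ₂) ≤ D * (ω (X, Ξ₁) * v Ξ₂)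
  regular : IsRegularPhase φ p h
  uniform : ∀ i j, UniformContinuous (h i j)
  bounded : ∀ i j X, |h i j X| ≤ M
  pos : 0 < δ
  det : ∀ X, δ ≤ |(mixedHessian h X).det|
  weightNonneg : 0 ≤ E
  weight : ∀ t, ω₂ t.1 ≤ E * (ω₁ t.2.1 * ω (fioPos t, fioFreq t - p (fioPos t)))

/-- The Schur bound of the kernel. -/
def fioSchur (d m : ℕ) (β D E δ : ℝ) (K : ℝ≥0) (I : ℝ≥0∞) : ℝ≥0 :=
  (ENNReal.ofReal (fioConst d m β * E * (ftc (Ix d m) * D)) *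
    (ENNReal.ofReal δ⁻¹ * (K * I))).toNNReal

theorem FioData.isSchurKernel (H : FioData φ p β v Ht K ω ω₁ ω₂ D E δ M h)
    (hG : FreqDominated ω u G) (hGm : Measurable G) (hGi : ∫⁻ Ξ, G Ξ ≠ ∞) :
    IsSchurKernel ω₁ ω₂ (fioKer φ p β u)
      (fun t => ENNReal.ofReal (fioConst d m β * E * (ftc (Ix d m) * D)) *
        fioMaj p (oscProfile Ht G) t) (fioSchur d m β D E δ K (∫⁻ Ξ, G Ξ)) := by
  have hQ := measurable_oscProfile H.osc.meas hGm
  have hpc := H.regular.continuous_grad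
  have hc := fioConst_pos d m H.osc.pos.le
  have hle : ∀ x : ℝ≥0∞, x ≤ ENNReal.ofReal δ⁻¹ * ∫⁻ Ξ, oscProfile Ht G Ξ →
      ENNReal.ofReal (fioConst d m β * E * (ftc (Ix d m) * D)) * x ≤
        (fioSchur d m β D E δ K (∫⁻ Ξ, G Ξ) : ℝ≥0∞) := by
    intro x hx
    rw [fioSchur, ENNReal.coe_toNNReal (ENNReal.mul_ne_top ENNReal.ofReal_ne_top
      (ENNReal.mul_ne_top ENNReal.ofReal_ne_top (ENNReal.mul_ne_top ENNReal.coe_ne_top hGi)))]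
    refine mul_le_mul_right (hx.trans (mul_le_mul_right ?_ _)) _
    rw [lintegral_oscProfile H.osc.meas hGm]
    exact mul_le_mul_left H.osc.lintegral_le _
  refine ⟨?_, (measurable_fioMaj hpc hQ).const_mul _, fun z w ζ => ?_, fun z => ?_, fun w => ?_⟩
  · exact ((measurable_oscStft H.osc.contPhase H.osc.contGrad H.osc.pos u).comp
      (by fun_prop : Continuous fun t : (RR (Fin d) × RR (Fin d)) × (RR (Fin d) × RR (Fin d)) ×
        RR (Fin m) => (fioPos t, fioFreq t)).measurable).const_mul _
  · set t := (z, w, ζ) with ht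
    have h1 := H.osc.enorm_oscStft_le H.modNonneg H.mod hG (fioPos t, fioFreq t)
    have h2 := ENNReal.ofReal_le_ofReal (H.weight t)
    rw [fioKer, enorm_mul, ← ofReal_norm (fioConst d m β : ℂ), Complex.norm_real,
      Real.norm_of_nonneg hc.le]
    have p1 := (ω₁.pos' w).le
    calc _ ≤ ENNReal.ofReal (fioConst d m β) * ‖oscStft φ p β u (fioPos t, fioFreq t)‖ₑ *
          ENNReal.ofReal (E * (ω₁ w * ω (fioPos t, fioFreq t - p (fioPos t)))) :=
          mul_le_mul_right h2 _
      _ = ENNReal.ofReal (fioConst d m β) * ENNReal.ofReal E * ENNReal.ofReal (ω₁ w) *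
          (‖oscStft φ p β u (fioPos t, fioFreq t)‖ₑ *
            ENNReal.ofReal (ω (fioPos t, fioFreq t - p (fioPos t)))) := by
          rw [ENNReal.ofReal_mul H.weightNonneg, ENNReal.ofReal_mul p1]
          ring
      _ ≤ ENNReal.ofReal (fioConst d m β) * ENNReal.ofReal E * ENNReal.ofReal (ω₁ w) *
          (ENNReal.ofReal (ftc (Ix d m) * D) * oscProfile Ht G (fioFreq t - p (fioPos t))) :=
          mul_le_mul_right h1 _
      _ = _ := by
          rw [ENNReal.ofReal_mul (mul_nonneg hc.le H.weightNonneg), ENNReal.ofReal_mul hc.le, fioMaj,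
            fioFreq, fioPos]
          ring
  · simp only [lintegral_const_mul' _ _ ENNReal.ofReal_ne_top]
    exact hle _ (lintegral_fioMaj_row H.regular H.uniform H.bounded H.pos H.det hQ z)
  · simp only [lintegral_const_mul' _ _ ENNReal.ofReal_ne_top]
    exact hle _ (lintegral_fioMaj_col H.regular H.uniform H.bounded H.pos H.det hQ w)

end
end

noncomputable section

section

/-! ### Fourier integral operators with amplitudes in `Σ₁` -/

theorem OscBound.integrable_oscFt {ι : Type} [Fintype ι] {φ : RR ι → ℝ} {p : RR ι → RR ι} {β : ℝ}
    {v : Weight (RR ι)} {Ht : RR ι → ℝ≥0∞} {K : ℝ≥0} (h : OscBound φ p β v Ht K) {c₀ : ℝ}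
    (hc₀ : 0 < c₀) (hv : ∀ Θ, c₀ ≤ v Θ) (X : RR ι) : Integrable (oscFt φ p β X) := by
  have hc : Continuous (oscFt φ p β X) :=
    Continuous.comp (g := fun q : RR ι × RR ι => oscFt φ p β q.1 q.2) (f := fun Θ : RR ι => (X, Θ))
      (continuous_oscFt h.contPhase h.contGrad h.pos) (by fun_prop)
  refine ⟨hc.aestronglyMeasurable, ?_⟩
  rw [hasFiniteIntegral_iff_enorm]
  have h0 : ENNReal.ofReal c₀ ≠ 0 := (ENNReal.ofReal_pos.2 hc₀).ne'
  have h1 : ENNReal.ofReal c₀ * ∫⁻ Θ, ‖oscFt φ p β X Θ‖ₑ ≤ K := by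
    rw [← lintegral_const_mul' _ _ ENNReal.ofReal_ne_top]
    refine (lintegral_mono fun Θ => ?_).trans h.lintegral_le
    exact (mul_le_mul_left (ENNReal.ofReal_le_ofReal (hv Θ)) _).trans (h.bound X Θ)
  exact ENNReal.lt_top_of_mul_ne_top_right (h1.trans_lt ENNReal.coe_lt_top).ne h0

theorem integral_flip_snd {ι : Type} [Fintype ι] (F : RR ι × RR ι → ℂ) :
    ∫ z : RR ι × RR ι, F (z.1, -z.2) = ∫ z, F z := by
  let e : (RR ι × RR ι) ≃ᵐ (RR ι × RR ι) :=
    (MeasurableEquiv.refl (RR ι)).prodCongr (MeasurableEquiv.neg (RR ι))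
  have he : MeasurePreserving e volume volume :=
    (MeasurePreserving.id volume).prod (Measure.measurePreserving_neg volume)
  exact he.integral_comp' F

variable {d m : ℕ}

instance : SFinite (volume : Measure ((RR (Fin d) × RR (Fin d)) ×
    (RR (Fin d) × RR (Fin d)) × RR (Fin m))) := by
  have : SFinite (volume : Measure (RR (Fin d) × RR (Fin d))) :=
    inferInstanceAs (SFinite (Measure.prod volume volume))
  have : SFinite (volume : Measure ((RR (Fin d) × RR (Fin d)) × RR (Fin m))) :=
    inferInstanceAs (SFinite (Measure.prod volume volume))
  exact inferInstanceAs (SFinite (Measure.prod volume volume))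

/-- The integrand of `Op_φ(a) f` paired with `ψ`. -/
def opIntegrand (φ : RR (Ix d m) → ℝ) (a : GS (Ix d m)) (f ψ : GS (Fin d)) (X : RR (Ix d m)) : ℂ :=
  a X * Complex.exp (Complex.I * (φ X : ℂ)) * (f (catFst (catSnd X)) * ψ (catFst X))

theorem integrable_opIntegrand {φ : RR (Ix d m) → ℝ} (hφ : Continuous φ) (a : GS (Ix d m))
    (f ψ : GS (Fin d)) : Integrable (opIntegrand φ a f ψ) := by
  have hf : Continuous (f : RR (Fin d) → ℂ) := f.2.1.continuous
  have hψ : Continuous (ψ : RR (Fin d) → ℂ) := ψ.2.1.continuous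
  have h1 : Continuous fun X : RR (Ix d m) => Complex.exp (Complex.I * (φ X : ℂ)) *
      (f (catFst (catSnd X)) * ψ (catFst X)) :=
    (Complex.continuous_exp.comp (continuous_const.mul (Complex.continuous_ofReal.comp hφ))).mul
      ((hf.comp (by fun_prop)).mul (hψ.comp (by fun_prop)))
  have h2 := a.integrable.mul_bdd (c := gsSeminorm (Fin d) ⟨1, Set.mem_Ioi.2 one_pos⟩ f *
    gsSeminorm (Fin d) ⟨1, Set.mem_Ioi.2 one_pos⟩ ψ) h1.aestronglyMeasurable
    (Eventually.of_forall fun X => by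
      rw [norm_mul, norm_exp_I_mul, one_mul, norm_mul]
      exact mul_le_mul (f.norm_le _) (ψ.norm_le _) (norm_nonneg _) (apply_nonneg _ _))
  refine h2.congr (Eventually.of_forall fun X => ?_)
  simp only [opIntegrand]
  ring

theorem opFun_mul_eq (φ : RR (Ix d m) → ℝ) (a : GS (Ix d m)) (f ψ : GS (Fin d)) (x : RR (Fin d)) :
    opFun φ a f x * ψ x = (((2 * Real.pi) ^ (-((d : ℝ) + m) / 2) : ℝ) : ℂ) *
      ∫ Y : RR (Fin d ⊕ Fin m), opIntegrand φ a f ψ (cat x Y) := by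
  rw [opFun, integral_cat, mul_assoc, ← integral_mul_const]
  congr 1
  refine integral_congr_ae (Eventually.of_forall fun q => ?_)
  simp only [opIntegrand, catFst_cat, catSnd_cat]
  ring

theorem integral_opFun_mul {φ : RR (Ix d m) → ℝ} (hφ : Continuous φ) (a : GS (Ix d m))
    (f ψ : GS (Fin d)) : Integrable (fun x => opFun φ a f x * ψ x) ∧
      ∫ x, opFun φ a f x * ψ x = (((2 * Real.pi) ^ (-((d : ℝ) + m) / 2) : ℝ) : ℂ) *
        ∫ X, opIntegrand φ a f ψ X := by
  have h1 : Integrable (fun q : RR (Fin d) × RR (Fin d ⊕ Fin m) =>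
      opIntegrand φ a f ψ (cat q.1 q.2)) (volume.prod volume) :=
    (measurePreserving_cat.integrable_comp_emb measurableEmbedding_cat).2
      (integrable_opIntegrand hφ a f ψ)
  simp only [opFun_mul_eq]
  refine ⟨h1.integral_prod_left.const_mul _, ?_⟩
  rw [integral_const_mul, integral_cat, Measure.volume_eq_prod, integral_prod _ h1]

variable {φ : RR (Ix d m) → ℝ} {p : RR (Ix d m) → RR (Ix d m)} {β : ℝ} {v : Weight (RR (Ix d m))}
  {Ht : RR (Ix d m) → ℝ≥0∞} {K : ℝ≥0}

/-- The integrand of the kernel applied to test functions. -/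
def fioIntegrand (φ : RR (Ix d m) → ℝ) (β : ℝ) (a : GS (Ix d m)) (f ψ : GS (Fin d))
    (t : (RR (Fin d) × RR (Fin d)) × (RR (Fin d) × RR (Fin d)) × RR (Fin m))
    (X : RR (Ix d m)) : ℂ :=
  a X * Complex.exp (Complex.I * (φ X : ℂ)) *
    ((stft ψ.toDual (t.1.1, -t.1.2) * ((bwin β (catFst X - t.1.1) : ℂ) * ecis (catFst X) t.1.2)) *
      ((stft f.toDual t.2.1 * ((bwin β (catFst (catSnd X) - t.2.1.1) : ℂ) *
        ecis (catFst (catSnd X)) (-t.2.1.2))) * (bwin β (catSnd (catSnd X) - t.2.2) : ℂ)))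

theorem continuous_fioIntegrand (hφ : Continuous φ) (a : GS (Ix d m)) (f ψ : GS (Fin d)) :
    Continuous fun q : ((RR (Fin d) × RR (Fin d)) × (RR (Fin d) × RR (Fin d)) × RR (Fin m)) ×
      RR (Ix d m) => fioIntegrand φ β a f ψ q.1 q.2 := by
  have ha : Continuous fun q : ((RR (Fin d) × RR (Fin d)) × (RR (Fin d) × RR (Fin d)) ×
      RR (Fin m)) × RR (Ix d m) => a q.2 := a.2.1.continuous.comp continuous_snd
  have he : Continuous fun q : ((RR (Fin d) × RR (Fin d)) × (RR (Fin d) × RR (Fin d)) ×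
      RR (Fin m)) × RR (Ix d m) => Complex.exp (Complex.I * (φ q.2 : ℂ)) :=
    Complex.continuous_exp.comp (continuous_const.mul (Complex.continuous_ofReal.comp
      (hφ.comp continuous_snd)))
  have hψ : Continuous fun q : ((RR (Fin d) × RR (Fin d)) × (RR (Fin d) × RR (Fin d)) ×
      RR (Fin m)) × RR (Ix d m) => stft ψ.toDual (q.1.1.1, -q.1.1.2) :=
    (continuous_stft ψ.toDual).comp (by fun_prop)
  have hf : Continuous fun q : ((RR (Fin d) × RR (Fin d)) × (RR (Fin d) × RR (Fin d)) ×
      RR (Fin m)) × RR (Ix d m) => stft f.toDual q.1.2.1 :=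
    (continuous_stft f.toDual).comp (by fun_prop)
  refine (ha.mul he).mul ((hψ.mul ((Complex.continuous_ofReal.comp (by fun_prop)).mul
    (by fun_prop))).mul ((hf.mul ((Complex.continuous_ofReal.comp (by fun_prop)).mul
    (by fun_prop))).mul (Complex.continuous_ofReal.comp (by fun_prop))))

theorem enorm_bwin_mul_ecis_le {ι : Type} [Fintype ι] (hβ : 0 ≤ β) (x y ξ : RR ι) (c : ℂ) :
    ‖c * ((bwin β x : ℂ) * ecis y ξ)‖ₑ ≤
      ‖c‖ₑ * ENNReal.ofReal (Real.pi ^ (-(Fintype.card ι : ℝ) / 4)) := by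
  rw [enorm_mul]
  refine mul_le_mul_right ?_ _
  rw [← ofReal_norm, norm_mul, norm_ecis, mul_one, Complex.norm_real]
  exact ENNReal.ofReal_le_ofReal (abs_bwin_le hβ x)

theorem integrable_fioIntegrand (hφ : Continuous φ) (hβ : 0 ≤ β) (a : GS (Ix d m))
    (f ψ : GS (Fin d)) : Integrable (fun q : ((RR (Fin d) × RR (Fin d)) ×
      (RR (Fin d) × RR (Fin d)) × RR (Fin m)) × RR (Ix d m) => fioIntegrand φ β a f ψ q.1 q.2)
      (volume.prod volume) := by
  have hc := continuous_fioIntegrand (β := β) hφ a f ψ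
  refine ⟨hc.aestronglyMeasurable, ?_⟩
  rw [hasFiniteIntegral_iff_enorm, lintegral_prod_symm _ hc.measurable.enorm.aemeasurable]
  set c : ℝ≥0∞ := ENNReal.ofReal (Real.pi ^ (-(Fintype.card (Fin d) : ℝ) / 4)) with hcd
  have hct : c ≠ ∞ := ENNReal.ofReal_ne_top
  have hVm : ∀ g : GS (Fin d), Measurable fun z => ‖stft g.toDual z‖ₑ * c := fun g =>
    (continuous_stft g.toDual).measurable.enorm.mul_const _
  have hV : ∀ g : GS (Fin d), ∫⁻ z, ‖stft g.toDual z‖ₑ * c ≠ ∞ := fun g => by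
    rw [lintegral_mul_const' _ _ hct]
    exact ENNReal.mul_ne_top (integrable_stft g).2.ne hct
  have hVm' : Measurable fun z : RR (Fin d) × RR (Fin d) => ‖stft ψ.toDual (z.1, -z.2)‖ₑ * c :=
    (hVm ψ).comp (by fun_prop : Measurable fun z : RR (Fin d) × RR (Fin d) => (z.1, -z.2))
  have hV' : ∫⁻ z : RR (Fin d) × RR (Fin d), ‖stft ψ.toDual (z.1, -z.2)‖ₑ * c ≠ ∞ := by
    let e : (RR (Fin d) × RR (Fin d)) ≃ᵐ (RR (Fin d) × RR (Fin d)) :=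
      (MeasurableEquiv.refl (RR (Fin d))).prodCongr (MeasurableEquiv.neg (RR (Fin d)))
    have he : MeasurePreserving e volume volume :=
      (MeasurePreserving.id volume).prod (Measure.measurePreserving_neg volume)
    have := he.lintegral_comp_emb e.measurableEmbedding fun z => ‖stft ψ.toDual z‖ₑ * c
    exact this.trans_ne (hV ψ)
  have hbm : ∀ y : RR (Fin m), Measurable fun ζ => ENNReal.ofReal (bwin β (y - ζ)) := fun y =>
    ((continuous_bwin β).comp (by fun_prop)).measurable.ennreal_ofReal
  have hb : ∫⁻ ζ : RR (Fin m), ENNReal.ofReal (bwin β ζ) ≠ ∞ :=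
    (integrable_bwin hβ).lintegral_lt_top.ne
  set J : ℝ≥0∞ := (∫⁻ z : RR (Fin d) × RR (Fin d), ‖stft ψ.toDual (z.1, -z.2)‖ₑ * c) *
    ((∫⁻ z, ‖stft f.toDual z‖ₑ * c) * ∫⁻ ζ : RR (Fin m), ENNReal.ofReal (bwin β ζ)) with hJ
  have hJt : J ≠ ∞ := ENNReal.mul_ne_top hV' (ENNReal.mul_ne_top (hV f) hb)
  refine lt_of_le_of_lt (lintegral_mono fun X => ?_) (?_ : ∫⁻ X, ‖a X‖ₑ * J < ∞)
  · calc _ ≤ ∫⁻ t : (RR (Fin d) × RR (Fin d)) × (RR (Fin d) × RR (Fin d)) × RR (Fin m),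
          ‖a X‖ₑ * ((‖stft ψ.toDual (t.1.1, -t.1.2)‖ₑ * c) * ((‖stft f.toDual t.2.1‖ₑ * c) *
            ENNReal.ofReal (bwin β (catSnd (catSnd X) - t.2.2)))) := by
          refine lintegral_mono fun t => ?_
          rw [fioIntegrand, enorm_mul, enorm_mul, ← ofReal_norm (Complex.exp _), norm_exp_I_mul,
            ENNReal.ofReal_one, mul_one, enorm_mul, enorm_mul (stft f.toDual t.2.1 * _),
            ← ofReal_norm ((bwin β (catSnd (catSnd X) - t.2.2) : ℝ) : ℂ), Complex.norm_real,
            Real.norm_of_nonneg (bwin_pos β _).le]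
          exact mul_le_mul_right (mul_le_mul' (enorm_bwin_mul_ecis_le hβ _ _ _ _)
            (mul_le_mul' (enorm_bwin_mul_ecis_le hβ _ _ _ _) le_rfl)) _
      _ = ‖a X‖ₑ * J := by
          rw [lintegral_const_mul' _ _ enorm_ne_top]
          congr 1
          have h1 := lintegral_prod_mul (μ := (volume : Measure (RR (Fin d) × RR (Fin d))))
            (ν := (volume : Measure ((RR (Fin d) × RR (Fin d)) × RR (Fin m))))
            (f := fun z => ‖stft ψ.toDual (z.1, -z.2)‖ₑ * c)
            (g := fun r => (‖stft f.toDual r.1‖ₑ * c) *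
              ENNReal.ofReal (bwin β (catSnd (catSnd X) - r.2))) hVm'.aemeasurable
            (((hVm f).comp measurable_fst).mul ((hbm _).comp measurable_snd)).aemeasurable
          have h2 := lintegral_prod_mul (μ := (volume : Measure (RR (Fin d) × RR (Fin d))))
            (ν := (volume : Measure (RR (Fin m))))
            (f := fun z => ‖stft f.toDual z‖ₑ * c)
            (g := fun ζ => ENNReal.ofReal (bwin β (catSnd (catSnd X) - ζ))) (hVm f).aemeasurable
            (hbm _).aemeasurable
          rw [lintegral_sub_left_eq_self (fun ζ => ENNReal.ofReal (bwin β ζ))] at h2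
          rw [hJ, ← h2]
          exact h1
  · rw [lintegral_mul_const' _ _ hJt]
    exact ENNReal.mul_lt_top a.integrable.2 hJt.lt_top

/-- The integral of `fioIntegrand` over phase space. -/
theorem integral_fioIntegrand (hβ : 0 ≤ β) (a : GS (Ix d m)) (f ψ : GS (Fin d)) (X : RR (Ix d m)) :
    ∫ t, fioIntegrand φ β a f ψ t X = ((bwinConst (Fin d) β * bwinConst (Fin d) β *
      ∫ x : RR (Fin m), bwin β x : ℝ) : ℂ) * opIntegrand φ a f ψ X := by
  simp only [fioIntegrand]
  rw [integral_const_mul]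
  have h1 := integral_prod_mul (μ := (volume : Measure (RR (Fin d) × RR (Fin d))))
    (ν := (volume : Measure ((RR (Fin d) × RR (Fin d)) × RR (Fin m))))
    (fun z => stft ψ.toDual (z.1, -z.2) *
      ((bwin β (catFst X - z.1) : ℂ) * ecis (catFst X) z.2))
    (fun r => (stft f.toDual r.1 * ((bwin β (catFst (catSnd X) - r.1.1) : ℂ) *
        ecis (catFst (catSnd X)) (-r.1.2))) * (bwin β (catSnd (catSnd X) - r.2) : ℂ))
  have h2 := integral_prod_mul (μ := (volume : Measure (RR (Fin d) × RR (Fin d))))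
    (ν := (volume : Measure (RR (Fin m))))
    (fun w => stft f.toDual w * ((bwin β (catFst (catSnd X) - w.1) : ℂ) *
        ecis (catFst (catSnd X)) (-w.2)))
    (fun ζ => (bwin β (catSnd (catSnd X) - ζ) : ℂ))
  have h3 : ∫ z : RR (Fin d) × RR (Fin d), stft ψ.toDual (z.1, -z.2) *
      ((bwin β (catFst X - z.1) : ℂ) * ecis (catFst X) z.2) =
      (bwinConst (Fin d) β : ℂ) * ψ (catFst X) := by
    rw [bwinConst, ← stft_inversion ψ (continuous_bwin β) (abs_bwin_le hβ) (catFst X),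
      ← integral_flip_snd]
    simp only [neg_neg]
  have h4 := stft_inversion f (continuous_bwin β) (abs_bwin_le hβ) (catFst (catSnd X))
  have h5 : ∫ ζ : RR (Fin m), (bwin β (catSnd (catSnd X) - ζ) : ℂ) =
      ((∫ x : RR (Fin m), bwin β x : ℝ) : ℂ) := by
    rw [integral_sub_left_eq_self (fun ζ => (bwin β ζ : ℂ)), integral_complex_ofReal]
  rw [h4, h5] at h2
  refine (congrArg _ (h1.trans (congrArg₂ _ h3 h2))).trans ?_
  rw [opIntegrand, ← bwinConst]
  push_cast
  ring

theorem bwin_mul_ecis_fioPos (X : RR (Ix d m))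
    (t : (RR (Fin d) × RR (Fin d)) × (RR (Fin d) × RR (Fin d)) × RR (Fin m)) :
    ((win (X - fioPos t) * Real.exp (-β * ‖X - fioPos t‖ ^ 2) : ℝ) : ℂ) * ecis X (fioFreq t) =
      ((bwin β (catFst X - t.1.1) : ℂ) * ecis (catFst X) t.1.2) *
        (((bwin β (catFst (catSnd X) - t.2.1.1) : ℂ) * ecis (catFst (catSnd X)) (-t.2.1.2)) *
          (bwin β (catSnd (catSnd X) - t.2.2) : ℂ)) := by
  change ((bwin β (X - fioPos t) : ℝ) : ℂ) * ecis X (fioFreq t) = _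
  conv_lhs => rw [← cat_catFst_catSnd X, ← cat_catFst_catSnd (catSnd X)]
  rw [fioPos, fioFreq, cat_sub_cat, cat_sub_cat, bwin_cat, bwin_cat, ecis_cat, ecis_cat,
    ecis_zero_right]
  push_cast
  ring

/-- For amplitudes in `Σ₁` the phase space kernel represents the Fourier integral operator. -/
theorem isGivenBy_opFun (h : OscBound φ p β v Ht K) {c₀ : ℝ} (hc₀ : 0 < c₀) (hv : ∀ Θ, c₀ ≤ v Θ)
    (a : GS (Ix d m)) (f : GS (Fin d)) {u : GSDual (Fin d)}
    (hu : IsSynthesis u (kerApply (fioKer φ p β a.toDual) (stft f.toDual))) :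
    IsGivenBy u (opFun φ a f) := by
  intro ψ
  obtain ⟨hi, he⟩ := integral_opFun_mul h.contPhase a f ψ
  refine ⟨hi, ?_⟩
  have hInt := integrable_fioIntegrand h.contPhase h.pos.le a f ψ
  have hκ : ∀ t, fioKer φ p β a.toDual t * (stft f.toDual t.2.1 * stft ψ.toDual (t.1.1, -t.1.2)) =
      fioConst d m β * ∫ X, fioIntegrand φ β a f ψ t X := by
    intro t
    rw [fioKer, oscStft_toDual h.contPhase h.pos a _ (h.integrable_oscFt hc₀ hv _), mul_assoc,
      ← integral_mul_const]
    congr 1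
    refine integral_congr_ae (Eventually.of_forall fun X => ?_)
    simp only
    rw [mul_assoc (a X * _), bwin_mul_ecis_fioPos, fioIntegrand]
    ring
  have hkint : Integrable fun t => fioConst d m β * ∫ X, fioIntegrand φ β a f ψ t X :=
    hInt.integral_prod_left.const_mul _
  have hne : ((bwinConst (Fin d) β * bwinConst (Fin d) β * ∫ x : RR (Fin m), bwin β x : ℝ) : ℂ) ≠ 0 := by
    have h1 := bwinConst_pos (ι := Fin d) h.pos.le
    have h2 : 0 < ∫ x : RR (Fin m), bwin β x := by
      rw [integral_bwin h.pos.le]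
      have := h.pos
      positivity
    exact_mod_cast (by positivity : 0 < bwinConst (Fin d) β * bwinConst (Fin d) β *
      ∫ x : RR (Fin m), bwin β x).ne'
  calc u ψ = ∫ z, ∫ r : (RR (Fin d) × RR (Fin d)) × RR (Fin m),
        fioConst d m β * ∫ X, fioIntegrand φ β a f ψ (z, r) X := by
        rw [hu ψ]
        refine integral_congr_ae (Eventually.of_forall fun z => ?_)
        simp only [kerApply]
        rw [← integral_mul_const]
        refine integral_congr_ae (Eventually.of_forall fun r => ?_)
        simp only
        rw [← hκ, mul_assoc]
    _ = ∫ t, fioConst d m β * ∫ X, fioIntegrand φ β a f ψ t X :=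
        (integral_prod _ hkint).symm
    _ = fioConst d m β * ∫ X, ∫ t, fioIntegrand φ β a f ψ t X := by
        rw [integral_const_mul, integral_integral_swap hInt]
    _ = _ := by
        simp only [integral_fioIntegrand h.pos.le]
        rw [integral_const_mul, he, ← mul_assoc, fioConst]
        congr 1
        push_cast at hne ⊢
        rw [div_mul_cancel₀ _ hne]

end
end

noncomputable section

section

/-! ### The topologies of `Σ₁'` and of the operators from `Σ₁` to `Σ₁'` -/

variable {ι κ : Type} [Fintype ι] [Fintype κ]

theorem exists_gsSeminorm_lt {B : Set (GS ι)} (hB : Bornology.IsVonNBounded ℂ B)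
    (h : Set.Ioi (0 : ℝ)) : ∃ r > 0, ∀ ψ ∈ B, gsSeminorm ι h ψ < r :=
  (gs_withSeminorms ι).isVonNBounded_iff_seminorm_bounded.1 hB h

theorem tendsto_gsDual_zero {α : Type} {l : Filter α} {L : α → GSDual ι} {c : α → ℝ}
    {h : Set.Ioi (0 : ℝ)} (hc : Tendsto c l (𝓝 0))
    (hL : ∀ x ψ, ‖L x ψ‖ ≤ c x * gsSeminorm ι h ψ) : Tendsto L l (𝓝 0) := by
  rw [(ContinuousLinearMap.hasBasis_nhds_zero_of_basis Metric.nhds_basis_ball).tendsto_right_iff]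
  rintro ⟨B, ε⟩ ⟨hB, hε⟩
  simp only at hB hε ⊢
  obtain ⟨r, hr, hBr⟩ := exists_gsSeminorm_lt hB h
  filter_upwards [hc.eventually_lt_const (by positivity : 0 < ε / r),
    hc.eventually_const_lt (by linarith [div_pos hε hr] : -(ε / r) < 0)] with x hx hx'
  intro ψ hψ
  rw [mem_ball_zero_iff]
  refine (hL x ψ).trans_lt ?_
  have h0 : 0 ≤ gsSeminorm ι h ψ := apply_nonneg _ _
  have h1 := hBr ψ hψ
  calc c x * gsSeminorm ι h ψ ≤ (ε / r) * gsSeminorm ι h ψ :=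
        mul_le_mul_of_nonneg_right hx.le h0
    _ < (ε / r) * r := mul_lt_mul_of_pos_left h1 (by positivity)
    _ = ε := div_mul_cancel₀ _ hr.ne'

theorem continuous_of_gsSeminorm_bound (L : GS κ →ₗ[ℂ] GSDual ι) {K : ℝ} {h : Set.Ioi (0 : ℝ)}
    {h' : Set.Ioi (0 : ℝ)}
    (hL : ∀ f ψ, ‖L f ψ‖ ≤ K * gsSeminorm κ h f * gsSeminorm ι h' ψ) : Continuous L := by
  refine continuous_of_continuousAt_zero L ?_
  rw [ContinuousAt, map_zero]
  have h1 : Continuous (gsSeminorm κ h) := (gs_withSeminorms κ).continuous_seminorm h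
  have h2 := (h1.tendsto 0).const_mul K
  rw [map_zero, mul_zero] at h2
  exact tendsto_gsDual_zero h2 hL

theorem tendsto_clm_gsDual_zero {α : Type} {l : Filter α} {L : α → (GS κ →L[ℂ] GSDual ι)}
    {c : α → ℝ≥0∞} {h h' : Set.Ioi (0 : ℝ)} {K : ℝ} (hK : 0 < K) (hc : Tendsto c l (𝓝 0))
    (hL : ∀ x f ψ, ‖L x f ψ‖ₑ ≤
      ENNReal.ofReal (K * gsSeminorm κ h f * gsSeminorm ι h' ψ) * c x) : Tendsto L l (𝓝 0) := by
  rw [(ContinuousLinearMap.hasBasis_nhds_zero_of_basis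
    (ContinuousLinearMap.hasBasis_nhds_zero_of_basis Metric.nhds_basis_ball)).tendsto_right_iff]
  rintro ⟨A, B, ε⟩ ⟨hA, hB, hε⟩
  simp only at hA hB hε ⊢
  obtain ⟨r, hr, hAr⟩ := exists_gsSeminorm_lt hA h
  obtain ⟨r', hr', hBr⟩ := exists_gsSeminorm_lt hB h'
  have hpos : 0 < ε / (K * r * r') := by positivity
  filter_upwards [hc.eventually_lt_const (ENNReal.ofReal_pos.2 hpos)] with x hx
  intro f hf ψ hψ
  rw [mem_ball_zero_iff]
  have h0 : 0 ≤ gsSeminorm κ h f := apply_nonneg _ _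
  have h0' : 0 ≤ gsSeminorm ι h' ψ := apply_nonneg _ _
  have h1 : K * gsSeminorm κ h f * gsSeminorm ι h' ψ ≤ K * r * r' :=
    mul_le_mul (mul_le_mul_of_nonneg_left (hAr f hf).le hK.le) (hBr ψ hψ).le h0' (by positivity)
  have h2 : ENNReal.ofReal ‖L x f ψ‖ < ENNReal.ofReal ε := by
    rw [ofReal_norm]
    calc _ ≤ ENNReal.ofReal (K * r * r') * c x :=
          (hL x f ψ).trans (mul_le_mul_left (ENNReal.ofReal_le_ofReal h1) _)
      _ < ENNReal.ofReal (K * r * r') * ENNReal.ofReal (ε / (K * r * r')) :=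
          ENNReal.mul_lt_mul_right (ENNReal.ofReal_pos.2 (by positivity)).ne'
            ENNReal.ofReal_ne_top hx
      _ = ENNReal.ofReal ε := by
          rw [← ENNReal.ofReal_mul (by positivity), mul_div_cancel₀ _ (by positivity)]
  exact (ENNReal.ofReal_lt_ofReal_iff hε).1 h2

/-! ### Kernels acting on test functions and on modulation spaces -/

theorem IsSynthesis.unique {u u' : GSDual ι} {F : RR ι × RR ι → ℂ} (hu : IsSynthesis u F)
    (hu' : IsSynthesis u' F) : u = u' :=
  ContinuousLinearMap.ext fun ψ => (hu ψ).trans (hu' ψ).symm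

theorem exists_enorm_stft_mul_weight_le {ω : Weight (RR ι × RR ι)} {r C : ℝ}
    (h : ω.IsModerate r C) (f : GS ι) :
    ∃ S : ℝ≥0∞, S ≠ ∞ ∧ ∀ z, ‖stft f.toDual z * (ω z : ℂ)‖ₑ ≤ S := by
  obtain ⟨K, hK, hb⟩ := norm_stft_mul_weight_le h f
  refine ⟨ENNReal.ofReal K, ENNReal.ofReal_ne_top, fun z => ?_⟩
  rw [← ofReal_norm]
  refine ENNReal.ofReal_le_ofReal ((hb z).trans ?_)
  refine mul_le_of_le_one_right hK.le ?_
  have h1 := expw_mul_neg 1 z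
  have h2 : (1 : ℝ) ≤ expw 1 z := one_le_expw zero_le_one z
  nlinarith [expw_pos (-1) z]

/-- A rate of exponential decay that absorbs two moderate weights. -/
theorem exists_expw_weight_bounds {ω₁ ω₂ : Weight (RR ι × RR ι)} {r₁ C₁ r₂ C₂ : ℝ}
    (h₁ : ω₁.IsModerate r₁ C₁) (h₂ : ω₂.IsModerate r₂ C₂) :
    ∃ R c₁ c₂ : ℝ, 0 ≤ R ∧ 0 ≤ c₁ ∧ 0 ≤ c₂ ∧ (∀ w, ω₁ w * expw (-R) w ≤ c₁) ∧
      ∀ z, expw (-R) z ≤ c₂ * (ω₂ z * expw (-1) z) := by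
  obtain ⟨hr₁, hC₁, hb₁⟩ := h₁
  have hr₂ := h₂.1
  have hC₂ := h₂.2.1
  have p₁ := ω₁.pos' 0
  have p₂ := ω₂.pos' 0
  refine ⟨r₁ + r₂ + 1, C₁ * ω₁ 0, C₂ / ω₂ 0, by linarith, by positivity, by positivity,
    fun w => ?_, fun z => ?_⟩
  · have h := hb₁ 0 w
    rw [zero_add] at h
    have e : expw r₁ w * expw (-(r₁ + r₂ + 1)) w ≤ 1 :=
      (mul_le_mul_of_nonneg_left (expw_mono (by linarith) w) (expw_pos _ _).le).trans_eq
        (expw_mul_neg r₁ w)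
    calc _ ≤ C₁ * ω₁ 0 * expw r₁ w * expw (-(r₁ + r₂ + 1)) w :=
          mul_le_mul_of_nonneg_right h (expw_pos _ _).le
      _ = C₁ * ω₁ 0 * (expw r₁ w * expw (-(r₁ + r₂ + 1)) w) := by ring
      _ ≤ _ := mul_le_of_le_one_right (by positivity) e
  · have h := h₂.le_sub 0 z
    rw [zero_sub, expw_neg'] at h
    have e : expw (-(r₁ + r₂ + 1)) z ≤ expw (-r₂) z * expw (-1) z := by
      rw [← expw_add]
      exact expw_mono (by linarith) z
    have e2 : expw (-r₂) z ≤ C₂ / ω₂ 0 * ω₂ z := by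
      rw [div_mul_eq_mul_div, le_div_iff₀ p₂]
      calc expw (-r₂) z * ω₂ 0 ≤ expw (-r₂) z * (C₂ * ω₂ z * expw r₂ z) :=
            mul_le_mul_of_nonneg_left h (expw_pos _ _).le
        _ = C₂ * ω₂ z * (expw r₂ z * expw (-r₂) z) := by ring
        _ = _ := by rw [expw_mul_neg, mul_one]
    calc _ ≤ expw (-r₂) z * expw (-1) z := e
      _ ≤ C₂ / ω₂ 0 * ω₂ z * expw (-1) z := mul_le_mul_of_nonneg_right e2 (expw_pos _ _).le
      _ = _ := by ring

/-- The continuity estimate for kernels acting on test functions. -/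
theorem exists_enorm_synthesis_le (R : ℝ) (hR : 0 ≤ R) : ∃ (h : Set.Ioi (0 : ℝ)) (C : ℝ), 0 < C ∧
    ∀ (B : (RR ι × RR ι) × (RR ι × RR ι) × RR κ → ℂ) (f : GS ι) (u : GSDual ι),
      IsSynthesis u (kerApply B (stft f.toDual)) → ∀ ψ, ‖u ψ‖ₑ ≤
        ENNReal.ofReal (C * gsSeminorm ι h f * gsSeminorm ι h ψ) * kerMass R B := by
  obtain ⟨h, C, hC, hd⟩ := stft_decay' (ι := ι) R hR
  refine ⟨h, C * C, by positivity, fun B f u hu ψ => ?_⟩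
  refine (hu.enorm_kerApply_le (mul_nonneg hC.le (apply_nonneg _ _)) (hd f)
    (mul_nonneg hC.le (apply_nonneg _ _)) (hd ψ)).trans (le_of_eq ?_)
  congr 2
  ring

namespace IsSchurKernel

variable {ω₁ ω₂ : Weight (RR ι × RR ι)} {B : (RR ι × RR ι) × (RR ι × RR ι) × RR κ → ℂ}
  {q : (RR ι × RR ι) × (RR ι × RR ι) × RR κ → ℝ≥0∞} {M : ℝ≥0} {r₁ C₁ r₂ C₂ : ℝ}

theorem kerMass_ne_top (h : IsSchurKernel ω₁ ω₂ B q M) {R : ℝ} {c₁ c₂ : ℝ} (hc₁ : 0 ≤ c₁)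
    (hc₂ : 0 ≤ c₂) (h₁ : ∀ w, ω₁ w * expw (-R) w ≤ c₁)
    (h₂ : ∀ z, expw (-R) z ≤ c₂ * (ω₂ z * expw (-1) z)) : kerMass R B ≠ ∞ :=
  ((h.kerMass_le hc₁ hc₂ h₁ h₂).trans_lt (ENNReal.mul_lt_top ENNReal.coe_lt_top
    (ENNReal.mul_lt_top ENNReal.ofReal_lt_top
      (integrable_expw (by norm_num)).lintegral_lt_top))).ne

/-- The operator from `Σ₁` to `Σ₁'` defined by a kernel. -/
theorem exists_clm (h : IsSchurKernel ω₁ ω₂ B q M) (h₁ : ω₁.IsModerate r₁ C₁)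
    (h₂ : ω₂.IsModerate r₂ C₂) : ∃ L : GS ι →L[ℂ] GSDual ι,
      ∀ f, IsSynthesis (L f) (kerApply B (stft f.toDual)) := by
  have hm : ∀ f : GS ι, Measurable (stft f.toDual) := fun f => (continuous_stft _).measurable
  have hex : ∀ f : GS ι, ∃ u : GSDual ι, IsSynthesis u (kerApply B (stft f.toDual)) := fun f => by
    obtain ⟨S, hSt, hS⟩ := exists_enorm_stft_mul_weight_le h₁ f
    exact h.exists_isSynthesis h₂ (hm f) hSt hS
  choose L hL using hex
  obtain ⟨R, c₁, c₂, hR, hc₁, hc₂, hb₁, hb₂⟩ := exists_expw_weight_bounds h₁ h₂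
  obtain ⟨ρ, C, hC, hest⟩ := exists_enorm_synthesis_le (ι := ι) (κ := κ) R hR
  have hmass := h.kerMass_ne_top hc₁ hc₂ hb₁ hb₂
  let Λ : GS ι →ₗ[ℂ] GSDual ι :=
    { toFun := L
      map_add' := fun f g => by
        obtain ⟨S, hSt, hS⟩ := exists_enorm_stft_mul_weight_le h₁ f
        obtain ⟨S', hSt', hS'⟩ := exists_enorm_stft_mul_weight_le h₁ g
        refine (hL (f + g)).unique ?_
        rw [GS.toDual_add, stft_add]
        exact h.isSynthesis_add h₂ (hm f) hSt hS (hm g) hSt' hS' (hL f) (hL g)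
      map_smul' := fun c f => by
        refine (hL (c • f)).unique ?_
        rw [GS.toDual_smul, stft_smul]
        exact isSynthesis_smul (hL f) c }
  refine ⟨⟨Λ, continuous_of_gsSeminorm_bound Λ (K := C * (kerMass R B).toReal) (h := ρ) (h' := ρ)
    fun f ψ => ?_⟩, hL⟩
  have h3 := ENNReal.toReal_mono (ENNReal.mul_ne_top ENNReal.ofReal_ne_top hmass)
    (hest B f (L f) (hL f) ψ)
  have h4 : 0 ≤ C * gsSeminorm ι ρ f * gsSeminorm ι ρ ψ :=
    mul_nonneg (mul_nonneg hC.le (apply_nonneg _ _)) (apply_nonneg _ _)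
  rw [toReal_enorm, ENNReal.toReal_mul, ENNReal.toReal_ofReal h4] at h3
  refine h3.trans (le_of_eq ?_)
  ring

/-- The operator between Orlicz modulation spaces defined by a kernel. -/
theorem exists_orlicz (h : IsSchurKernel ω₁ ω₂ B q M) (h₁ : ω₁.IsModerate r₁ C₁)
    (h₂ : ω₂.IsModerate r₂ C₂) {Φ : YoungFunction} (hp : Φ.upperExp < ∞) {N : ℝ≥0}
    (hN : ∀ (u : GSDual ι) (F : RR ι × RR ι → ℂ), Measurable F → IsSynthesis u F →
      normOrlicz Φ ω₂ (stft u) ≤ N * normOrlicz Φ ω₂ F) :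
    ∃ S : ModOrlicz Φ ω₁ →L[ℂ] ModOrlicz Φ ω₂,
      (∀ u, IsSynthesis (S u).1 (kerApply B (stft u.1))) ∧ ‖S‖ ≤ N * M := by
  obtain ⟨P, hP⟩ := exists_enorm_stft_le_normOrlicz h₁ hp
  have hSt : ∀ u : ModOrlicz Φ ω₁, (P : ℝ≥0∞) * normOrlicz Φ ω₁ (stft u.1) ≠ ∞ := fun u =>
    ENNReal.mul_ne_top ENNReal.coe_ne_top u.2.2.ne
  have hex : ∀ u : ModOrlicz Φ ω₁, ∃ w : GSDual ι, IsSynthesis w (kerApply B (stft u.1)) :=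
    fun u => h.exists_isSynthesis h₂ u.2.1 (hSt u) (hP u.1)
  choose L hL using hex
  have hle : ∀ u, normOrlicz Φ ω₂ (stft (L u)) ≤ N * (M * normOrlicz Φ ω₁ (stft u.1)) := fun u =>
    (hN _ _ (measurable_kerApply h.meas u.2.1) (hL u)).trans
      (mul_le_mul_right (h.normOrlicz_kerApply_le hp u.2.1 u.2.2.ne) _)
  have hfin : ∀ u : ModOrlicz Φ ω₁, (N : ℝ≥0∞) * (M * normOrlicz Φ ω₁ (stft u.1)) ≠ ∞ := fun u =>
    ENNReal.mul_ne_top ENNReal.coe_ne_top (ENNReal.mul_ne_top ENNReal.coe_ne_top u.2.2.ne)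
  let Λ : ModOrlicz Φ ω₁ →ₗ[ℂ] ModOrlicz Φ ω₂ :=
    { toFun := fun u => ⟨L u, (continuous_stft _).measurable, (hle u).trans_lt (hfin u).lt_top⟩
      map_add' := fun u w => by
        refine Subtype.ext ((hL (u + w)).unique ?_)
        have e : stft (u + w).1 = stft u.1 + stft w.1 := stft_add u.1 w.1
        rw [e]
        exact h.isSynthesis_add h₂ u.2.1 (hSt u) (hP u.1) w.2.1 (hSt w) (hP w.1) (hL u) (hL w)
      map_smul' := fun c u => by
        refine Subtype.ext ((hL (c • u)).unique ?_)
        have e : stft (c • u).1 = c • stft u.1 := stft_smul c u.1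
        rw [e]
        exact isSynthesis_smul (hL u) c }
  have hbd : ∀ u, ‖Λ u‖ ≤ (N * M : ℝ) * ‖u‖ := fun u => by
    have h3 := ENNReal.toReal_mono (hfin u) (hle u)
    rw [ENNReal.toReal_mul, ENNReal.toReal_mul] at h3
    exact h3.trans (le_of_eq (mul_assoc _ _ _).symm)
  exact ⟨Λ.mkContinuous _ hbd, hL, Λ.mkContinuous_norm_le (by positivity) hbd⟩

end IsSchurKernel

/-- The continuous extension from `Σ₁` to an Orlicz modulation space is unique. -/
theorem ExtendsToOrlicz.unique {d : ℕ} {Φ : YoungFunction}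
    {ω₁ ω₂ : Weight (RR (Fin d) × RR (Fin d))} {r₁ C₁ r₂ C₂ : ℝ} (h₁ : ω₁.IsModerate r₁ C₁)
    (h₂ : ω₂.IsModerate r₂ C₂) (hp : Φ.upperExp < ∞) {L : GS (Fin d) →L[ℂ] GSDual (Fin d)}
    {S S' : ModOrlicz Φ ω₁ →L[ℂ] ModOrlicz Φ ω₂} (hS : ExtendsToOrlicz L S)
    (hS' : ExtendsToOrlicz L S') : S' = S := by
  refine ContinuousLinearMap.ext fun u => sub_eq_zero.1 ?_
  have hzero : ∀ w : ModOrlicz Φ ω₂, ‖w‖ = 0 → w = 0 := fun w hw => by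
    obtain ⟨P, hP⟩ := exists_enorm_stft_le_normOrlicz h₂ hp
    have h0 : normOrlicz Φ ω₂ (stft w.1) = 0 :=
      ((ENNReal.toReal_eq_zero_iff _).1 hw).resolve_right w.2.2.ne
    refine Subtype.ext (ContinuousLinearMap.ext fun ψ => ?_)
    have h3 : ∀ z, stft w.1 z = 0 := fun z => by
      have h4 := hP w.1 z
      rw [h0, mul_zero, nonpos_iff_eq_zero, enorm_eq_zero] at h4
      exact (mul_eq_zero.1 h4).resolve_right (Complex.ofReal_ne_zero.2 (ω₂.pos' z).ne')
    rw [dual_inversion w.1 ψ]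
    simp only [h3, zero_mul, integral_zero]
    rfl
  refine hzero _ (le_antisymm (le_of_forall_pos_le_add fun ε hε => ?_) (norm_nonneg _))
  rw [zero_add]
  set c : ℝ := ‖S‖ + ‖S'‖ + 1 with hc
  have hc0 : 0 < c := by positivity
  obtain ⟨g, hg⟩ := exists_gs_normOrlicz_sub_le h₁ hp u.1 u.2.2 (ε := (ε / c).toNNReal)
    (by simpa using by positivity)
  obtain ⟨F, hF, hSF⟩ := hS g
  obtain ⟨F', hF', hSF'⟩ := hS' g
  obtain rfl : F = F' := Subtype.ext (hF.trans hF'.symm)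
  have hSS : S F = S' F := Subtype.ext (hSF.trans hSF'.symm)
  have hn : ‖u - F‖ ≤ ε / c := by
    have e : (u - F).1 = u.1 - g.toDual := by rw [← hF]; rfl
    change (normOrlicz Φ ω₁ (stft (u - F).1)).toReal ≤ _
    rw [e]
    refine (ENNReal.toReal_mono ENNReal.coe_ne_top hg).trans (le_of_eq ?_)
    exact Real.coe_toNNReal _ (by positivity)
  calc ‖S' u - S u‖ = ‖S' (u - F) - S (u - F)‖ := by
        rw [map_sub, map_sub, hSS]
        congr 1
        abel
    _ ≤ ‖S'‖ * ‖u - F‖ + ‖S‖ * ‖u - F‖ :=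
        (norm_sub_le _ _).trans (add_le_add (S'.le_opNorm _) (S.le_opNorm _))
    _ ≤ c * ‖u - F‖ := by
        rw [hc]
        nlinarith [norm_nonneg (u - F)]
    _ ≤ c * (ε / c) := mul_le_mul_of_nonneg_left hn hc0.le
    _ = ε := mul_div_cancel₀ _ hc0.ne'

end
end

noncomputable section

section

/-! ### Fourier integral operators with amplitudes in `M^{∞,1}` -/

theorem freqDominated_of_supProfile_le {ι : Type} [Fintype ι] {ω : Weight (RR ι × RR ι)} {r C : ℝ}
    (h : ω.IsModerate r C) {u : GSDual ι} {G : RR ι → ℝ≥0∞}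
    (hG : ∀ᵐ Ξ, supProfile ω (stft u) Ξ ≤ G Ξ) :
    FreqDominated ω u fun Ξ => ENNReal.ofReal C * G Ξ := by
  filter_upwards [hG] with Ξ hΞ X
  exact (stft_mul_weight_le_supProfile h u X Ξ).trans (mul_le_mul_right hΞ _)

theorem FreqDominated.sub {ι : Type} [Fintype ι] {ω : Weight (RR ι × RR ι)} {u u' : GSDual ι}
    {G G' : RR ι → ℝ≥0∞} (h : FreqDominated ω u G) (h' : FreqDominated ω u' G') :
    FreqDominated ω (u - u') (G + G') := by
  filter_upwards [h, h'] with Ξ hΞ hΞ' X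
  have e : stft (u - u') (X, Ξ) = stft u (X, Ξ) - stft u' (X, Ξ) := by
    simp only [stft, sub_apply, mul_sub]
  have p := (ω.pos' (X, Ξ)).le
  refine le_trans ?_ (add_le_add (hΞ X) (hΞ' X))
  rw [← ENNReal.ofReal_add (mul_nonneg (norm_nonneg _) p) (mul_nonneg (norm_nonneg _) p), ← add_mul,
    e]
  exact ENNReal.ofReal_le_ofReal (mul_le_mul_of_nonneg_right (norm_sub_le _ _) p)

/-- Elements of `M^{∞,1}` are narrow limits of elements of `Σ₁`. -/
theorem exists_narrowTendsto {ι : Type} [Fintype ι] {ω : Weight (RR ι × RR ι)} {r C : ℝ}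
    (h : ω.IsModerate r C) (a : ModInf1 ω) : ∃ (g : ℕ → GS ι) (A : ℕ → ModInf1 ω),
      (∀ n, (A n).1 = (g n).toDual) ∧ NarrowTendsto A a := by
  choose g hg using exists_gs_truncation a.1
  obtain ⟨G, hGm, hGi, hG⟩ := exists_profile_truncation h a.1 a.2.2
  refine ⟨g, fun n => ⟨(g n).toDual, (continuous_stft _).measurable, normInf1_toDual_lt_top h _⟩,
    fun n => rfl, fun ψ => ?_, G, hGm, hGi, fun n => Eventually.of_forall (hG n (g n) (hg n))⟩
  have hi := integrable_indicator_stft_mul a.1 MeasurableSet.univ ψ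
  simp only [Set.indicator_univ] at hi
  rw [dual_inversion a.1 ψ]
  simp only [hg _ ψ]
  refine tendsto_integral_of_dominated_convergence _
    (fun n => (integrable_indicator_stft_mul a.1 measurableSet_closedBall ψ).aestronglyMeasurable)
    hi.norm (fun n => Eventually.of_forall fun z => ?_) (Eventually.of_forall fun z => ?_)
  · rw [norm_mul, norm_mul]
    exact mul_le_mul_of_nonneg_right (norm_indicator_le_norm_self _ _) (norm_nonneg _)
  · refine tendsto_const_nhds.congr' ?_
    obtain ⟨N, hN⟩ := exists_nat_ge ‖z‖
    filter_upwards [eventually_ge_atTop N] with n hn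
    rw [Set.indicator_of_mem]
    rw [mem_closedBall_zero_iff]
    exact hN.trans (by exact_mod_cast hn)

/-- The extension along narrowly convergent sequences is unique. -/
theorem ExtendsOp.unique {d m : ℕ} {ω : Weight (RR (Ix d m) × RR (Ix d m))} {r C : ℝ}
    (h : ω.IsModerate r C) {φ : RR (Ix d m) → ℝ}
    {T T' : ModInf1 ω → (GS (Fin d) →L[ℂ] GSDual (Fin d))} (hT : ExtendsOp φ T)
    (hT' : ExtendsOp φ T') (hc : NarrowContinuous T) (hc' : NarrowContinuous T') (a : ModInf1 ω) :
    T' a = T a := by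
  obtain ⟨g, A, hA, hlim⟩ := exists_narrowTendsto h a
  have heq : (fun n => T' (A n)) = fun n => T (A n) := by
    funext n
    obtain ⟨b, hb, hTb⟩ := hT (g n)
    obtain ⟨b', hb', hTb'⟩ := hT' (g n)
    obtain rfl : b = A n := Subtype.ext (hb.trans (hA n).symm)
    obtain rfl : b' = A n := Subtype.ext (hb'.trans (hA n).symm)
    refine ContinuousLinearMap.ext fun f => ContinuousLinearMap.ext fun ψ => ?_
    exact (hTb' f ψ).2.trans (hTb f ψ).2.symm
  have h1 := hc' A a hlim
  rw [heq] at h1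
  exact tendsto_nhds_unique h1 (hc A a hlim)

namespace FioData

variable {d m : ℕ} {φ : RR (Ix d m) → ℝ} {p : RR (Ix d m) → RR (Ix d m)} {β : ℝ}
  {v : Weight (RR (Ix d m))} {Ht : RR (Ix d m) → ℝ≥0∞} {K : ℝ≥0}
  {ω : Weight (RR (Ix d m) × RR (Ix d m))} {ω₁ ω₂ : Weight (RR (Fin d) × RR (Fin d))}
  {D E δ M : ℝ} {h : Ix d m → Ix d m → RR (Ix d m) → ℝ} {r C r₁ C₁ r₂ C₂ : ℝ}

theorem measurable_profile (C : ℝ) (a : ModInf1 ω) :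
    Measurable fun Ξ => ENNReal.ofReal C * supProfile ω (stft a.1) Ξ :=
  (measurable_supProfile ω a.2.1).const_mul _

theorem lintegral_profile (C : ℝ) (a : ModInf1 ω) :
    ∫⁻ Ξ, ENNReal.ofReal C * supProfile ω (stft a.1) Ξ =
      ENNReal.ofReal C * normInf1 ω (stft a.1) :=
  lintegral_const_mul' _ _ ENNReal.ofReal_ne_top

theorem lintegral_profile_ne_top (C : ℝ) (a : ModInf1 ω) :
    ∫⁻ Ξ, ENNReal.ofReal C * supProfile ω (stft a.1) Ξ ≠ ∞ := by
  rw [lintegral_profile]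
  exact ENNReal.mul_ne_top ENNReal.ofReal_ne_top a.2.2.ne

theorem exists_isSchurKernel (H : FioData φ p β v Ht K ω ω₁ ω₂ D E δ M h)
    (hω : ω.IsModerate r C) (a : ModInf1 ω) : ∃ q, IsSchurKernel ω₁ ω₂ (fioKer φ p β a.1) q
      (fioSchur d m β D E δ K (ENNReal.ofReal C * normInf1 ω (stft a.1))) := by
  rw [← lintegral_profile]
  exact ⟨_, H.isSchurKernel (freqDominated_of_supProfile_le hω (Eventually.of_forall fun _ =>
    le_rfl)) (measurable_profile C a) (lintegral_profile_ne_top C a)⟩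

theorem fioKer_add (H : FioData φ p β v Ht K ω ω₁ ω₂ D E δ M h) (hω : ω.IsModerate r C)
    (a b : ModInf1 ω) :
    fioKer φ p β (a.1 + b.1) = fioKer φ p β a.1 + fioKer φ p β b.1 := by
  have hd : ∀ a : ModInf1 ω, FreqDominated ω a.1 fun Ξ =>
      ENNReal.ofReal C * supProfile ω (stft a.1) Ξ := fun a =>
    freqDominated_of_supProfile_le hω (Eventually.of_forall fun _ => le_rfl)
  funext t
  simp only [fioKer, Pi.add_apply]
  rw [H.osc.oscStft_add H.modNonneg H.mod (hd a) (measurable_profile C a)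
    (lintegral_profile_ne_top C a) (hd b) (measurable_profile C b) (lintegral_profile_ne_top C b),
    mul_add]

theorem fioKer_smul (c : ℂ) (u : GSDual (Ix d m)) :
    fioKer φ p β (c • u) = c • fioKer φ p β u := by
  funext t
  simp only [fioKer, Pi.smul_apply, oscStft_smul, smul_eq_mul]
  ring

theorem fioSchur_toReal (H : FioData φ p β v Ht K ω ω₁ ω₂ D E δ M h) (hC : 0 ≤ C)
    (a : ModInf1 ω) : (fioSchur d m β D E δ K (ENNReal.ofReal C * normInf1 ω (stft a.1)) : ℝ) =
      fioConst d m β * E * (ftc (Ix d m) * D) * (δ⁻¹ * (K * (C * ‖a‖))) := by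
  have h1 := (fioConst_pos d m H.osc.pos.le).le
  have h2 := H.weightNonneg
  have h3 := H.modNonneg
  have h4 : 0 ≤ ftc (Ix d m) := ftc_pos.le
  have h5 := H.pos
  rw [fioSchur, ENNReal.coe_toNNReal_eq_toReal, ENNReal.toReal_mul, ENNReal.toReal_mul,
    ENNReal.toReal_mul, ENNReal.toReal_mul, ENNReal.toReal_ofReal (by positivity),
    ENNReal.toReal_ofReal (by positivity), ENNReal.toReal_ofReal hC]
  rfl

/-- The kernel mass tends to zero along dominated sequences that tend weakly to zero. -/
theorem tendsto_kerMass (H : FioData φ p β v Ht K ω ω₁ ω₂ D E δ M h) {b : ℕ → GSDual (Ix d m)}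
    {G : RR (Ix d m) → ℝ≥0∞} (hG : ∀ n, FreqDominated ω (b n) G) (hGm : Measurable G)
    (hGi : ∫⁻ Ξ, G Ξ ≠ ∞) (hb : ∀ ψ, Tendsto (fun n => b n ψ) atTop (𝓝 0)) {R c₁ c₂ : ℝ}
    (hc₁ : 0 ≤ c₁) (hc₂ : 0 ≤ c₂) (hb₁ : ∀ w, ω₁ w * expw (-R) w ≤ c₁)
    (hb₂ : ∀ z, expw (-R) z ≤ c₂ * (ω₂ z * expw (-1) z)) :
    Tendsto (fun n => kerMass R (fioKer φ p β (b n))) atTop (𝓝 0) := by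
  have hS := fun n => H.isSchurKernel (hG n) hGm hGi
  have hwm : Measurable fun t : (RR (Fin d) × RR (Fin d)) × (RR (Fin d) × RR (Fin d)) × RR (Fin m) =>
      ENNReal.ofReal (expw (-R) t.2.1 * expw (-R) t.1) :=
    (((continuous_expw (-R)).comp (by fun_prop)).mul
      ((continuous_expw (-R)).comp (by fun_prop))).measurable.ennreal_ofReal
  have hfm : ∀ n, Measurable fun t : (RR (Fin d) × RR (Fin d)) × (RR (Fin d) × RR (Fin d)) ×
      RR (Fin m) => ‖fioKer φ p β (b n) t‖ₑ * ENNReal.ofReal (expw (-R) t.2.1 * expw (-R) t.1) :=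
    fun n => (hS n).meas.enorm.mul hwm
  set q := fun t : (RR (Fin d) × RR (Fin d)) × (RR (Fin d) × RR (Fin d)) × RR (Fin m) =>
    ENNReal.ofReal (fioConst d m β * E * (ftc (Ix d m) * D)) * fioMaj p (oscProfile Ht G) t
  have hbm : Measurable fun t : (RR (Fin d) × RR (Fin d)) × (RR (Fin d) × RR (Fin d)) ×
      RR (Fin m) => ENNReal.ofReal (c₁ * c₂) * ENNReal.ofReal (expw (-1) t.1) * q t :=
    (((continuous_expw (-1)).measurable.comp measurable_fst).ennreal_ofReal.const_mul _).mul
      (hS 0).measMaj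
  have hfin : ∫⁻ t, ENNReal.ofReal (c₁ * c₂) * ENNReal.ofReal (expw (-1) t.1) * q t ≠ ∞ := by
    rw [Measure.volume_eq_prod, lintegral_prod _ hbm.aemeasurable]
    exact (((hS 0).lintegral_expw_mul_le ENNReal.ofReal_ne_top).trans_lt
      (ENNReal.mul_lt_top ENNReal.coe_lt_top (ENNReal.mul_lt_top ENNReal.ofReal_lt_top
        (integrable_expw (by norm_num)).lintegral_lt_top))).ne
  have hlim := tendsto_lintegral_of_dominated_convergence _ hfm
    (fun n => Eventually.of_forall ((hS n).enorm_mul_expw_le hc₁ hc₂ hb₁ hb₂)) hfin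
    (f := fun _ => 0) (Eventually.of_forall fun t => by
      have h0 : oscStft φ p β (0 : GSDual (Ix d m)) (fioPos t, fioFreq t) = 0 := by
        simp only [oscStft, stft_zero, Pi.zero_apply, mul_zero, integral_zero]
      have h1 := H.osc.tendsto_oscStft H.modNonneg H.mod hG hGm hGi (u := 0) hb
        (fioPos t, fioFreq t)
      rw [h0] at h1
      have h2 := (h1.const_mul (fioConst d m β : ℂ)).enorm
      rw [mul_zero, enorm_zero] at h2
      have h3 := ENNReal.Tendsto.mul_const (b := ENNReal.ofReal
        (expw (-R) t.2.1 * expw (-R) t.1)) h2 (Or.inr ENNReal.ofReal_ne_top)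
      rwa [zero_mul] at h3)
  rw [lintegral_zero] at hlim
  refine hlim.congr fun n => ?_
  rw [kerMass, Measure.volume_eq_prod, lintegral_prod _ (hfm n).aemeasurable]

/-- The operators with amplitudes in `M^{∞,1}`. -/
theorem exists_op (H : FioData φ p β v Ht K ω ω₁ ω₂ D E δ M h) (hω : ω.IsModerate r C)
    (h₁ : ω₁.IsModerate r₁ C₁) (h₂ : ω₂.IsModerate r₂ C₂) :
    ∃ T : ModInf1 ω →L[ℂ] (GS (Fin d) →L[ℂ] GSDual (Fin d)),
      (∀ a f, IsSynthesis (T a f) (kerApply (fioKer φ p β a.1) (stft f.toDual))) ∧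
        NarrowContinuous T := by
  obtain ⟨R, c₁, c₂, hR, hc₁, hc₂, hb₁, hb₂⟩ := exists_expw_weight_bounds h₁ h₂
  obtain ⟨ρ, C₀, hC₀, hest⟩ := exists_enorm_synthesis_le (ι := Fin d) (κ := Fin m) R hR
  have hex : ∀ a : ModInf1 ω, ∃ L : GS (Fin d) →L[ℂ] GSDual (Fin d),
      ∀ f, IsSynthesis (L f) (kerApply (fioKer φ p β a.1) (stft f.toDual)) := fun a => by
    obtain ⟨q, hq⟩ := H.exists_isSchurKernel hω a
    exact hq.exists_clm h₁ h₂
  choose L hL using hex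
  let Λ : ModInf1 ω →ₗ[ℂ] (GS (Fin d) →L[ℂ] GSDual (Fin d)) :=
    { toFun := L
      map_add' := fun a b => by
        refine ContinuousLinearMap.ext fun f => (hL (a + b) f).unique ?_
        obtain ⟨q, hq⟩ := H.exists_isSchurKernel hω a
        obtain ⟨q', hq'⟩ := H.exists_isSchurKernel hω b
        obtain ⟨S, hSt, hS⟩ := exists_enorm_stft_mul_weight_le h₁ f
        have e : fioKer φ p β (a + b).1 = fioKer φ p β a.1 + fioKer φ p β b.1 :=
          H.fioKer_add hω a b
        rw [e]
        exact hq.isSynthesis_add_left h₂ (continuous_stft _).measurable hSt hS hq' (hL a f) (hL b f)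
      map_smul' := fun c a => by
        refine ContinuousLinearMap.ext fun f => (hL (c • a) f).unique ?_
        have e : fioKer φ p β (c • a).1 = c • fioKer φ p β a.1 := fioKer_smul c a.1
        rw [e]
        exact isSynthesis_smul_left (hL a f) c }
  have hest' : ∀ a f ψ, ‖Λ a f ψ‖ₑ ≤ ENNReal.ofReal (C₀ * gsSeminorm (Fin d) ρ f *
      gsSeminorm (Fin d) ρ ψ) * kerMass R (fioKer φ p β a.1) := fun a f ψ =>
    hest _ f _ (hL a f) ψ
  have hcont : Continuous Λ := by
    refine continuous_iff_continuousAt.2 fun a₀ => ?_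
    rw [ContinuousAt, ← tendsto_sub_nhds_zero_iff]
    refine Tendsto.congr (fun a => map_sub Λ a a₀) ?_
    refine tendsto_clm_gsDual_zero hC₀ ?_ fun a => hest' (a - a₀)
    set J : ℝ≥0∞ := ENNReal.ofReal (c₁ * c₂) *
      ∫⁻ z : RR (Fin d) × RR (Fin d), ENNReal.ofReal (expw (-1) z) with hJ
    have hJt : J ≠ ∞ := ENNReal.mul_ne_top ENNReal.ofReal_ne_top
      (integrable_expw (by norm_num)).lintegral_lt_top.ne
    refine tendsto_of_tendsto_of_tendsto_of_le_of_le tendsto_const_nhds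
      (h := fun a => ENNReal.ofReal (fioConst d m β * E * (ftc (Ix d m) * D) *
        (δ⁻¹ * (K * (C * ‖a - a₀‖)))) * J) ?_ (fun _ => zero_le) fun a => ?_
    · have h3 : Continuous fun a : ModInf1 ω => ENNReal.ofReal (fioConst d m β * E *
          (ftc (Ix d m) * D) * (δ⁻¹ * (K * (C * ‖a - a₀‖)))) :=
        ENNReal.continuous_ofReal.comp (by fun_prop)
      have h4 := ENNReal.Tendsto.mul_const (b := J) (h3.tendsto a₀) (Or.inr hJt)
      simpa using h4
    · obtain ⟨q, hq⟩ := H.exists_isSchurKernel hω (a - a₀)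
      simp only
      rw [← H.fioSchur_toReal hω.2.1.le, ENNReal.ofReal_coe_nnreal]
      exact hq.kerMass_le hc₁ hc₂ hb₁ hb₂
  refine ⟨⟨Λ, hcont⟩, hL, fun a a₀ ⟨hlim, G, hGm, hGi, hG⟩ => ?_⟩
  change Tendsto (fun j => Λ (a j)) atTop (𝓝 (Λ a₀))
  rw [← tendsto_sub_nhds_zero_iff]
  refine Tendsto.congr (fun j => map_sub Λ (a j) a₀) ?_
  refine tendsto_clm_gsDual_zero hC₀ ?_ fun j => hest' (a j - a₀)
  refine H.tendsto_kerMass (b := fun j => (a j).1 - a₀.1) (G := (fun Ξ => ENNReal.ofReal C * G Ξ) +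
    fun Ξ => ENNReal.ofReal C * supProfile ω (stft a₀.1) Ξ) (fun j =>
    (freqDominated_of_supProfile_le hω (hG j)).sub (freqDominated_of_supProfile_le hω
      (Eventually.of_forall fun _ => le_rfl))) ((hGm.const_mul _).add (measurable_profile C a₀)) ?_
    (fun ψ => ?_) hc₁ hc₂ hb₁ hb₂
  · simp only [Pi.add_apply]
    rw [lintegral_add_left (hGm.const_mul _), lintegral_const_mul' _ _ ENNReal.ofReal_ne_top]
    exact ENNReal.add_ne_top.2 ⟨ENNReal.mul_ne_top ENNReal.ofReal_ne_top hGi.ne,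
      lintegral_profile_ne_top C a₀⟩
  · exact tendsto_sub_nhds_zero_iff.2 (hlim ψ)

end FioData

end
end

noncomputable section

section

theorem hessNorm_nonneg {ι : Type} [Fintype ι] {v : Weight (RR ι × RR ι)} (U : ι → ι → ModInf1 v) :
    0 ≤ hessNorm U :=
  Finset.sum_nonneg fun _ _ => Finset.sum_nonneg fun _ _ => norm_nonneg _

/-- Phase functions whose second derivatives belong to `M^{∞,1}` satisfy the hypotheses of the
kernel estimates, with constants that grow exponentially in the norm of the second derivatives. -/
theorem exists_fioData {d m : ℕ} {s : ℝ} (hs : 1 < s) {ω : Weight (RR (Ix d m) × RR (Ix d m))}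
    {ω₀ : Weight (RR (Fin d ⊕ Fin d) × RR (Fin d ⊕ Fin d))}
    {ω₁ ω₂ : Weight (RR (Fin d) × RR (Fin d))} {v : Weight (RR (Ix d m))} (hv : v.IsP s)
    (hsub : v.IsSubmultiplicative)
    (hdil : ∃ D : ℝ, ∀ t ∈ Set.Icc (0 : ℝ) 1, ∀ᵐ Ξ, v (t • Ξ) / v Ξ ≤ D)
    (hmod : ∃ D : ℝ, ∀ X Ξ₁ Ξ₂, ω (X, Ξ₁ + Ξ₂) ≤ D * (ω (X, Ξ₁) * v Ξ₂)) (C₁ C₂ : ℝ) :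
    ∃ c₀ : ℝ, 0 < c₀ ∧ (∀ Θ, c₀ ≤ v Θ) ∧ ∃ P Q : ℝ, 0 ≤ P ∧ 0 ≤ Q ∧
      ∀ (φ : RR (Ix d m) → ℝ) (H : Ix d m → Ix d m → RR (Ix d m) → ℝ)
        (U : Ix d m → Ix d m → ModInf1 v.onSnd) (δ : ℝ), IsPhase v.onSnd φ H U →
        (∀ (x y ξ η : RR (Fin d)) (ζ : RR (Fin m)),
          ω₂ (x, ξ) / ω₁ (y, -η) ≤ C₁ * ω₀ (cat x y, cat ξ η) ∧
          C₁ * ω₀ (cat x y, cat ξ η) ≤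
            C₂ * ω (cat x (cat y ζ), cat ξ (cat η 0) - gradient φ (cat x (cat y ζ)))) →
        0 < δ → (∀ᵐ X, δ ≤ |(mixedHessian H X).det|) →
        ∃ p β Ht, ∃ K : ℝ≥0, ∃ D E M h, FioData φ p β v Ht K ω ω₁ ω₂ D E δ M h ∧
          fioConst d m β * E * (ftc (Ix d m) * D) * K ≤ P * Real.exp (Q * hessNorm U) := by
  obtain ⟨c₀, c₁, c₂, ρ, hdw⟩ := hv.exists_isDilationWeight hs hsub hdil
  obtain ⟨r, C, hm⟩ := hv.exists_isModerate_onSnd hs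
  obtain ⟨Ck, hCk, hkey⟩ := exists_gaussian_oscillation_bound v.measurable' hdw.pos hdw.le
    hdw.nonneg hdw.dilation hdw.rate hdw.growth
  obtain ⟨Cf, hCf, hfio⟩ := exists_fioConst_le d m
  obtain ⟨D, hD⟩ := hmod
  have hC : 0 < C := hm.2.1
  have hft : 0 < ftc (Ix d m) := ftc_pos
  set e : ℝ := (d : ℝ) + (m : ℝ) / 2 with he
  have he0 : 0 ≤ e := by positivity
  refine ⟨c₀, hdw.pos, hdw.le, Cf * (1 + Ck) ^ e * |C₂| * (ftc (Ix d m) * |D|) * Ck,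
    (e + Ck) * (ftc (Ix d m) * C), by positivity, by positivity,
    fun φ H U δ hφ hw hδ hdet => ?_⟩
  obtain ⟨p, h, hreg, huc, ⟨M, hM⟩, hae, N, hNm, hN, hb⟩ :=
    hφ.exists_isRegularPhase hm hdw.pos hdw.le
  set A : ℝ := ftc (Ix d m) * C * hessNorm U with hA
  have hn := hessNorm_nonneg U
  have hA0 : 0 ≤ A := by positivity
  obtain ⟨β, hβ, hβA, hN'⟩ := hkey A hA0
  obtain ⟨Ht, hHm, hHi, hHb, hH⟩ := hN' N hNm hN
  have hK : ENNReal.ofReal (Ck * Real.exp (Ck * A)) =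
      ((Ck * Real.exp (Ck * A)).toNNReal : ℝ≥0∞) := rfl
  rw [hK] at hHi
  simp only [hK] at hHb
  refine ⟨p, β, Ht, (Ck * Real.exp (Ck * A)).toNNReal, |D|, |C₂|, M, h, ⟨⟨hφ.continuous,
    hreg.continuous_grad, hβ, hHm, fun X Θ => ?_, hHi, hHb⟩, abs_nonneg _, fun X Ξ₁ Ξ₂ => ?_, hreg,
    huc, hM, hδ, le_abs_det_of_ae hreg.cont_hess hae hdet, abs_nonneg _, fun t => ?_⟩, ?_⟩
  · obtain ⟨b, hbN, hbe⟩ := hb X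
    have h1 := hH b hbN Θ
    simp only [hbe] at h1
    exact h1
  · exact (hD X Ξ₁ Ξ₂).trans (mul_le_mul_of_nonneg_right (le_abs_self D)
      (mul_nonneg (ω.pos' _).le (v.pos' _).le))
  · obtain ⟨h1, h2⟩ := hw t.1.1 t.2.1.1 t.1.2 (-t.2.1.2) t.2.2
    have h3 := h1.trans h2
    rw [neg_neg, div_le_iff₀ (ω₁.pos' _), (hreg.hasGradientAt _).gradient] at h3
    refine h3.trans ?_
    rw [mul_assoc, mul_comm (ω₁ _)]
    exact mul_le_mul_of_nonneg_right (le_abs_self C₂) (mul_nonneg (ω.pos' _).le (ω₁.pos' _).le)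
  · rw [Real.coe_toNNReal _ (by positivity)]
    have h1 : 1 + β ≤ (1 + Ck) * Real.exp A := by
      have h2 := Real.add_one_le_exp A
      nlinarith
    have h2 : fioConst d m β ≤ Cf * ((1 + Ck) ^ e * Real.exp (e * A)) := by
      refine (hfio β hβ.le).trans (mul_le_mul_of_nonneg_left ?_ hCf.le)
      refine (Real.rpow_le_rpow (by positivity) h1 he0).trans (le_of_eq ?_)
      rw [Real.mul_rpow (by positivity) (by positivity), ← Real.exp_mul, mul_comm A]
    have h3 : Real.exp ((e + Ck) * (ftc (Ix d m) * C) * hessNorm U) =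
        Real.exp (e * A) * Real.exp (Ck * A) := by
      rw [← Real.exp_add, hA]
      congr 1
      ring
    rw [h3]
    calc _ ≤ Cf * ((1 + Ck) ^ e * Real.exp (e * A)) * |C₂| * (ftc (Ix d m) * |D|) *
          (Ck * Real.exp (Ck * A)) := by
          refine mul_le_mul_of_nonneg_right (mul_le_mul_of_nonneg_right
            (mul_le_mul_of_nonneg_right h2 (abs_nonneg _)) ?_) ?_ <;> positivity
      _ = _ := by ring

end
end

theorem mainTheorem1 (d m : ℕ) (s : ℝ) (hs : 1 < s)
    (Φ : YoungFunction) (hq : 1 < Φ.lowerExp) (hqp : Φ.lowerExp ≤ Φ.upperExp)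
    (hp : Φ.upperExp < ∞)
    (ω : Weight (RR (Ix d m) × RR (Ix d m))) (hω : ω.IsP s)
    (ω₀ : Weight (RR (Fin d ⊕ Fin d) × RR (Fin d ⊕ Fin d))) (hω₀ : ω₀.IsP s)
    (ω₁ ω₂ : Weight (RR (Fin d) × RR (Fin d))) (hω₁ : ω₁.IsP s) (hω₂ : ω₂.IsP s)
    (v₀ : Weight (RR (Ix d m))) (hv₀ : v₀.IsP s) (hsub : v₀.IsSubmultiplicative)
    (hdil : ∃ D : ℝ, ∀ t ∈ Set.Icc (0 : ℝ) 1, ∀ᵐ Ξ, v₀ (t • Ξ) / v₀ Ξ ≤ D)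
    (hmod : ∃ D : ℝ, ∀ X Ξ₁ Ξ₂, ω (X, Ξ₁ + Ξ₂) ≤ D * (ω (X, Ξ₁) * v₀ Ξ₂))
    (C₁ C₂ : ℝ) :
    ∃ C > 0, ∀ (φ : RR (Ix d m) → ℝ) (H : Ix d m → Ix d m → RR (Ix d m) → ℝ)
      (U : Ix d m → Ix d m → ModInf1 v₀.onSnd) (δ : ℝ),
      IsPhase v₀.onSnd φ H U →
      (∀ (x y ξ η : RR (Fin d)) (ζ : RR (Fin m)),
        ω₂ (x, ξ) / ω₁ (y, -η) ≤ C₁ * ω₀ (cat x y, cat ξ η) ∧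
        C₁ * ω₀ (cat x y, cat ξ η) ≤
          C₂ * ω (cat x (cat y ζ), cat ξ (cat η 0) - gradient φ (cat x (cat y ζ)))) →
      0 < δ → (∀ᵐ X, δ ≤ |(mixedHessian H X).det|) →
      ∃ T : ModInf1 ω →L[ℂ] (GS (Fin d) →L[ℂ] GSDual (Fin d)),
        ExtendsOp φ T ∧ NarrowContinuous T ∧
        (∀ T' : ModInf1 ω → (GS (Fin d) →L[ℂ] GSDual (Fin d)),
          ExtendsOp φ T' → NarrowContinuous T' → ∀ a, T' a = T a) ∧
        ∀ a : ModInf1 ω, ∃ S : ModOrlicz Φ ω₁ →L[ℂ] ModOrlicz Φ ω₂,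
          ExtendsToOrlicz (T a) S ∧
          (∀ S' : ModOrlicz Φ ω₁ →L[ℂ] ModOrlicz Φ ω₂, ExtendsToOrlicz (T a) S' → S' = S) ∧
          ‖S‖ ≤ C * δ⁻¹ * ‖a‖ * Real.exp (C * hessNorm U) := by
  obtain ⟨r, Cω, hm⟩ := hω.exists_isModerate hs
  obtain ⟨r₁, c₁, hm₁⟩ := hω₁.exists_isModerate hs
  obtain ⟨r₂, c₂, hm₂⟩ := hω₂.exists_isModerate hs
  obtain ⟨c₀, hc₀, hv, P, Q, hP, hQ, hdata⟩ := exists_fioData (ω := ω) (ω₀ := ω₀) (ω₁ := ω₁)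
    (ω₂ := ω₂) hs hv₀ hsub hdil hmod C₁ C₂
  obtain ⟨N, hN, hsyn⟩ := exists_normOrlicz_synthesis_le hm₂
  have hCω : 0 < Cω := hm.2.1
  refine ⟨N * P * Cω + Q + 1, by positivity, fun φ H U δ hφ hw hδ hdet => ?_⟩
  obtain ⟨p, β, Ht, K, D, E, M, h, hF, hK⟩ := hdata φ H U δ hφ hw hδ hdet
  obtain ⟨T, hT, hTn⟩ := hF.exists_op hm hm₁ hm₂
  have hext : ExtendsOp φ T := fun a =>
    ⟨⟨a.toDual, (continuous_stft _).measurable, normInf1_toDual_lt_top hm a⟩, rfl, fun f =>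
      isGivenBy_opFun hF.osc hc₀ hv a f (hT _ f)⟩
  refine ⟨T, hext, hTn, fun T' hT' hTn' a => hext.unique hm hT' hTn hTn' a, fun a => ?_⟩
  obtain ⟨q, hker⟩ := hF.exists_isSchurKernel hm a
  obtain ⟨S, hS, hSn⟩ := hker.exists_orlicz hm₁ hm₂ hp fun u F => hsyn Φ u F hp
  have hSe : ExtendsToOrlicz (T a) S := fun f =>
    ⟨⟨f.toDual, (continuous_stft _).measurable, normOrlicz_toDual_lt_top hm₁ hp f⟩, rfl,
      (hS _).unique (hT a f)⟩
  refine ⟨S, hSe, fun S' hS' => hSe.unique hm₁ hm₂ hp hS', hSn.trans ?_⟩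
  rw [hF.fioSchur_toReal hCω.le]
  have hn := hessNorm_nonneg U
  have h1 : Real.exp (Q * hessNorm U) ≤ Real.exp ((N * P * Cω + Q + 1) * hessNorm U) :=
    Real.exp_le_exp.2 (mul_le_mul_of_nonneg_right
      (by linarith [(by positivity : 0 ≤ N * P * Cω)]) hn)
  calc _ = N * Cω * δ⁻¹ * ‖a‖ * (fioConst d m β * E * (ftc (Ix d m) * D) * K) := by ring
    _ ≤ N * Cω * δ⁻¹ * ‖a‖ * (P * Real.exp ((N * P * Cω + Q + 1) * hessNorm U)) :=
        mul_le_mul_of_nonneg_left (hK.trans (mul_le_mul_of_nonneg_left h1 hP)) (by positivity)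
    _ = N * P * Cω * (δ⁻¹ * ‖a‖ * Real.exp ((N * P * Cω + Q + 1) * hessNorm U)) := by ring
    _ ≤ (N * P * Cω + Q + 1) * (δ⁻¹ * ‖a‖ * Real.exp ((N * P * Cω + Q + 1) * hessNorm U)) :=
        mul_le_mul_of_nonneg_right (by linarith) (by positivity)
    _ = _ := by ring
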